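/- **Setting.** For $x\in\mathbb R^3$ let $r=\sqrt{x_1^2+x_2^2}$, $e_r=(x_1/r,x_2/r,0)$, $e_\theta=(-x_2/r,x_1/r,0)$, $e_3=(0,0,1)$, $\partial_r=e_r\cdot\nabla$, $\tilde\nabla=(\partial_r,\partial_3)$, and let $\|\cdot\|_q$ be the norm of $L^q(\mathbb R^3)$. Let $N(x)=-\frac1{4\pi|x|}$. Write $\Delta^{-1}\partial_i f=(\partial_iN)*f$, $\mathcal R_{ij}W=\Delta^{-1}\partial_i(\partial_jW)$, and $\Delta^{-1}W(x)=\int_{\mathbb R^3}\bigl(N(x-y)-N(-y)\bigr)W(y)\,dy$ (the Newtonian potential, normalised by an additive constant that plays no role since only derivatives of it occur); $\Delta^{-2}\partial_3=\Delta^{-1}(\Delta^{-1}\partial_3)$. Let $u$ be a smooth axisymmetric solution of the Navier–Stokes equations $\partial_tu+(u\cdot\nabla)u-\Delta u+\nabla p=0$, $\nabla\cdot u=0$ on $(0,T)\times\mathbb R^3$, i.e. $u$ and $p$ are smooth and $u=u^r(t,r,x_3)e_r+u^\theta(t,r,x_3)e_\theta+u^3(t,r,x_3)e_3$, with $u(t)\in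 H^2(\mathbb R^3)$ for every $t\in(0,T)$. Let $\omega=\operatorname{curl}u$, $\omega^\theta=\omega\cdot e_\theta$ and $\Gamma=\omega^\theta/r$. **Statement.** 1. Let $W=W(r,x_3)$ be an axisymmetric $C^1$ function on $\mathbb R^3$ such that $W$ and $\nabla W$ are integrable with respect to $dy/(1+|y|^2)$. Then the integrals defining $\Delta^{-1}W$ and $\mathcal R_{ij}W$ converge absolutely, $\Delta^{-1}W\in C^2$, $\Delta(\Delta^{-1}W)=W$, and for $r\neq0$ $$\frac{\partial_r}{r}\Delta^{-1}W=\frac{x_2^2}{r^2}\mathcal R_{11}W+\frac{x_1^2}{r^2}\mathcal R_{22}W-2\,\frac{x_1x_2}{r^2}\mathcal R_{12}W .$$ 2. For every $t\in(0,T)$ the integral defining $\Delta^{-1}\partial_3\Gamma$ converges absolutely, $W=\Delta^{-1}\partial_3\Gamma$ satisfies the hypotheses of 1, and for $r\ne0$ $$\frac{u^r}{r}=\Delta^{-1}\partial_3\Gamma-2\,\frac{\partial_r}{r}\Delta^{-2}\partial_3\Gamma .$$ 3. For every $1<q<\infty$ there is a constant $C=C(q)$, depending only on $q$, such that for all such $T$,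 $u$, $p$ and all $t\in(0,T)$ $$\Bigl\|\tilde\nabla\frac{u^r}{r}\Bigr\|_q\le C\,\|\Gamma\|_q,\qquad \Bigl\|\tilde\nabla\tilde\nabla\frac{u^r}{r}\Bigr\|_q\le C\,\|\partial_3\Gamma\|_q ,$$ where a right-hand side may be $+\infty$. -/

import Mathlib

open MeasureTheory Set
open scoped ContDiff

/-- Three-dimensional Euclidean space; the coordinates `x₁, x₂, x₃` are `x 0, x 1, x 2`. -/
abbrev E3 : Type := EuclideanSpace ℝ (Fin 3)

namespace Axi

noncomputable section

/-! ### Cylindrical coordinates and differential operators -/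

/-- `r = √(x₁² + x₂²)`. -/
def rad (x : E3) : ℝ := Real.sqrt ((x 0) ^ 2 + (x 1) ^ 2)

/-- `e_r = (x₁/r, x₂/r, 0)` (used off the axis `r = 0`). -/
def eR (x : E3) : E3 := !₂[x 0 / rad x, x 1 / rad x, 0]

/-- `e_θ = (-x₂/r, x₁/r, 0)` (used off the axis `r = 0`). -/
def eTheta (x : E3) : E3 := !₂[-(x 1) / rad x, x 0 / rad x, 0]

/-- `e₃ = (0, 0, 1)`. -/
def eThree : E3 := !₂[0, 0, 1]

/-- The Cartesian partial derivative `∂ᵢ f`. -/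
def pd (i : Fin 3) (f : E3 → ℝ) (x : E3) : ℝ := fderiv ℝ f x (EuclideanSpace.single i 1)

/-- The radial derivative `∂_r f = e_r · ∇f`. -/
def dr (f : E3 → ℝ) (x : E3) : ℝ := fderiv ℝ f x (eR x)

/-- The Laplacian `Δ f = ∂₁²f + ∂₂²f + ∂₃²f`. -/
def lap (f : E3 → ℝ) (x : E3) : ℝ := ∑ i : Fin 3, pd i (pd i f) x

/-- The curl of a vector field. -/
def curl (v : E3 → E3) (x : E3) : E3 :=
  !₂[pd 1 (fun y => v y 2) x - pd 2 (fun y => v y 1) x,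
     pd 2 (fun y => v y 0) x - pd 0 (fun y => v y 2) x,
     pd 0 (fun y => v y 1) x - pd 1 (fun y => v y 0) x]

/-- The pointwise size of `∇̃ f = (∂_r f, ∂₃ f)`. -/
def tgrad (f : E3 → ℝ) (x : E3) : ℝ := Real.sqrt ((dr f x) ^ 2 + (pd 2 f x) ^ 2)

/-- The pointwise size of `∇̃∇̃ f = (∂_r∂_r f, ∂_r∂₃ f, ∂₃∂_r f, ∂₃∂₃ f)`. -/
def tgradTwo (f : E3 → ℝ) (x : E3) : ℝ :=
  Real.sqrt ((dr (dr f) x) ^ 2 + (dr (pd 2 f) x) ^ 2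
    + (pd 2 (dr f) x) ^ 2 + (pd 2 (pd 2 f) x) ^ 2)

/-! ### Axisymmetric fields and solutions of the Navier–Stokes equations -/

/-- A vector field of the form `v = v^r(r,x₃) e_r + v^θ(r,x₃) e_θ + v³(r,x₃) e₃`. -/
def IsAxisymmetricField (v : E3 → E3) : Prop :=
  ∃ vr vθ v3 : ℝ → ℝ → ℝ, ∀ x : E3, rad x ≠ 0 →
    v x = vr (rad x) (x 2) • eR x + vθ (rad x) (x 2) • eTheta x + v3 (rad x) (x 2) • eThree

/-- A scalar function of the form `W = W(r, x₃)`. -/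
def IsAxisymmetricScalar (W : E3 → ℝ) : Prop :=
  ∃ w : ℝ → ℝ → ℝ, ∀ x : E3, W x = w (rad x) (x 2)

/-- `u` (with pressure `p`) is a smooth axisymmetric solution of the three-dimensional
Navier–Stokes equations (with unit viscosity) on `(0,T) × ℝ³`, with `u(t) ∈ H²(ℝ³)` for all `t`. -/
structure IsSmoothAxisymmetricSolution (T : ℝ) (u : ℝ → E3 → E3) (p : ℝ → E3 → ℝ) : Prop where
  smooth_u : ContDiffOn ℝ ∞ (fun z : ℝ × E3 => u z.1 z.2) (Ioo 0 T ×ˢ univ)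
  smooth_p : ContDiffOn ℝ ∞ (fun z : ℝ × E3 => p z.1 z.2) (Ioo 0 T ×ˢ univ)
  momentum : ∀ t ∈ Ioo 0 T, ∀ x : E3, ∀ i : Fin 3,
    deriv (fun s => u s x i) t + ∑ j : Fin 3, u t x j * pd j (fun y => u t y i) x
      - lap (fun y => u t y i) x + pd i (p t) x = 0
  div_free : ∀ t ∈ Ioo 0 T, ∀ x : E3, ∑ i : Fin 3, pd i (fun y => u t y i) x = 0
  axisymmetric : ∀ t ∈ Ioo 0 T, IsAxisymmetricField (u t)
  memH2 : ∀ t ∈ Ioo 0 T, ∀ k ≤ 2, MemLp (iteratedFDeriv ℝ k (u t)) 2 volume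

/-- `v^r / r`, where `v^r = v · e_r` (off the axis). -/
def radialOverR (v : E3 → E3) (x : E3) : ℝ := inner ℝ (v x) (eR x) / rad x

/-- `Γ = ω^θ / r`, where `ω = curl v` and `ω^θ = ω · e_θ` (off the axis). -/
def Gam (v : E3 → E3) (x : E3) : ℝ := inner ℝ (curl v x) (eTheta x) / rad x

/-! ### The inverse Laplacian -/

/-- The fundamental solution `N(x) = -1/(4π|x|)` of the Laplacian on `ℝ³`. -/
def newton (x : E3) : ℝ := -1 / (4 * Real.pi * ‖x‖)

/-- The derivative `∂ᵢN(x) = xᵢ/(4π|x|³)`; see `pd_newton`. -/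
def dNewton (i : Fin 3) (x : E3) : ℝ := x i / (4 * Real.pi * ‖x‖ ^ 3)

theorem pd_newton (i : Fin 3) (x : E3) (hx : x ≠ 0) : pd i newton x = dNewton i x := by
  have hn : ‖x‖ ≠ 0 := norm_ne_zero_iff.mpr hx
  have h1 : HasFDerivAt (fun y : E3 => ‖y‖ ^ 2) (2 • (innerSL ℝ x)) x :=
    (hasStrictFDerivAt_norm_sq x).hasFDerivAt
  have h2 := h1.sqrt (by positivity)
  simp only [Real.sqrt_sq (norm_nonneg _)] at h2
  have h3 := ((hasDerivAt_inv hn).comp_hasFDerivAt x h2).const_mul (-1 / (4 * Real.pi))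
  have h4 : newton = fun y : E3 => -1 / (4 * Real.pi) * ((fun t : ℝ => t⁻¹) ∘ fun y => ‖y‖) y := by
    funext y
    simp only [newton, Function.comp]
    rw [div_mul_eq_div_div, div_eq_mul_inv _ ‖y‖]
  rw [pd, h4, HasFDerivAt.fderiv h3]
  simp [dNewton, EuclideanSpace.inner_single_right]
  field_simp

/-- `Δ⁻¹ W`, the Newtonian potential `N * W`, normalised to vanish at the origin.  The subtracted
constant makes the integral converge as soon as `W` is locally bounded and integrable with respect
to `dy / (1 + |y|²)`; it is irrelevant below, as `Δ⁻¹ W` occurs only under derivatives. -/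
def invLap (W : E3 → ℝ) (x : E3) : ℝ := ∫ y, (newton (x - y) - newton (-y)) * W y

/-- `Δ⁻¹ ∂ᵢ f = ∂ᵢ Δ⁻¹ f = (∂ᵢN) * f`. -/
def invLapD (i : Fin 3) (f : E3 → ℝ) (x : E3) : ℝ := ∫ y, dNewton i (x - y) * f y

/-- The Riesz operators `R_ij = Δ⁻¹ ∂ᵢ ∂ⱼ`. -/
def riesz (i j : Fin 3) (W : E3 → ℝ) : E3 → ℝ := invLapD i (pd j W)

/-- The operator `(∂_r / r) Δ⁻¹` (off the axis). -/
def drOverRInvLap (W : E3 → ℝ) (x : E3) : ℝ := dr (invLap W) x / rad x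

/-- The axisymmetric functions `W` to which the operators above are applied: continuously
differentiable, `W` and `∇W` being integrable with respect to `dy / (1 + |y|²)`
(for instance every axisymmetric `C¹` function in `W^{1,s}(ℝ³)` with `1 ≤ s < 3`). -/
structure IsAdmissible (W : E3 → ℝ) : Prop where
  axisymmetric : IsAxisymmetricScalar W
  contDiff : ContDiff ℝ 1 W
  integrable : Integrable (fun y => W y / (1 + ‖y‖ ^ 2)) volume
  integrable_fderiv : Integrable (fun y => ‖fderiv ℝ W y‖ / (1 + ‖y‖ ^ 2)) volume

end

end Axi

set_option linter.style.longLine false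
set_option linter.unusedSectionVars false

namespace Axi

/-! ### Smoothness of integrals depending on a parameter -/

section Parametric

variable {α Z F : Type*} [MeasurableSpace α] {μ : Measure α}
  [NormedAddCommGroup Z] [NormedSpace ℝ Z] [NormedAddCommGroup F] [NormedSpace ℝ F]

/-! At each time `u(t)` is a smooth axisymmetric solenoidal field in H² (`IsProfile`), and the
argument concerns such fields. Write F = u^r/r, W = Δ⁻¹∂₃Γ, V = Δ⁻¹W.

Potentials. The kernel ∂ᵢN is homogeneous of degree −2, so integrability of f against dy/(1+|y|²),
with continuity, bounds ∫|x−y|⁻²|f(y)|dy locally uniformly in x. A cutoff splits a potential into a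
convolution with a compactly supported function, which inherits the regularity of f, and a far part
with a smooth harmonic kernel; together they give Δ(Δ⁻¹f) = f (`Weighted.lap_invLap`). An
axisymmetric V satisfies x₁∂₂V = x₂∂₁V, and differentiating this relation once expresses ∂_rV/r
through second derivatives of V (`dr_div_rad_of_axisymmetric`).

The identity. F and Γ extend smoothly across the axis (`quot`), and Δu = −curl ω becomes ΔF +
(2/r)∂_rF = ∂₃Γ (`IsProfile.lap_velQuot`). Since (x₁/r)∂_rF = ∂₁F, this says Δ(x₁F) = x₁∂₃Γ, and x₁W
− 2∂₁V has the same Laplacian. Hence X = x₁(F−W) + 2∂₁V is harmonic. It is integrable against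
(1+|x|²)⁻², so a Liouville theorem makes it constant, and axisymmetry makes the constant zero
(`IsProfile.coord_mul_velQuot`); division by x₁ gives the formula. That W is admissible rests on Γ
and rΓ lying in L², which makes Γ/(1+|x|) integrable, and on ∇W ∈ L².

The Calderón–Zygmund estimate (`exists_cz_bound`). If Δφ = ∂ᵢf and φ is integrable against
(1+|x|²)⁻², then ‖∂ⱼφ‖_p ≤ C‖f‖_p. The proof is by heat flow and a Bellman function. With P_t the
heat semigroup, the pairing of ∂ⱼφ with a test function g is, up to sign and a reflection, 2∫₀^∞∫
∂ᵢP_tf ∂ⱼP_tg dx dt. There is a function B(ζ,η), of size at most a multiple of ζ^p + η^q, whose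
Hessian is so positive that (∂_t−Δ)B(P_tf,P_tg) ≤ −2|∂ᵢP_tf ∂ⱼP_tg| for positive data
(`bellman_hess`, `bellman_flow_le`). Integration in space and time bounds the pairing by C(‖f‖_p^p +
‖g‖_q^q), and duality finishes. The case f = 0 is the Liouville theorem used above.

The bounds. F is a combination of W and the second derivatives of V with coefficients that depend on
the angle only, and ∂_r and ∂₃ annihilate such coefficients (`Represents.dirOp`). So ∇̃F and ∇̃∇̃F
are controlled by ordinary derivatives of W and of ∂ᵢ∂ⱼV. As ΔW = ∂₃Γ and Δ∂ᵢ∂ⱼV = ∂ᵢ∂ⱼW, at most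
two applications of the Calderón–Zygmund estimate lead back to Γ or ∂₃Γ. -/

theorem hasFTaylorSeriesUpToOn_integral [CompleteSpace F] {D : Set Z} (hD : IsOpen D)
    {k : Z → α → F} (hk : ∀ y, ContDiffOn ℝ ∞ (fun z => k z y) D)
    (hm : ∀ n : ℕ, ∀ z ∈ D, AEStronglyMeasurable
      (fun y => iteratedFDeriv ℝ n (fun z => k z y) z) μ)
    (hb : ∀ n : ℕ, ∀ z ∈ D, ∃ ε > 0, ∃ h : α → ℝ, Integrable h μ ∧
      ∀ z' ∈ Metric.ball z ε, ∀ y, ‖iteratedFDeriv ℝ n (fun z => k z y) z'‖ ≤ h y) :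
    HasFTaylorSeriesUpToOn ∞ (fun z => ∫ y, k z y ∂μ)
      (fun z n => ∫ y, iteratedFDeriv ℝ n (fun z => k z y) z ∂μ) D := by
  have hint : ∀ n : ℕ, ∀ z ∈ D, Integrable (fun y => iteratedFDeriv ℝ n (fun z => k z y) z) μ := by
    intro n z hz
    obtain ⟨ε, hε, h, hh, hle⟩ := hb n z hz
    exact hh.mono' (hm n z hz) (.of_forall fun y => hle z (Metric.mem_ball_self hε) y)
  have hder : ∀ n : ℕ, ∀ z ∈ D, HasFDerivAt
      (fun z => ∫ y, iteratedFDeriv ℝ n (fun z => k z y) z ∂μ)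
      ((∫ y, iteratedFDeriv ℝ (n + 1) (fun z => k z y) z ∂μ).curryLeft) z := by
    intro n z hz
    obtain ⟨ε, hε, h, hh, hle⟩ := hb (n + 1) z hz
    obtain ⟨δ, hδ, hδD⟩ := Metric.isOpen_iff.1 hD z hz
    have key := hasFDerivAt_integral_of_dominated_of_fderiv_le (𝕜 := ℝ) (μ := μ) (x₀ := z)
      (F := fun z y => iteratedFDeriv ℝ n (fun z => k z y) z)
      (F' := fun z y => (iteratedFDeriv ℝ (n + 1) (fun z => k z y) z).curryLeft) (bound := h)
      (s := Metric.ball z ε ∩ D) (Filter.inter_mem (Metric.ball_mem_nhds z hε) (hD.mem_nhds hz))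
      (by filter_upwards [hD.mem_nhds hz] with w hw using hm n w hw) (hint n z hz)
      ((continuousMultilinearCurryLeftEquiv ℝ (fun _ : Fin (n + 1) => Z) F).continuous.comp_aestronglyMeasurable
        (hm (n + 1) z hz))
      (.of_forall fun y w hw => by
        have := hle w hw.1 y
        rwa [← (continuousMultilinearCurryLeftEquiv ℝ (fun _ : Fin (n + 1) => Z) F).norm_map] at this)
      hh (.of_forall fun y w hw => by
        have h1 : DifferentiableAt ℝ (iteratedFDeriv ℝ n fun z => k z y) w :=
          ((hk y).contDiffAt (hD.mem_nhds hw.2)).differentiableAt_iteratedFDeriv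
            (by exact_mod_cast WithTop.coe_lt_top _)
        have h2 := h1.hasFDerivAt
        rw [fderiv_iteratedFDeriv] at h2
        exact h2)
    have hc := ContinuousLinearMap.integral_comp_comm (𝕜 := ℝ) (E := Z [×(n + 1)]→L[ℝ] F) (Fₗ := Z →L[ℝ] (Z [×n]→L[ℝ] F))
      (continuousMultilinearCurryLeftEquiv ℝ (fun _ : Fin (n + 1) => Z)
        F).toContinuousLinearEquiv.toContinuousLinearMap (hint (n + 1) z hz)
    have e : (∫ y, (iteratedFDeriv ℝ (n + 1) (fun z => k z y) z).curryLeft ∂μ) =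
        (∫ y, iteratedFDeriv ℝ (n + 1) (fun z => k z y) z ∂μ).curryLeft := hc
    rw [← e]; exact key
  refine ⟨fun z hz => ?_, fun n _ z hz => (hder n z hz).hasFDerivWithinAt,
    fun n _ z hz => (hder n z hz).continuousAt.continuousWithinAt⟩
  have hc := (continuousMultilinearCurryFin0 ℝ Z
      F).toContinuousLinearEquiv.toContinuousLinearMap.integral_comp_comm (hint 0 z hz)
  exact hc.symm

theorem contDiffOn_integral [CompleteSpace F] {D : Set Z} (hD : IsOpen D)
    {k : Z → α → F} (hk : ∀ y, ContDiffOn ℝ ∞ (fun z => k z y) D)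
    (hm : ∀ n : ℕ, ∀ z ∈ D, AEStronglyMeasurable
      (fun y => iteratedFDeriv ℝ n (fun z => k z y) z) μ)
    (hb : ∀ n : ℕ, ∀ z ∈ D, ∃ ε > 0, ∃ h : α → ℝ, Integrable h μ ∧
      ∀ z' ∈ Metric.ball z ε, ∀ y, ‖iteratedFDeriv ℝ n (fun z => k z y) z'‖ ≤ h y) :
    ContDiffOn ℝ ∞ (fun z => ∫ y, k z y ∂μ) D :=
  (hasFTaylorSeriesUpToOn_integral hD hk hm hb).contDiffOn

theorem hasFDerivAt_integral_param [CompleteSpace F] {D : Set Z} (hD : IsOpen D)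
    {k : Z → α → F} (hk : ∀ y, ContDiffOn ℝ ∞ (fun z => k z y) D)
    (hm : ∀ n : ℕ, ∀ z ∈ D, AEStronglyMeasurable
      (fun y => iteratedFDeriv ℝ n (fun z => k z y) z) μ)
    (hb : ∀ n : ℕ, ∀ z ∈ D, ∃ ε > 0, ∃ h : α → ℝ, Integrable h μ ∧
      ∀ z' ∈ Metric.ball z ε, ∀ y, ‖iteratedFDeriv ℝ n (fun z => k z y) z'‖ ≤ h y)
    {z : Z} (hz : z ∈ D) (v : Z) :
    fderiv ℝ (fun z => ∫ y, k z y ∂μ) z v = ∫ y, fderiv ℝ (fun z => k z y) z v ∂μ := by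
  obtain ⟨ε, hε, h, hh, hle⟩ := hb 1 z hz
  have hint : Integrable (fun y => iteratedFDeriv ℝ 1 (fun z => k z y) z) μ :=
    hh.mono' (hm 1 z hz) (.of_forall fun y => hle z (Metric.mem_ball_self hε) y)
  have h1 := (hasFTaylorSeriesUpToOn_integral hD hk hm hb).hasFDerivAt (by simp) (hD.mem_nhds hz)
  rw [h1.fderiv]
  have hc := (((continuousMultilinearCurryFin1 ℝ Z
      F).toContinuousLinearEquiv.toContinuousLinearMap)).integral_comp_comm hint
  have hc' : (continuousMultilinearCurryFin1 ℝ Z F)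
      (∫ y, iteratedFDeriv ℝ 1 (fun z => k z y) z ∂μ) = 
      ∫ y, fderiv ℝ (fun z => k z y) z ∂μ := by
    refine hc.symm.trans (integral_congr_ae (.of_forall fun y => ?_))
    ext w
    simp
  have hi2 : Integrable (fun y => fderiv ℝ (fun z => k z y) z) μ := by
    refine ((((continuousMultilinearCurryFin1 ℝ Z
      F).toContinuousLinearEquiv.toContinuousLinearMap)).integrable_comp hint).congr
      (.of_forall fun y => ?_)
    ext w
    simp
  rw [hc', ContinuousLinearMap.integral_apply hi2]

variable {Y : Type*} [NormedAddCommGroup Y] [NormedSpace ℝ Y] [MeasurableSpace Y] [BorelSpace Y]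
  [SecondCountableTopology Y] {ν : Measure Y}

/-- The hypotheses under which `z ↦ ∫ g(y) κ(z - ι y) dy` is smooth on `D`. -/
structure SmoothTranslates (ν : Measure Y) (g : Y → ℝ) (κ : Z → F) (ι : Y →L[ℝ] Z) (O D : Set Z) :
    Prop where
  isOpen_O : IsOpen O
  isOpen_D : IsOpen D
  contDiffOn : ContDiffOn ℝ ∞ κ O
  meas : AEStronglyMeasurable g ν
  mem : ∀ z ∈ D, ∀ y, g y ≠ 0 → z - ι y ∈ O
  bound : ∀ n : ℕ, ∀ z ∈ D, ∃ ε > 0, ∃ h : Y → ℝ, Integrable h ν ∧ ∀ z' ∈ Metric.ball z ε ∩ D,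
    ∀ y, g y ≠ 0 → |g y| * ‖iteratedFDeriv ℝ n κ (z' - ι y)‖ ≤ h y

namespace SmoothTranslates

variable {g : Y → ℝ} {κ : Z → F} {ι : Y →L[ℝ] Z} {O D : Set Z}

/-- Where g vanishes, κ(z − ιy) may be singular, but the product is then identically zero in z; this
is why smoothness of κ is asked only over the support of g. -/
theorem iteratedFDeriv_eq (H : SmoothTranslates ν g κ ι O D) (n : ℕ) {z : Z} (hz : z ∈ D) (y : Y) :
    iteratedFDeriv ℝ n (fun z => g y • κ (z - ι y)) z
      = g y • iteratedFDeriv ℝ n κ (z - ι y) := by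
  by_cases hg : g y = 0
  · simp only [hg, zero_smul]
    simp
  have h1 : ContDiffAt ℝ n κ (z - ι y) :=
    (H.contDiffOn.contDiffAt (H.isOpen_O.mem_nhds (H.mem z hz y hg))).of_le
      (by exact_mod_cast le_top)
  have h2 : ContDiffAt ℝ n (fun z => κ (z - ι y)) z :=
    h1.comp z (contDiffAt_id.sub contDiffAt_const)
  rw [iteratedFDeriv_const_smul_apply' h2]
  simp [sub_eq_add_neg, iteratedFDeriv_comp_add_right]

theorem hyps (H : SmoothTranslates ν g κ ι O D) :
    (∀ y, ContDiffOn ℝ ∞ (fun z => g y • κ (z - ι y)) D) ∧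
    (∀ n : ℕ, ∀ z ∈ D, AEStronglyMeasurable
      (fun y => iteratedFDeriv ℝ n (fun z => g y • κ (z - ι y)) z) ν) ∧
    (∀ n : ℕ, ∀ z ∈ D, ∃ ε > 0, ∃ h : Y → ℝ, Integrable h ν ∧
      ∀ z' ∈ Metric.ball z ε, ∀ y,
        ‖iteratedFDeriv ℝ n (fun z => g y • κ (z - ι y)) z'‖ ≤ h y) := by
  refine ⟨fun y => ?_, fun n z hz => ?_, fun n z hz => ?_⟩
  · by_cases hg : g y = 0
    · simp only [hg, zero_smul]; exact contDiffOn_const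
    · exact contDiffOn_const.smul (H.contDiffOn.comp (contDiffOn_id.sub contDiffOn_const)
        fun z hz => H.mem z hz y hg)
  · simp only [H.iteratedFDeriv_eq n hz]
    have ho : IsOpen {y | z - ι y ∈ O} := H.isOpen_O.preimage (by fun_prop)
    have hc : ContinuousOn (fun y => iteratedFDeriv ℝ n κ (z - ι y)) {y | z - ι y ∈ O} := by
      have := H.contDiffOn.continuousOn_iteratedFDerivWithin (m := n)
        (by exact_mod_cast le_top) H.isOpen_O.uniqueDiffOn
      have h2 : ContinuousOn (iteratedFDeriv ℝ n κ) O :=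
        this.congr fun w hw => (iteratedFDerivWithin_of_isOpen n H.isOpen_O hw).symm
      exact h2.comp (by fun_prop) fun y hy => hy
    -- The derivatives of κ are continuous on O only. Their extension by zero is measurable, and
    -- multiplication by g hides the difference.
    have hm : AEStronglyMeasurable ({y | z - ι y ∈ O}.indicator
        (fun y => iteratedFDeriv ℝ n κ (z - ι y))) ν :=
      (aestronglyMeasurable_indicator_iff ho.measurableSet).2
        (hc.aestronglyMeasurable ho.measurableSet)
    refine (H.meas.smul hm).congr (.of_forall fun y => ?_)
    by_cases hg : g y = 0
    · simp [hg]
    · simp [indicator_of_mem (show y ∈ {y | z - ι y ∈ O} from H.mem z hz y hg)]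
  · obtain ⟨ε, hε, h, hh, hle⟩ := H.bound n z hz
    obtain ⟨δ, hδ, hδD⟩ := Metric.isOpen_iff.1 H.isOpen_D z hz
    refine ⟨min ε δ, lt_min hε hδ, fun y => |h y|, hh.abs, fun z' hz' y => ?_⟩
    have hz1 : z' ∈ Metric.ball z ε := Metric.ball_subset_ball (min_le_left _ _) hz'
    have hz2 : z' ∈ D := hδD (Metric.ball_subset_ball (min_le_right _ _) hz')
    rw [H.iteratedFDeriv_eq n hz2, norm_smul, Real.norm_eq_abs]
    by_cases hg : g y = 0
    · simp [hg]
    · exact (hle z' ⟨hz1, hz2⟩ y hg).trans (le_abs_self _)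

theorem contDiffOn_integral [CompleteSpace F] (H : SmoothTranslates ν g κ ι O D) :
    ContDiffOn ℝ ∞ (fun z => ∫ y, g y • κ (z - ι y) ∂ν) D :=
  Axi.contDiffOn_integral H.isOpen_D H.hyps.1 H.hyps.2.1 H.hyps.2.2

theorem fderiv_integral [CompleteSpace F] (H : SmoothTranslates ν g κ ι O D) {z : Z} (hz : z ∈ D)
    (v : Z) : fderiv ℝ (fun z => ∫ y, g y • κ (z - ι y) ∂ν) z v
      = ∫ y, g y • fderiv ℝ κ (z - ι y) v ∂ν := by
  rw [hasFDerivAt_integral_param H.isOpen_D H.hyps.1 H.hyps.2.1 H.hyps.2.2 hz v]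
  refine integral_congr_ae (.of_forall fun y => ?_)
  by_cases hg : g y = 0
  · simp [hg]
  have h1 : DifferentiableAt ℝ κ (z - ι y) :=
    (H.contDiffOn.contDiffAt (H.isOpen_O.mem_nhds (H.mem z hz y hg))).differentiableAt (by simp)
  have h2 : HasFDerivAt (fun z => κ (z - ι y)) (fderiv ℝ κ (z - ι y)) z := by
    simpa [Function.comp_def] using h1.hasFDerivAt.comp z ((hasFDerivAt_id z).sub_const (ι y))
  have h3 : HasFDerivAt (fun z => g y • κ (z - ι y)) (g y • fderiv ℝ κ (z - ι y)) z :=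
    h2.const_smul (g y)
  simp only [h3.fderiv, smul_apply]

end SmoothTranslates

end Parametric

/-! ### Partial derivatives -/

theorem sum_smul_single (v : E3) : ∑ i : Fin 3, v i • EuclideanSpace.single i (1 : ℝ) = v := by
  ext j
  fin_cases j <;> simp [Fin.sum_univ_three]

theorem fderiv_eq_sum_pd (f : E3 → ℝ) (x v : E3) :
    fderiv ℝ f x v = ∑ i : Fin 3, v i * pd i f x := by
  conv_lhs => rw [← sum_smul_single v]
  simp [pd]

theorem norm_fderiv_le_sum_pd (f : E3 → ℝ) (x : E3) :
    ‖fderiv ℝ f x‖ ≤ ∑ i : Fin 3, |pd i f x| := by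
  refine ContinuousLinearMap.opNorm_le_bound _ (Finset.sum_nonneg fun i _ => abs_nonneg _) fun v => ?_
  rw [fderiv_eq_sum_pd, Finset.sum_mul]
  refine (norm_sum_le _ _).trans (Finset.sum_le_sum fun i _ => ?_)
  rw [norm_mul, mul_comm]
  exact mul_le_mul_of_nonneg_left (PiLp.norm_apply_le v i) (norm_nonneg _)

theorem abs_pd_le (i : Fin 3) (f : E3 → ℝ) (x : E3) : |pd i f x| ≤ ‖fderiv ℝ f x‖ := by
  have := (fderiv ℝ f x).le_opNorm (EuclideanSpace.single i 1)
  simpa [pd] using this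

theorem _root_.HasFDerivAt.pd_eq {f : E3 → ℝ} {f' : E3 →L[ℝ] ℝ} {x : E3} (h : HasFDerivAt f f' x)
    (i : Fin 3) : pd i f x = f' (EuclideanSpace.single i 1) := by
  rw [pd, h.fderiv]

theorem _root_.ContDiff.pd {n m : ℕ∞} {f : E3 → ℝ} (hf : ContDiff ℝ n f) (hm : m + 1 ≤ n) (i : Fin 3) :
    ContDiff ℝ m (pd i f) :=
  (hf.fderiv_right (by exact_mod_cast hm)).clm_apply contDiff_const

theorem _root_.ContDiff.pd_infty {f : E3 → ℝ} (hf : ContDiff ℝ ∞ f) (i : Fin 3) :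
    ContDiff ℝ ∞ (Axi.pd i f) :=
  ContDiff.pd (n := ⊤) (m := ⊤) hf (by simp) i

theorem _root_.ContDiff.continuous_pd {f : E3 → ℝ} (hf : ContDiff ℝ 1 f) (i : Fin 3) :
    Continuous (Axi.pd i f) :=
  (hf.continuous_fderiv one_ne_zero).clm_apply continuous_const

theorem pd_comm_of_contDiffAt {f : E3 → ℝ} {x : E3} (hf : ContDiffAt ℝ 2 f x) (i j : Fin 3) :
    pd i (pd j f) x = pd j (pd i f) x := by
  have hs := hf.isSymmSndFDerivAt (by simp)
  have hd : DifferentiableAt ℝ (fderiv ℝ f) x :=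
    (hf.fderiv_right (m := 1) (by norm_num)).differentiableAt one_ne_zero
  have key : ∀ k l : Fin 3, pd k (pd l f) x
      = fderiv ℝ (fderiv ℝ f) x (EuclideanSpace.single k 1) (EuclideanSpace.single l 1) := by
    intro k l
    have h1 : HasFDerivAt (pd l f) ((ContinuousLinearMap.apply ℝ ℝ
        (EuclideanSpace.single l (1 : ℝ) : E3)).comp (fderiv ℝ (fderiv ℝ f) x)) x :=
      ((ContinuousLinearMap.apply ℝ ℝ (EuclideanSpace.single l (1 : ℝ) : E3)).hasFDerivAt).comp x
        hd.hasFDerivAt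
    rw [h1.pd_eq]; rfl
  rw [key, key]
  exact hs _ _

theorem pd_comm {f : E3 → ℝ} (hf : ContDiff ℝ 2 f) (i j : Fin 3) :
    pd i (pd j f) = pd j (pd i f) :=
  funext fun _ => pd_comm_of_contDiffAt hf.contDiffAt i j

theorem pd_add {f g : E3 → ℝ} {x : E3} (hf : DifferentiableAt ℝ f x) (hg : DifferentiableAt ℝ g x)
    (i : Fin 3) : pd i (fun y => f y + g y) x = pd i f x + pd i g x := by
  have := (hf.hasFDerivAt.add hg.hasFDerivAt).pd_eq i
  exact this

theorem pd_sub {f g : E3 → ℝ} {x : E3} (hf : DifferentiableAt ℝ f x) (hg : DifferentiableAt ℝ g x)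
    (i : Fin 3) : pd i (fun y => f y - g y) x = pd i f x - pd i g x := by
  have := (hf.hasFDerivAt.sub hg.hasFDerivAt).pd_eq i
  exact this

theorem pd_mul {f g : E3 → ℝ} {x : E3} (hf : DifferentiableAt ℝ f x) (hg : DifferentiableAt ℝ g x)
    (i : Fin 3) : pd i (fun y => f y * g y) x = f x * pd i g x + g x * pd i f x := by
  have := (hf.hasFDerivAt.mul hg.hasFDerivAt).pd_eq i
  exact this.trans (by simp [pd])

theorem pd_const_mul {f : E3 → ℝ} {x : E3} (c : ℝ) (hf : DifferentiableAt ℝ f x)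
    (i : Fin 3) : pd i (fun y => c * f y) x = c * pd i f x := by
  have := (hf.hasFDerivAt.const_mul c).pd_eq i
  simpa [pd] using this

theorem pd_sum {f : Fin 3 → E3 → ℝ} {x : E3} (hf : ∀ j, DifferentiableAt ℝ (f j) x)
    (i : Fin 3) : pd i (fun y => ∑ j, f j y) x = ∑ j, pd i (f j) x := by
  have := (HasFDerivAt.fun_sum (u := Finset.univ) fun j _ => (hf j).hasFDerivAt).pd_eq i
  simpa [pd] using this

theorem pd_coord (i j : Fin 3) (x : E3) : pd i (fun y => y j) x = if i = j then 1 else 0 := by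
  have h : HasFDerivAt (fun y : E3 => y j) (EuclideanSpace.proj j : E3 →L[ℝ] ℝ) x :=
    (EuclideanSpace.proj j : E3 →L[ℝ] ℝ).hasFDerivAt
  rw [h.pd_eq]
  simp [eq_comm]

theorem contDiff_coord {n : WithTop ℕ∞} (j : Fin 3) : ContDiff ℝ n (fun y : E3 => y j) :=
  (EuclideanSpace.proj j : E3 →L[ℝ] ℝ).contDiff

theorem differentiable_coord (j : Fin 3) : Differentiable ℝ (fun y : E3 => y j) :=
  (EuclideanSpace.proj j : E3 →L[ℝ] ℝ).differentiable

theorem pd_congr {f g : E3 → ℝ} {x : E3} (h : f =ᶠ[nhds x] g) (i : Fin 3) : pd i f x = pd i g x := by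
  rw [pd, pd, h.fderiv_eq]

theorem lap_eq (f : E3 → ℝ) (x : E3) :
    lap f x = pd 0 (pd 0 f) x + pd 1 (pd 1 f) x + pd 2 (pd 2 f) x := by
  simp [lap, Fin.sum_univ_three]

/-! ### The kernel `∂ᵢN` -/

theorem abs_dNewton_le (i : Fin 3) (x : E3) : |dNewton i x| ≤ (‖x‖ ^ 2)⁻¹ := by
  rcases eq_or_ne x 0 with rfl | hx
  · simp [dNewton]
  have hn : 0 < ‖x‖ := norm_pos_iff.2 hx
  have h1 : |x i| ≤ ‖x‖ := PiLp.norm_apply_le x i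
  have hpi : 1 ≤ 4 * Real.pi := by linarith [Real.pi_gt_three]
  rw [dNewton, abs_div, abs_of_pos (by positivity : 0 < 4 * Real.pi * ‖x‖ ^ 3), inv_eq_one_div,
    div_le_div_iff₀ (by positivity) (by positivity)]
  calc |x i| * ‖x‖ ^ 2 ≤ ‖x‖ * ‖x‖ ^ 2 := by gcongr
    _ = 1 * ‖x‖ ^ 3 := by ring
    _ ≤ (4 * Real.pi) * ‖x‖ ^ 3 := by gcongr
    _ = _ := by ring

theorem dNewton_smul (i : Fin 3) {c : ℝ} (hc : 0 < c) (x : E3) :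
    dNewton i (c • x) = (c ^ 2)⁻¹ * dNewton i x := by
  rcases eq_or_ne x 0 with rfl | hx
  · simp [dNewton]
  have hn : 0 < ‖x‖ := norm_pos_iff.2 hx
  simp only [dNewton, norm_smul, Real.norm_eq_abs, abs_of_pos hc, PiLp.smul_apply, smul_eq_mul]
  field_simp

theorem contDiffOn_dNewton (i : Fin 3) : ContDiffOn ℝ ∞ (dNewton i) {0}ᶜ := by
  intro x hx
  have hn : ‖x‖ ≠ 0 := norm_ne_zero_iff.2 hx
  have h : ContDiffAt ℝ ∞ (dNewton i) x := by
    unfold dNewton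
    exact (contDiff_coord i).contDiffAt.div
      (contDiffAt_const.mul ((contDiffAt_norm ℝ hx).pow 3)) (by positivity)
  exact h.contDiffWithinAt

theorem contDiffOn_newton : ContDiffOn ℝ ∞ newton {0}ᶜ := by
  intro x hx
  have hn : ‖x‖ ≠ 0 := norm_ne_zero_iff.2 hx
  have h : ContDiffAt ℝ ∞ newton x := by
    unfold newton
    exact contDiffAt_const.div (contDiffAt_const.mul (contDiffAt_norm ℝ hx)) (by positivity)
  exact h.contDiffWithinAt

theorem measurable_dNewton (i : Fin 3) : Measurable (dNewton i) := by
  unfold dNewton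
  exact (contDiff_coord (n := 0) i).continuous.measurable.div (by fun_prop)

theorem measurable_newton : Measurable newton := by
  unfold newton; fun_prop

/-- Harmonicity of N off the origin: ∂ᵢ∂ᵢN = (4π)⁻¹(|x|⁻³ − 3xᵢ²|x|⁻⁵), and the three terms cancel.
-/
theorem sum_pd_dNewton {x : E3} (hx : x ≠ 0) : ∑ i : Fin 3, pd i (dNewton i) x = 0 := by
  have hn : ‖x‖ ≠ 0 := norm_ne_zero_iff.2 hx
  have h1 : HasFDerivAt (fun y : E3 => ‖y‖ ^ 2) (2 • (innerSL ℝ x)) x :=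
    (hasStrictFDerivAt_norm_sq x).hasFDerivAt
  have h2 := h1.sqrt (by positivity)
  simp only [Real.sqrt_sq (norm_nonneg _)] at h2
  have h3 := (hasDerivAt_zpow (-3) ‖x‖ (Or.inl hn)).comp_hasFDerivAt x h2
  have h4 : ∀ i, dNewton i = fun y : E3 => (1 / (4 * Real.pi)) * (y i * ((fun t : ℝ => t ^ (-3 : ℤ)) ∘ fun y => ‖y‖) y) := by
    intro i
    funext y
    simp only [dNewton, Function.comp, zpow_neg]
    norm_cast
    rw [div_mul_eq_div_div, div_eq_mul_inv _ (‖y‖ ^ 3)]; ring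
  have h3' : HasFDerivAt ((fun t : ℝ => t ^ (-3 : ℤ)) ∘ fun y : E3 => ‖y‖) _ x := h3
  have h5 : ∀ i, pd i (dNewton i) x = 1 / (4 * Real.pi) * (‖x‖ ^ (-3 : ℤ) - 3 * x i ^ 2 * ‖x‖ ^ (-5 : ℤ)) := by
    intro i
    have h6 : HasFDerivAt (fun y : E3 => (1 / (4 * Real.pi)) *
        (y i * ((fun t : ℝ => t ^ (-3 : ℤ)) ∘ fun y : E3 => ‖y‖) y)) _ x :=
      ((EuclideanSpace.proj i : E3 →L[ℝ] ℝ).hasFDerivAt.mul h3').const_mul _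
    rw [h4, h6.pd_eq i]
    simp [EuclideanSpace.inner_single_right]
    have e5 : ‖x‖ ^ (-5 : ℤ) = (‖x‖ ^ 5)⁻¹ := by rw [zpow_neg]; norm_cast
    have e4 : ‖x‖ ^ (-3 - 1 : ℤ) = (‖x‖ ^ 4)⁻¹ := by
      rw [show (-3 - 1 : ℤ) = -4 by norm_num, zpow_neg]; norm_cast
    have e3 : ‖x‖ ^ (-3 : ℤ) = (‖x‖ ^ 3)⁻¹ := by rw [zpow_neg]; norm_cast
    field_simp
    ring
  simp only [h5, Fin.sum_univ_three]
  have hs : ‖x‖ ^ 2 = x 0 ^ 2 + x 1 ^ 2 + x 2 ^ 2 := by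
    rw [EuclideanSpace.real_norm_sq_eq, Fin.sum_univ_three]
  have e : ‖x‖ ^ (-3 : ℤ) = ‖x‖ ^ (-5 : ℤ) * ‖x‖ ^ 2 := by
    rw [← zpow_natCast, ← zpow_add₀ hn]; norm_num
  rw [e, hs]; ring

theorem norm_le_of_comp_smul {n : ℕ} {c C : ℝ} (hc : 0 < c)
    (p q : ContinuousMultilinearMap ℝ (fun _ : Fin n => E3) ℝ) (hC : 0 ≤ C) (hp : ‖p‖ ≤ C)
    (h : ∀ m : Fin n → E3, q (fun j => c • m j) = (c ^ 2)⁻¹ * p m) :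
    ‖q‖ ≤ C * (c ^ (n + 2))⁻¹ := by
  refine ContinuousMultilinearMap.opNorm_le_bound (by positivity) fun m => ?_
  have h1 := h m
  rw [ContinuousMultilinearMap.map_smul_univ] at h1
  simp only [Finset.prod_const, Finset.card_univ, Fintype.card_fin, smul_eq_mul] at h1
  have h2 : q m = (c ^ (n + 2))⁻¹ * p m := by
    rw [pow_add, mul_inv, mul_assoc, ← h1]
    field_simp
  rw [h2, norm_mul, Real.norm_of_nonneg (by positivity)]
  have h3 := p.le_of_opNorm_le hp m
  calc _ ≤ (c ^ (n + 2))⁻¹ * (C * ∏ i, ‖m i‖) := by gcongr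
    _ = _ := by ring

/-- The kernel is homogeneous of degree −2, so its n-th derivative is homogeneous of degree −2−n,
and it suffices to bound it on the compact unit sphere. -/
theorem norm_iteratedFDeriv_dNewton_le (i : Fin 3) (n : ℕ) :
    ∃ C, 0 ≤ C ∧ ∀ z : E3, z ≠ 0 → ‖iteratedFDeriv ℝ n (dNewton i) z‖ ≤ C * (‖z‖ ^ (n + 2))⁻¹ := by
  have hO : IsOpen ({0}ᶜ : Set E3) := isOpen_compl_singleton
  have hc : ContinuousOn (iteratedFDeriv ℝ n (dNewton i)) {0}ᶜ := by
    have := (contDiffOn_dNewton i).continuousOn_iteratedFDerivWithin (m := n)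
      (by exact_mod_cast le_top) hO.uniqueDiffOn
    exact this.congr fun w hw => (iteratedFDerivWithin_of_isOpen n hO hw).symm
  obtain ⟨C, hC⟩ := (isCompact_sphere (0 : E3) 1).exists_bound_of_continuousOn
    (hc.mono fun z hz => by
      have : ‖z‖ = 1 := by simpa using hz
      intro h0; simp [mem_singleton_iff.1 h0] at this)
  refine ⟨max C 0, le_max_right _ _, fun z hz => ?_⟩
  have hn : 0 < ‖z‖ := norm_pos_iff.2 hz
  set c := ‖z‖ with hcdef
  set w : E3 := c⁻¹ • z with hw
  have hw1 : ‖w‖ = 1 := by rw [hw, norm_smul, norm_inv, norm_norm, inv_mul_cancel₀ hn.ne']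
  have hw0 : w ≠ 0 := by intro h; simp [h] at hw1
  have hzw : z = c • w := by rw [hw, smul_smul, mul_inv_cancel₀ hn.ne', one_smul]
  let g : E3 ≃L[ℝ] E3 := ContinuousLinearEquiv.smulLeft (Units.mk0 c hn.ne')
  have hg : ∀ y : E3, g y = c • y := fun y => rfl
  have e1 := g.iteratedFDerivWithin_comp_right (dNewton i) uniqueDiffOn_univ
    (x := w) (mem_univ _) n
  simp only [preimage_univ, iteratedFDerivWithin_univ] at e1
  have e2 : dNewton i ∘ g = fun y => (c ^ 2)⁻¹ • dNewton i y := by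
    funext y; simp [hg, dNewton_smul i hn]
  have hca : ContDiffAt ℝ n (dNewton i) w :=
    ((contDiffOn_dNewton i).contDiffAt (hO.mem_nhds hw0)).of_le (by exact_mod_cast le_top)
  rw [e2, iteratedFDeriv_const_smul_apply' hca, hg, ← hzw] at e1
  have hp := (hC w (by simpa using hw1)).trans (le_max_left C 0)
  exact norm_le_of_comp_smul hn _ _ (le_max_right _ _) hp fun m => by
    have e4 := congrArg (fun p => p m) e1
    exact e4.symm

/-! ### Radial integrals and the kernel `|x|⁻²` -/

theorem integrable_radial {φ : ℝ → ℝ} (h : IntegrableOn (fun r => r ^ 2 * φ r) (Ioi 0)) :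
    Integrable (fun z : E3 => φ ‖z‖) := by
  have h1 := (integrable_fun_norm_addHaar (volume : Measure E3) (f := φ))
  rw [h1]
  simpa using h

/-- In polar coordinates the Jacobian r² cancels the singularity and leaves the one-dimensional
Cauchy density. -/
theorem integrable_inv_sq_mul_inv {c : ℝ} (hc : 0 < c) :
    Integrable (fun z : E3 => (‖z‖ ^ 2)⁻¹ * (c ^ 2 + ‖z‖ ^ 2)⁻¹) := by
  apply integrable_radial (φ := fun r => (r ^ 2)⁻¹ * (c ^ 2 + r ^ 2)⁻¹)
  have h1 : Integrable (fun r : ℝ => (c ^ 2)⁻¹ * (1 + (c⁻¹ * r) ^ 2)⁻¹) :=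
    ((integrable_inv_one_add_sq).comp_mul_left' (inv_ne_zero hc.ne')).const_mul _
  refine h1.integrableOn.congr_fun (fun r hr => ?_) measurableSet_Ioi
  have hr' : (0 : ℝ) < r := hr
  simp only []
  field_simp

theorem integral_inv_sq_mul_inv_scale {c : ℝ} (hc : 0 < c) :
    ∫ z : E3, (‖z‖ ^ 2)⁻¹ * (c ^ 2 + ‖z‖ ^ 2)⁻¹
      = c⁻¹ * ∫ z : E3, (‖z‖ ^ 2)⁻¹ * (1 ^ 2 + ‖z‖ ^ 2)⁻¹ := by
  have h := Measure.integral_comp_smul (volume : Measure E3)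
    (fun z : E3 => (‖z‖ ^ 2)⁻¹ * (1 ^ 2 + ‖z‖ ^ 2)⁻¹) c⁻¹
  have e : ∀ z : E3, (‖c⁻¹ • z‖ ^ 2)⁻¹ * (1 ^ 2 + ‖c⁻¹ • z‖ ^ 2)⁻¹
      = c ^ 4 * ((‖z‖ ^ 2)⁻¹ * (c ^ 2 + ‖z‖ ^ 2)⁻¹) := by
    intro z
    rw [norm_smul, norm_inv, Real.norm_of_nonneg hc.le]
    rcases eq_or_ne z 0 with rfl | hz
    · simp
    have : 0 < ‖z‖ := norm_pos_iff.2 hz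
    field_simp
  simp only [e, integral_const_mul] at h
  simp only [finrank_euclideanSpace, Fintype.card_fin, smul_eq_mul] at h
  rw [abs_of_pos (by positivity)] at h
  field_simp at h ⊢
  linarith

theorem integrable_inv_one_add_sq_sq : Integrable (fun z : E3 => ((1 + ‖z‖ ^ 2) ^ 2)⁻¹) := by
  have h := integrable_rpow_neg_one_add_norm_sq (E := E3) (μ := volume) (r := 4)
    (by simp; norm_num)
  refine h.congr (.of_forall fun z => ?_)
  have h0 : (0 : ℝ) ≤ 1 + ‖z‖ ^ 2 := by positivity
  simp only []
  rw [show (-4 / 2 : ℝ) = -(2 : ℕ) by norm_num, Real.rpow_neg h0, Real.rpow_natCast]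

/-- With ρ² = 1+|y|² one has ρ² ≤ 2|x−y|² + 2(1+|x|²), so the larger of |x−y|² and 1+|x|² dominates
ρ². Replacing the inverse of the larger quantity leaves the integrand |z|⁻²(ρ²+|z|²)⁻¹, centred at y
or at 0, whose integral is proportional to ρ⁻¹ by scaling. -/
theorem lintegral_kernel_weight_one :
    ∃ C : ℝ, 0 ≤ C ∧ ∀ y : E3, ∫⁻ x, ENNReal.ofReal ((‖x - y‖ ^ 2)⁻¹ * (1 + ‖x‖ ^ 2)⁻¹)
      ≤ ENNReal.ofReal (C * (1 + ‖y‖)⁻¹) := by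
  set I := ∫ z : E3, (‖z‖ ^ 2)⁻¹ * (1 ^ 2 + ‖z‖ ^ 2)⁻¹ with hI
  have hI0 : 0 ≤ I := integral_nonneg fun z => by positivity
  refine ⟨20 * I, by positivity, fun y => ?_⟩
  set ρ := Real.sqrt (1 + ‖y‖ ^ 2) with hρ
  have hρ2 : ρ ^ 2 = 1 + ‖y‖ ^ 2 := Real.sq_sqrt (by positivity)
  have hρ0 : 0 < ρ := Real.sqrt_pos.2 (by positivity)
  have hint := integrable_inv_sq_mul_inv hρ0
  have hint2 : Integrable (fun x : E3 => (‖x - y‖ ^ 2)⁻¹ * (ρ ^ 2 + ‖x - y‖ ^ 2)⁻¹) :=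
    hint.comp_sub_right y
  have hle : ∀ᵐ x : E3, (‖x - y‖ ^ 2)⁻¹ * (1 + ‖x‖ ^ 2)⁻¹
      ≤ 5 * ((‖x - y‖ ^ 2)⁻¹ * (ρ ^ 2 + ‖x - y‖ ^ 2)⁻¹) + 5 * ((‖x‖ ^ 2)⁻¹ * (ρ ^ 2 + ‖x‖ ^ 2)⁻¹) := by
    have hne : ∀ᵐ x : E3, x ≠ 0 := by simp [ae_iff]
    filter_upwards [hne] with x hx
    rcases eq_or_ne (x - y) 0 with h0 | h0
    · rw [h0]; simp; positivity
    have ha : 0 < ‖x - y‖ := norm_pos_iff.2 h0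
    have hb : 0 < ‖x‖ := norm_pos_iff.2 hx
    have hy : ‖y‖ ≤ ‖x - y‖ + ‖x‖ := by
      calc ‖y‖ = ‖x - (x - y)‖ := by congr 1; abel
        _ ≤ _ := by rw [add_comm]; exact norm_sub_le _ _
    have hρle : ρ ^ 2 ≤ 2 * ‖x - y‖ ^ 2 + 2 * (1 + ‖x‖ ^ 2) := by
      rw [hρ2]; nlinarith [sq_nonneg (‖x - y‖ - ‖x‖), norm_nonneg y]
    -- The larger quantity M satisfies ρ² ≤ 4M, and adding the smaller one gives the constant 5.
    rcases le_total (‖x - y‖ ^ 2) (1 + ‖x‖ ^ 2) with h | h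
    · have : (1 + ‖x‖ ^ 2)⁻¹ ≤ 5 * (ρ ^ 2 + ‖x - y‖ ^ 2)⁻¹ := by
        rw [← div_eq_mul_inv, inv_eq_one_div, div_le_div_iff₀ (by positivity) (by positivity)]
        linarith
      have h2 : 0 ≤ 5 * ((‖x‖ ^ 2)⁻¹ * (ρ ^ 2 + ‖x‖ ^ 2)⁻¹) := by positivity
      have h3 := mul_le_mul_of_nonneg_left this (by positivity : 0 ≤ (‖x - y‖ ^ 2)⁻¹)
      linarith
    · have h1 : (‖x - y‖ ^ 2)⁻¹ ≤ 5 * (ρ ^ 2 + ‖x‖ ^ 2)⁻¹ := by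
        rw [← div_eq_mul_inv, inv_eq_one_div, div_le_div_iff₀ (by positivity) (by positivity)]
        linarith
      have h2 : 0 ≤ 5 * ((‖x - y‖ ^ 2)⁻¹ * (ρ ^ 2 + ‖x - y‖ ^ 2)⁻¹) := by positivity
      have h3 : (1 + ‖x‖ ^ 2)⁻¹ ≤ (‖x‖ ^ 2)⁻¹ := by gcongr; linarith
      have h4 : (‖x - y‖ ^ 2)⁻¹ * (1 + ‖x‖ ^ 2)⁻¹ ≤ 5 * (ρ ^ 2 + ‖x‖ ^ 2)⁻¹ * (‖x‖ ^ 2)⁻¹ := by gcongr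
      linarith
  have hint3 : Integrable (fun x : E3 => 5 * ((‖x - y‖ ^ 2)⁻¹ * (ρ ^ 2 + ‖x - y‖ ^ 2)⁻¹)
      + 5 * ((‖x‖ ^ 2)⁻¹ * (ρ ^ 2 + ‖x‖ ^ 2)⁻¹)) := (hint2.const_mul 5).add (hint.const_mul 5)
  calc _ ≤ ∫⁻ x : E3, ENNReal.ofReal (5 * ((‖x - y‖ ^ 2)⁻¹ * (ρ ^ 2 + ‖x - y‖ ^ 2)⁻¹)
        + 5 * ((‖x‖ ^ 2)⁻¹ * (ρ ^ 2 + ‖x‖ ^ 2)⁻¹)) :=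
        lintegral_mono_ae (hle.mono fun x hx => ENNReal.ofReal_le_ofReal hx)
    _ = ENNReal.ofReal (10 * ρ⁻¹ * I) := by
        rw [← ofReal_integral_eq_lintegral_ofReal hint3 (.of_forall fun x => by
          simp only [Pi.zero_apply]; positivity)]
        congr 1
        rw [integral_add (hint2.const_mul 5) (hint.const_mul 5), integral_const_mul, integral_const_mul,
          integral_sub_right_eq_self (fun x : E3 => (‖x‖ ^ 2)⁻¹ * (ρ ^ 2 + ‖x‖ ^ 2)⁻¹) y,
          integral_inv_sq_mul_inv_scale hρ0]
        ring
    _ ≤ _ := by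
        apply ENNReal.ofReal_le_ofReal
        have : ρ⁻¹ ≤ 2 * (1 + ‖y‖)⁻¹ := by
          rw [← div_eq_mul_inv, inv_eq_one_div, div_le_div_iff₀ hρ0 (by positivity)]
          nlinarith [sq_nonneg (‖y‖ - 1), norm_nonneg y]
        calc 10 * ρ⁻¹ * I ≤ 10 * (2 * (1 + ‖y‖)⁻¹) * I := by gcongr
          _ = _ := by ring

/-- The same dichotomy. If 1+|x|² is the larger quantity, one of its two inverse powers pays for
(1+|y|²)⁻¹ and the other for the decay of the kernel at infinity; if |x−y|² is the larger one, the
kernel itself is at most 4(1+|y|²)⁻¹ and the remaining weight is integrable. -/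
theorem lintegral_kernel_weight_two :
    ∃ C : ℝ, 0 ≤ C ∧ ∀ y : E3, ∫⁻ x, ENNReal.ofReal ((‖x - y‖ ^ 2)⁻¹ * ((1 + ‖x‖ ^ 2) ^ 2)⁻¹)
      ≤ ENNReal.ofReal (C * (1 + ‖y‖ ^ 2)⁻¹) := by
  have hint := integrable_inv_sq_mul_inv one_pos
  set I := ∫ z : E3, (‖z‖ ^ 2)⁻¹ * (1 ^ 2 + ‖z‖ ^ 2)⁻¹ with hI
  set J := ∫ z : E3, ((1 + ‖z‖ ^ 2) ^ 2)⁻¹ with hJ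
  have hI0 : 0 ≤ I := integral_nonneg fun z => by positivity
  have hJ0 : 0 ≤ J := integral_nonneg fun z => by positivity
  refine ⟨8 * I + 4 * J, by positivity, fun y => ?_⟩
  have hint2 : Integrable (fun x : E3 => (‖x - y‖ ^ 2)⁻¹ * (1 ^ 2 + ‖x - y‖ ^ 2)⁻¹) :=
    hint.comp_sub_right y
  have hle : ∀ x : E3, (‖x - y‖ ^ 2)⁻¹ * ((1 + ‖x‖ ^ 2) ^ 2)⁻¹
      ≤ (1 + ‖y‖ ^ 2)⁻¹ * (8 * ((‖x - y‖ ^ 2)⁻¹ * (1 ^ 2 + ‖x - y‖ ^ 2)⁻¹)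
        + 4 * ((1 + ‖x‖ ^ 2) ^ 2)⁻¹) := by
    intro x
    rcases eq_or_ne (x - y) 0 with h0 | h0
    · rw [h0]; simp; positivity
    have ha : 0 < ‖x - y‖ := norm_pos_iff.2 h0
    have hy : ‖y‖ ≤ ‖x - y‖ + ‖x‖ := by
      calc ‖y‖ = ‖x - (x - y)‖ := by congr 1; abel
        _ ≤ _ := by rw [add_comm]; exact norm_sub_le _ _
    have hρle : 1 + ‖y‖ ^ 2 ≤ 2 * ‖x - y‖ ^ 2 + 2 * (1 + ‖x‖ ^ 2) := by
      nlinarith [sq_nonneg (‖x - y‖ - ‖x‖), norm_nonneg y]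
    rcases le_total (‖x - y‖ ^ 2) (1 + ‖x‖ ^ 2) with h | h
    · have h1 : (1 + ‖x‖ ^ 2)⁻¹ ≤ 4 * (1 + ‖y‖ ^ 2)⁻¹ := by
        rw [← div_eq_mul_inv, inv_eq_one_div, div_le_div_iff₀ (by positivity) (by positivity)]
        linarith
      have h1' : (1 + ‖x‖ ^ 2)⁻¹ ≤ 2 * (1 ^ 2 + ‖x - y‖ ^ 2)⁻¹ := by
        rw [← div_eq_mul_inv, inv_eq_one_div, div_le_div_iff₀ (by positivity) (by positivity)]
        nlinarith [sq_nonneg ‖x‖]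
      have h2 : 0 ≤ (1 + ‖y‖ ^ 2)⁻¹ * (4 * ((1 + ‖x‖ ^ 2) ^ 2)⁻¹) := by positivity
      have h3 : (‖x - y‖ ^ 2)⁻¹ * ((1 + ‖x‖ ^ 2)⁻¹ * (1 + ‖x‖ ^ 2)⁻¹)
        ≤ (‖x - y‖ ^ 2)⁻¹ * ((4 * (1 + ‖y‖ ^ 2)⁻¹) * (2 * (1 ^ 2 + ‖x - y‖ ^ 2)⁻¹)) := by gcongr
      rw [sq (1 + ‖x‖ ^ 2), mul_inv] at *
      linarith
    · have h1 : (‖x - y‖ ^ 2)⁻¹ ≤ 4 * (1 + ‖y‖ ^ 2)⁻¹ := by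
        rw [← div_eq_mul_inv, inv_eq_one_div, div_le_div_iff₀ (by positivity) (by positivity)]
        linarith
      have h2 : 0 ≤ (1 + ‖y‖ ^ 2)⁻¹ * (8 * ((‖x - y‖ ^ 2)⁻¹ * (1 ^ 2 + ‖x - y‖ ^ 2)⁻¹)) := by positivity
      have h4 : (‖x - y‖ ^ 2)⁻¹ * ((1 + ‖x‖ ^ 2) ^ 2)⁻¹
        ≤ 4 * (1 + ‖y‖ ^ 2)⁻¹ * ((1 + ‖x‖ ^ 2) ^ 2)⁻¹ := by gcongr
      linarith
  have hint3 : Integrable (fun x : E3 => (1 + ‖y‖ ^ 2)⁻¹ *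
      (8 * ((‖x - y‖ ^ 2)⁻¹ * (1 ^ 2 + ‖x - y‖ ^ 2)⁻¹) + 4 * ((1 + ‖x‖ ^ 2) ^ 2)⁻¹)) :=
    ((hint2.const_mul 8).add (integrable_inv_one_add_sq_sq.const_mul 4)).const_mul _
  calc _ ≤ ∫⁻ x : E3, ENNReal.ofReal ((1 + ‖y‖ ^ 2)⁻¹ * (8 * ((‖x - y‖ ^ 2)⁻¹ * (1 ^ 2 + ‖x - y‖ ^ 2)⁻¹)
        + 4 * ((1 + ‖x‖ ^ 2) ^ 2)⁻¹)) :=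
        lintegral_mono fun x => ENNReal.ofReal_le_ofReal (hle x)
    _ = ENNReal.ofReal ((8 * I + 4 * J) * (1 + ‖y‖ ^ 2)⁻¹) := by
        rw [← ofReal_integral_eq_lintegral_ofReal hint3 (.of_forall fun x => by
          simp only [Pi.zero_apply]; positivity)]
        congr 1
        rw [integral_const_mul, integral_add (hint2.const_mul 8)
          (integrable_inv_one_add_sq_sq.const_mul 4), integral_const_mul, integral_const_mul,
          integral_sub_right_eq_self (fun x : E3 => (‖x‖ ^ 2)⁻¹ * (1 ^ 2 + ‖x‖ ^ 2)⁻¹) y]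
        ring

/-! ### Convolutions with kernels of order `|x|⁻²` -/

/-- A continuous function that is integrable with respect to `dy / (1 + |y|²)`. -/
structure Weighted (f : E3 → ℝ) : Prop where
  continuous : Continuous f
  integrable : Integrable (fun y => f y / (1 + ‖y‖ ^ 2))

/-- The integrals `∫ |x - y|⁻² |f(y)| dy` are bounded locally uniformly in `x`. -/
theorem Weighted.exists_lintegral_kernel_le {f : E3 → ℝ} (hf : Weighted f) (R : ℝ) :
    ∃ C : ENNReal, C ≠ ⊤ ∧ ∀ x : E3, ‖x‖ ≤ R →
      ∫⁻ y, ENNReal.ofReal ((‖x - y‖ ^ 2)⁻¹ * |f y|) ≤ C := by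
  wlog hR : 0 ≤ R generalizing R
  · obtain ⟨C, hC, h⟩ := this 0 le_rfl
    exact ⟨C, hC, fun x hx => absurd ((norm_nonneg x).trans hx) hR⟩
  obtain ⟨M, hM⟩ := (isCompact_closedBall (0 : E3) (2 * R + 1)).exists_bound_of_continuousOn
    hf.continuous.continuousOn
  have hM0 : 0 ≤ M := (norm_nonneg _).trans (hM 0 (by simp; positivity))
  set c := 1 + (3 * R + 1) ^ 2 with hc
  have hint := integrable_inv_sq_mul_inv one_pos
  set G : E3 → ℝ := fun x => M * c * ((‖x‖ ^ 2)⁻¹ * (1 ^ 2 + ‖x‖ ^ 2)⁻¹) with hG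
  have hGi : Integrable G := hint.const_mul _
  refine ⟨ENNReal.ofReal (∫ z, G z) + ENNReal.ofReal (∫ y, 8 * |f y / (1 + ‖y‖ ^ 2)|),
    by simp, fun x hx => ?_⟩
  have hle : ∀ y, ENNReal.ofReal ((‖x - y‖ ^ 2)⁻¹ * |f y|)
      ≤ ENNReal.ofReal (G (x - y)) + ENNReal.ofReal (8 * |f y / (1 + ‖y‖ ^ 2)|) := by
    intro y
    rw [← ENNReal.ofReal_add (by positivity) (by positivity)]
    apply ENNReal.ofReal_le_ofReal
    -- On |y| ≤ 2R+1 the function is bounded by M, and |x−y| ≤ 3R+1 lets the constant c make up for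
    -- the artificial decay in G. Outside, |x−y| ≥ |y|/2 makes the kernel comparable to the weight.
    by_cases hy : ‖y‖ ≤ 2 * R + 1
    · have h1 : |f y| ≤ M := hM y (by simpa using hy)
      have h2 : ‖x - y‖ ≤ 3 * R + 1 := (norm_sub_le _ _).trans (by linarith)
      have h3 : 1 ≤ c * (1 ^ 2 + ‖x - y‖ ^ 2)⁻¹ := by
        rw [← div_eq_mul_inv, one_le_div (by positivity), hc]; gcongr; norm_num
      have h4 : (‖x - y‖ ^ 2)⁻¹ * |f y| ≤ G (x - y) := by
        calc (‖x - y‖ ^ 2)⁻¹ * |f y| ≤ (‖x - y‖ ^ 2)⁻¹ * M * 1 := by rw [mul_one]; gcongr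
          _ ≤ (‖x - y‖ ^ 2)⁻¹ * M * (c * (1 ^ 2 + ‖x - y‖ ^ 2)⁻¹) := by gcongr
          _ = _ := by rw [hG]; ring
      have h5 : 0 ≤ 8 * |f y / (1 + ‖y‖ ^ 2)| := by positivity
      linarith
    · push Not at hy
      have hyx : ‖y‖ - ‖x‖ ≤ ‖x - y‖ := by rw [norm_sub_rev]; exact norm_sub_norm_le _ _
      have h1 : ‖y‖ / 2 ≤ ‖x - y‖ := by linarith
      have h2 : 1 ≤ ‖y‖ := by linarith
      have h3 : (‖x - y‖ ^ 2)⁻¹ ≤ 8 * (1 + ‖y‖ ^ 2)⁻¹ := by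
        have : (‖y‖ / 2) ^ 2 ≤ ‖x - y‖ ^ 2 := by gcongr
        rw [← div_eq_mul_inv, inv_eq_one_div, div_le_div_iff₀ (by nlinarith) (by positivity)]
        nlinarith
      have h4 : (‖x - y‖ ^ 2)⁻¹ * |f y| ≤ 8 * |f y / (1 + ‖y‖ ^ 2)| := by
        calc (‖x - y‖ ^ 2)⁻¹ * |f y| ≤ 8 * (1 + ‖y‖ ^ 2)⁻¹ * |f y| := by gcongr
          _ = _ := by rw [abs_div, abs_of_pos (by positivity : 0 < 1 + ‖y‖ ^ 2)]; ring
      have h5 : 0 ≤ G (x - y) := by rw [hG]; positivity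
      linarith
  refine (lintegral_mono hle).trans ?_
  have hGm : Measurable fun y => ENNReal.ofReal (G (x - y)) := by
    rw [hG]; fun_prop
  rw [lintegral_add_left hGm]
  gcongr
  · rw [lintegral_sub_left_eq_self (fun z => ENNReal.ofReal (G z)) x,
      ← ofReal_integral_eq_lintegral_ofReal hGi (.of_forall fun z => by rw [hG]; simp only [Pi.zero_apply]; positivity)]
  · rw [← ofReal_integral_eq_lintegral_ofReal (hf.integrable.abs.const_mul 8)
      (.of_forall fun z => by simp only [Pi.zero_apply]; positivity)]

theorem Weighted.integrable_of_le {f k : E3 → ℝ} (hf : Weighted f) (x : E3) {C : ℝ}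
    (hk : Measurable k) (hle : ∀ y, |k y| ≤ C * (‖x - y‖ ^ 2)⁻¹) :
    Integrable (fun y => k y * f y) := by
  obtain ⟨B, hB, h⟩ := hf.exists_lintegral_kernel_le ‖x‖
  refine ⟨(hk.mul hf.continuous.measurable).aestronglyMeasurable, ?_⟩
  refine lt_of_le_of_lt (b := ENNReal.ofReal |C| * B) ?_ (ENNReal.mul_lt_top (by simp) hB.lt_top)
  refine le_trans ?_ (mul_le_mul_right (h x le_rfl) _)
  rw [← lintegral_const_mul' _ _ (by simp)]
  refine lintegral_mono fun y => ?_
  rw [← ENNReal.ofReal_mul (abs_nonneg _), ← ofReal_norm]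
  apply ENNReal.ofReal_le_ofReal
  rw [norm_mul, Real.norm_eq_abs, Real.norm_eq_abs, ← mul_assoc]
  refine mul_le_mul_of_nonneg_right ((hle y).trans ?_) (abs_nonneg _)
  exact mul_le_mul_of_nonneg_right (le_abs_self _) (by positivity)

theorem Weighted.integrable_dNewton {f : E3 → ℝ} (hf : Weighted f) (i : Fin 3) (x : E3) :
    Integrable (fun y => dNewton i (x - y) * f y) :=
  hf.integrable_of_le x (C := 1) ((measurable_dNewton i).comp (by fun_prop))
    fun y => by rw [one_mul]; exact abs_dNewton_le i _

/-- A difference of two values of N gains the factor |x−y| and one order of decay, since 1/(|x||y|)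
is at most the sum of the inverse squares. This is what makes the normalised potential of a weighted
function converge. -/
theorem abs_newton_sub_le (x y : E3) (hx : x ≠ 0) (hy : y ≠ 0) :
    |newton x - newton y| ≤ ‖x - y‖ * ((‖x‖ ^ 2)⁻¹ + (‖y‖ ^ 2)⁻¹) := by
  have ha : 0 < ‖x‖ := norm_pos_iff.2 hx
  have hb : 0 < ‖y‖ := norm_pos_iff.2 hy
  have hpi : 1 ≤ 4 * Real.pi := by linarith [Real.pi_gt_three]
  have e : newton x - newton y = (4 * Real.pi)⁻¹ * ((‖x‖ - ‖y‖) * (‖x‖⁻¹ * ‖y‖⁻¹)) := by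
    simp only [newton]; field_simp; ring
  rw [e, abs_mul, abs_mul, abs_of_pos (by positivity : 0 < (4 * Real.pi)⁻¹),
    abs_of_pos (by positivity : 0 < ‖x‖⁻¹ * ‖y‖⁻¹)]
  have h1 : (4 * Real.pi)⁻¹ ≤ 1 := inv_le_one_of_one_le₀ hpi
  have h2 : |‖x‖ - ‖y‖| ≤ ‖x - y‖ := abs_norm_sub_norm_le x y
  have h3 : ‖x‖⁻¹ * ‖y‖⁻¹ ≤ (‖x‖ ^ 2)⁻¹ + (‖y‖ ^ 2)⁻¹ := by
    rw [← inv_pow, ← inv_pow]; nlinarith [sq_nonneg (‖x‖⁻¹ - ‖y‖⁻¹), sq_nonneg (‖x‖⁻¹), sq_nonneg (‖y‖⁻¹)]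
  calc _ ≤ 1 * (‖x - y‖ * ((‖x‖ ^ 2)⁻¹ + (‖y‖ ^ 2)⁻¹)) := by gcongr
    _ = _ := one_mul _

theorem Weighted.integrable_newton_sub {f : E3 → ℝ} (hf : Weighted f) (x x' : E3) :
    Integrable (fun y => (newton (x - y) - newton (x' - y)) * f y) := by
  have h1 : ∀ w : E3, Integrable (fun y => (‖w - y‖ ^ 2)⁻¹ * f y) := fun w =>
    hf.integrable_of_le w (C := 1) (by fun_prop) fun y => by rw [one_mul, abs_of_nonneg (by positivity)]
  have h2 := ((h1 x).abs.add (h1 x').abs).const_mul ‖x - x'‖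
  refine h2.mono' (((measurable_newton.comp (by fun_prop)).sub (measurable_newton.comp
    (by fun_prop))).mul hf.continuous.measurable).aestronglyMeasurable ?_
  have hne : ∀ w : E3, ∀ᵐ y : E3, w - y ≠ 0 := by
    intro w
    have : ∀ᵐ y : E3, y ≠ w := by simp [ae_iff]
    filter_upwards [this] with y hy h
    exact hy (sub_eq_zero.1 h).symm
  filter_upwards [hne x, hne x'] with y hy hy'
  rw [norm_mul, Real.norm_eq_abs, Real.norm_eq_abs]
  have := abs_newton_sub_le _ _ hy hy'
  rw [sub_sub_sub_cancel_right] at this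
  simp only [Pi.add_apply, abs_mul, abs_of_nonneg (by positivity : 0 ≤ (‖x - y‖ ^ 2)⁻¹),
    abs_of_nonneg (by positivity : 0 ≤ (‖x' - y‖ ^ 2)⁻¹)]
  calc _ ≤ ‖x - x'‖ * ((‖x - y‖ ^ 2)⁻¹ + (‖x' - y‖ ^ 2)⁻¹) * |f y| := by gcongr
    _ = _ := by ring

/-! ### Polar coordinates -/

theorem integral_polar {F : E3 → ℝ} (hF : Integrable F) :
    ∫ z, F z = ∫ σ : Metric.sphere (0 : E3) 1, ∫ r in Ioi (0 : ℝ), r ^ 2 * F (r • (σ : E3))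
      ∂volume ∂(volume : Measure E3).toSphere := by
  set μ : Measure E3 := volume
  set G : Metric.sphere (0 : E3) 1 × Ioi (0 : ℝ) → ℝ := fun p => F ((p.2 : ℝ) • (p.1 : E3)) with hG
  have hGh : ∀ x : ({0}ᶜ : Set E3), G (homeomorphUnitSphereProd E3 x) = F x := by
    intro x
    have hx : ‖(x : E3)‖ ≠ 0 := norm_ne_zero_iff.2 x.2
    simp [hG, smul_smul, hx]
  have hmp := μ.measurePreserving_homeomorphUnitSphereProd
  have hemb := (homeomorphUnitSphereProd E3).measurableEmbedding
  have hGi : Integrable G (μ.toSphere.prod (Measure.volumeIoiPow (Module.finrank ℝ E3 - 1))) := by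
    rw [← hmp.integrable_comp_emb hemb]
    have : (G ∘ homeomorphUnitSphereProd E3) = fun x : ({0}ᶜ : Set E3) => F x := funext hGh
    rw [this]
    exact (integrableOn_iff_comap_subtypeVal (measurableSet_singleton _).compl).1 hF.integrableOn
  calc ∫ z, F z = ∫ x : ({0}ᶜ : Set E3), F x ∂(μ.comap (↑)) := by
        rw [integral_subtype_comap (measurableSet_singleton _).compl F, restrict_compl_singleton]
    _ = ∫ p, G p ∂(μ.toSphere.prod (Measure.volumeIoiPow (Module.finrank ℝ E3 - 1))) := by
        rw [← hmp.integral_comp hemb G]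
        simp only [hGh]
    _ = ∫ σ, ∫ r, G (σ, r) ∂(Measure.volumeIoiPow (Module.finrank ℝ E3 - 1)) ∂μ.toSphere :=
        integral_prod _ hGi
    _ = _ := by
        congr 1
        funext σ
        simp only [Measure.volumeIoiPow, ENNReal.ofReal]
        rw [integral_withDensity_eq_integral_smul]
        · rw [integral_subtype_comap measurableSet_Ioi fun a : ℝ =>
            Real.toNNReal (a ^ (Module.finrank ℝ E3 - 1)) • F (a • (σ : E3))]
          refine setIntegral_congr_fun measurableSet_Ioi fun x hx => ?_
          have hx' : (0 : ℝ) < x := hx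
          simp [NNReal.smul_def, Real.coe_toNNReal _ (pow_nonneg hx'.le _)]
        · exact (measurable_subtype_coe.pow_const _).real_toNNReal

theorem toSphere_real_univ : (volume : Measure E3).toSphere.real univ = 4 * Real.pi := by
  rw [Measure.toSphere_real_apply_univ, Measure.real, EuclideanSpace.volume_ball_fin_three]
  have h : 0 ≤ Real.pi * 4 / 3 := by positivity
  rw [ENNReal.toReal_mul, ENNReal.toReal_ofReal h]
  simp
  ring

/-! ### The kernels as distributions -/

theorem weighted_of_hasCompactSupport {g : E3 → ℝ} (hg : Continuous g) (hc : HasCompactSupport g) :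
    Weighted g := by
  refine ⟨hg, ?_⟩
  have : (fun y : E3 => g y / (1 + ‖y‖ ^ 2)) = fun y => g y * (1 + ‖y‖ ^ 2)⁻¹ := by
    funext y; rw [div_eq_mul_inv]
  rw [this]
  refine Continuous.integrable_of_hasCompactSupport (hg.mul ?_) hc.mul_right
  exact Continuous.inv₀ (by fun_prop) fun y => by positivity

theorem hasCompactSupport_pd {g : E3 → ℝ} (hc : HasCompactSupport g) (i : Fin 3) :
    HasCompactSupport (pd i g) :=
  (hc.fderiv (𝕜 := ℝ)).comp_left (g := fun L : E3 →L[ℝ] ℝ => L (EuclideanSpace.single i 1)) rfl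

theorem sum_dNewton_mul_pd {h : E3 → ℝ} (z : E3) :
    ∑ i, dNewton i z * pd i h z = (4 * Real.pi)⁻¹ * ((‖z‖ ^ 3)⁻¹ * fderiv ℝ h z z) := by
  rw [fderiv_eq_sum_pd h z z, Finset.mul_sum, Finset.mul_sum]
  refine Finset.sum_congr rfl fun i _ => ?_
  rw [dNewton, div_eq_mul_inv, mul_inv]; ring

/-- This is ΔN = δ in weak form. On the ray of direction σ the factor r² turns the integrand into
(4π)⁻¹ times the derivative of h(rσ), so every ray contributes −h(0)/(4π), and the sphere has area
4π. -/
theorem sum_integral_dNewton_mul_pd {h : E3 → ℝ} (hh : ContDiff ℝ 1 h) (hc : HasCompactSupport h) :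
    ∑ i, ∫ z, dNewton i z * pd i h z = - h 0 := by
  have hi : ∀ i, Integrable (fun z => dNewton i z * pd i h z) := fun i =>
    (weighted_of_hasCompactSupport (hh.continuous_pd i) (hasCompactSupport_pd hc i)).integrable_of_le 0
      (C := 1) (measurable_dNewton i) fun y => by
        rw [one_mul, zero_sub, norm_neg]; exact abs_dNewton_le i y
  rw [← integral_finsetSum _ fun i _ => hi i]
  rw [integral_polar (integrable_finsetSum _ fun i _ => hi i)]
  have key : ∀ σ : Metric.sphere (0 : E3) 1,
      ∫ r in Ioi (0 : ℝ), r ^ 2 * (∑ i, dNewton i (r • (σ : E3)) * pd i h (r • (σ : E3)))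
        = - (4 * Real.pi)⁻¹ * h 0 := by
    intro σ
    have hσ : ‖(σ : E3)‖ = 1 := by simp
    set φ : ℝ → ℝ := fun r => h (r • (σ : E3)) with hφ
    have hφd : ∀ r, HasDerivAt φ (fderiv ℝ h (r • (σ : E3)) σ) r := by
      intro r
      have h1 : HasDerivAt (fun r : ℝ => r • (σ : E3)) (σ : E3) r := by
        simpa using (hasDerivAt_id r).smul_const (σ : E3)
      exact ((hh.differentiable one_ne_zero _).hasFDerivAt).comp_hasDerivAt r h1
    have hφ1 : ContDiff ℝ 1 φ := hh.comp (contDiff_id.smul contDiff_const)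
    have hφc : HasCompactSupport φ := by
      refine hc.comp_isClosedEmbedding (f := h) (g := fun r : ℝ => r • (σ : E3)) ?_
      have hiso : Isometry (fun r : ℝ => r • (σ : E3)) := by
        refine Isometry.of_dist_eq fun a b => ?_
        rw [dist_eq_norm, ← sub_smul, norm_smul, hσ, mul_one, Real.dist_eq, Real.norm_eq_abs]
      exact hiso.isClosedEmbedding
    have h2 := hφc.integral_Ioi_deriv_eq hφ1 0
    rw [show φ 0 = h 0 by simp [hφ]] at h2
    rw [neg_mul, ← mul_neg, ← h2, ← integral_const_mul]
    refine setIntegral_congr_fun measurableSet_Ioi fun r hr => ?_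
    have hr' : (0 : ℝ) < r := hr
    rw [sum_dNewton_mul_pd, (hφd r).deriv, norm_smul, hσ, Real.norm_of_nonneg hr'.le, map_smul]
    simp only [smul_eq_mul]
    field_simp
  simp only [key]
  rw [integral_const, toSphere_real_univ, smul_eq_mul]
  have := Real.pi_pos
  field_simp

theorem locallyIntegrable_dNewton (i : Fin 3) : LocallyIntegrable (dNewton i) volume := by
  have h1 : Integrable (fun z : E3 => dNewton i z * (1 ^ 2 + ‖z‖ ^ 2)⁻¹) := by
    refine (integrable_inv_sq_mul_inv one_pos).mono'
      ((measurable_dNewton i).mul (by fun_prop)).aestronglyMeasurable (.of_forall fun z => ?_)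
    rw [norm_mul, Real.norm_eq_abs, Real.norm_of_nonneg (by positivity)]
    exact mul_le_mul_of_nonneg_right (abs_dNewton_le i z) (by positivity)
  refine locallyIntegrable_iff.2 fun K hK => ?_
  have h2 := h1.integrableOn (s := K)
  have h3 : ContinuousOn (fun z : E3 => 1 ^ 2 + ‖z‖ ^ 2) K := by fun_prop
  refine (h2.mul_continuousOn h3 hK).congr_fun (fun z _ => ?_) hK.measurableSet
  have : (0 : ℝ) < 1 ^ 2 + ‖z‖ ^ 2 := by positivity
  simp only []
  field_simp

theorem invLapD_eq_convolution (i : Fin 3) (g : E3 → ℝ) :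
    invLapD i g = convolution (dNewton i) g (ContinuousLinearMap.mul ℝ ℝ) volume := by
  funext x
  rw [convolution_mul_swap]
  rfl

theorem invLapD_eq_swap (i : Fin 3) (g : E3 → ℝ) (x : E3) :
    invLapD i g x = ∫ z, dNewton i z * g (x - z) := by
  rw [invLapD_eq_convolution]; rfl

theorem contDiff_invLapD_of_hasCompactSupport {n : ℕ∞} {g : E3 → ℝ} (hg : ContDiff ℝ n g)
    (hc : HasCompactSupport g) (i : Fin 3) : ContDiff ℝ n (invLapD i g) := by
  rw [invLapD_eq_convolution]
  exact hc.contDiff_convolution_right _ (locallyIntegrable_dNewton i) hg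

theorem pd_invLapD_of_hasCompactSupport {g : E3 → ℝ} (hg : ContDiff ℝ 1 g)
    (hc : HasCompactSupport g) (i j : Fin 3) : pd j (invLapD i g) = invLapD i (pd j g) := by
  funext x
  have h := hc.hasFDerivAt_convolution_right (ContinuousLinearMap.mul ℝ ℝ)
    (locallyIntegrable_dNewton i) hg x
  rw [← invLapD_eq_convolution] at h
  rw [h.pd_eq, convolution_precompR_apply _ (locallyIntegrable_dNewton i) (hc.fderiv (𝕜 := ℝ))
    (hg.continuous_fderiv one_ne_zero), invLapD_eq_convolution]
  rfl

theorem sum_pd_invLapD_of_hasCompactSupport {g : E3 → ℝ} (hg : ContDiff ℝ 1 g)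
    (hc : HasCompactSupport g) (x : E3) : ∑ i, pd i (invLapD i g) x = g x := by
  simp only [pd_invLapD_of_hasCompactSupport hg hc, invLapD_eq_swap]
  set h : E3 → ℝ := fun z => g (x - z) with hh
  have hh1 : ContDiff ℝ 1 h := hg.comp (contDiff_const.sub contDiff_id)
  have hhc : HasCompactSupport h := hc.comp_homeomorph (Homeomorph.subLeft x)
  have e : ∀ i z, pd i h z = - pd i g (x - z) := by
    intro i z
    have h1 : HasFDerivAt (fun z : E3 => x - z) (-ContinuousLinearMap.id ℝ E3) z := by
      simpa using (hasFDerivAt_id z).const_sub x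
    have h2 := ((hg.differentiable one_ne_zero (x - z)).hasFDerivAt).comp z h1
    have h3 : HasFDerivAt h _ z := h2
    rw [h3.pd_eq]; simp [pd]
  have key := sum_integral_dNewton_mul_pd hh1 hhc
  simp only [e, mul_neg, integral_neg, Finset.sum_neg_distrib, neg_inj] at key
  rw [key]; simp [hh]

/-! ### Potentials of functions that vanish near a ball -/

/-- For |z| < R and |y| > 2R one has |z−y| ≥ |y|/2 ≥ 1. Every derivative of the kernel then decays
at least quadratically and is dominated by the weight. -/
theorem Weighted.smoothTranslates {g : E3 → ℝ} (hg : Weighted g) {R : ℝ} (hR : 1 ≤ R)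
    (h0 : ∀ y, ‖y‖ ≤ 2 * R → g y = 0) (i : Fin 3) :
    SmoothTranslates volume g (dNewton i) (ContinuousLinearMap.id ℝ E3) {0}ᶜ (Metric.ball 0 R) := by
  have hgt : ∀ y, g y ≠ 0 → 2 * R < ‖y‖ := fun y hy => by
    by_contra h; exact hy (h0 y (not_lt.1 h))
  have hfar : ∀ z ∈ Metric.ball (0 : E3) R, ∀ y, g y ≠ 0 → ‖y‖ / 2 ≤ ‖z - y‖ := by
    intro z hz y hy
    have h1 := hgt y hy
    have h2 : ‖z‖ < R := by simpa using hz
    have hyx : ‖y‖ - ‖z‖ ≤ ‖z - y‖ := by rw [norm_sub_rev]; exact norm_sub_norm_le _ _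
    linarith
  refine ⟨isOpen_compl_singleton, Metric.isOpen_ball, contDiffOn_dNewton i,
    hg.continuous.aestronglyMeasurable, fun z hz y hy => ?_, fun n z hz => ?_⟩
  · have h1 := hfar z hz y hy
    have h2 := hgt y hy
    have : z - y ≠ 0 := norm_pos_iff.1 (by linarith)
    simpa using this
  · obtain ⟨C, hC, hb⟩ := norm_iteratedFDeriv_dNewton_le i n
    refine ⟨1, one_pos, fun y => 8 * C * |g y / (1 + ‖y‖ ^ 2)|, hg.integrable.abs.const_mul _,
      fun z' hz' y hy => ?_⟩
    have h1 := hfar z' hz'.2 y hy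
    have h2 := hgt y hy
    have h3 : z' - y ≠ 0 := norm_pos_iff.1 (by linarith)
    have h4 : (‖z' - y‖ ^ (n + 2))⁻¹ ≤ 8 * (1 + ‖y‖ ^ 2)⁻¹ := by
      have e1 : 1 ≤ ‖z' - y‖ := by linarith
      have e2 : (‖y‖ / 2) ^ 2 ≤ ‖z' - y‖ ^ 2 := by gcongr
      have e3 : ‖z' - y‖ ^ 2 ≤ ‖z' - y‖ ^ (n + 2) := pow_le_pow_right₀ e1 (by omega)
      rw [← div_eq_mul_inv, inv_eq_one_div, div_le_div_iff₀ (by positivity) (by positivity)]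
      nlinarith
    calc |g y| * ‖iteratedFDeriv ℝ n (dNewton i) (z' - ContinuousLinearMap.id ℝ E3 y)‖
        ≤ |g y| * (C * (8 * (1 + ‖y‖ ^ 2)⁻¹)) := by
          gcongr
          exact (hb _ h3).trans (by gcongr)
      _ = _ := by
        simp only [abs_div, abs_of_pos (by positivity : 0 < 1 + ‖y‖ ^ 2)]; ring

theorem invLapD_eq_integral_smul (i : Fin 3) (g : E3 → ℝ) :
    invLapD i g = fun z => ∫ y, g y • dNewton i (z - ContinuousLinearMap.id ℝ E3 y) := by
  funext z
  simp [invLapD, mul_comm]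

theorem Weighted.contDiffOn_invLapD_far {g : E3 → ℝ} (hg : Weighted g) {R : ℝ} (hR : 1 ≤ R)
    (h0 : ∀ y, ‖y‖ ≤ 2 * R → g y = 0) (i : Fin 3) :
    ContDiffOn ℝ ∞ (invLapD i g) (Metric.ball 0 R) := by
  rw [invLapD_eq_integral_smul]
  exact (hg.smoothTranslates hR h0 i).contDiffOn_integral

theorem Weighted.sum_pd_invLapD_far {g : E3 → ℝ} (hg : Weighted g) {R : ℝ} (hR : 1 ≤ R)
    (h0 : ∀ y, ‖y‖ ≤ 2 * R → g y = 0) {x : E3} (hx : x ∈ Metric.ball (0 : E3) R) :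
    ∑ i, pd i (invLapD i g) x = 0 := by
  have e : ∀ i, pd i (invLapD i g) x = ∫ y, g y • pd i (dNewton i) (x - y) := fun i => by
    rw [invLapD_eq_integral_smul, pd, (hg.smoothTranslates hR h0 i).fderiv_integral hx]; rfl
  have hint : ∀ i, Integrable (fun y => g y • pd i (dNewton i) (x - y)) := by
    intro i
    obtain ⟨-, hm, hb⟩ := (hg.smoothTranslates hR h0 i).hyps
    obtain ⟨ε, hε, h, hh, hle⟩ := hb 1 x hx
    have h1 : Integrable _ volume := hh.mono' (hm 1 x hx) (.of_forall fun y => hle x (Metric.mem_ball_self hε) y)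
    simp only [(hg.smoothTranslates hR h0 i).iteratedFDeriv_eq 1 hx] at h1
    have h2 := (ContinuousMultilinearMap.apply ℝ (fun _ : Fin 1 => E3) ℝ
      (fun _ => EuclideanSpace.single i (1 : ℝ))).integrable_comp h1
    refine h2.congr (.of_forall fun y => ?_)
    simp [pd]
  simp only [e]
  rw [← integral_finsetSum _ fun i _ => hint i]
  refine integral_eq_zero_of_ae (.of_forall fun y => ?_)
  simp only [Pi.zero_apply, ← Finset.smul_sum]
  by_cases hgy : g y = 0
  · simp [hgy]
  · have := (hg.smoothTranslates hR h0 0).mem x hx y hgy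
    rw [sum_pd_dNewton (by simpa using this), smul_zero]

/-! ### Potentials of weighted functions -/

/-- Near a given point the regularity of the potential comes from f for the compactly supported
piece and from the kernel for the piece that vanishes on a larger ball. R is chosen according to the
point. -/
theorem Weighted.exists_split {f : E3 → ℝ} (hf : Weighted f) (R : ℝ) (hR : 1 ≤ R) :
    ∃ χ : E3 → ℝ, ContDiff ℝ ∞ χ ∧ HasCompactSupport (fun y => χ y * f y) ∧
      Weighted (fun y => (1 - χ y) * f y) ∧ (∀ y, ‖y‖ ≤ 2 * R → (1 - χ y) * f y = 0) ∧
      (∀ i, invLapD i f = fun x => invLapD i (fun y => χ y * f y) x + invLapD i (fun y => (1 - χ y) * f y) x) := by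
  let χ : ContDiffBump (0 : E3) := ⟨2 * R, 2 * R + 1, by linarith, by linarith⟩
  have hχ : ContDiff ℝ ∞ χ := χ.contDiff
  have hc : HasCompactSupport (fun y => χ y * f y) := χ.hasCompactSupport.mul_right
  have hw : Weighted (fun y => (1 - χ y) * f y) := by
    refine ⟨(continuous_const.sub hχ.continuous).mul hf.continuous, ?_⟩
    refine hf.integrable.mono ?_ (.of_forall fun y => ?_)
    · refine (Continuous.div ((continuous_const.sub hχ.continuous).mul hf.continuous) (by fun_prop)
        fun y => by positivity).aestronglyMeasurable
    · rw [norm_div, norm_div, norm_mul]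
      have h1 : ‖1 - χ y‖ ≤ 1 := by
        rw [Real.norm_of_nonneg (by linarith [χ.le_one (x := y)])]; linarith [χ.nonneg (x := y)]
      gcongr
      exact mul_le_of_le_one_left (norm_nonneg _) h1
  refine ⟨χ, hχ, hc, hw, fun y hy => ?_, fun i => funext fun x => ?_⟩
  · rw [χ.one_of_mem_closedBall (by simpa using hy), sub_self, zero_mul]
  · have hw1 : Weighted (fun y => χ y * f y) := weighted_of_hasCompactSupport (hχ.continuous.mul hf.continuous) hc
    simp only [invLapD]
    rw [← integral_add (hw1.integrable_dNewton i x) (hw.integrable_dNewton i x)]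
    congr 1; funext y; ring

theorem Weighted.contDiff_invLapD {n : ℕ∞} {f : E3 → ℝ} (hf : Weighted f) (hn : ContDiff ℝ n f)
    (i : Fin 3) : ContDiff ℝ n (invLapD i f) := by
  refine contDiff_iff_contDiffAt.2 fun x => ?_
  obtain ⟨χ, hχ, hc, hw, h0, he⟩ := hf.exists_split (‖x‖ + 1) (by linarith [norm_nonneg x])
  rw [he i]
  refine ContDiffAt.add ?_ ?_
  · exact (contDiff_invLapD_of_hasCompactSupport ((hχ.of_le (by exact_mod_cast le_top)).mul hn) hc i).contDiffAt
  · refine ((hw.contDiffOn_invLapD_far (by linarith [norm_nonneg x]) h0 i).contDiffAt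
      (Metric.isOpen_ball.mem_nhds (by simp))).of_le (by exact_mod_cast le_top)

theorem Weighted.sum_pd_invLapD {f : E3 → ℝ} (hf : Weighted f) (h1 : ContDiff ℝ 1 f)
    (x : E3) : ∑ i, pd i (invLapD i f) x = f x := by
  obtain ⟨χ, hχ, hc, hw, h0, he⟩ := hf.exists_split (‖x‖ + 1) (by linarith [norm_nonneg x])
  have hR : 1 ≤ ‖x‖ + 1 := by linarith [norm_nonneg x]
  have hx : x ∈ Metric.ball (0 : E3) (‖x‖ + 1) := by simp
  have hl : ContDiff ℝ 1 (fun y => χ y * f y) := (hχ.of_le (by simp)).mul h1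
  have e : ∀ i, pd i (invLapD i f) x = pd i (invLapD i (fun y => χ y * f y)) x
      + pd i (invLapD i (fun y => (1 - χ y) * f y)) x := by
    intro i
    rw [he i]
    exact pd_add ((contDiff_invLapD_of_hasCompactSupport (n := 1) hl hc i).differentiable one_ne_zero _)
      (((hw.contDiffOn_invLapD_far hR h0 i).contDiffAt (Metric.isOpen_ball.mem_nhds hx)).differentiableAt
        (by simp)) i
  simp only [e, Finset.sum_add_distrib]
  rw [sum_pd_invLapD_of_hasCompactSupport hl hc, hw.sum_pd_invLapD_far hR h0 hx, add_zero]
  have := h0 x (by linarith [norm_nonneg x])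
  linarith

/-! ### Derivatives of potentials -/

/-- The increment is an average of L over a segment, and L is continuous. Verifying the integrated
identity needs only Fubini and the local bound for |x−y|⁻²; differentiating under the integral would
meet a kernel that is singular at a point moving with x. -/
theorem hasFDerivAt_of_segment_integral {F : E3 → ℝ} {L : E3 → E3 →L[ℝ] ℝ} (hL : Continuous L)
    (h : ∀ x v, F (x + v) - F x = ∫ s in (0 : ℝ)..1, L (x + s • v) v) (x : E3) :
    HasFDerivAt F (L x) x := by
  rw [hasFDerivAt_iff_isLittleO_nhds_zero, Asymptotics.isLittleO_iff]
  intro c hc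
  obtain ⟨δ, hδ, hb⟩ := Metric.continuousAt_iff.1 hL.continuousAt c hc
  filter_upwards [Metric.ball_mem_nhds (0 : E3) hδ] with v hv
  have hv' : ‖v‖ < δ := by simpa using hv
  have hLv : Continuous fun s : ℝ => L (x + s • v) v :=
    (hL.comp (by fun_prop)).clm_apply continuous_const
  have e : F (x + v) - F x - L x v = ∫ s in (0 : ℝ)..1, (L (x + s • v) - L x) v := by
    simp only [sub_apply]
    rw [intervalIntegral.integral_sub (hLv.intervalIntegrable _ _) (by simp), h]
    simp
  rw [e]
  have := intervalIntegral.norm_integral_le_of_norm_le_const (a := (0 : ℝ)) (b := 1)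
    (f := fun s => (L (x + s • v) - L x) v) (C := c * ‖v‖) fun s hs => by
      rw [uIoc_of_le zero_le_one] at hs
      refine (ContinuousLinearMap.le_opNorm _ _).trans ?_
      gcongr
      refine le_of_lt ?_
      rw [← dist_eq_norm]
      apply hb
      rw [dist_eq_norm, add_sub_cancel_left, norm_smul, Real.norm_of_nonneg hs.1.le]
      nlinarith [hs.2, norm_nonneg v]
  simpa using this

theorem Weighted.integrable_segment {f : E3 → ℝ} (hf : Weighted f) (i : Fin 3) (x v : E3) :
    Integrable (fun p : ℝ × E3 => dNewton i (x + p.1 • v - p.2) * f p.2)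
      ((volume.restrict (Ioc (0 : ℝ) 1)).prod volume) := by
  have hmeas : Measurable (fun p : ℝ × E3 => dNewton i (x + p.1 • v - p.2) * f p.2) :=
    ((measurable_dNewton i).comp (by fun_prop)).mul (hf.continuous.measurable.comp measurable_snd)
  refine ⟨hmeas.aestronglyMeasurable, ?_⟩
  obtain ⟨C, hC, hb⟩ := hf.exists_lintegral_kernel_le (‖x‖ + ‖v‖)
  rw [HasFiniteIntegral, lintegral_prod _ hmeas.enorm.aemeasurable]
  refine lt_of_le_of_lt (lintegral_mono_ae (g := fun _ => C) ?_) ?_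
  · filter_upwards [ae_restrict_mem measurableSet_Ioc] with s hs
    refine le_trans (lintegral_mono fun y => ?_) (hb (x + s • v) ?_)
    · rw [← ofReal_norm, norm_mul, Real.norm_eq_abs, Real.norm_eq_abs]
      apply ENNReal.ofReal_le_ofReal
      gcongr
      exact abs_dNewton_le i _
    · refine (norm_add_le _ _).trans ?_
      gcongr
      rw [norm_smul, Real.norm_of_nonneg hs.1.le]
      exact mul_le_of_le_one_left (norm_nonneg _) hs.2
  · simp [hC.lt_top]

/-- A line is a null set in space, so for almost every y the path x + sv − y avoids the singularity
and the fundamental theorem of calculus applies to N along it. -/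
theorem ae_not_mem_line (x v : E3) : ∀ᵐ y : E3, ∀ s : ℝ, x + s • v - y ≠ 0 := by
  have h1 : (volume : Measure E3) (Submodule.span ℝ {v} : Submodule ℝ E3) = 0 := by
    refine Measure.addHaar_submodule _ _ fun h => ?_
    have h2 := finrank_span_le_card (R := ℝ) ({v} : Set E3)
    rw [h, finrank_top] at h2
    simp at h2
  have h2 : (volume : Measure E3) ((fun y => y - x) ⁻¹' (Submodule.span ℝ {v} : Submodule ℝ E3)) = 0 := by
    rw [(measurePreserving_sub_right volume x).measure_preimage
      (Submodule.closed_of_finiteDimensional _).measurableSet.nullMeasurableSet, h1]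
  have h3 : ∀ᵐ y : E3, y ∉ (fun y => y - x) ⁻¹' (Submodule.span ℝ {v} : Submodule ℝ E3) :=
    measure_eq_zero_iff_ae_notMem.1 h2
  filter_upwards [h3] with y hy s hs
  apply hy
  have : y - x = s • v := by rw [sub_eq_zero] at hs; rw [← hs]; abel
  rw [mem_preimage, this]
  exact Submodule.smul_mem _ _ (Submodule.mem_span_singleton_self v)

theorem newton_sub_eq_integral {x v : E3} (h : ∀ s : ℝ, x + s • v ≠ 0) :
    newton (x + v) - newton x = ∫ s in (0 : ℝ)..1, ∑ i, v i * dNewton i (x + s • v) := by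
  have hd : ∀ s : ℝ, HasDerivAt (fun s : ℝ => newton (x + s • v))
      (∑ i, v i * dNewton i (x + s • v)) s := by
    intro s
    have h1 : HasDerivAt (fun s : ℝ => x + s • v) v s := by
      simpa using ((hasDerivAt_id s).smul_const v).const_add x
    have h2 : DifferentiableAt ℝ newton (x + s • v) :=
      (contDiffOn_newton.contDiffAt (isOpen_compl_singleton.mem_nhds (h s))).differentiableAt (by simp)
    have h3 := h2.hasFDerivAt.comp_hasDerivAt s h1
    rw [fderiv_eq_sum_pd] at h3
    simp only [pd_newton _ _ (h s)] at h3
    exact h3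
  have hc : Continuous fun s : ℝ => ∑ i, v i * dNewton i (x + s • v) := by
    refine continuous_finsetSum _ fun i _ => continuous_const.mul ?_
    exact (contDiffOn_dNewton i).continuousOn.comp_continuous (by fun_prop) h
  rw [intervalIntegral.integral_eq_sub_of_hasDerivAt (fun s _ => hd s) (hc.intervalIntegrable _ _)]
  simp

/-- The linear form `v ↦ ∑ vᵢ Dᵢ(x)`. -/
noncomputable def gradForm (D : Fin 3 → E3 → ℝ) (x : E3) : E3 →L[ℝ] ℝ :=
  ∑ i, D i x • (EuclideanSpace.proj i : E3 →L[ℝ] ℝ)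

theorem gradForm_apply (D : Fin 3 → E3 → ℝ) (x v : E3) : gradForm D x v = ∑ i, v i * D i x := by
  simp [gradForm, mul_comm]

theorem continuous_gradForm {D : Fin 3 → E3 → ℝ} (hD : ∀ i, Continuous (D i)) :
    Continuous (gradForm D) :=
  continuous_finsetSum _ fun i _ => (hD i).smul continuous_const

theorem Weighted.continuous_invLapD {f : E3 → ℝ} (hf : Weighted f) (i : Fin 3) :
    Continuous (invLapD i f) :=
  (hf.contDiff_invLapD (n := 0) (contDiff_zero.2 hf.continuous) i).continuous

theorem Weighted.integral_segment {f : E3 → ℝ} (hf : Weighted f) (x v : E3) :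
    ∫ s in (0 : ℝ)..1, gradForm (fun i => invLapD i f) (x + s • v) v
      = ∫ y, (∫ s in (0 : ℝ)..1, ∑ i, v i * dNewton i (x + s • v - y)) * f y := by
  have hi : Integrable (Function.uncurry fun (s : ℝ) (y : E3) =>
      ∑ i, v i * (dNewton i (x + s • v - y) * f y))
      ((volume.restrict (Ioc (0 : ℝ) 1)).prod volume) :=
    integrable_finsetSum _ fun i _ => (hf.integrable_segment i x v).const_mul (v i)
  have hs := integral_integral_swap hi
  rw [intervalIntegral.integral_of_le zero_le_one]
  refine Eq.trans (integral_congr_ae (.of_forall fun s => ?_)) (hs.trans (integral_congr_ae (.of_forall fun y => ?_)))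
  · simp only [gradForm_apply]
    rw [integral_finsetSum _ fun i _ => (hf.integrable_dNewton i _).const_mul (v i)]
    simp only [integral_const_mul, invLapD]
  · simp only []
    rw [intervalIntegral.integral_of_le zero_le_one, ← integral_mul_const]
    simp only [Finset.sum_mul, mul_assoc]

theorem Weighted.hasFDerivAt_invLap {f : E3 → ℝ} (hf : Weighted f) (x : E3) :
    HasFDerivAt (invLap f) (gradForm (fun i => invLapD i f) x) x := by
  refine hasFDerivAt_of_segment_integral
    (continuous_gradForm fun i => hf.continuous_invLapD i) (fun x v => ?_) x
  rw [hf.integral_segment]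
  have hI : ∀ w : E3, Integrable (fun y => (newton (w - y) - newton (-y)) * f y) := fun w => by
    simpa using hf.integrable_newton_sub w 0
  rw [invLap, invLap, ← integral_sub (hI _) (hI _)]
  refine integral_congr_ae ?_
  filter_upwards [ae_not_mem_line x v] with y hy
  have := newton_sub_eq_integral (x := x - y) (v := v) fun s => by
    have := hy s; rwa [add_sub_right_comm] at this
  simp only [add_sub_right_comm x _ y]
  rw [← this]; ring

theorem Weighted.pd_invLap {f : E3 → ℝ} (hf : Weighted f) (i : Fin 3) :
    pd i (invLap f) = invLapD i f := by
  funext x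
  rw [(hf.hasFDerivAt_invLap x).pd_eq, gradForm_apply]
  fin_cases i <;> simp

theorem Weighted.contDiff_invLap {n : ℕ} {f : E3 → ℝ} (hf : Weighted f) (hn : ContDiff ℝ n f) :
    ContDiff ℝ (n + 1) (invLap f) := by
  refine (contDiff_succ_iff_hasFDerivAt (n := n)).2 ⟨gradForm (fun i => invLapD i f), ?_, hf.hasFDerivAt_invLap⟩
  exact ContDiff.sum fun i _ => (hf.contDiff_invLapD (n := n) hn i).smul contDiff_const

theorem Weighted.contDiff_infty_invLap {f : E3 → ℝ} (hf : Weighted f) (hn : ContDiff ℝ ∞ f) :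
    ContDiff ℝ ∞ (invLap f) :=
  contDiff_infty.2 fun n => (hf.contDiff_invLap (contDiff_infty.1 hn n)).of_le (by simp)

theorem Weighted.lap_invLap {f : E3 → ℝ} (hf : Weighted f) (h1 : ContDiff ℝ 1 f) (x : E3) :
    lap (invLap f) x = f x := by
  rw [lap]
  simp only [hf.pd_invLap]
  exact hf.sum_pd_invLapD h1 x

/-- Differentiating ∂ᵢN would give a kernel of order −3. Instead the convolution is written with the
fixed kernel ∂ᵢN(z), so that the segment argument moves f and the derivative falls on f. -/
theorem Weighted.hasFDerivAt_invLapD {f : E3 → ℝ} (hf : Weighted f) (h1 : ContDiff ℝ 1 f)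
    (hp : ∀ j, Weighted (pd j f)) (i : Fin 3) (x : E3) :
    HasFDerivAt (invLapD i f) (gradForm (fun j => invLapD i (pd j f)) x) x := by
  refine hasFDerivAt_of_segment_integral
    (continuous_gradForm fun j => (hp j).continuous_invLapD i) (fun x v => ?_) x
  have hsw : ∀ (g : E3 → ℝ), Weighted g → ∀ w, Integrable (fun z => dNewton i z * g (w - z)) := by
    intro g hg w
    have := (hg.integrable_dNewton i w).comp_sub_left w
    simpa using this
  have hi : ∀ j, Integrable (fun p : ℝ × E3 => dNewton i p.2 * pd j f (x + p.1 • v - p.2))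
      ((volume.restrict (Ioc (0 : ℝ) 1)).prod volume) := by
    intro j
    have hmeas : Measurable (fun p : ℝ × E3 => dNewton i p.2 * pd j f (x + p.1 • v - p.2)) :=
      ((measurable_dNewton i).comp measurable_snd).mul ((hp j).continuous.measurable.comp (by fun_prop))
    have hmeas' : Measurable (fun p : ℝ × E3 => dNewton i (x + p.1 • v - p.2) * pd j f p.2) :=
      ((measurable_dNewton i).comp (by fun_prop)).mul ((hp j).continuous.measurable.comp measurable_snd)
    refine ⟨hmeas.aestronglyMeasurable, ?_⟩
    have h2 := ((hp j).integrable_segment i x v).2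
    rw [HasFiniteIntegral, lintegral_prod _ hmeas'.enorm.aemeasurable] at h2
    rw [HasFiniteIntegral, lintegral_prod _ hmeas.enorm.aemeasurable]
    refine lt_of_le_of_lt (lintegral_mono fun s => ?_) h2
    refine le_of_eq ?_
    simp only []
    -- For each s the substitution z = x + sv − y returns to the integrals already controlled by
    -- `Weighted.integrable_segment`.
    rw [← lintegral_sub_left_eq_self _ (x + s • v)]
    simp
  have hi' : Integrable (Function.uncurry fun (s : ℝ) (z : E3) =>
      ∑ j, v j * (dNewton i z * pd j f (x + s • v - z)))
      ((volume.restrict (Ioc (0 : ℝ) 1)).prod volume) :=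
    integrable_finsetSum _ fun j _ => (hi j).const_mul (v j)
  have hs := integral_integral_swap hi'
  rw [invLapD_eq_swap, invLapD_eq_swap, ← integral_sub (hsw f hf _) (hsw f hf _),
    intervalIntegral.integral_of_le zero_le_one]
  refine Eq.symm (Eq.trans (integral_congr_ae (.of_forall fun s => ?_))
    (hs.trans (integral_congr_ae (.of_forall fun z => ?_))))
  · simp only [gradForm_apply, invLapD_eq_swap]
    rw [integral_finsetSum _ fun j _ => (hsw _ (hp j) _).const_mul (v j)]
    simp only [integral_const_mul]
  · simp only []
    rw [← intervalIntegral.integral_of_le zero_le_one]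
    have hd : ∀ s : ℝ, HasDerivAt (fun s : ℝ => dNewton i z * f (x + s • v - z))
      (∑ j, v j * (dNewton i z * pd j f (x + s • v - z))) s := by
      intro s
      have h3 : HasDerivAt (fun s : ℝ => x + s • v - z) v s := by
        simpa using (((hasDerivAt_id s).smul_const v).const_add x).sub_const z
      have h4 := ((h1.differentiable one_ne_zero (x + s • v - z)).hasFDerivAt.comp_hasDerivAt s h3).const_mul
        (dNewton i z)
      rw [fderiv_eq_sum_pd, Finset.mul_sum] at h4
      refine h4.congr_deriv (Finset.sum_congr rfl fun j _ => by ring)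
    have hc : Continuous fun s : ℝ => ∑ j, v j * (dNewton i z * pd j f (x + s • v - z)) :=
      continuous_finsetSum _ fun j _ => continuous_const.mul (continuous_const.mul
        ((hp j).continuous.comp (by fun_prop)))
    rw [intervalIntegral.integral_eq_sub_of_hasDerivAt (fun s _ => hd s) (hc.intervalIntegrable _ _)]
    simp only [one_smul, zero_smul, add_zero]

theorem Weighted.pd_invLapD {f : E3 → ℝ} (hf : Weighted f) (h1 : ContDiff ℝ 1 f)
    (hp : ∀ j, Weighted (pd j f)) (i j : Fin 3) : pd j (invLapD i f) = invLapD i (pd j f) := by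
  funext x
  rw [(hf.hasFDerivAt_invLapD h1 hp i x).pd_eq, gradForm_apply]
  fin_cases j <;> simp

/-! ### Weighted integrability of potentials -/

/-- By Tonelli the weight w is integrated against the kernel first, which produces the weight v on
f. -/
theorem integrable_weight_invLapD {f : E3 → ℝ} (hf : Weighted f) (i : Fin 3) {w v : E3 → ℝ}
    (hw : Continuous w) (hw0 : ∀ x, 0 ≤ w x) {C : ℝ}
    (hb : ∀ y : E3, ∫⁻ x, ENNReal.ofReal ((‖x - y‖ ^ 2)⁻¹ * w x) ≤ ENNReal.ofReal (C * v y))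
    (hv : Integrable (fun y => f y * v y)) (hv0 : ∀ y, 0 ≤ v y) :
    Integrable (fun x => invLapD i f x * w x) := by
  refine ⟨((hf.continuous_invLapD i).mul hw).aestronglyMeasurable, ?_⟩
  have hk : Measurable (Function.uncurry fun (x y : E3) =>
      ENNReal.ofReal (|f y| * ((‖x - y‖ ^ 2)⁻¹ * w x))) := by
    have := hf.continuous.measurable
    have := hw.measurable
    refine Measurable.ennreal_ofReal ?_
    fun_prop
  calc ∫⁻ x, ‖invLapD i f x * w x‖ₑ
      ≤ ∫⁻ x, ∫⁻ y, ENNReal.ofReal (|f y| * ((‖x - y‖ ^ 2)⁻¹ * w x)) := by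
        refine lintegral_mono fun x => ?_
        simp only [invLapD]
        rw [← integral_mul_const]
        refine (enorm_integral_le_lintegral_enorm _).trans (lintegral_mono fun y => ?_)
        rw [← ofReal_norm, norm_mul, norm_mul, Real.norm_eq_abs, Real.norm_eq_abs,
          Real.norm_of_nonneg (hw0 x)]
        apply ENNReal.ofReal_le_ofReal
        calc _ ≤ (‖x - y‖ ^ 2)⁻¹ * |f y| * w x := by
              have := hw0 x
              gcongr
              exact abs_dNewton_le i _
          _ = _ := by ring
    _ = ∫⁻ y, ∫⁻ x, ENNReal.ofReal (|f y| * ((‖x - y‖ ^ 2)⁻¹ * w x)) :=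
        lintegral_lintegral_swap hk.aemeasurable
    _ ≤ ∫⁻ y, ENNReal.ofReal (C * |f y * v y|) := by
        refine lintegral_mono fun y => ?_
        simp only [ENNReal.ofReal_mul (abs_nonneg (f y))]
        rw [lintegral_const_mul' _ _ (by simp)]
        calc _ ≤ ENNReal.ofReal |f y| * ENNReal.ofReal (C * v y) := by gcongr; exact hb y
          _ = _ := by
            rw [← ENNReal.ofReal_mul (abs_nonneg _), abs_mul, abs_of_nonneg (hv0 y)]
            congr 1; ring
    _ < ⊤ := (hv.abs.const_mul C).lintegral_lt_top

theorem Weighted.integrable_invLapD {f : E3 → ℝ} (hf : Weighted f) (i : Fin 3) :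
    Integrable (fun x => invLapD i f x / (1 + ‖x‖ ^ 2) ^ 2) := by
  obtain ⟨C, -, hb⟩ := lintegral_kernel_weight_two
  simp only [div_eq_mul_inv]
  exact integrable_weight_invLapD hf i (w := fun x => ((1 + ‖x‖ ^ 2) ^ 2)⁻¹)
    (v := fun y => (1 + ‖y‖ ^ 2)⁻¹) (Continuous.inv₀ (by fun_prop) fun y => by positivity)
    (fun x => by positivity) hb (by simpa only [div_eq_mul_inv] using hf.integrable)
    fun y => by positivity

theorem Weighted.weighted_invLapD {f : E3 → ℝ} (hf : Weighted f)
    (h : Integrable (fun y => f y / (1 + ‖y‖))) (i : Fin 3) : Weighted (invLapD i f) := by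
  obtain ⟨C, -, hb⟩ := lintegral_kernel_weight_one
  refine ⟨hf.continuous_invLapD i, ?_⟩
  simp only [div_eq_mul_inv] at h ⊢
  exact integrable_weight_invLapD hf i (w := fun x => (1 + ‖x‖ ^ 2)⁻¹)
    (v := fun y => (1 + ‖y‖)⁻¹) (Continuous.inv₀ (by fun_prop) fun y => by positivity)
    (fun x => by positivity) hb h fun y => by positivity

/-! ### Rotations about the third axis -/

/-- The rotation by the angle `a` about the third axis. -/
noncomputable def rotate (a : ℝ) (x : E3) : E3 :=
  !₂[Real.cos a * x 0 - Real.sin a * x 1, Real.sin a * x 0 + Real.cos a * x 1, x 2]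

@[simp] theorem rotate_apply_zero (a : ℝ) (x : E3) :
    rotate a x 0 = Real.cos a * x 0 - Real.sin a * x 1 := by simp [rotate]
@[simp] theorem rotate_apply_one (a : ℝ) (x : E3) :
    rotate a x 1 = Real.sin a * x 0 + Real.cos a * x 1 := by simp [rotate]
@[simp] theorem rotate_apply_two (a : ℝ) (x : E3) : rotate a x 2 = x 2 := by simp [rotate]

theorem ext3 {x y : E3} (h0 : x 0 = y 0) (h1 : x 1 = y 1) (h2 : x 2 = y 2) : x = y := by
  ext i; fin_cases i <;> assumption

theorem norm_sq_eq (x : E3) : ‖x‖ ^ 2 = x 0 ^ 2 + x 1 ^ 2 + x 2 ^ 2 := by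
  rw [EuclideanSpace.real_norm_sq_eq, Fin.sum_univ_three]

theorem norm_rotate (a : ℝ) (x : E3) : ‖rotate a x‖ = ‖x‖ := by
  rw [← sq_eq_sq₀ (norm_nonneg _) (norm_nonneg _), norm_sq_eq, norm_sq_eq]
  simp only [rotate_apply_zero, rotate_apply_one, rotate_apply_two]
  linear_combination (x 0 ^ 2 + x 1 ^ 2) * Real.sin_sq_add_cos_sq a

/-- Rotation about the third axis as a linear isometry. -/
noncomputable def rotateEquiv (a : ℝ) : E3 ≃ₗᵢ[ℝ] E3 :=
  LinearIsometry.toLinearIsometryEquiv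
    { toFun := rotate a
      map_add' := fun x y => ext3 (by simp; ring) (by simp; ring) (by simp)
      map_smul' := fun c x => ext3 (by simp; ring) (by simp; ring) (by simp)
      norm_map' := norm_rotate a } rfl

theorem rotateEquiv_apply (a : ℝ) (x : E3) : rotateEquiv a x = rotate a x := rfl

theorem rad_sq (x : E3) : rad x ^ 2 = x 0 ^ 2 + x 1 ^ 2 := Real.sq_sqrt (by positivity)

theorem rad_nonneg (x : E3) : 0 ≤ rad x := Real.sqrt_nonneg _

theorem rad_rotate (a : ℝ) (x : E3) : rad (rotate a x) = rad x := by
  simp only [rad, rotate_apply_zero, rotate_apply_one]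
  congr 1
  linear_combination (x 0 ^ 2 + x 1 ^ 2) * Real.sin_sq_add_cos_sq a

theorem rad_eq_zero_iff {x : E3} : rad x = 0 ↔ x 0 = 0 ∧ x 1 = 0 := by
  rw [rad, Real.sqrt_eq_zero (by positivity), add_eq_zero_iff_of_nonneg (by positivity) (by positivity)]
  simp

theorem exists_eq_rotate (x : E3) : ∃ a, x = rotate a !₂[rad x, 0, x 2] := by
  have h : ‖(⟨x 0, x 1⟩ : ℂ)‖ = rad x := by
    rw [rad, ← Real.sqrt_sq (norm_nonneg _), Complex.sq_norm, Complex.normSq_apply]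
    congr 1; simp only []; ring
  refine ⟨Complex.arg ⟨x 0, x 1⟩, ext3 ?_ ?_ ?_⟩
  · have := Complex.norm_mul_cos_arg (⟨x 0, x 1⟩ : ℂ)
    rw [h] at this
    simp [mul_comm, this]
  · have := Complex.norm_mul_sin_arg (⟨x 0, x 1⟩ : ℂ)
    rw [h] at this
    simp [mul_comm, this]
  · simp

theorem isAxisymmetricScalar_iff {W : E3 → ℝ} :
    IsAxisymmetricScalar W ↔ ∀ a x, W (rotate a x) = W x := by
  constructor
  · rintro ⟨w, hw⟩ a x
    rw [hw, hw, rad_rotate, rotate_apply_two]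
  · intro h
    refine ⟨fun r z => W !₂[r, 0, z], fun x => ?_⟩
    obtain ⟨a, ha⟩ := exists_eq_rotate x
    conv_lhs => rw [ha]
    exact h a _

theorem hasDerivAt_rotate (x : E3) (a : ℝ) :
    HasDerivAt (fun a => rotate a x) !₂[-(rotate a x 1), rotate a x 0, 0] a := by
  have e : (fun a => rotate a x) = fun a : ℝ => Real.cos a • (!₂[x 0, x 1, 0] : E3)
      + Real.sin a • (!₂[-x 1, x 0, 0] : E3) + !₂[0, 0, x 2] := by
    funext a; refine ext3 ?_ ?_ ?_ <;> simp <;> ring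
  rw [e]
  have h := (((Real.hasDerivAt_cos a).smul_const (!₂[x 0, x 1, 0] : E3)).add
    ((Real.hasDerivAt_sin a).smul_const (!₂[-x 1, x 0, 0] : E3))).add_const (!₂[0, 0, x 2] : E3)
  refine h.congr_deriv ?_
  refine ext3 ?_ ?_ ?_ <;> simp <;> ring

/-- The derivative of `f` along the rotations about the third axis, `-x₂∂₁f + x₁∂₂f`. -/
noncomputable def rotDeriv (f : E3 → ℝ) (x : E3) : ℝ := x 0 * pd 1 f x - x 1 * pd 0 f x

theorem hasDerivAt_comp_rotate {f : E3 → ℝ} (hf : Differentiable ℝ f) (x : E3) (a : ℝ) :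
    HasDerivAt (fun a => f (rotate a x)) (rotDeriv f (rotate a x)) a := by
  refine ((hf _).hasFDerivAt.comp_hasDerivAt a (hasDerivAt_rotate x a)).congr_deriv ?_
  rw [fderiv_eq_sum_pd, Fin.sum_univ_three, rotDeriv]
  simp; ring

@[simp] theorem rotate_zero (x : E3) : rotate 0 x = x := ext3 (by simp) (by simp) (by simp)

theorem IsAxisymmetricScalar.rotDeriv_eq_zero {f : E3 → ℝ} (h : IsAxisymmetricScalar f)
    (hf : Differentiable ℝ f) (x : E3) : rotDeriv f x = 0 := by
  have h1 := hasDerivAt_comp_rotate hf x 0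
  have h2 : (fun a => f (rotate a x)) = fun _ => f x := funext fun a => isAxisymmetricScalar_iff.1 h a x
  rw [h2, rotate_zero] at h1
  exact h1.unique (hasDerivAt_const _ _)

theorem isAxisymmetricScalar_of_rotDeriv {f : E3 → ℝ} (hf : Differentiable ℝ f)
    (h : ∀ x, rotDeriv f x = 0) : IsAxisymmetricScalar f := by
  refine isAxisymmetricScalar_iff.2 fun a x => ?_
  have hd : ∀ a, HasDerivAt (fun a => f (rotate a x)) 0 a := fun a => by
    simpa [h] using hasDerivAt_comp_rotate hf x a
  have := is_const_of_deriv_eq_zero (fun a => (hd a).differentiableAt) (fun a => (hd a).deriv) a 0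
  simpa using this

theorem IsAxisymmetricScalar.invLap {W : E3 → ℝ} (h : IsAxisymmetricScalar W) :
    IsAxisymmetricScalar (invLap W) := by
  refine isAxisymmetricScalar_iff.2 fun a x => ?_
  have hmp := (rotateEquiv a).measurePreserving
  rw [Axi.invLap, ← hmp.integral_comp (rotateEquiv a).toHomeomorph.measurableEmbedding]
  refine integral_congr_ae (.of_forall fun y => ?_)
  simp only [rotateEquiv_apply, isAxisymmetricScalar_iff.1 h a y]
  have e1 : rotate a x - rotate a y = rotate a (x - y) := ((rotateEquiv a).map_sub x y).symm
  have e2 : -rotate a y = rotate a (-y) := ((rotateEquiv a).map_neg y).symm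
  rw [e1, e2]
  simp only [newton, norm_rotate]

theorem IsAxisymmetricScalar.invLapD_two {W : E3 → ℝ} (h : IsAxisymmetricScalar W) :
    IsAxisymmetricScalar (invLapD 2 W) := by
  refine isAxisymmetricScalar_iff.2 fun a x => ?_
  have hmp := (rotateEquiv a).measurePreserving
  rw [Axi.invLapD, ← hmp.integral_comp (rotateEquiv a).toHomeomorph.measurableEmbedding]
  refine integral_congr_ae (.of_forall fun y => ?_)
  simp only [rotateEquiv_apply, isAxisymmetricScalar_iff.1 h a y]
  have e1 : rotate a x - rotate a y = rotate a (x - y) := ((rotateEquiv a).map_sub x y).symm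
  rw [e1]
  simp only [dNewton, norm_rotate, rotate_apply_two]

/-! ### The operator `(∂_r / r) Δ⁻¹` on axisymmetric functions -/

theorem dr_eq (f : E3 → ℝ) (x : E3) :
    dr f x = x 0 / rad x * pd 0 f x + x 1 / rad x * pd 1 f x := by
  rw [dr, fderiv_eq_sum_pd, Fin.sum_univ_three]
  simp [eR]

/-- The relation x₁∂₂V − x₂∂₁V = 0 is differentiated in x₁ and in x₂; the product rule releases ∂₂V
and −∂₁V, and the combination with factors x₂ and −x₁ is r∂_rV plus second derivatives. -/
theorem dr_div_rad_of_axisymmetric {V : E3 → ℝ} (hV : IsAxisymmetricScalar V) (h2 : ContDiff ℝ 2 V)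
    {x : E3} (hx : rad x ≠ 0) :
    dr V x / rad x = x 1 ^ 2 / rad x ^ 2 * pd 0 (pd 0 V) x + x 0 ^ 2 / rad x ^ 2 * pd 1 (pd 1 V) x
      - 2 * (x 0 * x 1 / rad x ^ 2) * pd 1 (pd 0 V) x := by
  have hd : Differentiable ℝ V := h2.differentiable two_ne_zero
  have hp : ∀ i, Differentiable ℝ (pd i V) := fun i =>
    (ContDiff.pd (n := 2) (m := 1) h2 (by norm_num) i).differentiable one_ne_zero
  have h0 : (fun y => y 0 * pd 1 V y - y 1 * pd 0 V y) = fun _ : E3 => (0 : ℝ) :=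
    funext fun y => hV.rotDeriv_eq_zero hd y
  have key : ∀ i, (x 0 * pd i (pd 1 V) x + pd 1 V x * (if i = 0 then 1 else 0))
      - (x 1 * pd i (pd 0 V) x + pd 0 V x * (if i = 1 then 1 else 0)) = 0 := by
    intro i
    have h1 : pd i (fun y => y 0 * pd 1 V y - y 1 * pd 0 V y) x = 0 := by
      rw [h0]; simp [pd]
    rwa [pd_sub (f := fun y => y 0 * pd 1 V y) (g := fun y => y 1 * pd 0 V y) ((differentiable_coord 0 x).mul (hp 1 x)) ((differentiable_coord 1 x).mul (hp 0 x)),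
      pd_mul (differentiable_coord 0 x) (hp 1 x), pd_mul (differentiable_coord 1 x) (hp 0 x),
      pd_coord, pd_coord] at h1
  have k0 := key 0
  have k1 := key 1
  simp only [if_true, Fin.isValue, zero_ne_one, one_ne_zero, if_false, mul_one, mul_zero, add_zero] at k0 k1
  rw [pd_comm h2 0 1] at k0
  rw [dr_eq]
  field_simp
  linear_combination x 1 * k0 - x 0 * k1

theorem IsAdmissible.weighted {W : E3 → ℝ} (h : IsAdmissible W) : Weighted W :=
  ⟨h.contDiff.continuous, h.integrable⟩

theorem IsAdmissible.weighted_pd {W : E3 → ℝ} (h : IsAdmissible W) (i : Fin 3) :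
    Weighted (pd i W) := by
  have hc := h.contDiff.continuous_pd i
  refine ⟨hc, h.integrable_fderiv.mono' (hc.div (by fun_prop) fun y => by positivity).aestronglyMeasurable
    (.of_forall fun y => ?_)⟩
  rw [norm_div, Real.norm_eq_abs, Real.norm_of_nonneg (by positivity : 0 ≤ 1 + ‖y‖ ^ 2)]
  gcongr
  exact abs_pd_le i W y

theorem IsAdmissible.riesz_eq {W : E3 → ℝ} (h : IsAdmissible W) (i j : Fin 3) :
    riesz i j W = pd j (pd i (invLap W)) := by
  rw [h.weighted.pd_invLap, h.weighted.pd_invLapD h.contDiff h.weighted_pd, riesz]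

theorem IsAdmissible.drOverRInvLap_eq {W : E3 → ℝ} (h : IsAdmissible W) {x : E3} (hx : rad x ≠ 0) :
    drOverRInvLap W x = x 1 ^ 2 / rad x ^ 2 * riesz 0 0 W x + x 0 ^ 2 / rad x ^ 2 * riesz 1 1 W x
      - 2 * (x 0 * x 1 / rad x ^ 2) * riesz 0 1 W x := by
  simp only [h.riesz_eq, drOverRInvLap]
  exact dr_div_rad_of_axisymmetric h.axisymmetric.invLap
    (h.weighted.contDiff_invLap (n := 1) h.contDiff) hx

theorem IsAdmissible.potential {W : E3 → ℝ} (hW : IsAdmissible W) :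
    (∀ x, Integrable (fun y => (newton (x - y) - newton (-y)) * W y) volume) ∧
    (∀ i j x, Integrable (fun y => dNewton i (x - y) * pd j W y) volume) ∧
    ContDiff ℝ 2 (invLap W) ∧
    (∀ x, lap (invLap W) x = W x) ∧
    ∀ x, rad x ≠ 0 →
      drOverRInvLap W x
        = (x 1) ^ 2 / (rad x) ^ 2 * riesz 0 0 W x
          + (x 0) ^ 2 / (rad x) ^ 2 * riesz 1 1 W x
          - 2 * (x 0 * x 1 / (rad x) ^ 2) * riesz 0 1 W x :=
  ⟨fun x => by simpa using hW.weighted.integrable_newton_sub x 0,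
    fun i j x => (hW.weighted_pd j).integrable_dNewton i x,
    hW.weighted.contDiff_invLap (n := 1) hW.contDiff,
    hW.weighted.lap_invLap hW.contDiff, fun _ hx => hW.drOverRInvLap_eq hx⟩

/-! ### A Bellman function -/

/-- The Bellman function `ζ² (ζᵖ + η^q)^γ + K η^q`. -/
noncomputable def bellman (p q γ K ζ η : ℝ) : ℝ := ζ ^ 2 * (ζ ^ p + η ^ q) ^ γ + K * η ^ q

/-- The derivative `∂_ζ` of the Bellman function. -/
noncomputable def bellmanZ (p q γ ζ η : ℝ) : ℝ :=
  (ζ ^ p + η ^ q) ^ γ * (2 * ζ + γ * p * ζ * (ζ ^ p / (ζ ^ p + η ^ q)))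

/-- The derivative `∂_η` of the Bellman function. -/
noncomputable def bellmanE (p q γ K ζ η : ℝ) : ℝ :=
  γ * q * ζ ^ 2 * (ζ ^ p + η ^ q) ^ γ * (η ^ q / (ζ ^ p + η ^ q)) / η + K * q * (η ^ q / η)

/-- The derivative `∂_ζ∂_ζ` of the Bellman function. -/
noncomputable def bellmanZZ (p q γ ζ η : ℝ) : ℝ :=
  (ζ ^ p + η ^ q) ^ γ * (2 + γ * p * (p + 3) * (ζ ^ p / (ζ ^ p + η ^ q))
    - γ * (1 - γ) * p ^ 2 * (ζ ^ p / (ζ ^ p + η ^ q)) ^ 2)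

/-- The derivative `∂_ζ∂_η` of the Bellman function. -/
noncomputable def bellmanZE (p q γ ζ η : ℝ) : ℝ :=
  γ * q * ζ * (ζ ^ p + η ^ q) ^ γ * (η ^ q / (ζ ^ p + η ^ q)) / η
    * (2 - (1 - γ) * p * (ζ ^ p / (ζ ^ p + η ^ q)))

/-- The derivative `∂_η∂_η` of the Bellman function. -/
noncomputable def bellmanEE (p q γ K ζ η : ℝ) : ℝ :=
  (γ * q * ζ ^ 2 * (ζ ^ p + η ^ q) ^ γ * ((q - 1) * (η ^ q / (ζ ^ p + η ^ q))
    - (1 - γ) * q * (η ^ q / (ζ ^ p + η ^ q)) ^ 2) + K * q * (q - 1) * η ^ q) / η ^ 2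

/-! ### The chain rule for the Bellman function along a curve. -/

section Curve

variable {p q γ K : ℝ} {U V : ℝ → ℝ} {U' V' s : ℝ}

theorem hasDerivAt_rpow_curve (hU : HasDerivAt U U' s) (h0 : 0 < U s) :
    HasDerivAt (fun s => U s ^ p) (p * (U s ^ p / U s) * U') s := by
  refine (hU.rpow_const (p := p) (Or.inl h0.ne')).congr_deriv ?_
  rw [Real.rpow_sub_one h0.ne']; ring

theorem hasDerivAt_sum_curve (hU : HasDerivAt U U' s) (hV : HasDerivAt V V' s) (h0 : 0 < U s)
    (h1 : 0 < V s) : HasDerivAt (fun s => U s ^ p + V s ^ q)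
      (p * (U s ^ p / U s) * U' + q * (V s ^ q / V s) * V') s :=
  (hasDerivAt_rpow_curve hU h0).add (hasDerivAt_rpow_curve hV h1)

theorem sum_curve_pos (h0 : 0 < U s) (h1 : 0 < V s) : 0 < U s ^ p + V s ^ q :=
  add_pos (Real.rpow_pos_of_pos h0 _) (Real.rpow_pos_of_pos h1 _)

theorem hasDerivAt_bellman (hU : HasDerivAt U U' s) (hV : HasDerivAt V V' s) (h0 : 0 < U s)
    (h1 : 0 < V s) : HasDerivAt (fun s => bellman p q γ K (U s) (V s))
      (bellmanZ p q γ (U s) (V s) * U' + bellmanE p q γ K (U s) (V s) * V') s := by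
  have hS := hasDerivAt_sum_curve (p := p) (q := q) hU hV h0 h1
  have hSp : 0 < U s ^ p + V s ^ q := sum_curve_pos h0 h1
  have hA := hasDerivAt_rpow_curve (p := γ) hS hSp
  refine (((hU.pow 2).mul hA).add ((hasDerivAt_rpow_curve (p := q) hV h1).const_mul K)).congr_deriv ?_
  simp only [bellmanZ, bellmanE, Pi.pow_apply, Nat.cast_ofNat]
  -- With the three real powers treated as independent symbols, the claim is an identity between
  -- rational functions.
  generalize (U s ^ p + V s ^ q) ^ γ = A
  generalize hP : U s ^ p = P at *
  generalize hE : V s ^ q = E at *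
  field_simp
  ring

theorem hasDerivAt_bellmanZ (hU : HasDerivAt U U' s) (hV : HasDerivAt V V' s) (h0 : 0 < U s)
    (h1 : 0 < V s) : HasDerivAt (fun s => bellmanZ p q γ (U s) (V s))
      (bellmanZZ p q γ (U s) (V s) * U' + bellmanZE p q γ (U s) (V s) * V') s := by
  have hS := hasDerivAt_sum_curve (p := p) (q := q) hU hV h0 h1
  have hSp : 0 < U s ^ p + V s ^ q := sum_curve_pos h0 h1
  have hA := hasDerivAt_rpow_curve (p := γ) hS hSp
  have hP' := hasDerivAt_rpow_curve (p := p) hU h0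
  refine (hA.mul ((hU.const_mul 2).add ((hU.const_mul (γ * p)).mul (hP'.div hS hSp.ne')))).congr_deriv ?_
  simp only [bellmanZZ, bellmanZE, Pi.add_apply, Pi.mul_apply, Pi.div_apply]
  generalize (U s ^ p + V s ^ q) ^ γ = A
  generalize hP : U s ^ p = P at *
  generalize hE : V s ^ q = E at *
  field_simp
  ring

theorem hasDerivAt_bellmanE (hU : HasDerivAt U U' s) (hV : HasDerivAt V V' s) (h0 : 0 < U s)
    (h1 : 0 < V s) : HasDerivAt (fun s => bellmanE p q γ K (U s) (V s))
      (bellmanZE p q γ (U s) (V s) * U' + bellmanEE p q γ K (U s) (V s) * V') s := by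
  have hS := hasDerivAt_sum_curve (p := p) (q := q) hU hV h0 h1
  have hSp : 0 < U s ^ p + V s ^ q := sum_curve_pos h0 h1
  have hA := hasDerivAt_rpow_curve (p := γ) hS hSp
  have hE' := hasDerivAt_rpow_curve (p := q) hV h1
  refine (((((hU.pow 2).const_mul (γ * q)).mul hA).mul (hE'.div hS hSp.ne')).div hV h1.ne' |>.add
    ((hE'.div hV h1.ne').const_mul (K * q))).congr_deriv ?_
  simp only [bellmanZE, bellmanEE, Pi.mul_apply, Pi.div_apply, Pi.pow_apply, Nat.cast_ofNat]
  generalize (U s ^ p + V s ^ q) ^ γ = A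
  generalize hP : U s ^ p = P at *
  generalize hE : V s ^ q = E at *
  field_simp
  ring

end Curve

/-! ### Size and convexity of the Bellman function. -/

section Convexity

variable {p q ζ η : ℝ}

/-- Because ζ² = (ζ^p)^(2/p) ≤ S^(2/p). This fixes the exponent γ = 1 − 2/p, for which both terms of
the Bellman function have size at most a multiple of ζ^p + η^q. -/
theorem sq_mul_rpow_le (hp : 2 ≤ p) (hζ : 0 < ζ) {S : ℝ} (hS : ζ ^ p ≤ S) :
    ζ ^ 2 * S ^ (1 - 2 / p) ≤ S := by
  have hp0 : 0 < p := by linarith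
  have hP : 0 < ζ ^ p := Real.rpow_pos_of_pos hζ _
  have hS0 : 0 < S := hP.trans_le hS
  have h1 : ζ ^ 2 = (ζ ^ p) ^ (2 / p) := by
    rw [← Real.rpow_mul hζ.le, mul_div_cancel₀ _ hp0.ne']; norm_cast
  calc ζ ^ 2 * S ^ (1 - 2 / p) ≤ S ^ (2 / p) * S ^ (1 - 2 / p) := by
        rw [h1]; gcongr
    _ = S := by rw [← Real.rpow_add hS0]; simp

theorem bellman_nonneg {γ K : ℝ} (hK : 0 ≤ K) (hζ : 0 < ζ) (hη : 0 < η) :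
    0 ≤ bellman p q γ K ζ η := by
  unfold bellman; positivity

theorem bellman_le {K : ℝ} (hp : 2 ≤ p) (hK : 0 ≤ K) (hζ : 0 < ζ) (hη : 0 < η) :
    bellman p q (1 - 2 / p) K ζ η ≤ (1 + K) * (ζ ^ p + η ^ q) := by
  have hP : 0 < ζ ^ p := Real.rpow_pos_of_pos hζ _
  have hE : 0 < η ^ q := Real.rpow_pos_of_pos hη _
  have h := sq_mul_rpow_le hp hζ (S := ζ ^ p + η ^ q) (by linarith)
  unfold bellman
  nlinarith [mul_nonneg hK hP.le]

/-- The Hessian dominates a diagonal form with ad ≥ 1, which by the arithmetic–geometric mean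
inequality controls 2|XY|. The value of K is a budget: of 5q² + 1, a share q² absorbs the negative
part of the ηη-derivative, 4q² absorbs the mixed term, and 1 survives as d. -/
theorem bellman_hess (hp : 2 ≤ p) (hq : p⁻¹ + q⁻¹ = 1) {K : ℝ} (hK : K * q * (q - 1) = 5 * q ^ 2 + 1)
    (hζ : 0 < ζ) (hη : 0 < η) :
    ∃ a d : ℝ, 0 ≤ a ∧ 0 ≤ d ∧ 1 ≤ a * d ∧ ∀ X Y : ℝ, a * X ^ 2 + d * Y ^ 2 ≤
      bellmanZZ p q (1 - 2 / p) ζ η * X ^ 2 + 2 * (bellmanZE p q (1 - 2 / p) ζ η * X * Y)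
        + bellmanEE p q (1 - 2 / p) K ζ η * Y ^ 2 := by
  have hp0 : 0 < p := by linarith
  have hpi : p⁻¹ ≤ 1 / 2 := by rw [inv_eq_one_div]; gcongr
  have hpi0 : 0 < p⁻¹ := by positivity
  have hqi : q⁻¹ = 1 - p⁻¹ := by linarith
  have hq0 : 0 < q := inv_pos.1 (by linarith)
  have hq1 : 1 < q := (one_lt_inv₀ (inv_pos.2 hq0)).2 (by linarith) |>.trans_eq (inv_inv q)
  have hP : 0 < ζ ^ p := Real.rpow_pos_of_pos hζ _
  have hE : 0 < η ^ q := Real.rpow_pos_of_pos hη _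
  set γ := 1 - 2 / p with hγ
  have hγ0 : 0 ≤ γ := by rw [hγ, div_eq_mul_inv]; linarith
  have hγ1 : γ ≤ 1 := by rw [hγ, div_eq_mul_inv]; linarith
  have hγp : (1 - γ) * p = 2 := by rw [hγ]; field_simp; ring
  set S := ζ ^ p + η ^ q with hS
  have hS0 : 0 < S := by positivity
  have hA0 : 0 < S ^ γ := Real.rpow_pos_of_pos hS0 _
  set A := S ^ γ with hA
  set σ := ζ ^ p / S with hσ
  set τ := η ^ q / S with hτ
  have hσ0 : 0 < σ := by positivity
  have hτ0 : 0 < τ := by positivity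
  have hστ : σ + τ = 1 := by rw [hσ, hτ, ← add_div, div_self hS0.ne']
  have hEτ : η ^ q = τ * S := by rw [hτ]; field_simp
  have hζA : ζ ^ 2 * A * τ ≤ η ^ q := by
    have := sq_mul_rpow_le hp hζ (S := S) (by rw [hS]; linarith)
    rw [hEτ, mul_comm τ S]; gcongr
  -- Since A ≥ η^(qγ) and qγ + q − 2 = 0 for conjugate exponents, the product of the two weights is
  -- at least 1.
  refine ⟨A, η ^ q / η ^ 2, hA0.le, by positivity, ?_, fun X Y => ?_⟩
  · have h1 : (η ^ q) ^ γ ≤ A := Real.rpow_le_rpow hE.le (by rw [hS]; linarith) hγ0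
    have h2 : (η ^ q) ^ γ * (η ^ q / η ^ 2) = 1 := by
      rw [← Real.rpow_mul hη.le, ← Real.rpow_natCast, ← Real.rpow_sub hη, ← Real.rpow_add hη]
      have : q * γ + (q - (2 : ℕ)) = 0 := by
        have h3 : q * p⁻¹ = q - 1 := by
          have : q * q⁻¹ = 1 := mul_inv_cancel₀ hq0.ne'
          rw [hqi] at this; linarith
        rw [hγ, div_eq_mul_inv]; push_cast; linear_combination -2 * h3
      rw [this, Real.rpow_zero]
    calc (1 : ℝ) = (η ^ q) ^ γ * (η ^ q / η ^ 2) := h2.symm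
      _ ≤ _ := by gcongr
  · have eZZ : bellmanZZ p q γ ζ η = A * (2 + γ * p * (p + 3) * σ - 2 * γ * p * σ ^ 2) := by
      rw [bellmanZZ, ← hS, ← hA, ← hσ]; linear_combination -A * γ * p * σ ^ 2 * hγp
    have eZE : bellmanZE p q γ ζ η = 2 * γ * q * ζ * A * τ ^ 2 / η := by
      rw [bellmanZE, ← hS, ← hA, ← hσ, ← hτ, hγp]
      have : σ = 1 - τ := by linarith
      rw [this]; ring
    have eEE : bellmanEE p q γ K ζ η = (γ * q * (ζ ^ 2 * A * τ) * ((q - 1) - (1 - γ) * q * τ)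
        + (5 * q ^ 2 + 1) * η ^ q) / η ^ 2 := by
      rw [bellmanEE, ← hS, ← hA, ← hτ, hK]; ring
    -- One copy of A is kept as the weight a; the other is spent on the mixed term.
    have hZZ : 2 * A ≤ bellmanZZ p q γ ζ η := by
      rw [eZZ]
      have h1 : σ ^ 2 ≤ σ := by nlinarith
      have h2 : 0 ≤ γ * p := by positivity
      have h3 : 2 * (γ * p) * σ ^ 2 ≤ γ * p * (p + 3) * σ := by
        calc 2 * (γ * p) * σ ^ 2 ≤ 2 * (γ * p) * σ := by gcongr
          _ ≤ γ * p * (p + 3) * σ := by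
            have : 2 * (γ * p) ≤ γ * p * (p + 3) := by nlinarith
            gcongr
      have h4 : 2 ≤ 2 + γ * p * (p + 3) * σ - 2 * γ * p * σ ^ 2 := by linarith
      calc 2 * A = A * 2 := mul_comm _ _
        _ ≤ _ := mul_le_mul_of_nonneg_left h4 hA0.le
    set T := ζ ^ 2 * A * τ with hT
    have hT0 : 0 ≤ T := by positivity
    have hEE : (4 * q ^ 2 + 1) * (η ^ q / η ^ 2) ≤ bellmanEE p q γ K ζ η := by
      rw [eEE, ← mul_div_assoc]
      gcongr
      have h1 : (1 - γ) * q * τ ≤ q := by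
        have : (1 - γ) * τ ≤ 1 := mul_le_one₀ (by linarith) hτ0.le (by linarith)
        nlinarith
      have h2 : γ * q * T * ((q - 1) - (1 - γ) * q * τ) ≥ - (q ^ 2 * η ^ q) := by
        have h3 : -q ≤ (q - 1) - (1 - γ) * q * τ := by linarith
        have h4 : γ * q * T ≤ q * η ^ q := by
          calc γ * q * T ≤ 1 * q * η ^ q := by gcongr
            _ = _ := by ring
        have h5 : 0 ≤ γ * q * T := by positivity
        have h6 := mul_le_mul_of_nonneg_left h3 h5
        have h7 := mul_le_mul_of_nonneg_right h4 hq0.le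
        linarith
      linarith
    -- The mixed term is 2AX(wY), and completing the square leaves the error Aw²Y². The bound on w
    -- uses T ≤ η^q and γ, τ ≤ 1.
    have hmix : -(A * X ^ 2 + 4 * q ^ 2 * (η ^ q / η ^ 2) * Y ^ 2)
        ≤ 2 * (bellmanZE p q γ ζ η * X * Y) := by
      rw [eZE]
      set w := 2 * γ * q * ζ * τ ^ 2 / η with hw
      have h1 : A * w ^ 2 ≤ 4 * q ^ 2 * (η ^ q / η ^ 2) := by
        have e : A * w ^ 2 = 4 * q ^ 2 * ((γ ^ 2 * τ ^ 3) * T / η ^ 2) := by rw [hw, hT]; field_simp; ring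
        rw [e]
        have h2 : γ ^ 2 * τ ^ 3 ≤ 1 := mul_le_one₀ (pow_le_one₀ hγ0 hγ1) (by positivity)
          (pow_le_one₀ hτ0.le (by linarith))
        gcongr
        calc γ ^ 2 * τ ^ 3 * T ≤ 1 * η ^ q := by gcongr
          _ = _ := one_mul _
      have h3 : 2 * (2 * γ * q * ζ * A * τ ^ 2 / η * X * Y) = 2 * A * X * (w * Y) := by
        rw [hw]; ring
      rw [h3]
      have h4 := mul_le_mul_of_nonneg_right h1 (sq_nonneg Y)
      have h5 := mul_nonneg hA0.le (sq_nonneg (X + w * Y))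
      linarith
    have h5 := mul_le_mul_of_nonneg_right hZZ (sq_nonneg X)
    have h6 := mul_le_mul_of_nonneg_right hEE (sq_nonneg Y)
    linarith

end Convexity

/-! ### The heat kernel -/

/-- The heat kernel as a function of time and space. -/
noncomputable def heatKernel (z : ℝ × E3) : ℝ :=
  (Real.sqrt (4 * Real.pi * z.1) ^ 3)⁻¹ * Real.exp (-(‖z.2‖ ^ 2 / (4 * z.1)))

/-- The half space of positive times. -/
def posTime : Set (ℝ × E3) := {z | 0 < z.1}

theorem isOpen_posTime : IsOpen posTime := isOpen_lt continuous_const continuous_fst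

theorem contDiffOn_heatKernel : ContDiffOn ℝ ∞ heatKernel posTime := by
  intro z hz
  have hz' : (0 : ℝ) < z.1 := hz
  have hpi := Real.pi_pos
  have h1 : ContDiffAt ℝ ∞ (fun z : ℝ × E3 => Real.sqrt (4 * Real.pi * z.1)) z :=
    (contDiffAt_const.mul contDiffAt_fst).sqrt (by positivity)
  have h2 : ContDiffAt ℝ ∞ (fun z : ℝ × E3 => ‖z.2‖ ^ 2 / (4 * z.1)) z :=
    (contDiffAt_snd.norm_sq ℝ).div (contDiffAt_const.mul contDiffAt_fst) (by positivity)
  exact (((h1.pow 3).inv (by positivity)).mul h2.neg.exp).contDiffWithinAt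

theorem heatKernel_pos {z : ℝ × E3} (hz : z ∈ posTime) : 0 < heatKernel z := by
  have hz' : (0 : ℝ) < z.1 := hz
  have hpi := Real.pi_pos
  unfold heatKernel; positivity

/-- The unit vector in the time direction. -/
def eTime : ℝ × E3 := (1, 0)

/-- The unit vectors in the space directions. -/
noncomputable def eSpace (i : Fin 3) : ℝ × E3 := (0, EuclideanSpace.single i 1)

/-- Directional derivatives of functions of time and space. -/
noncomputable def dirD (v : ℝ × E3) (F : ℝ × E3 → ℝ) (z : ℝ × E3) : ℝ := fderiv ℝ F z v

theorem _root_.ContDiffOn.hasDerivAt_dirD {F : ℝ × E3 → ℝ} (hF : ContDiffOn ℝ ∞ F posTime) {z : ℝ × E3} (hz : z ∈ posTime)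
    (v : ℝ × E3) : HasDerivAt (fun s : ℝ => F (z + s • v)) (dirD v F z) 0 := by
  have h1 : DifferentiableAt ℝ F z :=
    (hF.contDiffAt (isOpen_posTime.mem_nhds hz)).differentiableAt (by simp)
  have h2 : HasDerivAt (fun s : ℝ => z + s • v) v 0 := by
    simpa using ((hasDerivAt_id (0 : ℝ)).smul_const v).const_add z
  have h3 : HasFDerivAt F (fderiv ℝ F z) (z + (0 : ℝ) • v) := by simpa using h1.hasFDerivAt
  exact h3.comp_hasDerivAt (0 : ℝ) h2

theorem _root_.ContDiffOn.dirD_eq {F : ℝ × E3 → ℝ} (hF : ContDiffOn ℝ ∞ F posTime) {z : ℝ × E3} (hz : z ∈ posTime)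
    {v : ℝ × E3} {d : ℝ} (h : HasDerivAt (fun s : ℝ => F (z + s • v)) d 0) : dirD v F z = d :=
  (hF.hasDerivAt_dirD hz v).unique h

theorem _root_.ContDiffOn.dirD {F : ℝ × E3 → ℝ} (hF : ContDiffOn ℝ ∞ F posTime) (v : ℝ × E3) :
    ContDiffOn ℝ ∞ (Axi.dirD v F) posTime :=
  (hF.fderiv_of_isOpen isOpen_posTime (by simp)).clm_apply contDiffOn_const

theorem dirD_congr {F G : ℝ × E3 → ℝ} (h : EqOn F G posTime) {z : ℝ × E3} (hz : z ∈ posTime)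
    (v : ℝ × E3) : dirD v F z = dirD v G z := by
  have : F =ᶠ[nhds z] G := by
    filter_upwards [isOpen_posTime.mem_nhds hz] with w hw using h hw
  rw [dirD, dirD, this.fderiv_eq]

theorem norm_sq_add_smul_single (x : E3) (s : ℝ) (i : Fin 3) :
    ‖x + s • (EuclideanSpace.single i (1 : ℝ) : E3)‖ ^ 2 = ‖x‖ ^ 2 + 2 * x i * s + s ^ 2 := by
  rw [norm_add_sq_real, norm_smul, inner_smul_right, EuclideanSpace.inner_single_right]
  simp
  ring

theorem dirD_heatKernel_space {z : ℝ × E3} (hz : z ∈ posTime) (i : Fin 3) :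
    dirD (eSpace i) heatKernel z = -(z.2 i / (2 * z.1)) * heatKernel z := by
  have hz' : (0 : ℝ) < z.1 := hz
  refine contDiffOn_heatKernel.dirD_eq hz ?_
  have h1 : HasDerivAt (fun s : ℝ => ‖z.2‖ ^ 2 + 2 * z.2 i * s + s ^ 2) (2 * z.2 i) 0 := by
    exact ((((hasDerivAt_id (0 : ℝ)).const_mul (2 * z.2 i)).const_add (‖z.2‖ ^ 2)).add
      (hasDerivAt_pow 2 (0 : ℝ))).congr_deriv (by simp)
  have h2 := ((h1.div_const (4 * z.1)).fun_neg.exp).const_mul ((Real.sqrt (4 * Real.pi * z.1) ^ 3)⁻¹)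
  have e : (fun s : ℝ => heatKernel (z + s • eSpace i)) = fun s : ℝ => (Real.sqrt (4 * Real.pi * z.1) ^ 3)⁻¹ *
      Real.exp (-((‖z.2‖ ^ 2 + 2 * z.2 i * s + s ^ 2) / (4 * z.1))) := by
    funext s
    simp only [heatKernel, eSpace, Prod.fst_add, Prod.smul_fst, smul_zero, add_zero, Prod.snd_add,
      Prod.smul_snd, norm_sq_add_smul_single]
  rw [e]
  refine h2.congr_deriv ?_
  simp only [heatKernel]
  ring_nf

theorem dirD_dirD_heatKernel_space {z : ℝ × E3} (hz : z ∈ posTime) (i : Fin 3) :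
    dirD (eSpace i) (dirD (eSpace i) heatKernel) z
      = (z.2 i ^ 2 / (4 * z.1 ^ 2) - 1 / (2 * z.1)) * heatKernel z := by
  have hz' : (0 : ℝ) < z.1 := hz
  have h0 : EqOn (dirD (eSpace i) heatKernel) (fun z => -(z.2 i / (2 * z.1)) * heatKernel z) posTime :=
    fun w hw => dirD_heatKernel_space hw i
  refine (contDiffOn_heatKernel.dirD (eSpace i)).dirD_eq hz ?_
  have hev : (fun s : ℝ => dirD (eSpace i) heatKernel (z + s • eSpace i))
      = fun s : ℝ => -((z.2 i + s) / (2 * z.1)) * heatKernel (z + s • eSpace i) := by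
    funext s
    rw [h0 (show z + s • eSpace i ∈ posTime by simpa [posTime, eSpace] using hz')]
    simp [eSpace]
  rw [hev]
  have h1 : HasDerivAt (fun s : ℝ => -((z.2 i + s) / (2 * z.1))) (-(1 / (2 * z.1))) 0 :=
    (((hasDerivAt_id (0 : ℝ)).const_add (z.2 i)).div_const (2 * z.1)).fun_neg
  refine (h1.mul (contDiffOn_heatKernel.hasDerivAt_dirD hz (eSpace i))).congr_deriv ?_
  rw [dirD_heatKernel_space hz]
  simp
  field_simp
  ring

theorem dirD_heatKernel_time {z : ℝ × E3} (hz : z ∈ posTime) :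
    dirD eTime heatKernel z = ∑ i, dirD (eSpace i) (dirD (eSpace i) heatKernel) z := by
  have hz' : (0 : ℝ) < z.1 := hz
  have hpi := Real.pi_pos
  have h0 : dirD eTime heatKernel z = (‖z.2‖ ^ 2 / (4 * z.1 ^ 2) - 3 / (2 * z.1)) * heatKernel z := by
    refine contDiffOn_heatKernel.dirD_eq hz ?_
    have e : (fun s : ℝ => heatKernel (z + s • eTime)) = fun s : ℝ =>
        (Real.sqrt (4 * Real.pi * (z.1 + s)) ^ 3)⁻¹ * Real.exp (-(‖z.2‖ ^ 2 / (4 * (z.1 + s)))) := by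
      funext s
      simp [heatKernel, eTime]
    rw [e]
    have h1 : HasDerivAt (fun s : ℝ => z.1 + s) 1 0 := (hasDerivAt_id (0 : ℝ)).const_add z.1
    have h2 := (h1.const_mul (4 * Real.pi)).sqrt (by simp; positivity)
    have hne : Real.sqrt (4 * Real.pi * (z.1 + 0)) ^ 3 ≠ 0 := by rw [add_zero]; positivity
    have h3 := ((h2.pow 3).inv hne)
    have h4 : HasDerivAt (fun s : ℝ => ‖z.2‖ ^ 2 / (4 * (z.1 + s))) (-(‖z.2‖ ^ 2) * 4 / (4 * z.1) ^ 2) 0 := by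
      have := ((h1.const_mul 4).inv (by rw [add_zero]; positivity)).const_mul (‖z.2‖ ^ 2)
      refine (this.congr_deriv ?_)
      rw [add_zero]; ring
    refine (h3.mul h4.fun_neg.exp).congr_deriv ?_
    simp only [heatKernel, add_zero, Pi.inv_apply, Pi.pow_apply]
    have hs : Real.sqrt (4 * Real.pi * z.1) ^ 2 = 4 * Real.pi * z.1 := Real.sq_sqrt (by positivity)
    have hs0 : 0 < Real.sqrt (4 * Real.pi * z.1) := by positivity
    generalize Real.exp (-(‖z.2‖ ^ 2 / (4 * z.1))) = E
    have key : (3 : ℝ) * Real.sqrt (4 * Real.pi * z.1) ^ 2 * (4 * Real.pi * 1 / (2 * Real.sqrt (4 * Real.pi * z.1)))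
        / (Real.sqrt (4 * Real.pi * z.1) ^ 3) ^ 2
        = 3 / (2 * z.1) * (Real.sqrt (4 * Real.pi * z.1) ^ 3)⁻¹ := by
      have e2 : 4 * Real.pi = Real.sqrt (4 * Real.pi * z.1) ^ 2 / z.1 := by rw [hs]; field_simp
      set S := Real.sqrt (4 * Real.pi * z.1)
      rw [e2]
      field_simp
    simp only [Nat.cast_ofNat, Nat.add_one_sub_one] at *
    rw [neg_div, key]
    field_simp
    ring
  rw [h0]
  simp only [dirD_dirD_heatKernel_space hz, ← Finset.sum_mul, Fin.sum_univ_three, norm_sq_eq]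
  ring

/-- The heat kernel at a fixed time. -/
noncomputable def gauss (t : ℝ) (x : E3) : ℝ := heatKernel (t, x)

theorem gauss_pos {t : ℝ} (ht : 0 < t) (x : E3) : 0 < gauss t x := heatKernel_pos (z := (t, x)) ht

theorem gauss_neg (t : ℝ) (x : E3) : gauss t (-x) = gauss t x := by simp [gauss, heatKernel]

theorem integrable_gauss {t : ℝ} (ht : 0 < t) : Integrable (gauss t) := by
  have h := (GaussianFourier.integrable_cexp_neg_mul_sq_norm_add (V := E3) (b := ((4 * t)⁻¹ : ℝ))
    (by simpa using ht) 0 0).re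
  have h2 : Integrable (fun x : E3 => Real.exp (-(‖x‖ ^ 2 / (4 * t)))) := by
    refine h.congr (.of_forall fun x => ?_)
    simp only [inner_zero_left, Complex.ofReal_zero, mul_zero, add_zero]
    have : (-(((4 * t)⁻¹ : ℝ) : ℂ) * (‖x‖ : ℂ) ^ 2) = ((-(‖x‖ ^ 2 / (4 * t)) : ℝ) : ℂ) := by
      push_cast; ring
    rw [this, ← Complex.ofReal_exp]; rfl
  exact h2.const_mul ((Real.sqrt (4 * Real.pi * t) ^ 3)⁻¹)

theorem integral_gauss {t : ℝ} (ht : 0 < t) : ∫ x, gauss t x = 1 := by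
  have h := GaussianFourier.integral_rexp_neg_mul_sq_norm (V := E3) (b := (4 * t)⁻¹) (by positivity)
  have hpi := Real.pi_pos
  have e : ∀ x, gauss t x = (Real.sqrt (4 * Real.pi * t) ^ 3)⁻¹ * Real.exp (-(4 * t)⁻¹ * ‖x‖ ^ 2) := by
    intro x; simp only [gauss, heatKernel]; congr 2; ring
  simp only [e, integral_const_mul, h]
  have e2 : Real.pi / (4 * t)⁻¹ = 4 * Real.pi * t := by field_simp
  rw [e2]
  have e3 : (4 * Real.pi * t) ^ ((Module.finrank ℝ E3 : ℝ) / 2) = Real.sqrt (4 * Real.pi * t) ^ 3 := by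
    rw [Real.sqrt_eq_rpow, ← Real.rpow_natCast, ← Real.rpow_mul (by positivity)]
    congr 1; simp
    norm_num
  rw [e3, inv_mul_cancel₀ (by positivity)]

theorem continuous_gauss (t : ℝ) : Continuous (gauss t) := by
  have h : Continuous fun x : E3 => Real.exp (-(‖x‖ ^ 2 / (4 * t))) :=
    Real.continuous_exp.comp (((continuous_norm (E := E3)).pow 2).div_const (4 * t)).neg
  exact h.const_mul ((Real.sqrt (4 * Real.pi * t) ^ 3)⁻¹)

/-- The semigroup property for two equal times, by completing the square around the midpoint x/2. -/
theorem integral_gauss_mul_gauss {t : ℝ} (ht : 0 < t) (x : E3) :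
    ∫ y, gauss t (x - y) * gauss t y = gauss (2 * t) x := by
  have hpi := Real.pi_pos
  have e : ∀ y, gauss t (x - y) * gauss t y = gauss (2 * t) x * gauss (t / 2) (y - (1 / 2 : ℝ) • x) := by
    intro y
    have h1 : ‖x - y‖ ^ 2 + ‖y‖ ^ 2 = ‖x‖ ^ 2 / 2 + 2 * ‖y - (1 / 2 : ℝ) • x‖ ^ 2 := by
      rw [norm_sub_sq_real, norm_sub_sq_real, norm_smul, inner_smul_right, real_inner_comm]
      norm_num; ring
    simp only [gauss, heatKernel]
    have h2 : Real.sqrt (4 * Real.pi * t) ^ 2 = Real.sqrt (4 * Real.pi * (2 * t)) * Real.sqrt (4 * Real.pi * (t / 2)) := by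
      rw [← Real.sqrt_mul (by positivity), Real.sq_sqrt (by positivity)]
      rw [show 4 * Real.pi * (2 * t) * (4 * Real.pi * (t / 2)) = (4 * Real.pi * t) ^ 2 by ring,
        Real.sqrt_sq (by positivity)]
    have h3 : (Real.sqrt (4 * Real.pi * t) ^ 3)⁻¹ * (Real.sqrt (4 * Real.pi * t) ^ 3)⁻¹
        = (Real.sqrt (4 * Real.pi * (2 * t)) ^ 3)⁻¹ * (Real.sqrt (4 * Real.pi * (t / 2)) ^ 3)⁻¹ := by
      rw [← mul_inv, ← mul_inv, ← mul_pow, ← mul_pow, ← h2]; ring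
    have h4 : Real.exp (-(‖x - y‖ ^ 2 / (4 * t))) * Real.exp (-(‖y‖ ^ 2 / (4 * t)))
        = Real.exp (-(‖x‖ ^ 2 / (4 * (2 * t)))) * Real.exp (-(‖y - (1 / 2 : ℝ) • x‖ ^ 2 / (4 * (t / 2)))) := by
      rw [← Real.exp_add, ← Real.exp_add]
      congr 1
      field_simp
      linarith
    calc _ = ((Real.sqrt (4 * Real.pi * t) ^ 3)⁻¹ * (Real.sqrt (4 * Real.pi * t) ^ 3)⁻¹)
        * (Real.exp (-(‖x - y‖ ^ 2 / (4 * t))) * Real.exp (-(‖y‖ ^ 2 / (4 * t)))) := by ring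
      _ = _ := by rw [h3, h4]; ring
  simp only [e, integral_const_mul]
  rw [integral_sub_right_eq_self (gauss (t / 2)), integral_gauss (by positivity), mul_one]

theorem pow_five_mul_exp_le (r : ℝ) (hr : 0 ≤ r) : r ^ 5 * Real.exp (-(r ^ 2 / 4)) ≤ 385 := by
  -- The cubic term of the exponential series gives r⁶ ≤ 4³·3!·exp(r²/4) = 384·exp(r²/4); together
  -- with r⁵ ≤ 1 + r⁶ this makes 385.
  have h1 := Real.pow_div_factorial_le_exp (r ^ 2 / 4) (by positivity) 3
  have h2 : 1 ≤ Real.exp (r ^ 2 / 4) := Real.one_le_exp (by positivity)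
  have h3 : r ^ 5 ≤ 1 + r ^ 6 := by
    rcases le_total r 1 with h | h
    · have : r ^ 5 ≤ 1 := pow_le_one₀ hr h
      nlinarith [pow_nonneg hr 6]
    · have := pow_le_pow_right₀ h (show 5 ≤ 6 by norm_num)
      linarith
  rw [Real.exp_neg, ← div_eq_mul_inv, div_le_iff₀ (Real.exp_pos _)]
  norm_num [Nat.factorial] at h1
  nlinarith

theorem mul_exp_le (r : ℝ) : r * Real.exp (-(r ^ 2 / 4)) ≤ 4 := by
  have h1 := Real.add_one_le_exp (r ^ 2 / 4)
  rw [Real.exp_neg, ← div_eq_mul_inv, div_le_iff₀ (Real.exp_pos _)]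
  nlinarith [sq_nonneg (r - 1)]

theorem abs_dirD_heatKernel_le {t : ℝ} (ht : 0 < t) (x : E3) (i : Fin 3) :
    |dirD (eSpace i) heatKernel (t, x)| ≤ (Real.sqrt t ^ 4)⁻¹ * (‖x‖ / Real.sqrt t * Real.exp (-((‖x‖ / Real.sqrt t) ^ 2 / 4))) := by
  have hpi := Real.pi_gt_three
  rw [dirD_heatKernel_space (z := (t, x)) ht]
  set τ := Real.sqrt t with hτ
  have hτ0 : 0 < τ := Real.sqrt_pos.2 ht
  have htτ : t = τ ^ 2 := (Real.sq_sqrt ht.le).symm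
  have h1 : Real.sqrt (4 * Real.pi * t) = Real.sqrt (4 * Real.pi) * τ := Real.sqrt_mul (by positivity) t
  have h2 : 1 ≤ Real.sqrt (4 * Real.pi) := Real.one_le_sqrt.2 (by linarith)
  have h3 : |x i| ≤ ‖x‖ := PiLp.norm_apply_le x i
  rw [abs_mul, abs_of_pos (heatKernel_pos (z := (t, x)) ht), abs_neg, abs_div, abs_of_pos (by positivity : 0 < 2 * t)]
  simp only [heatKernel, h1, mul_pow]
  have h4 : ‖x‖ ^ 2 / (4 * t) = (‖x‖ / τ) ^ 2 / 4 := by rw [htτ]; field_simp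
  rw [h4]
  calc |x i| / (2 * t) * ((Real.sqrt (4 * Real.pi) ^ 3 * τ ^ 3)⁻¹ * Real.exp (-((‖x‖ / τ) ^ 2 / 4)))
      ≤ ‖x‖ / (1 * t) * ((1 ^ 3 * τ ^ 3)⁻¹ * Real.exp (-((‖x‖ / τ) ^ 2 / 4))) := by
        gcongr; norm_num
    _ = _ := by rw [htτ]; field_simp

/-- The gradient of the kernel is t⁻² times a profile of |x|/√t. The Gaussian absorbs four more
powers of |x|/√t, which exchanges t⁻² for |x|⁻⁴ with a bound uniform in time. -/
theorem abs_dirD_heatKernel_le_pow {t : ℝ} (ht : 0 < t) {x : E3} (hx : x ≠ 0) (i : Fin 3) :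
    |dirD (eSpace i) heatKernel (t, x)| ≤ 385 * (‖x‖ ^ 4)⁻¹ := by
  refine (abs_dirD_heatKernel_le ht x i).trans ?_
  have hn : 0 < ‖x‖ := norm_pos_iff.2 hx
  have hτ0 : 0 < Real.sqrt t := Real.sqrt_pos.2 ht
  have h := pow_five_mul_exp_le (‖x‖ / Real.sqrt t) (by positivity)
  calc _ = (‖x‖ ^ 4)⁻¹ * ((‖x‖ / Real.sqrt t) ^ 5 * Real.exp (-((‖x‖ / Real.sqrt t) ^ 2 / 4))) := by
        field_simp
    _ ≤ (‖x‖ ^ 4)⁻¹ * 385 := by gcongr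
    _ = _ := mul_comm _ _

theorem abs_dirD_heatKernel_le_time {t : ℝ} (ht : 0 < t) (x : E3) (i : Fin 3) :
    |dirD (eSpace i) heatKernel (t, x)| ≤ 4 * (Real.sqrt t ^ 4)⁻¹ := by
  refine (abs_dirD_heatKernel_le ht x i).trans ?_
  rw [mul_comm 4]
  gcongr
  exact mul_exp_le _

/-! ### The heat extension -/

/-! ### Translates integrated against compactly supported densities. -/

section CompactTranslates

variable {Z F Y : Type*} [NormedAddCommGroup Z] [NormedSpace ℝ Z] [ProperSpace Z]
  [NormedAddCommGroup F] [NormedSpace ℝ F]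
  [NormedAddCommGroup Y] [NormedSpace ℝ Y] [MeasurableSpace Y] [BorelSpace Y]
  {ν : Measure Y} [IsFiniteMeasureOnCompacts ν]

theorem smoothTranslates_of_hasCompactSupport {g : Y → ℝ} {κ : Z → F} (ι : Y →L[ℝ] Z) {O D : Set Z}
    (hO : IsOpen O) (hD : IsOpen D) (hκ : ContDiffOn ℝ ∞ κ O) (hg : Continuous g)
    (hgc : HasCompactSupport g) (hmem : ∀ z ∈ D, ∀ y, z - ι y ∈ O) :
    SmoothTranslates ν g κ ι O D := by
  refine ⟨hO, hD, hκ, hg.aestronglyMeasurable, fun z hz y _ => hmem z hz y, fun n z hz => ?_⟩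
  obtain ⟨ε, hε, hεD⟩ := Metric.nhds_basis_closedBall.mem_iff.1 (hD.mem_nhds hz)
  have hK : IsCompact ((fun w : Z × Y => w.1 - ι w.2) '' (Metric.closedBall z ε ×ˢ tsupport g)) :=
    ((isCompact_closedBall z ε).prod hgc).image (by fun_prop)
  have hc : ContinuousOn (iteratedFDeriv ℝ n κ) O :=
    (hκ.continuousOn_iteratedFDerivWithin (m := n) (by exact_mod_cast le_top)
      hO.uniqueDiffOn).congr fun w hw => (iteratedFDerivWithin_of_isOpen n hO hw).symm
  have hKO : (fun w : Z × Y => w.1 - ι w.2) '' (Metric.closedBall z ε ×ˢ tsupport g) ⊆ O := by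
    rintro _ ⟨w, hw, rfl⟩
    exact hmem _ (hεD hw.1) _
  obtain ⟨M, hM⟩ := hK.exists_bound_of_continuousOn (hc.mono hKO)
  refine ⟨ε, hε, fun y => |g y| * M, ((hg.integrable_of_hasCompactSupport hgc).abs.mul_const M), ?_⟩
  intro z' hz' y hy
  exact mul_le_mul_of_nonneg_left (hM _ ⟨(z', y), ⟨Metric.ball_subset_closedBall hz'.1, subset_tsupport g hy⟩, rfl⟩) (abs_nonneg _)

end CompactTranslates

/-- The space-time convolution of a function of space with a kernel. -/
noncomputable def heatConv (κ : ℝ × E3 → ℝ) (h : E3 → ℝ) (z : ℝ × E3) : ℝ :=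
  ∫ y, h y • κ (z - ContinuousLinearMap.inr ℝ ℝ E3 y)

/-- The solution of the heat equation with initial value `h`. -/
noncomputable def heatExt (h : E3 → ℝ) : ℝ × E3 → ℝ := heatConv heatKernel h

theorem sub_inr (t : ℝ) (x y : E3) : (t, x) - ContinuousLinearMap.inr ℝ ℝ E3 y = (t, x - y) := by
  simp

theorem heatExt_apply (h : E3 → ℝ) (t : ℝ) (x : E3) :
    heatExt h (t, x) = ∫ y, h y * gauss t (x - y) := by
  simp only [heatExt, heatConv, sub_inr, gauss, smul_eq_mul]

section Conv

variable {κ : ℝ × E3 → ℝ} {h : E3 → ℝ}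

theorem smoothTranslates_posTime (hκ : ContDiffOn ℝ ∞ κ posTime) (h1 : Continuous h)
    (h2 : HasCompactSupport h) :
    SmoothTranslates volume h κ (ContinuousLinearMap.inr ℝ ℝ E3) posTime posTime :=
  smoothTranslates_of_hasCompactSupport _ isOpen_posTime isOpen_posTime hκ h1 h2
    fun z hz y => by simpa [posTime] using hz

theorem contDiffOn_heatConv (hκ : ContDiffOn ℝ ∞ κ posTime) (h1 : Continuous h)
    (h2 : HasCompactSupport h) : ContDiffOn ℝ ∞ (heatConv κ h) posTime :=
  (smoothTranslates_posTime hκ h1 h2).contDiffOn_integral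

theorem dirD_heatConv (hκ : ContDiffOn ℝ ∞ κ posTime) (h1 : Continuous h)
    (h2 : HasCompactSupport h) (v : ℝ × E3) :
    EqOn (dirD v (heatConv κ h)) (heatConv (dirD v κ) h) posTime := fun _ hz =>
  (smoothTranslates_posTime hκ h1 h2).fderiv_integral hz v

theorem contDiffOn_heatExt (h1 : Continuous h) (h2 : HasCompactSupport h) :
    ContDiffOn ℝ ∞ (heatExt h) posTime := contDiffOn_heatConv contDiffOn_heatKernel h1 h2

theorem dirD_dirD_heatExt (h1 : Continuous h) (h2 : HasCompactSupport h) (v w : ℝ × E3) :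
    EqOn (dirD v (dirD w (heatExt h))) (heatConv (dirD v (dirD w heatKernel)) h) posTime := by
  intro z hz
  rw [heatExt, dirD_congr (dirD_heatConv contDiffOn_heatKernel h1 h2 w) hz,
    dirD_heatConv (contDiffOn_heatKernel.dirD w) h1 h2 v hz]

theorem integrable_heatConv (hκ : ContDiffOn ℝ ∞ κ posTime) (h1 : Continuous h)
    (h2 : HasCompactSupport h) {z : ℝ × E3} (hz : z ∈ posTime) :
    Integrable (fun y => h y • κ (z - ContinuousLinearMap.inr ℝ ℝ E3 y)) := by
  refine Continuous.integrable_of_hasCompactSupport (h1.smul ?_) h2.smul_right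
  exact hκ.continuousOn.comp_continuous (by fun_prop) fun y => by simpa [posTime] using hz

theorem heat_equation (h1 : Continuous h) (h2 : HasCompactSupport h) {z : ℝ × E3}
    (hz : z ∈ posTime) :
    dirD eTime (heatExt h) z = ∑ i, dirD (eSpace i) (dirD (eSpace i) (heatExt h)) z := by
  simp only [dirD_dirD_heatExt h1 h2 _ _ hz]
  rw [heatExt, dirD_heatConv contDiffOn_heatKernel h1 h2 eTime hz]
  simp only [heatConv]
  rw [← integral_finsetSum _ fun i _ => integrable_heatConv
    ((contDiffOn_heatKernel.dirD (eSpace i)).dirD (eSpace i)) h1 h2 hz]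
  refine integral_congr_ae (.of_forall fun y => ?_)
  simp only
  rw [dirD_heatKernel_time (by simpa [posTime] using hz), Finset.smul_sum]

theorem heatExt_pos (h1 : Continuous h) (h2 : HasCompactSupport h) (h0 : ∀ x, 0 ≤ h x)
    {x₀ : E3} (hx₀ : h x₀ ≠ 0) {z : ℝ × E3} (hz : z ∈ posTime) : 0 < heatExt h z := by
  have hpos : ∀ y, 0 < heatKernel (z - ContinuousLinearMap.inr ℝ ℝ E3 y) := fun y =>
    heatKernel_pos (by simpa [posTime] using hz)
  have hc : Continuous fun y => h y • heatKernel (z - ContinuousLinearMap.inr ℝ ℝ E3 y) :=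
    h1.smul (contDiffOn_heatKernel.continuousOn.comp_continuous (by fun_prop)
      fun y => by simpa [posTime] using hz)
  exact hc.integral_pos_of_hasCompactSupport_nonneg_nonzero h2.smul_right
    (fun y => mul_nonneg (h0 y) (hpos y).le) (x := x₀) (mul_ne_zero hx₀ (hpos x₀).ne')

/-- The spatial derivative of a function of time and space. -/
theorem hasDerivAt_slice {G : ℝ × E3 → ℝ} (hG : ContDiffOn ℝ ∞ G posTime) {t : ℝ} (ht : 0 < t) :
    ContDiff ℝ ∞ (fun x => G (t, x)) ∧ ∀ i x, pd i (fun x => G (t, x)) x = dirD (eSpace i) G (t, x) := by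
  refine ⟨hG.comp_contDiff (by fun_prop) fun x => ht, fun i x => ?_⟩
  have h1 : HasFDerivAt G (fderiv ℝ G (t, x)) (t, x) :=
    ((hG.contDiffAt (isOpen_posTime.mem_nhds ht)).differentiableAt (by simp)).hasFDerivAt
  have h2 : HasFDerivAt (fun x : E3 => (t, x)) (ContinuousLinearMap.inr ℝ ℝ E3) x :=
    hasFDerivAt_prodMk_right t x
  have h3 : HasFDerivAt (fun x => G (t, x)) ((fderiv ℝ G (t, x)).comp (ContinuousLinearMap.inr ℝ ℝ E3)) x :=
    h1.comp x h2
  rw [h3.pd_eq]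
  simp [dirD, eSpace]

theorem integral_mul_pd {a b : E3 → ℝ} (ha : ContDiff ℝ 1 a) (hb : ContDiff ℝ 1 b)
    (hc : HasCompactSupport a) (i : Fin 3) : ∫ x, a x * pd i b x = -∫ x, pd i a x * b x := by
  have hca := hasCompactSupport_pd hc i
  exact integral_mul_fderiv_eq_neg_fderiv_mul_of_integrable
    (((ha.continuous_pd i).mul hb.continuous).integrable_of_hasCompactSupport hca.mul_right)
    ((ha.continuous.mul (hb.continuous_pd i)).integrable_of_hasCompactSupport hc.mul_right)
    ((ha.continuous.mul hb.continuous).integrable_of_hasCompactSupport hc.mul_right)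
    (fun x _ => ha.differentiable (by simp) x) (fun x _ => hb.differentiable (by simp) x)

theorem pd_comp_sub {b : E3 → ℝ} (hb : Differentiable ℝ b) (i : Fin 3) (x y : E3) :
    pd i (fun y => b (x - y)) y = -pd i b (x - y) := by
  have h : HasFDerivAt (fun y => b (x - y)) ((fderiv ℝ b (x - y)).comp (-ContinuousLinearMap.id ℝ E3)) y :=
    (hb (x - y)).hasFDerivAt.comp y ((hasFDerivAt_id y).const_sub x)
  rw [h.pd_eq]; simp [pd]

theorem heatConv_pd (hκ : ContDiffOn ℝ ∞ κ posTime) (h1 : ContDiff ℝ 1 h)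
    (h2 : HasCompactSupport h) (i : Fin 3) :
    EqOn (heatConv (dirD (eSpace i) κ) h) (heatConv κ (pd i h)) posTime := by
  rintro ⟨t, x⟩ hz
  obtain ⟨s1, s2⟩ := hasDerivAt_slice hκ hz
  have h4 := integral_mul_pd h1 (b := fun y => κ (t, x - y))
    ((s1.of_le (by simp)).comp (contDiff_const.sub contDiff_id)) h2 i
  simp only [heatConv, sub_inr, smul_eq_mul, ← s2]
  have h5 : ∀ y, pd i (fun y => κ (t, x - y)) y = -pd i (fun x => κ (t, x)) (x - y) := fun y =>
    pd_comp_sub (b := fun x => κ (t, x)) (s1.differentiable (by simp)) i x y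
  simp only [h5, mul_neg, integral_neg, neg_inj] at h4
  exact h4

theorem dirD_heatExt_eq (h1 : ContDiff ℝ 1 h) (h2 : HasCompactSupport h) (i : Fin 3) :
    EqOn (dirD (eSpace i) (heatExt h)) (heatExt (pd i h)) posTime := fun _ hz =>
  (dirD_heatConv contDiffOn_heatKernel h1.continuous h2 (eSpace i) hz).trans
    (heatConv_pd contDiffOn_heatKernel h1 h2 i hz)

end Conv

theorem heatExt_eq_average (h : E3 → ℝ) (t : ℝ) (x : E3) :
    heatExt h (t, x) = ∫ y, gauss t y * h (x - y) := by
  rw [heatExt_apply, ← integral_sub_left_eq_self _ volume x]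
  refine integral_congr_ae (.of_forall fun y => ?_)
  simp [mul_comm]

theorem lintegral_gauss {t : ℝ} (ht : 0 < t) : ∫⁻ x, ENNReal.ofReal (gauss t x) = 1 := by
  rw [← ofReal_integral_eq_lintegral_ofReal (integrable_gauss ht)
    (.of_forall fun x => (gauss_pos ht x).le), integral_gauss ht, ENNReal.ofReal_one]

theorem abs_heatExt_le {t : ℝ} (ht : 0 < t) {h : E3 → ℝ} {M : ℝ} (hM : ∀ x, |h x| ≤ M) (x : E3) :
    |heatExt h (t, x)| ≤ M := by
  rw [heatExt_eq_average]
  have := norm_integral_le_of_norm_le (μ := volume) (f := fun y => gauss t y * h (x - y))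
    ((integrable_gauss ht).mul_const M) (.of_forall fun y => ?_)
  · rwa [integral_mul_const, integral_gauss ht, one_mul] at this
  · rw [norm_mul, Real.norm_of_nonneg (gauss_pos ht y).le]
    exact mul_le_mul_of_nonneg_left (hM _) (gauss_pos ht y).le

/-- The heat semigroup is a contraction on `L^p`. -/
theorem lintegral_heatExt_rpow_le {t : ℝ} (ht : 0 < t) {h : E3 → ℝ} (h1 : Continuous h)
    (h2 : HasCompactSupport h) (h0 : ∀ x, 0 ≤ h x) {p : ℝ} (hp : 1 ≤ p) :
    ∫⁻ x, ENNReal.ofReal (heatExt h (t, x) ^ p) ≤ ∫⁻ x, ENNReal.ofReal (h x ^ p) := by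
  set G : Measure E3 := volume.withDensity fun y => ENNReal.ofReal (gauss t y) with hG
  have hmeas : Measurable fun y => ENNReal.ofReal (gauss t y) :=
    (continuous_gauss t).measurable.ennreal_ofReal
  have hprob : IsProbabilityMeasure G := ⟨by
    rw [hG, withDensity_apply _ MeasurableSet.univ, Measure.restrict_univ, lintegral_gauss ht]⟩
  have hI : ∀ F : E3 → ℝ, ∫ y, F y ∂G = ∫ y, gauss t y * F y := fun F => by
    rw [hG, integral_withDensity_eq_integral_toReal_smul hmeas (.of_forall fun y => ENNReal.ofReal_lt_top)]
    refine integral_congr_ae (.of_forall fun y => ?_)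
    simp only
    rw [ENNReal.toReal_ofReal (gauss_pos ht y).le, smul_eq_mul]
  have hbd : ∀ {F : E3 → ℝ}, Continuous F → HasCompactSupport F → ∀ x, Integrable (fun y => F (x - y)) G := by
    intro F hF hFc x
    obtain ⟨M, hM⟩ := hFc.exists_bound_of_continuous hF
    exact Integrable.of_bound (by fun_prop) M (.of_forall fun y => hM _)
  have hpc : Continuous fun x => h x ^ p := h1.rpow_const fun x => Or.inr (by linarith)
  have hpcs : HasCompactSupport fun x => h x ^ p :=
    h2.comp_left (g := fun s : ℝ => s ^ p) (Real.zero_rpow (by linarith))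
  -- The kernel is a probability density, so Jensen's inequality applies pointwise; Tonelli and
  -- translation invariance then conclude.
  have hJ : ∀ x, heatExt h (t, x) ^ p ≤ ∫ y, h (x - y) ^ p ∂G := by
    intro x
    rw [heatExt_eq_average, ← hI fun y => h (x - y)]
    exact (convexOn_rpow hp).map_integral_le (Real.continuous_rpow_const (by linarith)).continuousOn
      isClosed_Ici (.of_forall fun y => h0 _) (hbd h1 h2 x) (hbd hpc hpcs x)
  calc ∫⁻ x, ENNReal.ofReal (heatExt h (t, x) ^ p)
      ≤ ∫⁻ x, ∫⁻ y, ENNReal.ofReal (h (x - y) ^ p) ∂G := by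
        refine lintegral_mono fun x => (ENNReal.ofReal_le_ofReal (hJ x)).trans ?_
        rw [ofReal_integral_eq_lintegral_ofReal (hbd hpc hpcs x)
          (.of_forall fun y => Real.rpow_nonneg (h0 _) _)]
    _ = ∫⁻ y, ∫⁻ x, ENNReal.ofReal (h (x - y) ^ p) ∂volume ∂G := by
        refine lintegral_lintegral_swap (Measurable.aemeasurable ?_)
        exact (hpc.comp (continuous_fst.sub continuous_snd)).measurable.ennreal_ofReal
    _ = ∫⁻ y, (∫⁻ x, ENNReal.ofReal (h x ^ p)) ∂G := by
        refine lintegral_congr fun y => ?_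
        exact lintegral_sub_right_eq_self (fun x => ENNReal.ofReal (h x ^ p)) y
    _ = _ := by simp

/-! ### The Bellman function along two heat flows -/

section Flow

variable {F G : ℝ × E3 → ℝ} {p q γ K : ℝ}

theorem contDiffOn_bellman (hF : ContDiffOn ℝ ∞ F posTime) (hG : ContDiffOn ℝ ∞ G posTime)
    (hF0 : ∀ z ∈ posTime, 0 < F z) (hG0 : ∀ z ∈ posTime, 0 < G z) :
    ContDiffOn ℝ ∞ (fun z => bellman p q γ K (F z) (G z)) posTime := by
  have h1 : ContDiffOn ℝ ∞ (fun z => F z ^ p) posTime := hF.rpow_const_of_ne fun z hz => (hF0 z hz).ne'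
  have h2 : ContDiffOn ℝ ∞ (fun z => G z ^ q) posTime := hG.rpow_const_of_ne fun z hz => (hG0 z hz).ne'
  have h3 : ContDiffOn ℝ ∞ (fun z => (F z ^ p + G z ^ q) ^ γ) posTime :=
    (h1.add h2).rpow_const_of_ne fun z hz =>
      (add_pos (Real.rpow_pos_of_pos (hF0 z hz) p) (Real.rpow_pos_of_pos (hG0 z hz) q)).ne'
  exact ((hF.pow 2).mul h3).add (contDiffOn_const.mul h2)

theorem dirD_bellman (hF : ContDiffOn ℝ ∞ F posTime) (hG : ContDiffOn ℝ ∞ G posTime)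
    (hF0 : ∀ z ∈ posTime, 0 < F z) (hG0 : ∀ z ∈ posTime, 0 < G z) (v : ℝ × E3) :
    EqOn (dirD v fun z => bellman p q γ K (F z) (G z)) (fun z =>
      bellmanZ p q γ (F z) (G z) * dirD v F z + bellmanE p q γ K (F z) (G z) * dirD v G z) posTime := by
  intro z hz
  refine (contDiffOn_bellman hF hG hF0 hG0).dirD_eq hz ?_
  have h0 : z + (0 : ℝ) • v = z := by simp
  refine (hasDerivAt_bellman (p := p) (q := q) (γ := γ) (K := K) (hF.hasDerivAt_dirD hz v) (hG.hasDerivAt_dirD hz v)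
    (by rw [h0]; exact hF0 z hz) (by rw [h0]; exact hG0 z hz)).congr_deriv ?_
  simp only [h0]

theorem dirD_dirD_bellman (hF : ContDiffOn ℝ ∞ F posTime) (hG : ContDiffOn ℝ ∞ G posTime)
    (hF0 : ∀ z ∈ posTime, 0 < F z) (hG0 : ∀ z ∈ posTime, 0 < G z) (v : ℝ × E3) {z : ℝ × E3}
    (hz : z ∈ posTime) :
    dirD v (dirD v fun z => bellman p q γ K (F z) (G z)) z
      = bellmanZZ p q γ (F z) (G z) * dirD v F z ^ 2
        + 2 * (bellmanZE p q γ (F z) (G z) * dirD v F z * dirD v G z)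
        + bellmanEE p q γ K (F z) (G z) * dirD v G z ^ 2
        + (bellmanZ p q γ (F z) (G z) * dirD v (dirD v F) z
        + bellmanE p q γ K (F z) (G z) * dirD v (dirD v G) z) := by
  refine ((contDiffOn_bellman hF hG hF0 hG0).dirD v).dirD_eq hz ?_
  have h0 : z + (0 : ℝ) • v = z := by simp
  have hF0' : 0 < F (z + (0 : ℝ) • v) := by rw [h0]; exact hF0 z hz
  have hG0' : 0 < G (z + (0 : ℝ) • v) := by rw [h0]; exact hG0 z hz
  have hF1 := hF.hasDerivAt_dirD hz v
  have hG1 := hG.hasDerivAt_dirD hz v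
  have h1 := ((hasDerivAt_bellmanZ (p := p) (q := q) (γ := γ) hF1 hG1 hF0' hG0').mul ((hF.dirD v).hasDerivAt_dirD hz v)).add
    ((hasDerivAt_bellmanE (p := p) (q := q) (γ := γ) (K := K) hF1 hG1 hF0' hG0').mul ((hG.dirD v).hasDerivAt_dirD hz v))
  have hev : ∀ᶠ s : ℝ in nhds 0, z + s • v ∈ posTime := by
    have hc : Continuous fun s : ℝ => z + s • v := by fun_prop
    exact hc.continuousAt.eventually_mem (isOpen_posTime.mem_nhds (by rw [h0]; exact hz))
  refine (h1.congr_of_eventuallyEq ?_).congr_deriv ?_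
  · filter_upwards [hev] with s hs using dirD_bellman hF hG hF0 hG0 v hs
  · simp only [h0]; ring

/-- The terms with first derivatives of the Bellman function cancel by the two heat equations. What
remains is the Hessian evaluated on (∂ₖF, ∂ₖG) and summed over k, whose diagonal lower bound yields
the product for any pair i, j. -/
theorem bellman_flow_le (hF : ContDiffOn ℝ ∞ F posTime) (hG : ContDiffOn ℝ ∞ G posTime)
    (hF0 : ∀ z ∈ posTime, 0 < F z) (hG0 : ∀ z ∈ posTime, 0 < G z)
    (hFt : ∀ z ∈ posTime, dirD eTime F z = ∑ k, dirD (eSpace k) (dirD (eSpace k) F) z)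
    (hGt : ∀ z ∈ posTime, dirD eTime G z = ∑ k, dirD (eSpace k) (dirD (eSpace k) G) z)
    (hp : 2 ≤ p) (hq : p⁻¹ + q⁻¹ = 1) (hK : K * q * (q - 1) = 5 * q ^ 2 + 1) (i j : Fin 3)
    {z : ℝ × E3} (hz : z ∈ posTime) :
    2 * |dirD (eSpace i) F z * dirD (eSpace j) G z| ≤
      (∑ k, dirD (eSpace k) (dirD (eSpace k) fun z => bellman p q (1 - 2 / p) K (F z) (G z)) z)
        - dirD eTime (fun z => bellman p q (1 - 2 / p) K (F z) (G z)) z := by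
  simp only [dirD_dirD_bellman hF hG hF0 hG0 _ hz, dirD_bellman hF hG hF0 hG0 _ hz, hFt z hz, hGt z hz]
  obtain ⟨a, d, ha, hd, had, h⟩ := bellman_hess hp hq hK (hF0 z hz) (hG0 z hz)
  have h1 : ∀ k, a * dirD (eSpace k) F z ^ 2 + d * dirD (eSpace k) G z ^ 2 ≤ _ :=
    fun k => h (dirD (eSpace k) F z) (dirD (eSpace k) G z)
  have h2 := Finset.sum_le_sum fun k (_ : k ∈ Finset.univ) => h1 k
  have h3 : a * dirD (eSpace i) F z ^ 2 ≤ ∑ k, a * dirD (eSpace k) F z ^ 2 :=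
    Finset.single_le_sum (f := fun k => a * dirD (eSpace k) F z ^ 2) (fun k _ => by positivity) (Finset.mem_univ i)
  have h4 : d * dirD (eSpace j) G z ^ 2 ≤ ∑ k, d * dirD (eSpace k) G z ^ 2 :=
    Finset.single_le_sum (f := fun k => d * dirD (eSpace k) G z ^ 2) (fun k _ => by positivity) (Finset.mem_univ j)
  have h5 : 2 * |dirD (eSpace i) F z * dirD (eSpace j) G z|
      ≤ a * dirD (eSpace i) F z ^ 2 + d * dirD (eSpace j) G z ^ 2 := by
    generalize dirD (eSpace i) F z = X
    generalize dirD (eSpace j) G z = Y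
    -- In squared form: (aX² + dY²)² = (aX² − dY²)² + 4adX²Y², with ad ≥ 1.
    refine abs_le_of_sq_le_sq' (a := 2 * |X * Y|) ?_ (by positivity) |>.2
    rw [mul_pow, sq_abs]
    nlinarith [sq_nonneg (a * X ^ 2 - d * Y ^ 2), mul_nonneg (sub_nonneg.2 had) (sq_nonneg (X * Y))]
  simp only [Fin.sum_univ_three] at h2 h3 h4 ⊢
  linarith

end Flow

theorem hasDerivAt_integral_slice {H : ℝ × E3 → ℝ} (hH : ContDiffOn ℝ ∞ H posTime) {χ : E3 → ℝ}
    (h1 : Continuous χ) (h2 : HasCompactSupport χ) {t : ℝ} (ht : 0 < t) :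
    HasDerivAt (fun t => ∫ x, χ x * H (t, x)) (∫ x, χ x * dirD eTime H (t, x)) t := by
  have hK : IsCompact (Icc (t / 2) (2 * t) ×ˢ tsupport χ) := isCompact_Icc.prod h2
  have hsub : Icc (t / 2) (2 * t) ×ˢ tsupport χ ⊆ posTime := fun z hz =>
    lt_of_lt_of_le (by positivity) hz.1.1
  obtain ⟨M, hM⟩ := hK.exists_bound_of_continuousOn ((hH.dirD eTime).continuousOn.mono hsub)
  have hc : ∀ {J : ℝ × E3 → ℝ}, ContDiffOn ℝ ∞ J posTime → ∀ s, 0 < s → Continuous fun x => χ x * J (s, x) :=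
    fun hJ s hs => h1.mul (hasDerivAt_slice hJ hs).1.continuous
  have hnear : Ioo (t / 2) (2 * t) ∈ nhds t := Ioo_mem_nhds (by linarith) (by linarith)
  refine (hasDerivAt_integral_of_dominated_loc_of_deriv_le (μ := volume) (F := fun t x => χ x * H (t, x))
    (F' := fun t x => χ x * dirD eTime H (t, x)) (bound := fun x => |χ x| * M) hnear ?_
    ((hc hH t ht).integrable_of_hasCompactSupport h2.mul_right)
    (hc (hH.dirD eTime) t ht).aestronglyMeasurable ?_
    ((h1.integrable_of_hasCompactSupport h2).abs.mul_const M) ?_).2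
  · filter_upwards [hnear] with s hs
    exact (hc hH s (by linarith [hs.1])).aestronglyMeasurable
  · refine .of_forall fun x s hs => ?_
    by_cases hx : χ x = 0
    · simp [hx]
    rw [norm_mul, Real.norm_eq_abs]
    exact mul_le_mul_of_nonneg_left (hM _ ⟨Ioo_subset_Icc_self hs, subset_tsupport χ hx⟩) (abs_nonneg _)
  · refine .of_forall fun x s hs => HasDerivAt.const_mul _ ?_
    have hs0 : (s, x) ∈ posTime := show 0 < s by linarith [hs.1]
    have h3 : HasFDerivAt H (fderiv ℝ H (s, x)) (s, x) :=
      ((hH.contDiffAt (isOpen_posTime.mem_nhds hs0)).differentiableAt (by simp)).hasFDerivAt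
    exact h3.comp_hasDerivAt s ((hasDerivAt_id s).prodMk (hasDerivAt_const s x))

theorem integral_mul_lap {a b : E3 → ℝ} (ha : ContDiff ℝ ∞ a) (hb : ContDiff ℝ ∞ b)
    (hc : HasCompactSupport a) : ∫ x, a x * lap b x = ∫ x, lap a x * b x := by
  have hle : (1 : WithTop ℕ∞) ≤ ∞ := by simp
  simp only [lap, Finset.mul_sum, Finset.sum_mul]
  rw [integral_finsetSum _ fun k _ => ?_, integral_finsetSum _ fun k _ => ?_]
  · refine Finset.sum_congr rfl fun k _ => ?_
    rw [integral_mul_pd (ha.of_le hle) ((hb.pd_infty k).of_le hle) hc, ← neg_eq_iff_eq_neg.2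
      (integral_mul_pd ((ha.pd_infty k).of_le hle) (hb.of_le hle) (hasCompactSupport_pd hc k) k)]
  · exact (((ha.pd_infty k).pd_infty k).continuous.mul hb.continuous).integrable_of_hasCompactSupport
      (hasCompactSupport_pd (hasCompactSupport_pd hc k) k).mul_right
  · exact (ha.continuous.mul ((hb.pd_infty k).pd_infty k).continuous).integrable_of_hasCompactSupport
      hc.mul_right

theorem pd_comp_smul {f : E3 → ℝ} (hf : Differentiable ℝ f) (c : ℝ) (i : Fin 3) (x : E3) :
    pd i (fun y => f (c • y)) x = c * pd i f (c • x) := by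
  have h : HasFDerivAt (fun y => f (c • y)) ((fderiv ℝ f (c • x)).comp (c • ContinuousLinearMap.id ℝ E3)) x :=
    (hf (c • x)).hasFDerivAt.comp x ((hasFDerivAt_id x).const_smul c)
  rw [h.pd_eq]; simp [pd]

theorem hasCompactSupport_lap {f : E3 → ℝ} (hf : HasCompactSupport f) : HasCompactSupport (lap f) := by
  have h2 : ∀ k, HasCompactSupport (pd k (pd k f)) := fun k =>
    hasCompactSupport_pd (hasCompactSupport_pd hf k) k
  have e : lap f = pd 0 (pd 0 f) + pd 1 (pd 1 f) + pd 2 (pd 2 f) := by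
    funext x; simp [lap, Fin.sum_univ_three]
  rw [e]
  exact ((h2 0).add (h2 1)).add (h2 2)

/-- Dilates of one bump function; two derivatives bring the factor R⁻². -/
theorem exists_cutoff : ∃ C : ℝ, 0 ≤ C ∧ ∀ R : ℝ, 0 < R → ∃ χ : E3 → ℝ, ContDiff ℝ ∞ χ ∧
    HasCompactSupport χ ∧ (∀ x, 0 ≤ χ x) ∧ (∀ x, χ x ≤ 1) ∧ (∀ x, ‖x‖ ≤ R → χ x = 1) ∧
    ∀ x, |lap χ x| ≤ C / R ^ 2 := by
  let ψ : ContDiffBump (0 : E3) := ⟨1, 2, by norm_num, by norm_num⟩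
  have hψ : ContDiff ℝ ∞ (ψ : E3 → ℝ) := ψ.contDiff
  have hL : Continuous (lap ψ) := continuous_finsetSum _ fun k _ => ((hψ.pd_infty k).pd_infty k).continuous
  have hLc : HasCompactSupport (lap ψ) := hasCompactSupport_lap ψ.hasCompactSupport
  obtain ⟨C, hC⟩ := hLc.exists_bound_of_continuous hL
  refine ⟨C, (norm_nonneg _).trans (hC 0), fun R hR => ⟨fun x => ψ (R⁻¹ • x), hψ.comp (contDiff_const_smul _),
    ?_, fun x => ψ.nonneg, fun x => ψ.le_one, fun x hx => ψ.one_of_mem_closedBall ?_, fun x => ?_⟩⟩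
  · exact ψ.hasCompactSupport.comp_homeomorph (Homeomorph.smulOfNeZero R⁻¹ (by positivity))
  · rw [mem_closedBall_zero_iff, norm_smul, norm_inv, Real.norm_of_nonneg hR.le, inv_mul_le_iff₀ hR]
    show ‖x‖ ≤ R * 1
    linarith
  · have e1 : ∀ k, pd k (fun x => ψ (R⁻¹ • x)) = fun x => R⁻¹ * pd k ψ (R⁻¹ • x) := fun k => by
      funext y; exact pd_comp_smul (hψ.differentiable (by simp)) _ _ _
    have e2 : lap (fun x => ψ (R⁻¹ • x)) x = (R ^ 2)⁻¹ * lap ψ (R⁻¹ • x) := by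
      simp only [lap, e1, Finset.mul_sum]
      refine Finset.sum_congr rfl fun k _ => ?_
      rw [pd_const_mul (f := fun y => pd k ψ (R⁻¹ • y)) _
        (((hψ.pd_infty k).comp (contDiff_const_smul _)).differentiable (by simp) x),
        pd_comp_smul ((hψ.pd_infty k).differentiable (by simp))]
      ring
    rw [e2, abs_mul, abs_of_pos (by positivity), div_eq_inv_mul]
    exact mul_le_mul_of_nonneg_left (hC _) (by positivity)

theorem heatExt_rpow {t : ℝ} (ht : 0 < t) {h : E3 → ℝ} (h1 : Continuous h)
    (h2 : HasCompactSupport h) (h0 : ∀ x, 0 ≤ h x) (hpos : ∀ z ∈ posTime, 0 < heatExt h z) {p : ℝ} (hp : 1 ≤ p) :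
    Integrable (fun x => heatExt h (t, x) ^ p) ∧ ∫ x, heatExt h (t, x) ^ p ≤ ∫ x, h x ^ p := by
  have hle := lintegral_heatExt_rpow_le ht h1 h2 h0 hp
  have hpc : Continuous fun x => h x ^ p := h1.rpow_const fun x => Or.inr (by linarith)
  have hpcs : HasCompactSupport fun x => h x ^ p :=
    h2.comp_left (g := fun s : ℝ => s ^ p) (Real.zero_rpow (by linarith))
  have hi := hpc.integrable_of_hasCompactSupport hpcs (μ := volume)
  rw [← ofReal_integral_eq_lintegral_ofReal hi (.of_forall fun x => Real.rpow_nonneg (h0 x) _)] at hle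
  have hc : Continuous fun x => heatExt h (t, x) ^ p :=
    (hasDerivAt_slice (contDiffOn_heatExt h1 h2) ht).1.continuous.rpow_const fun x => Or.inr (by linarith)
  have hnn : 0 ≤ᵐ[volume] fun x => heatExt h (t, x) ^ p :=
    .of_forall fun x => Real.rpow_nonneg (hpos (t, x) ht).le _
  have hI : Integrable (fun x => heatExt h (t, x) ^ p) :=
    (lintegral_ofReal_ne_top_iff_integrable hc.aestronglyMeasurable hnn).1 (hle.trans_lt ENNReal.ofReal_lt_top).ne
  refine ⟨hI, ?_⟩
  rw [← ofReal_integral_eq_lintegral_ofReal hI hnn] at hle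
  exact (ENNReal.ofReal_le_ofReal_iff (integral_nonneg fun x => Real.rpow_nonneg (h0 x) _)).1 hle

/-! ### The bilinear embedding -/

theorem integrableOn_slab {w : ℝ × E3 → ℝ} (hw : ContinuousOn w posTime) {χ : E3 → ℝ}
    (h1 : Continuous χ) (h2 : HasCompactSupport χ) {a b : ℝ} (ha : 0 < a) :
    IntegrableOn (fun z => χ z.2 * w z) (Icc a b ×ˢ univ) := by
  have hsub : Icc a b ×ˢ tsupport χ ⊆ posTime := fun z hz => lt_of_lt_of_le ha hz.1.1
  have h : IntegrableOn (fun z => χ z.2 * w z) (Icc a b ×ˢ tsupport χ) :=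
    ((h1.comp continuous_snd).continuousOn.mul (hw.mono hsub)).integrableOn_compact (isCompact_Icc.prod h2)
  refine h.of_forall_sdiff_eq_zero (measurableSet_Icc.prod MeasurableSet.univ) fun z hz => ?_
  have : χ z.2 = 0 := by
    by_contra h0
    exact hz.2 ⟨hz.1.1, subset_tsupport χ h0⟩
  simp [this]

theorem measurable_dirD (v : ℝ × E3) (F : ℝ × E3 → ℝ) : Measurable (dirD v F) :=
  measurable_fderiv_apply_const ℝ F v

section Energy

variable {f g : E3 → ℝ} {p q K : ℝ}

/-- The quantity ∫χB decreases along the flow at a rate at least twice the integral to be bounded,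
up to the error ∫(Δχ)B ≤ c∫B. The integral of B is controlled at every time because the heat
semigroup contracts L^p and L^q. -/
theorem bellman_energy_cutoff (hf : Continuous f) (hfc : HasCompactSupport f) (hf0 : ∀ x, 0 ≤ f x)
    (hg : Continuous g) (hgc : HasCompactSupport g) (hg0 : ∀ x, 0 ≤ g x)
    (hfp : ∀ z ∈ posTime, 0 < heatExt f z) (hgp : ∀ z ∈ posTime, 0 < heatExt g z)
    (hp : 2 ≤ p) (hq1 : 1 < q) (hq : p⁻¹ + q⁻¹ = 1) (hK : K * q * (q - 1) = 5 * q ^ 2 + 1) (hK0 : 0 ≤ K)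
    (i j : Fin 3) {a b : ℝ} (ha : 0 < a) (hab : a ≤ b) {χ : E3 → ℝ} (hχ : ContDiff ℝ ∞ χ)
    (hχc : HasCompactSupport χ) (hχ0 : ∀ x, 0 ≤ χ x) (hχ1 : ∀ x, χ x ≤ 1) {c : ℝ} (hc0 : 0 ≤ c)
    (hc : ∀ x, |lap χ x| ≤ c) :
    ∫ z in Ioc a b ×ˢ univ, χ z.2 * |dirD (eSpace i) (heatExt f) z * dirD (eSpace j) (heatExt g) z|
      ≤ (1 + K) / 2 * ((∫ x, f x ^ p) + ∫ x, g x ^ q) * (1 + c * (b - a)) := by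
  set F := heatExt f with hFdef
  set G := heatExt g with hGdef
  have hF : ContDiffOn ℝ ∞ F posTime := contDiffOn_heatExt hf hfc
  have hG : ContDiffOn ℝ ∞ G posTime := contDiffOn_heatExt hg hgc
  set B : ℝ × E3 → ℝ := fun z => bellman p q (1 - 2 / p) K (F z) (G z) with hBdef
  have hB : ContDiffOn ℝ ∞ B posTime := contDiffOn_bellman hF hG hfp hgp
  set E := (∫ x, f x ^ p) + ∫ x, g x ^ q with hE
  have hp1 : 1 ≤ p := by linarith
  have hB0 : ∀ t, 0 < t → ∀ x, 0 ≤ B (t, x) := fun t ht x => bellman_nonneg hK0 (hfp (t, x) ht) (hgp (t, x) ht)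
  have hBi : ∀ t, 0 < t → Integrable (fun x => B (t, x)) ∧ ∫ x, B (t, x) ≤ (1 + K) * E := by
    intro t ht
    obtain ⟨i1, i2⟩ := heatExt_rpow ht hf hfc hf0 hfp hp1
    obtain ⟨j1, j2⟩ := heatExt_rpow ht hg hgc hg0 hgp hq1.le
    have hle : ∀ x, B (t, x) ≤ (1 + K) * (F (t, x) ^ p + G (t, x) ^ q) := fun x =>
      bellman_le hp hK0 (hfp (t, x) ht) (hgp (t, x) ht)
    have hi : Integrable (fun x => (1 + K) * (F (t, x) ^ p + G (t, x) ^ q)) := (i1.add j1).const_mul (1 + K)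
    have hBI : Integrable (fun x => B (t, x)) := by
      refine hi.mono' (hasDerivAt_slice hB ht).1.continuous.aestronglyMeasurable (.of_forall fun x => ?_)
      rw [Real.norm_of_nonneg (hB0 t ht x)]; exact hle x
    refine ⟨hBI, (integral_mono hBI hi hle).trans ?_⟩
    rw [integral_const_mul, integral_add i1 j1]
    exact mul_le_mul_of_nonneg_left (add_le_add i2 j2) (by linarith)
  set w : ℝ × E3 → ℝ := fun z => |dirD (eSpace i) F z * dirD (eSpace j) G z| with hw
  have hwc : ContinuousOn w posTime :=
    ((hF.dirD _).continuousOn.mul (hG.dirD _).continuousOn).abs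
  have hslab := integrableOn_slab hwc hχ.continuous hχc ha (b := b)
  have hint : Integrable (fun t => ∫ x, χ x * w (t, x)) (volume.restrict (Icc a b)) := by
    have h := hslab
    rw [IntegrableOn, Measure.volume_eq_prod, ← Measure.prod_restrict, Measure.restrict_univ] at h
    exact h.integral_prod_left
  have hM : ∀ t, 0 < t → HasDerivAt (fun t => ∫ x, χ x * B (t, x)) (∫ x, χ x * dirD eTime B (t, x)) t :=
    fun t ht => hasDerivAt_integral_slice hB hχ.continuous hχc ht
  -- The differential inequality is tested against χ, and the Laplacian is moved onto the cutoff.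
  have hmain : ∀ t, 0 < t → 2 * (∫ x, χ x * w (t, x)) - c * ((1 + K) * E) ≤ -∫ x, χ x * dirD eTime B (t, x) := by
    intro t ht
    obtain ⟨s1, s2⟩ := hasDerivAt_slice hB ht
    have s3 : ∀ x, lap (fun x => B (t, x)) x = ∑ k, dirD (eSpace k) (dirD (eSpace k) B) (t, x) := by
      intro x
      refine Finset.sum_congr rfl fun k _ => ?_
      have : pd k (fun x => B (t, x)) = fun x => dirD (eSpace k) B (t, x) := funext fun x => s2 k x
      rw [this, (hasDerivAt_slice (hB.dirD (eSpace k)) ht).2]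
    have hLc : Continuous (lap fun x => B (t, x)) :=
      continuous_finsetSum _ fun k _ => ((s1.pd_infty k).pd_infty k).continuous
    have hTc : Continuous fun x => dirD eTime B (t, x) := (hasDerivAt_slice (hB.dirD eTime) ht).1.continuous
    have hwx : Continuous fun x => w (t, x) := hwc.comp_continuous (by fun_prop) fun x => ht
    have k1 : ∫ x, χ x * (2 * w (t, x)) ≤ ∫ x, χ x * (lap (fun x => B (t, x)) x - dirD eTime B (t, x)) := by
      refine integral_mono ((hχ.continuous.mul (hwx.const_mul 2)).integrable_of_hasCompactSupport hχc.mul_right)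
        ((hχ.continuous.mul (hLc.sub hTc)).integrable_of_hasCompactSupport hχc.mul_right) fun x => ?_
      refine mul_le_mul_of_nonneg_left ?_ (hχ0 x)
      rw [s3]
      exact bellman_flow_le hF hG hfp hgp (fun z hz => heat_equation hf hfc hz)
        (fun z hz => heat_equation hg hgc hz) hp hq hK i j (z := (t, x)) ht
    have k2 : ∫ x, χ x * (lap (fun x => B (t, x)) x - dirD eTime B (t, x))
        = (∫ x, χ x * lap (fun x => B (t, x)) x) - ∫ x, χ x * dirD eTime B (t, x) := by
      simp only [mul_sub]
      exact integral_sub ((hχ.continuous.mul hLc).integrable_of_hasCompactSupport hχc.mul_right)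
        ((hχ.continuous.mul hTc).integrable_of_hasCompactSupport hχc.mul_right)
    have k3 : ∫ x, χ x * lap (fun x => B (t, x)) x ≤ c * ((1 + K) * E) := by
      rw [integral_mul_lap hχ s1 hχc]
      calc ∫ x, lap χ x * B (t, x) ≤ ∫ x, c * B (t, x) := by
            refine integral_mono ?_ ((hBi t ht).1.const_mul c) fun x =>
              mul_le_mul_of_nonneg_right ((le_abs_self _).trans (hc x)) (hB0 t ht x)
            refine (Continuous.mul ?_ s1.continuous).integrable_of_hasCompactSupport ?_
            · exact continuous_finsetSum _ fun k _ => ((hχ.pd_infty k).pd_infty k).continuous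
            · exact (hasCompactSupport_lap hχc).mul_right
        _ ≤ c * ((1 + K) * E) := by
            rw [integral_const_mul]
            exact mul_le_mul_of_nonneg_left (hBi t ht).2 hc0
    have k4 : ∫ x, χ x * (2 * w (t, x)) = 2 * ∫ x, χ x * w (t, x) := by
      rw [← integral_const_mul]; congr 1; funext x; ring
    linarith
  have hpos : ∀ {t}, t ∈ Icc a b → 0 < t := fun ht => ha.trans_le ht.1
  -- Integration in time leaves the difference of ∫χB at the end points; the value at b is
  -- nonnegative and is dropped, the value at a is at most (1+K)E.
  have hfin := intervalIntegral.integral_le_sub_of_hasDeriv_right_of_le hab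
    (g := fun t => -∫ x, χ x * B (t, x)) (g' := fun t => -∫ x, χ x * dirD eTime B (t, x))
    (φ := fun t => 2 * (∫ x, χ x * w (t, x)) - c * ((1 + K) * E))
    (fun t ht => (hM t (hpos ht)).neg.continuousAt.continuousWithinAt)
    (fun t ht => (hM t (hpos (Ioo_subset_Icc_self ht))).neg.hasDerivWithinAt)
    ((hint.const_mul 2).sub (integrable_const _))
    (fun t ht => hmain t (hpos (Ioo_subset_Icc_self ht)))
  have e1 : ∫ z in Ioc a b ×ˢ univ, χ z.2 * w z = ∫ t in a..b, ∫ x, χ x * w (t, x) := by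
    have h := hslab.mono_set (prod_mono Ioc_subset_Icc_self subset_rfl)
    rw [Measure.volume_eq_prod] at h ⊢
    rw [setIntegral_prod _ h, intervalIntegral.integral_of_le hab]
    simp
  have hII : IntervalIntegrable (fun t => ∫ x, χ x * w (t, x)) volume a b :=
    (intervalIntegrable_iff_integrableOn_Icc_of_le hab).2 hint
  rw [intervalIntegral.integral_sub (hII.const_mul 2) (by simp), intervalIntegral.integral_const_mul,
    intervalIntegral.integral_const, smul_eq_mul, ← e1] at hfin
  have hMa : ∫ x, χ x * B (a, x) ≤ (1 + K) * E := by
    refine le_trans (integral_mono ?_ (hBi a ha).1 fun x => ?_) (hBi a ha).2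
    · exact (hχ.continuous.mul (hasDerivAt_slice hB ha).1.continuous).integrable_of_hasCompactSupport hχc.mul_right
    · exact mul_le_of_le_one_left (hB0 a ha x) (hχ1 x)
  have hMb : 0 ≤ ∫ x, χ x * B (b, x) :=
    integral_nonneg fun x => mul_nonneg (hχ0 x) (hB0 b (ha.trans_le hab) x)
  nlinarith

/-- As the cutoff radius n + 1 grows on a fixed time interval, the error C(b−a)/(n+1)² vanishes, and
Fatou's lemma removes the cutoff. -/
theorem bellman_energy (hf : Continuous f) (hfc : HasCompactSupport f) (hf0 : ∀ x, 0 ≤ f x)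
    (hg : Continuous g) (hgc : HasCompactSupport g) (hg0 : ∀ x, 0 ≤ g x)
    (hp : 2 ≤ p) (hq1 : 1 < q) (hq : p⁻¹ + q⁻¹ = 1) (hK : K * q * (q - 1) = 5 * q ^ 2 + 1) (hK0 : 0 ≤ K)
    (i j : Fin 3) {a b : ℝ} (ha : 0 < a) (hab : a ≤ b) :
    ∫⁻ z in Ioc a b ×ˢ univ, ‖dirD (eSpace i) (heatExt f) z * dirD (eSpace j) (heatExt g) z‖ₑ
      ≤ ENNReal.ofReal ((1 + K) / 2 * ((∫ x, f x ^ p) + ∫ x, g x ^ q)) := by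
  have hzero : ∀ k : E3 → ℝ, (∀ x, k x = 0) → ∀ l z, dirD (eSpace l) (heatExt k) z = 0 := by
    intro k hk l z
    have : heatExt k = fun _ => 0 := by funext z; simp [heatExt, heatConv, hk]
    rw [dirD, this]; simp
  -- The Bellman function is differentiated only at positive arguments. A nonnegative datum that is
  -- not identically zero has a strictly positive flow, so the zero function is treated apart.
  by_cases hf1 : ∀ x, f x = 0
  · simp [hzero f hf1]
  by_cases hg1 : ∀ x, g x = 0
  · simp [hzero g hg1]
  push Not at hf1 hg1
  obtain ⟨x₁, hx₁⟩ := hf1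
  obtain ⟨x₂, hx₂⟩ := hg1
  obtain ⟨C, hC0, hC⟩ := exists_cutoff
  choose! χ c1 c2 c3 c4 c5 c6 using hC
  set w : ℝ × E3 → ℝ := fun z => dirD (eSpace i) (heatExt f) z * dirD (eSpace j) (heatExt g) z with hw
  have hwm : Measurable w := (measurable_dirD _ _).mul (measurable_dirD _ _)
  set E := (1 + K) / 2 * ((∫ x, f x ^ p) + ∫ x, g x ^ q) with hE
  have hR : ∀ n : ℕ, (0 : ℝ) < n + 1 := fun n => by positivity
  have hn : ∀ n : ℕ, ∫⁻ z in Ioc a b ×ˢ univ, ENNReal.ofReal (χ (n + 1) z.2 * |w z|)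
      ≤ ENNReal.ofReal (E * (1 + C / ((n : ℝ) + 1) ^ 2 * (b - a))) := by
    intro n
    rw [← ofReal_integral_eq_lintegral_ofReal]
    · exact ENNReal.ofReal_le_ofReal (bellman_energy_cutoff hf hfc hf0 hg hgc hg0
        (fun z hz => heatExt_pos hf hfc hf0 hx₁ hz) (fun z hz => heatExt_pos hg hgc hg0 hx₂ hz)
        hp hq1 hq hK hK0 i j ha hab (c1 _ (hR n)) (c2 _ (hR n)) (c3 _ (hR n)) (c4 _ (hR n))
        (by positivity) (c6 _ (hR n)))
    · have hwc : ContinuousOn (fun z => |w z|) posTime :=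
        (((contDiffOn_heatExt hf hfc).dirD _).continuousOn.mul ((contDiffOn_heatExt hg hgc).dirD _).continuousOn).abs
      exact (integrableOn_slab hwc (c1 _ (hR n)).continuous (c2 _ (hR n)) ha (b := b)).mono_set
        (prod_mono Ioc_subset_Icc_self subset_rfl)
    · exact .of_forall fun z => mul_nonneg (c3 _ (hR n) _) (abs_nonneg _)
  have hlim : Filter.Tendsto (fun n : ℕ => ENNReal.ofReal (E * (1 + C / ((n : ℝ) + 1) ^ 2 * (b - a)))) Filter.atTop
      (nhds (ENNReal.ofReal E)) := by
    refine (ENNReal.continuous_ofReal.tendsto _).comp ?_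
    have h1 : Filter.Tendsto (fun n : ℕ => ((n : ℝ) + 1) ^ 2) Filter.atTop Filter.atTop :=
      (Filter.tendsto_pow_atTop two_ne_zero).comp
        (Filter.tendsto_atTop_add_const_right _ 1 tendsto_natCast_atTop_atTop)
    have h2 := (((h1.const_div_atTop C).mul_const (b - a)).const_add 1).const_mul E
    simpa using h2
  calc _ = ∫⁻ z in Ioc a b ×ˢ univ, Filter.liminf (fun n : ℕ => ENNReal.ofReal (χ (n + 1) z.2 * |w z|)) Filter.atTop := by
        refine lintegral_congr fun z => (Filter.Tendsto.liminf_eq ?_).symm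
        refine tendsto_const_nhds.congr' ?_
        obtain ⟨N, hN⟩ := exists_nat_gt ‖z.2‖
        filter_upwards [Filter.eventually_ge_atTop N] with n hn
        have : (N : ℝ) ≤ n := by exact_mod_cast hn
        rw [c5 _ (hR n) _ (by linarith), one_mul, ← Real.norm_eq_abs, ofReal_norm]
    _ ≤ Filter.liminf (fun n : ℕ => ∫⁻ z in Ioc a b ×ˢ univ, ENNReal.ofReal (χ (n + 1) z.2 * |w z|)) Filter.atTop :=
        lintegral_liminf_le fun n => ((((c1 _ (hR n)).continuous.measurable).comp measurable_snd).mul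
          hwm.abs).ennreal_ofReal
    _ ≤ Filter.liminf (fun n : ℕ => ENNReal.ofReal (E * (1 + C / ((n : ℝ) + 1) ^ 2 * (b - a)))) Filter.atTop :=
        Filter.liminf_le_liminf (.of_forall hn)
    _ = _ := hlim.liminf_eq

end Energy

/-- The bilinear estimate for the heat flows of two functions, uniform in the time interval. -/
theorem exists_bilinear_bound {p q : ℝ} (hp1 : 1 < p) (hq1 : 1 < q) (hq : p⁻¹ + q⁻¹ = 1) :
    ∃ C : ℝ, 0 < C ∧ ∀ f g : E3 → ℝ, Continuous f → HasCompactSupport f → Continuous g →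
      HasCompactSupport g → ∀ (i j : Fin 3) (a b : ℝ), 0 < a → a ≤ b →
      ∫⁻ z in Ioc a b ×ˢ univ, ‖dirD (eSpace i) (heatExt f) z * dirD (eSpace j) (heatExt g) z‖ₑ
        ≤ ENNReal.ofReal (C * ((∫ x, |f x| ^ p) + ∫ x, |g x| ^ q)) := by
  -- One of two conjugate exponents is at least 2, and the estimate is symmetric under exchange of f
  -- and g together with i and j.
  wlog hp : 2 ≤ p generalizing p q with H
  · have hq2 : 2 ≤ q := by
      have h1 : 1 / 2 < p⁻¹ := by
        rw [one_div, inv_lt_inv₀ (by norm_num) (by linarith)]; linarith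
      have h2 : q⁻¹ ≤ 2⁻¹ := by norm_num at h1 ⊢; linarith
      exact (inv_le_inv₀ (by linarith) (by norm_num)).1 h2
    obtain ⟨C, hC, h⟩ := H hq1 hp1 (by linarith) hq2
    refine ⟨C, hC, fun f g hf hfc hg hgc i j a b ha hab => ?_⟩
    have := h g f hg hgc hf hfc j i a b ha hab
    simp only [mul_comm (dirD (eSpace i) (heatExt f) _), add_comm (∫ x, |f x| ^ p)]
    exact this
  set K := (5 * q ^ 2 + 1) / (q * (q - 1)) with hKdef
  have hq10 : 0 < q - 1 := by linarith
  have hK : K * q * (q - 1) = 5 * q ^ 2 + 1 := by rw [hKdef]; field_simp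
  have hK0 : 0 ≤ K := by rw [hKdef]; positivity
  -- Splitting f and g into positive and negative parts produces four products, each bounded by E.
  refine ⟨4 * ((1 + K) / 2), by positivity, fun f g hf hfc hg hgc i j a b ha hab => ?_⟩
  set E := (1 + K) / 2 * ((∫ x, |f x| ^ p) + ∫ x, |g x| ^ q) with hE
  have hparts : ∀ h : E3 → ℝ, Continuous h → HasCompactSupport h → ∀ k, EqOn (dirD (eSpace k) (heatExt h))
      (fun z => dirD (eSpace k) (heatExt fun x => max (h x) 0) z - dirD (eSpace k) (heatExt fun x => max (-h x) 0) z) posTime := by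
    intro h hh hhc k z hz
    have hc : ∀ l : ℝ → ℝ, Continuous l → l 0 = 0 → Continuous (fun x => l (h x)) ∧ HasCompactSupport (fun x => l (h x)) :=
      fun l hl hl0 => ⟨hl.comp hh, hhc.comp_left hl0⟩
    obtain ⟨a1, a2⟩ := hc (fun s => max s 0) (by fun_prop) (by simp)
    obtain ⟨b1, b2⟩ := hc (fun s => max (-s) 0) (by fun_prop) (by simp)
    simp only [heatExt, dirD_heatConv contDiffOn_heatKernel hh hhc _ hz,
      dirD_heatConv contDiffOn_heatKernel a1 a2 _ hz, dirD_heatConv contDiffOn_heatKernel b1 b2 _ hz, heatConv]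
    rw [← integral_sub (integrable_heatConv (contDiffOn_heatKernel.dirD _) a1 a2 hz)
      (integrable_heatConv (contDiffOn_heatKernel.dirD _) b1 b2 hz)]
    refine integral_congr_ae (.of_forall fun y => ?_)
    simp only
    rw [← sub_smul]
    congr 1
    rcases le_total (h y) 0 with h0 | h0
    · rw [max_eq_right h0, max_eq_left (by linarith)]; ring
    · rw [max_eq_left h0, max_eq_right (by linarith)]; ring
  have hpart : ∀ (h k : E3 → ℝ), Continuous h → HasCompactSupport h → Continuous k → HasCompactSupport k →
      (∀ x, 0 ≤ h x) → (∀ x, 0 ≤ k x) → (∀ x, h x ≤ |f x|) → (∀ x, k x ≤ |g x|) →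
      ∫⁻ z in Ioc a b ×ˢ univ, ‖dirD (eSpace i) (heatExt h) z * dirD (eSpace j) (heatExt k) z‖ₑ ≤ ENNReal.ofReal E := by
    intro h k hh hhc hk hkc hh0 hk0 hhf hkg
    refine (bellman_energy hh hhc hh0 hk hkc hk0 hp hq1 hq hK hK0 i j ha hab).trans (ENNReal.ofReal_le_ofReal ?_)
    have hle : ∀ {u v : E3 → ℝ} {r : ℝ}, 1 < r → Continuous u → HasCompactSupport u → Continuous v → HasCompactSupport v →
        (∀ x, 0 ≤ u x) → (∀ x, u x ≤ |v x|) → ∫ x, u x ^ r ≤ ∫ x, |v x| ^ r := by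
      intro u v r hr hu huc hv hvc hu0 huv
      have hi : ∀ {y : E3 → ℝ}, Continuous y → HasCompactSupport y → Integrable fun x => y x ^ r := fun hy hyc =>
        (hy.rpow_const fun x => Or.inr (by linarith)).integrable_of_hasCompactSupport
          (hyc.comp_left (g := fun s : ℝ => s ^ r) (Real.zero_rpow (by linarith)))
      exact integral_mono (hi hu huc) (hi hv.abs hvc.norm) fun x =>
        Real.rpow_le_rpow (hu0 x) (huv x) (by linarith)
    rw [hE]
    have := hle hp1 hh hhc hf hfc hh0 hhf
    have := hle hq1 hk hkc hg hgc hk0 hkg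
    gcongr
  have hfp1 : Continuous fun x => max (f x) 0 := by fun_prop
  have hfm1 : Continuous fun x => max (-f x) 0 := by fun_prop
  have hgp1 : Continuous fun x => max (g x) 0 := by fun_prop
  have hgm1 : Continuous fun x => max (-g x) 0 := by fun_prop
  have hfp2 : HasCompactSupport fun x => max (f x) 0 := hfc.comp_left (g := fun s : ℝ => max s 0) (by simp)
  have hfm2 : HasCompactSupport fun x => max (-f x) 0 := hfc.comp_left (g := fun s : ℝ => max (-s) 0) (by simp)
  have hgp2 : HasCompactSupport fun x => max (g x) 0 := hgc.comp_left (g := fun s : ℝ => max s 0) (by simp)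
  have hgm2 : HasCompactSupport fun x => max (-g x) 0 := hgc.comp_left (g := fun s : ℝ => max (-s) 0) (by simp)
  have q0 : ∀ s : ℝ, 0 ≤ max s 0 := fun s => le_max_right _ _
  have q1 : ∀ s : ℝ, max s 0 ≤ |s| := fun s => max_le (le_abs_self s) (abs_nonneg s)
  have q2 : ∀ s : ℝ, max (-s) 0 ≤ |s| := fun s => max_le (neg_le_abs s) (abs_nonneg s)
  have P1 := hpart _ _ hfp1 hfp2 hgp1 hgp2 (fun x => q0 _) (fun x => q0 _) (fun x => q1 _) (fun x => q1 _)
  have P2 := hpart _ _ hfp1 hfp2 hgm1 hgm2 (fun x => q0 _) (fun x => q0 _) (fun x => q1 _) (fun x => q2 _)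
  have P3 := hpart _ _ hfm1 hfm2 hgp1 hgp2 (fun x => q0 _) (fun x => q0 _) (fun x => q2 _) (fun x => q1 _)
  have P4 := hpart _ _ hfm1 hfm2 hgm1 hgm2 (fun x => q0 _) (fun x => q0 _) (fun x => q2 _) (fun x => q2 _)
  set A := dirD (eSpace i) (heatExt fun x => max (f x) 0) with hA
  set A' := dirD (eSpace i) (heatExt fun x => max (-f x) 0) with hA'
  set D := dirD (eSpace j) (heatExt fun x => max (g x) 0) with hD
  set D' := dirD (eSpace j) (heatExt fun x => max (-g x) 0) with hD'
  have mA : Measurable A := measurable_dirD _ _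
  have mA' : Measurable A' := measurable_dirD _ _
  have mD : Measurable D := measurable_dirD _ _
  have mD' : Measurable D' := measurable_dirD _ _
  have m1 : Measurable fun z => ‖A z * D z‖ₑ := (mA.mul mD).enorm
  have m2 : Measurable fun z => ‖A z * D' z‖ₑ := (mA.mul mD').enorm
  have m3 : Measurable fun z => ‖A' z * D z‖ₑ := (mA'.mul mD).enorm
  calc _ ≤ ∫⁻ z in Ioc a b ×ˢ univ, (‖A z * D z‖ₑ + (‖A z * D' z‖ₑ + (‖A' z * D z‖ₑ + ‖A' z * D' z‖ₑ))) := by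
        refine setLIntegral_mono' (measurableSet_Ioc.prod MeasurableSet.univ) fun z hz => ?_
        have hz' : z ∈ posTime := lt_trans ha hz.1.1
        rw [hparts f hf hfc i hz', hparts g hg hgc j hz',
          show (A z - A' z) * (D z - D' z) = A z * D z + (-(A z * D' z) + (-(A' z * D z) + A' z * D' z)) by ring]
        refine (enorm_add_le _ _).trans (add_le_add le_rfl ((enorm_add_le _ _).trans (add_le_add ?_
          ((enorm_add_le _ _).trans (add_le_add ?_ le_rfl)))))
        · rw [enorm_neg]
        · rw [enorm_neg]
    _ ≤ ENNReal.ofReal E + (ENNReal.ofReal E + (ENNReal.ofReal E + ENNReal.ofReal E)) := by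
        rw [lintegral_add_left m1, lintegral_add_left m2, lintegral_add_left m3]
        exact add_le_add P1 (add_le_add P2 (add_le_add P3 P4))
    _ = _ := by
        have hE0 : 0 ≤ E := by rw [hE]; positivity
        rw [← ENNReal.ofReal_add hE0 hE0, ← ENNReal.ofReal_add hE0 (by positivity), ← ENNReal.ofReal_add hE0 (by positivity)]
        congr 1; rw [hE]; ring

/-! ### Convolution with test functions -/

/-- The convolution of two functions on space. -/
noncomputable def conv (G φ : E3 → ℝ) (y : E3) : ℝ := ∫ x, G x • φ (y - ContinuousLinearMap.id ℝ E3 x)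

theorem conv_apply (G φ : E3 → ℝ) (y : E3) : conv G φ y = ∫ x, G x * φ (y - x) := rfl

section Conv

variable {G φ : E3 → ℝ}

theorem smoothTranslates_conv (hG : Continuous G) (hGc : HasCompactSupport G) (hφ : ContDiff ℝ ∞ φ) :
    SmoothTranslates volume G φ (ContinuousLinearMap.id ℝ E3) univ univ :=
  smoothTranslates_of_hasCompactSupport _ isOpen_univ isOpen_univ hφ.contDiffOn hG hGc fun _ _ _ => mem_univ _

theorem contDiff_conv (hG : Continuous G) (hGc : HasCompactSupport G) (hφ : ContDiff ℝ ∞ φ) :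
    ContDiff ℝ ∞ (conv G φ) :=
  contDiffOn_univ.1 (smoothTranslates_conv hG hGc hφ).contDiffOn_integral

theorem pd_conv (hG : Continuous G) (hGc : HasCompactSupport G) (hφ : ContDiff ℝ ∞ φ) (k : Fin 3) :
    pd k (conv G φ) = conv G (pd k φ) :=
  funext fun y => (smoothTranslates_conv hG hGc hφ).fderiv_integral (mem_univ y) _

theorem conv_pd (hG : ContDiff ℝ ∞ G) (hGc : HasCompactSupport G) (hφ : ContDiff ℝ ∞ φ) (k : Fin 3) :
    conv G (pd k φ) = conv (pd k G) φ := by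
  funext y
  have hle : (1 : WithTop ℕ∞) ≤ ∞ := by simp
  have h := integral_mul_pd (hG.of_le hle) (b := fun x => φ (y - x))
    ((hφ.of_le hle).comp (contDiff_const.sub contDiff_id)) hGc k
  simp only [pd_comp_sub (hφ.differentiable (by simp)), mul_neg, integral_neg, neg_inj] at h
  exact h

theorem pd_conv' (hG : ContDiff ℝ ∞ G) (hGc : HasCompactSupport G) (hφ : ContDiff ℝ ∞ φ) (k : Fin 3) :
    pd k (conv G φ) = conv (pd k G) φ := by
  rw [pd_conv hG.continuous hGc hφ, conv_pd hG hGc hφ]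

theorem conv_eq (y : E3) : conv G φ y = ∫ x, φ (-x) * G (y + x) := by
  rw [conv_apply, ← integral_add_left_eq_self _ y]
  refine integral_congr_ae (.of_forall fun x => ?_)
  simp [mul_comm]

/-- On the support of G, of radius ρ, the weights at y − x and at y are comparable: 1+|y−x|² ≤
2(1+ρ²)(1+|y|²). A convolution therefore turns integrability against (1+|x|²)⁻² into pointwise
growth of order (1+|y|²)². -/
theorem integral_abs_mul_le (hG : Continuous G) (hGc : HasCompactSupport G) (hφ : Continuous φ)
    (hφw : Integrable fun x => φ x / (1 + ‖x‖ ^ 2) ^ 2) :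
    ∃ C : ℝ, 0 ≤ C ∧ ∀ y, ∫ x, |G x * φ (y - x)| ≤ C * (1 + ‖y‖ ^ 2) ^ 2 := by
  obtain ⟨M, hM⟩ := hGc.exists_bound_of_continuous hG
  have hM0 : 0 ≤ M := (norm_nonneg _).trans (hM 0)
  obtain ⟨ρ, hρ⟩ := hGc.isBounded.exists_norm_le
  set I := ∫ x, |φ x / (1 + ‖x‖ ^ 2) ^ 2| with hI
  have hI0 : 0 ≤ I := integral_nonneg fun x => abs_nonneg _
  refine ⟨M * (2 * (1 + ρ ^ 2)) ^ 2 * I, by positivity, fun y => ?_⟩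
  have hle : ∀ x, |G x * φ (y - x)| ≤ M * (2 * (1 + ρ ^ 2)) ^ 2 * (1 + ‖y‖ ^ 2) ^ 2 *
      |φ (y - x) / (1 + ‖y - x‖ ^ 2) ^ 2| := by
    intro x
    by_cases hx : G x = 0
    · rw [hx]; simp; positivity
    have hxρ := hρ x (subset_tsupport G hx)
    have h1 : 1 + ‖y - x‖ ^ 2 ≤ 2 * (1 + ρ ^ 2) * (1 + ‖y‖ ^ 2) := by
      have h2 := norm_sub_le y x
      have h3 : ‖y - x‖ ^ 2 ≤ (‖y‖ + ρ) ^ 2 := by gcongr; linarith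
      nlinarith [sq_nonneg (‖y‖ - ρ), mul_nonneg (sq_nonneg ρ) (sq_nonneg ‖y‖)]
    rw [abs_mul, abs_div, abs_of_pos (by positivity : 0 < (1 + ‖y - x‖ ^ 2) ^ 2)]
    calc |G x| * |φ (y - x)| ≤ M * |φ (y - x)| := by
          gcongr; exact hM x
      _ = M * ((1 + ‖y - x‖ ^ 2) ^ 2 * (|φ (y - x)| / (1 + ‖y - x‖ ^ 2) ^ 2)) := by field_simp
      _ ≤ M * ((2 * (1 + ρ ^ 2) * (1 + ‖y‖ ^ 2)) ^ 2 * (|φ (y - x)| / (1 + ‖y - x‖ ^ 2) ^ 2)) := by gcongr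
      _ = _ := by ring
  refine (integral_mono ?_ ((hφw.abs.comp_sub_left y).const_mul _) hle).trans ?_
  · exact ((hG.mul (hφ.comp (by fun_prop))).integrable_of_hasCompactSupport hGc.mul_right).abs
  · rw [integral_const_mul, integral_sub_left_eq_self (fun x => |φ x / (1 + ‖x‖ ^ 2) ^ 2|)]
    apply le_of_eq; ring

theorem exists_abs_conv_le (hG : Continuous G) (hGc : HasCompactSupport G) (hφ : Continuous φ)
    (hφw : Integrable fun x => φ x / (1 + ‖x‖ ^ 2) ^ 2) :
    ∃ C : ℝ, 0 ≤ C ∧ ∀ y, |conv G φ y| ≤ C * (1 + ‖y‖ ^ 2) ^ 2 := by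
  obtain ⟨C, hC, h⟩ := integral_abs_mul_le hG hGc hφ hφw
  exact ⟨C, hC, fun y => (abs_integral_le_integral_abs).trans (h y)⟩

end Conv

/-! ### Gaussian averages -/

theorem exists_gauss_mul_pow_le {t : ℝ} (ht : 0 < t) :
    ∃ M : ℝ, 0 ≤ M ∧ ∀ z : E3, gauss t z * (1 + ‖z‖ ^ 2) ^ 3 ≤ M * gauss (2 * t) z := by
  -- This makes 1+|z|² ≤ m·exp(|z|²/(24t)). The cube costs exp(|z|²/(8t)), half of the Gaussian
  -- exponent, and the other half is the exponent at time 2t.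
  set m := max 1 (24 * t) with hm
  have hm1 : 1 ≤ m := le_max_left _ _
  have hm2 : 24 * t ≤ m := le_max_right _ _
  refine ⟨m ^ 3 * (2 : ℝ) ^ 3, by positivity, fun z => ?_⟩
  have hpi := Real.pi_pos
  have h1 : 1 + ‖z‖ ^ 2 ≤ m * Real.exp (‖z‖ ^ 2 / (24 * t)) := by
    have h2 := Real.add_one_le_exp (‖z‖ ^ 2 / (24 * t))
    have h3 : ‖z‖ ^ 2 ≤ m * (‖z‖ ^ 2 / (24 * t)) := by
      rw [mul_div_assoc', le_div_iff₀ (by positivity)]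
      nlinarith [sq_nonneg ‖z‖]
    nlinarith
  have h2 : (1 + ‖z‖ ^ 2) ^ 3 ≤ m ^ 3 * Real.exp (‖z‖ ^ 2 / (8 * t)) := by
    calc (1 + ‖z‖ ^ 2) ^ 3 ≤ (m * Real.exp (‖z‖ ^ 2 / (24 * t))) ^ 3 := by gcongr
      _ = _ := by
        rw [mul_pow, ← Real.exp_nat_mul]; congr 2; push_cast; field_simp; ring
  have h3 : (Real.sqrt (4 * Real.pi * t) ^ 3)⁻¹ ≤ 2 ^ 3 * (Real.sqrt (4 * Real.pi * (2 * t)) ^ 3)⁻¹ := by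
    have h4 : Real.sqrt (4 * Real.pi * (2 * t)) ≤ 2 * Real.sqrt (4 * Real.pi * t) := by
      rw [Real.sqrt_le_left (by positivity), mul_pow, Real.sq_sqrt (by positivity)]
      nlinarith [mul_pos hpi ht]
    have h4' := pow_le_pow_left₀ (Real.sqrt_nonneg _) h4 3
    rw [← div_eq_mul_inv, inv_eq_one_div, div_le_div_iff₀ (by positivity) (by positivity)]
    linarith
  have h5 : Real.exp (-(‖z‖ ^ 2 / (4 * t))) * Real.exp (‖z‖ ^ 2 / (8 * t)) = Real.exp (-(‖z‖ ^ 2 / (4 * (2 * t)))) := by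
    rw [← Real.exp_add]; congr 1; field_simp; ring
  simp only [gauss, heatKernel]
  calc (Real.sqrt (4 * Real.pi * t) ^ 3)⁻¹ * Real.exp (-(‖z‖ ^ 2 / (4 * t))) * (1 + ‖z‖ ^ 2) ^ 3
      ≤ (2 ^ 3 * (Real.sqrt (4 * Real.pi * (2 * t)) ^ 3)⁻¹) * Real.exp (-(‖z‖ ^ 2 / (4 * t))) *
        (m ^ 3 * Real.exp (‖z‖ ^ 2 / (8 * t))) := by gcongr
    _ = m ^ 3 * 2 ^ 3 * ((Real.sqrt (4 * Real.pi * (2 * t)) ^ 3)⁻¹ * (Real.exp (-(‖z‖ ^ 2 / (4 * t))) *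
        Real.exp (‖z‖ ^ 2 / (8 * t)))) := by ring
    _ = _ := by rw [h5]

theorem integrable_gauss_mul_pow {t : ℝ} (ht : 0 < t) :
    Integrable fun z : E3 => gauss t z * (1 + ‖z‖ ^ 2) ^ 3 := by
  obtain ⟨M, hM, h⟩ := exists_gauss_mul_pow_le ht
  refine ((integrable_gauss (t := 2 * t) (by positivity)).const_mul M).mono' ?_ (.of_forall fun z => ?_)
  · exact ((continuous_gauss t).mul (by fun_prop)).aestronglyMeasurable
  · rw [Real.norm_of_nonneg (mul_nonneg (gauss_pos ht z).le (by positivity))]; exact h z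

theorem integrable_gauss_mul_of_le {t : ℝ} (ht : 0 < t) {b : E3 → ℝ} (hb : Continuous b) {C : ℝ}
    (h : ∀ z, |b z| ≤ C * (1 + ‖z‖ ^ 2) ^ 3) : Integrable fun z => gauss t z * b z := by
  refine ((integrable_gauss_mul_pow ht).const_mul C).mono' ((continuous_gauss t).mul hb).aestronglyMeasurable
    (.of_forall fun z => ?_)
  rw [norm_mul, Real.norm_of_nonneg (gauss_pos ht z).le]
  have := mul_le_mul_of_nonneg_left (h z) (gauss_pos ht z).le
  calc _ ≤ _ := this
    _ = _ := by ring

theorem contDiff_gauss {t : ℝ} (ht : 0 < t) : ContDiff ℝ ∞ (gauss t) :=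
  (hasDerivAt_slice contDiffOn_heatKernel ht).1

theorem pd_gauss {t : ℝ} (ht : 0 < t) (i : Fin 3) (x : E3) : pd i (gauss t) x = -(x i / (2 * t)) * gauss t x :=
  ((hasDerivAt_slice contDiffOn_heatKernel ht).2 i x).trans (dirD_heatKernel_space (z := (t, x)) ht i)

theorem abs_mul_coord_le {b B : ℝ} {z : E3} (k : Fin 3) (hB : 0 ≤ B) (h : |b| ≤ B * (1 + ‖z‖ ^ 2) ^ 2) :
    |b * z k| ≤ B * (1 + ‖z‖ ^ 2) ^ 3 := by
  have h3 : |z k| ≤ ‖z‖ := PiLp.norm_apply_le z k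
  have h4 : |z k| ≤ 1 + ‖z‖ ^ 2 := by nlinarith [sq_nonneg (‖z‖ - 1)]
  rw [abs_mul, pow_succ _ 2, ← mul_assoc]
  exact mul_le_mul h h4 (abs_nonneg _) (by positivity)

/-- Gaussian integration by parts. -/
theorem integral_coord_mul_gauss {b : E3 → ℝ} (hb : ContDiff ℝ 1 b) (k : Fin 3) {C : ℝ}
    (h0 : ∀ z, |b z| ≤ C * (1 + ‖z‖ ^ 2) ^ 2) (h1 : ∀ z, |pd k b z| ≤ C * (1 + ‖z‖ ^ 2) ^ 2) :
    ∫ z, gauss 1 z * (b z * z k) = 2 * ∫ z, gauss 1 z * pd k b z := by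
  have ht : (0 : ℝ) < 1 := one_pos
  have hC : 0 ≤ C := by simpa using (abs_nonneg _).trans (h0 0)
  have hup : ∀ z : E3, C * (1 + ‖z‖ ^ 2) ^ 2 ≤ C * (1 + ‖z‖ ^ 2) ^ 3 := fun z =>
    mul_le_mul_of_nonneg_left (pow_le_pow_right₀ (by nlinarith [sq_nonneg ‖z‖]) (by norm_num)) hC
  have hk : ∀ z : E3, |b z * z k| ≤ C * (1 + ‖z‖ ^ 2) ^ 3 :=
    fun z => abs_mul_coord_le k hC (h0 z)
  have hkc : Continuous fun z : E3 => z k := (contDiff_coord (n := 1) k).continuous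
  have hi1 := integrable_gauss_mul_of_le ht (hb.continuous.mul hkc) hk
  have hi2 := integrable_gauss_mul_of_le ht (hb.continuous_pd k) fun z => (h1 z).trans (hup z)
  have hi3 := integrable_gauss_mul_of_le ht hb.continuous fun z => (h0 z).trans (hup z)
  have e : ∀ z, pd k (gauss 1) z * b z = -(1 / 2) * (gauss 1 z * (b z * z k)) := fun z => by
    rw [pd_gauss ht]; ring
  have hi4 : Integrable fun z => pd k (gauss 1) z * b z := by
    simp only [e]; exact hi1.const_mul _
  have h := integral_mul_fderiv_eq_neg_fderiv_mul_of_integrable (v := EuclideanSpace.single k (1 : ℝ)) hi4 hi2 hi3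
    (fun x _ => (contDiff_gauss ht).differentiable (by simp) x) (fun x _ => hb.differentiable (by simp) x)
  have h' : ∫ z, gauss 1 z * pd k b z = -∫ z, pd k (gauss 1) z * b z := h
  rw [h']
  simp only [e, integral_const_mul]
  ring

/-- The substitution y = √t z freezes the Gaussian, so that differentiation in t falls on the
averaged function. -/
theorem integral_gauss_scale {t : ℝ} (ht : 0 < t) (Φ : E3 → ℝ) :
    ∫ z, gauss 1 z * Φ (Real.sqrt t • z) = ∫ y, gauss t y * Φ y := by
  have hs : 0 < Real.sqrt t := Real.sqrt_pos.2 ht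
  have hpi := Real.pi_pos
  have h := Measure.integral_comp_smul (volume : Measure E3) (fun y => gauss t y * Φ y) (Real.sqrt t)
  have e : ∀ z : E3, gauss t (Real.sqrt t • z) = (Real.sqrt t ^ 3)⁻¹ * gauss 1 z := by
    intro z
    simp only [gauss, heatKernel, norm_smul, mul_pow, Real.norm_of_nonneg hs.le, Real.sq_sqrt ht.le]
    rw [Real.sqrt_mul (by positivity), mul_one, mul_pow, mul_inv, mul_one]
    have : t * ‖z‖ ^ 2 / (4 * t) = ‖z‖ ^ 2 / 4 := by field_simp
    rw [this]; ring
  simp only [e, mul_assoc, integral_const_mul] at h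
  have h3 : Module.finrank ℝ E3 = 3 := by simp
  rw [h3, abs_of_pos (by positivity), smul_eq_mul] at h
  exact mul_left_cancel₀ (by positivity) h

/-! ### The heat flow at the origin of functions of polynomial growth. -/

section Average

variable {Φ : E3 → ℝ} {C : ℝ}

/-- Differentiating Φ(√t z) gives (2√t)⁻¹∑ zₖ∂ₖΦ(√t z). Gaussian integration by parts replaces zₖ by
2∂ₖ, the chain rule returns a factor √t, and the powers of t cancel to leave ΔΦ. -/
theorem hasDerivAt_average (hΦ : ContDiff ℝ ∞ Φ) (h0 : ∀ y, |Φ y| ≤ C * (1 + ‖y‖ ^ 2) ^ 2)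
    (h1 : ∀ k y, |pd k Φ y| ≤ C * (1 + ‖y‖ ^ 2) ^ 2) (h2 : ∀ k y, |pd k (pd k Φ) y| ≤ C * (1 + ‖y‖ ^ 2) ^ 2)
    {t : ℝ} (ht : 0 < t) :
    HasDerivAt (fun t => ∫ z, gauss 1 z * Φ (Real.sqrt t • z))
      (∫ z, gauss 1 z * lap Φ (Real.sqrt t • z)) t := by
  have hC : 0 ≤ C := by simpa using (abs_nonneg _).trans (h0 0)
  have hg : ∀ z, 0 ≤ gauss 1 z := fun z => (gauss_pos one_pos z).le
  have hsc : ∀ s : ℝ, Continuous fun z : E3 => s • z := fun s => continuous_const_smul s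
  have hgrow : ∀ {s T : ℝ}, 0 ≤ s → s ≤ T → 1 ≤ T → ∀ z : E3, C * (1 + ‖Real.sqrt s • z‖ ^ 2) ^ 2 ≤ C * T ^ 2 * (1 + ‖z‖ ^ 2) ^ 2 := by
    intro s T hs hsT hT z
    rw [norm_smul, Real.norm_of_nonneg (Real.sqrt_nonneg s), mul_pow, Real.sq_sqrt hs, mul_assoc, ← mul_pow]
    gcongr
    nlinarith [sq_nonneg ‖z‖]
  have hup : ∀ z : E3, (1 + ‖z‖ ^ 2) ^ 2 ≤ (1 + ‖z‖ ^ 2) ^ 3 := fun z =>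
    pow_le_pow_right₀ (by nlinarith [sq_nonneg ‖z‖]) (by norm_num)
  have hnear : Ioo (t / 2) (2 * t) ∈ nhds t := Ioo_mem_nhds (by linarith) (by linarith)
  set T := max 1 (2 * t) with hT
  have hT1 : 1 ≤ T := le_max_left _ _
  have hT2 : 2 * t ≤ T := le_max_right _ _
  set S := (2 * Real.sqrt (t / 2))⁻¹ with hS
  have hfd : ∀ s : ℝ, 0 < s → ∀ z : E3, HasDerivAt (fun s => gauss 1 z * Φ (Real.sqrt s • z))
      (gauss 1 z * ((2 * Real.sqrt s)⁻¹ * ∑ k, pd k Φ (Real.sqrt s • z) * z k)) s := by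
    intro s hs z
    have a1 : HasDerivAt (fun s => Real.sqrt s • z) ((1 / (2 * Real.sqrt s)) • z) s :=
      (Real.hasDerivAt_sqrt hs.ne').smul_const z
    have a2 := ((hΦ.differentiable (by simp)) (Real.sqrt s • z)).hasFDerivAt.comp_hasDerivAt s a1
    refine (a2.const_mul (gauss 1 z)).congr_deriv ?_
    rw [map_smul, fderiv_eq_sum_pd, one_div, smul_eq_mul]
    congr 2
    exact Finset.sum_congr rfl fun k _ => mul_comm _ _
  have hmain := hasDerivAt_integral_of_dominated_loc_of_deriv_le (μ := volume) (x₀ := t)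
    (F := fun s z => gauss 1 z * Φ (Real.sqrt s • z))
    (F' := fun s z => gauss 1 z * ((2 * Real.sqrt s)⁻¹ * ∑ k, pd k Φ (Real.sqrt s • z) * z k))
    (bound := fun z => gauss 1 z * (S * (3 * (C * T ^ 2)) * (1 + ‖z‖ ^ 2) ^ 3)) hnear ?_ ?_ ?_ ?_ ?_ ?_
  · refine hmain.2.congr_deriv ?_
    have hst : 0 < Real.sqrt t := Real.sqrt_pos.2 ht
    set s := Real.sqrt t with hs
    have hk : ∀ k, ∫ z, gauss 1 z * (pd k Φ (s • z) * z k) = 2 * ∫ z, gauss 1 z * (s * pd k (pd k Φ) (s • z)) := by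
      intro k
      have hd : Differentiable ℝ (pd k Φ) := (hΦ.pd_infty k).differentiable (by simp)
      have hb : ContDiff ℝ 1 fun z => pd k Φ (s • z) :=
        ((hΦ.pd_infty k).of_le (by simp)).comp (contDiff_const_smul s)
      have e : ∀ z, pd k (fun z => pd k Φ (s • z)) z = s * pd k (pd k Φ) (s • z) := fun z =>
        pd_comp_smul hd s k z
      have := integral_coord_mul_gauss hb k (C := (C * T ^ 2) * max 1 s) (fun z => ?_) (fun z => ?_)
      · simpa only [e] using this
      · calc _ ≤ C * (1 + ‖s • z‖ ^ 2) ^ 2 := h1 k _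
          _ ≤ C * T ^ 2 * (1 + ‖z‖ ^ 2) ^ 2 := hgrow ht.le (by linarith) hT1 z
          _ = C * T ^ 2 * 1 * (1 + ‖z‖ ^ 2) ^ 2 := by ring
          _ ≤ _ := by gcongr; exact le_max_left _ _
      · rw [e, abs_mul, abs_of_pos hst]
        calc s * |pd k (pd k Φ) (s • z)| ≤ s * (C * (1 + ‖s • z‖ ^ 2) ^ 2) := by gcongr; exact h2 k _
          _ ≤ max 1 s * (C * T ^ 2 * (1 + ‖z‖ ^ 2) ^ 2) := by
              exact mul_le_mul (le_max_right _ _) (hgrow ht.le (by linarith) hT1 z) (by positivity) (by positivity)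
          _ = _ := by ring
    have hi1 : ∀ k, Integrable fun z => gauss 1 z * (pd k Φ (s • z) * z k) := by
      intro k
      refine integrable_gauss_mul_of_le one_pos (C := C * T ^ 2) (((hΦ.pd_infty k).continuous.comp (hsc s)).mul
        (contDiff_coord (n := 1) k).continuous) fun z => ?_
      exact abs_mul_coord_le k (by positivity) ((h1 k _).trans (hgrow ht.le (by linarith) hT1 z))
    have hi2 : ∀ k, Integrable fun z => gauss 1 z * pd k (pd k Φ) (s • z) := by
      intro k
      refine integrable_gauss_mul_of_le one_pos (C := C * T ^ 2) (((hΦ.pd_infty k).pd_infty k).continuous.comp (hsc s)) fun z => ?_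
      refine ((h2 k _).trans (hgrow ht.le (by linarith) hT1 z)).trans ?_
      exact mul_le_mul_of_nonneg_left (hup z) (by positivity)
    have e1 : ∀ z, gauss 1 z * ((2 * s)⁻¹ * ∑ k, pd k Φ (s • z) * z k)
        = (2 * s)⁻¹ * ∑ k, gauss 1 z * (pd k Φ (s • z) * z k) := fun z => by
      rw [← Finset.mul_sum]; ring
    have e3 : ∀ z, gauss 1 z * lap Φ (s • z) = ∑ k, gauss 1 z * pd k (pd k Φ) (s • z) := fun z => by
      rw [lap, Finset.mul_sum]
    simp only [e1, e3, integral_const_mul]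
    rw [integral_finsetSum _ fun k _ => (hi1 k), integral_finsetSum _ fun k _ => hi2 k, Finset.mul_sum]
    refine Finset.sum_congr rfl fun k _ => ?_
    rw [hk k]
    have e2 : ∀ z, gauss 1 z * (s * pd k (pd k Φ) (s • z)) = s * (gauss 1 z * pd k (pd k Φ) (s • z)) := fun z => by ring
    simp only [e2, integral_const_mul]
    field_simp
  · exact .of_forall fun s => ((continuous_gauss 1).mul (hΦ.continuous.comp (hsc _))).aestronglyMeasurable
  · exact integrable_gauss_mul_of_le one_pos (C := C * T ^ 2) (hΦ.continuous.comp (hsc _)) fun z =>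
      ((h0 _).trans (hgrow ht.le (by linarith) hT1 z)).trans (mul_le_mul_of_nonneg_left (hup z) (by positivity))
  · refine ((continuous_gauss 1).mul (continuous_const.mul (continuous_finsetSum _ fun k _ => ?_))).aestronglyMeasurable
    exact ((hΦ.pd_infty k).continuous.comp (hsc _)).mul (contDiff_coord (n := 1) k).continuous
  · refine .of_forall fun z s hs => ?_
    have hs0 : 0 < s := by linarith [hs.1]
    rw [norm_mul, Real.norm_of_nonneg (hg z)]
    refine mul_le_mul_of_nonneg_left ?_ (hg z)
    rw [Real.norm_eq_abs, abs_mul, abs_of_nonneg (by positivity), mul_assoc]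
    refine mul_le_mul ?_ ?_ (abs_nonneg _) (by positivity)
    · rw [hS]; gcongr; exact hs.1.le
    · have hk : ∀ k, |pd k Φ (Real.sqrt s • z) * z k| ≤ C * T ^ 2 * (1 + ‖z‖ ^ 2) ^ 3 := fun k =>
        abs_mul_coord_le k (by positivity) ((h1 k _).trans (hgrow hs0.le (by linarith [hs.2]) hT1 z))
      refine (Finset.abs_sum_le_sum_abs _ _).trans ((Finset.sum_le_sum fun k _ => hk k).trans ?_)
      simp; apply le_of_eq; ring
  · have := (integrable_gauss_mul_pow (t := 1) one_pos).const_mul (S * (3 * (C * T ^ 2)))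
    refine this.congr (.of_forall fun z => ?_)
    simp only; ring
  · exact .of_forall fun z s hs => hfd s (by linarith [hs.1]) z

theorem tendsto_average_zero (hΦ : Continuous Φ) (h0 : ∀ y, |Φ y| ≤ C * (1 + ‖y‖ ^ 2) ^ 2) :
    Filter.Tendsto (fun t => ∫ z, gauss 1 z * Φ (Real.sqrt t • z)) (nhdsWithin 0 (Ioi 0)) (nhds (Φ 0)) := by
  have hC : 0 ≤ C := by simpa using (abs_nonneg _).trans (h0 0)
  have hlim : ∫ z, gauss 1 z * Φ 0 = Φ 0 := by rw [integral_mul_const, integral_gauss one_pos, one_mul]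
  rw [← hlim]
  refine tendsto_integral_filter_of_dominated_convergence (fun z => gauss 1 z * (C * (1 + ‖z‖ ^ 2) ^ 3)) ?_ ?_ ?_ ?_
  · exact .of_forall fun s => ((continuous_gauss 1).mul (hΦ.comp (continuous_const_smul _))).aestronglyMeasurable
  · filter_upwards [Ioo_mem_nhdsGT (zero_lt_one' ℝ)] with s hs
    refine .of_forall fun z => ?_
    rw [norm_mul, Real.norm_of_nonneg (gauss_pos one_pos z).le]
    refine mul_le_mul_of_nonneg_left ((h0 _).trans (mul_le_mul_of_nonneg_left ?_ hC)) (gauss_pos one_pos z).le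
    rw [norm_smul, Real.norm_of_nonneg (Real.sqrt_nonneg s), mul_pow, Real.sq_sqrt hs.1.le]
    calc (1 + s * ‖z‖ ^ 2) ^ 2 ≤ (1 + ‖z‖ ^ 2) ^ 2 := by
          have := hs.1.le
          gcongr; exact mul_le_of_le_one_left (by positivity) hs.2.le
      _ ≤ _ := pow_le_pow_right₀ (by nlinarith [sq_nonneg ‖z‖]) (by norm_num)
  · refine ((integrable_gauss_mul_pow (t := 1) one_pos).const_mul C).congr (.of_forall fun z => ?_)
    simp only; ring
  · refine .of_forall fun z => (Filter.Tendsto.const_mul _ ?_)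
    have : Filter.Tendsto (fun t => Φ (Real.sqrt t • z)) (nhds 0) (nhds (Φ (Real.sqrt 0 • z))) :=
      (hΦ.comp (Real.continuous_sqrt.smul continuous_const)).tendsto 0
    rw [Real.sqrt_zero, zero_smul] at this
    exact this.mono_left nhdsWithin_le_nhds

end Average

/-- By Fubini the heat flow passes from φ, which is controlled only in a weighted mean, to the
compactly supported G. The reflection of φ comes from evaluating the convolution at the origin. -/
theorem integral_gauss_mul_conv {t : ℝ} (ht : 0 < t) {G φ : E3 → ℝ} (hG : Continuous G)
    (hGc : HasCompactSupport G) (hφ : Continuous φ) (hφw : Integrable fun x => φ x / (1 + ‖x‖ ^ 2) ^ 2) :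
    ∫ y, gauss t y * conv G φ y = ∫ x, φ (-x) * heatExt G (t, x) := by
  obtain ⟨C, hC, h⟩ := integral_abs_mul_le hG hGc hφ hφw
  have hshift : ∀ y, (fun x => |φ (-x) * G (y + x)|) = fun x => (fun x => |G x * φ (y - x)|) (y + x) := fun y => by
    funext x; simp [mul_comm]
  have hcont : Continuous fun w : E3 × E3 => gauss t w.1 * (φ (-w.2) * G (w.1 + w.2)) :=
    ((continuous_gauss t).comp continuous_fst).mul ((hφ.comp continuous_snd.neg).mul (hG.comp (continuous_fst.add continuous_snd)))
  have hint : Integrable (fun w : E3 × E3 => gauss t w.1 * (φ (-w.2) * G (w.1 + w.2))) (volume.prod volume) := by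
    refine (integrable_prod_iff hcont.aestronglyMeasurable).2 ⟨.of_forall fun y => ?_, ?_⟩
    · have h1 : Integrable fun x => G x * φ (y - x) :=
        (hG.mul (hφ.comp (by fun_prop))).integrable_of_hasCompactSupport hGc.mul_right
      refine ((h1.comp_add_left y).const_mul (gauss t y)).congr (.of_forall fun x => ?_)
      simp [mul_comm]
    · refine ((integrable_gauss_mul_pow ht).const_mul C).mono' ?_ (.of_forall fun y => ?_)
      · exact (hcont.norm.stronglyMeasurable.integral_prod_right').aestronglyMeasurable
      · have e : ∀ x, ‖gauss t y * (φ (-x) * G (y + x))‖ = gauss t y * |φ (-x) * G (y + x)| := fun x => by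
          rw [norm_mul, Real.norm_of_nonneg (gauss_pos ht y).le, Real.norm_eq_abs]
        simp only [e, integral_const_mul]
        rw [hshift, integral_add_left_eq_self (fun x => |G x * φ (y - x)|),
          Real.norm_of_nonneg (mul_nonneg (gauss_pos ht y).le (integral_nonneg fun x => abs_nonneg _))]
        calc _ ≤ gauss t y * (C * (1 + ‖y‖ ^ 2) ^ 3) := by
              refine mul_le_mul_of_nonneg_left ((h y).trans (mul_le_mul_of_nonneg_left ?_ hC)) (gauss_pos ht y).le
              exact pow_le_pow_right₀ (by nlinarith [sq_nonneg ‖y‖]) (by norm_num)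
          _ = _ := by ring
  simp only [conv_eq, ← integral_const_mul]
  rw [integral_integral_swap hint]
  refine integral_congr_ae (.of_forall fun x => ?_)
  simp only
  rw [heatExt_eq_average, ← integral_const_mul, ← integral_neg_eq_self]
  refine integral_congr_ae (.of_forall fun y => ?_)
  simp only [gauss_neg]
  rw [show -y + x = x - y by abel]; ring

/-! ### The heat semigroup against test functions -/

theorem abs_dirD_heatExt_le {f : E3 → ℝ} (hf : Continuous f) (hfc : HasCompactSupport f) (i : Fin 3) {t : ℝ}
    (ht : 0 < t) (x : E3) :
    |dirD (eSpace i) (heatExt f) (t, x)| ≤ 4 * (∫ y, |f y|) * (Real.sqrt t ^ 4)⁻¹ := by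
  rw [heatExt, dirD_heatConv contDiffOn_heatKernel hf hfc _ (show (t, x) ∈ posTime from ht)]
  have hi : Integrable fun y => |f y| := (hf.integrable_of_hasCompactSupport hfc).abs
  refine (norm_integral_le_of_norm_le (f := fun y => f y • dirD (eSpace i) heatKernel
    ((t, x) - ContinuousLinearMap.inr ℝ ℝ E3 y)) (hi.mul_const (4 * (Real.sqrt t ^ 4)⁻¹)) (.of_forall fun y => ?_)).trans ?_
  · rw [norm_smul, sub_inr]
    exact mul_le_mul_of_nonneg_left (abs_dirD_heatKernel_le_time ht _ i) (abs_nonneg _)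
  · rw [integral_mul_const]; apply le_of_eq; ring

/-- The flow of a derivative decays like |x|⁻⁴ uniformly in time, which is the decay needed to pair
it with functions integrable against (1+|x|²)⁻². The decay in time makes the pairing vanish as t →
∞. -/
theorem exists_abs_heatExt_pd_le {g : E3 → ℝ} (hg : ContDiff ℝ ∞ g) (hgc : HasCompactSupport g) (j : Fin 3) :
    ∃ M : ℝ, 0 ≤ M ∧ (∀ t, 0 < t → ∀ x, |heatExt (pd j g) (t, x)| ≤ M * ((1 + ‖x‖ ^ 2) ^ 2)⁻¹) ∧
      ∀ t, 0 < t → ∀ x, |heatExt (pd j g) (t, x)| ≤ M * (Real.sqrt t ^ 4)⁻¹ := by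
  have hg1 : ContDiff ℝ 1 g := hg.of_le (by simp)
  obtain ⟨M1, hM1⟩ := (hasCompactSupport_pd hgc j).exists_bound_of_continuous (hg1.continuous_pd j)
  have hM10 : 0 ≤ M1 := (norm_nonneg _).trans (hM1 0)
  obtain ⟨ρ₀, hρ₀⟩ := hgc.isBounded.exists_norm_le
  set ρ := max ρ₀ 1 with hρ
  have hρ1 : 1 ≤ ρ := le_max_right _ _
  have hi : Integrable fun y => |g y| := (hg.continuous.integrable_of_hasCompactSupport hgc).abs
  set I := ∫ y, |g y| with hI
  have hI0 : 0 ≤ I := integral_nonneg fun y => abs_nonneg _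
  have heq : ∀ t, 0 < t → ∀ x, heatExt (pd j g) (t, x) = dirD (eSpace j) (heatExt g) (t, x) := fun t ht x =>
    (dirD_heatExt_eq hg1 hgc j ht).symm
  refine ⟨M1 * (1 + 4 * ρ ^ 2) ^ 2 + 385 * 16 * 4 * I + 4 * I, by positivity, fun t ht x => ?_, fun t ht x => ?_⟩
  · have hw : 0 ≤ ((1 + ‖x‖ ^ 2) ^ 2)⁻¹ := by positivity
    -- Close to the support the maximum principle suffices. Far away |x−y| ≥ |x|/2 costs a factor 2⁴
    -- = 16, and replacing |x|⁻⁴ by the weight costs another 4.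
    rcases le_total ‖x‖ (2 * ρ) with hx | hx
    · calc |heatExt (pd j g) (t, x)| ≤ M1 := abs_heatExt_le ht hM1 x
        _ = M1 * (1 + ‖x‖ ^ 2) ^ 2 * ((1 + ‖x‖ ^ 2) ^ 2)⁻¹ := by field_simp
        _ ≤ M1 * (1 + 4 * ρ ^ 2) ^ 2 * ((1 + ‖x‖ ^ 2) ^ 2)⁻¹ := by
            have : ‖x‖ ^ 2 ≤ 4 * ρ ^ 2 := by nlinarith [norm_nonneg x]
            gcongr
        _ ≤ _ := by gcongr; nlinarith
    · have hx2 : 2 ≤ ‖x‖ := by linarith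
      rw [heq t ht, heatExt, dirD_heatConv contDiffOn_heatKernel hg.continuous hgc _ (show (t, x) ∈ posTime from ht)]
      have h1 : |heatConv (dirD (eSpace j) heatKernel) g (t, x)| ≤ I * (385 * 16 * (‖x‖ ^ 4)⁻¹) := by
        rw [hI, ← integral_mul_const]
        refine norm_integral_le_of_norm_le (f := fun y => g y • dirD (eSpace j) heatKernel
          ((t, x) - ContinuousLinearMap.inr ℝ ℝ E3 y)) (hi.mul_const _) (.of_forall fun y => ?_)
        rw [norm_smul, sub_inr]
        by_cases hy : g y = 0
        · simp [hy]
        refine mul_le_mul_of_nonneg_left ?_ (abs_nonneg _)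
        have h2 : ‖x‖ / 2 ≤ ‖x - y‖ := by
          have h3 : ‖y‖ ≤ ρ := (hρ₀ y (subset_tsupport g hy)).trans (le_max_left _ _)
          have := norm_sub_norm_le x y
          linarith
        have h4 : x - y ≠ 0 := norm_pos_iff.1 (by linarith)
        refine (abs_dirD_heatKernel_le_pow ht h4 j).trans ?_
        calc 385 * (‖x - y‖ ^ 4)⁻¹ ≤ 385 * ((‖x‖ / 2) ^ 4)⁻¹ := by gcongr
          _ = _ := by rw [div_pow, inv_div]; ring
      have h5 : (‖x‖ ^ 4)⁻¹ ≤ 4 * ((1 + ‖x‖ ^ 2) ^ 2)⁻¹ := by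
        rw [← div_eq_mul_inv, inv_eq_one_div, div_le_div_iff₀ (by positivity) (by positivity)]
        have : 1 + ‖x‖ ^ 2 ≤ 2 * ‖x‖ ^ 2 := by nlinarith
        calc 1 * (1 + ‖x‖ ^ 2) ^ 2 ≤ 1 * (2 * ‖x‖ ^ 2) ^ 2 := by gcongr
          _ = _ := by ring
      calc _ ≤ I * (385 * 16 * (‖x‖ ^ 4)⁻¹) := h1
        _ ≤ I * (385 * 16 * (4 * ((1 + ‖x‖ ^ 2) ^ 2)⁻¹)) := by gcongr
        _ = 385 * 16 * 4 * I * ((1 + ‖x‖ ^ 2) ^ 2)⁻¹ := by ring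
        _ ≤ _ := by gcongr; nlinarith [mul_nonneg hM10 (sq_nonneg (1 + 4 * ρ ^ 2))]
  · rw [heq t ht]
    refine (abs_dirD_heatExt_le hg.continuous hgc j ht x).trans ?_
    gcongr
    nlinarith [mul_nonneg hM10 (sq_nonneg (1 + 4 * ρ ^ 2))]

theorem abs_gauss_le {t : ℝ} (ht : 0 < t) (x : E3) : |gauss t x| ≤ (Real.sqrt (4 * Real.pi * t) ^ 3)⁻¹ := by
  rw [abs_of_pos (gauss_pos ht x)]
  have h : Real.exp (-(‖x‖ ^ 2 / (4 * t))) ≤ 1 := Real.exp_le_one_iff.2 (by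
    have : 0 ≤ ‖x‖ ^ 2 / (4 * t) := by positivity
    linarith)
  exact mul_le_of_le_one_right (by positivity) h

theorem integral_heatExt_mul {F H : E3 → ℝ} (hF : Continuous F) (hFc : HasCompactSupport F) (hH : Continuous H)
    {M : ℝ} (hM : ∀ y, |H y| ≤ M) {t : ℝ} (ht : 0 < t) :
    ∫ y, heatExt F (t, y) * H y = ∫ x, F x * ∫ y, gauss t (y - x) * H y := by
  have h1 : Integrable (fun w : E3 × E3 => F w.2 * gauss t (w.1 - w.2)) (volume.prod volume) :=
    (hF.integrable_of_hasCompactSupport hFc).convolution_integrand (ContinuousLinearMap.mul ℝ ℝ) (integrable_gauss ht)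
  have h2 : Integrable (fun w : E3 × E3 => F w.2 * gauss t (w.1 - w.2) * H w.1) (volume.prod volume) :=
    h1.mul_bdd (c := M) (hH.comp continuous_fst).aestronglyMeasurable (.of_forall fun w => hM _)
  simp only [heatExt_apply, ← integral_mul_const, ← integral_const_mul]
  rw [integral_integral_swap h2]
  simp only [mul_assoc]

theorem heatExt_two_mul {G : E3 → ℝ} (hG : Continuous G) (hGc : HasCompactSupport G) {t : ℝ} (ht : 0 < t) (x : E3) :
    heatExt G (2 * t, x) = ∫ y, gauss t (y - x) * heatExt G (t, y) := by
  have h := integral_heatExt_mul hG hGc (H := fun y => gauss t (y - x)) ((continuous_gauss t).comp (by fun_prop))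
    (fun y => abs_gauss_le ht _) ht
  have h' : ∫ y, gauss t (y - x) * heatExt G (t, y) = ∫ y, heatExt G (t, y) * gauss t (y - x) :=
    integral_congr_ae (.of_forall fun y => mul_comm _ _)
  rw [h', h, heatExt_apply]
  refine integral_congr_ae (.of_forall fun w => ?_)
  simp only
  rw [← integral_gauss_mul_gauss ht, ← integral_sub_right_eq_self _ w]
  congr 1
  refine integral_congr_ae (.of_forall fun y => ?_)
  simp only
  rw [← gauss_neg t (x - w - (y - w)), mul_comm]
  congr 2; abel

/-- The flow over time 2t is split in two halves, one is moved onto f by symmetry of the kernel, and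
∂ᵢ is integrated by parts. This produces the product that the bilinear embedding controls. -/
theorem integral_mul_heatExt_pd_pd {f g : E3 → ℝ} (hf : Continuous f) (hfc : HasCompactSupport f)
    (hg : ContDiff ℝ ∞ g) (hgc : HasCompactSupport g) (i j : Fin 3) {t : ℝ} (ht : 0 < t) :
    ∫ x, f x * heatExt (pd i (pd j g)) (2 * t, x)
      = -∫ x, dirD (eSpace i) (heatExt f) (t, x) * dirD (eSpace j) (heatExt g) (t, x) := by
  have hgj := hg.pd_infty j
  have hgjc := hasCompactSupport_pd hgc j
  have hgij := hgj.pd_infty i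
  have hgijc := hasCompactSupport_pd hgjc i
  obtain ⟨M1, hM10, hM1, -⟩ := exists_abs_heatExt_pd_le hg hgc j
  obtain ⟨M2, hM20, hM2, -⟩ := exists_abs_heatExt_pd_le hgj hgjc i
  obtain ⟨Mf, hMf⟩ := hfc.exists_bound_of_continuous hf
  obtain ⟨sf, sf'⟩ := hasDerivAt_slice (contDiffOn_heatExt hf hfc) ht
  obtain ⟨sg, sg'⟩ := hasDerivAt_slice (contDiffOn_heatExt hgj.continuous hgjc) ht
  have sG := (hasDerivAt_slice (contDiffOn_heatExt hgij.continuous hgijc) ht).1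
  have hw1 : ∀ x : E3, ((1 + ‖x‖ ^ 2) ^ 2)⁻¹ ≤ 1 := fun x => inv_le_one_of_one_le₀ (one_le_pow₀ (by nlinarith [sq_nonneg ‖x‖]))
  simp only [heatExt_two_mul hgij.continuous hgijc ht]
  rw [← integral_heatExt_mul hf hfc sG.continuous (M := M2) (fun y => (hM2 t ht y).trans
    (mul_le_of_le_one_right hM20 (hw1 y))) ht]
  have e1 : ∀ x, heatExt (pd i (pd j g)) (t, x) = pd i (fun x => heatExt (pd j g) (t, x)) x := fun x => by
    rw [sg', dirD_heatExt_eq (hgj.of_le (by simp)) hgjc i (show (t, x) ∈ posTime from ht)]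
  have e2 : ∀ x, dirD (eSpace j) (heatExt g) (t, x) = heatExt (pd j g) (t, x) := fun x =>
    dirD_heatExt_eq (hg.of_le (by simp)) hgc j (show (t, x) ∈ posTime from ht)
  have hi : ∀ {K : E3 → ℝ} {M : ℝ}, Continuous K → (∀ x, |K x| ≤ M * ((1 + ‖x‖ ^ 2) ^ 2)⁻¹) → Integrable K :=
    fun hK hKM => (integrable_inv_one_add_sq_sq.const_mul _).mono' hK.aestronglyMeasurable (.of_forall hKM)
  have i1 := hi sg.continuous (hM1 t ht)
  have i2 := hi sG.continuous (hM2 t ht)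
  simp only [e2, ← sf']
  simp only [e1] at i2 ⊢
  refine integral_mul_fderiv_eq_neg_fderiv_mul_of_integrable ?_ ?_ ?_
    (fun x _ => sf.differentiable (by simp) x) (fun x _ => sg.differentiable (by simp) x)
  · exact i1.bdd_mul (c := 4 * (∫ y, |f y|) * (Real.sqrt t ^ 4)⁻¹)
      (sf.pd_infty i).continuous.aestronglyMeasurable (.of_forall fun x => by
      have := abs_dirD_heatExt_le hf hfc i ht x
      rw [← sf'] at this; exact this)
  · exact i2.bdd_mul (c := Mf) sf.continuous.aestronglyMeasurable (.of_forall fun x => abs_heatExt_le ht hMf x)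
  · exact i1.bdd_mul (c := Mf) sf.continuous.aestronglyMeasurable (.of_forall fun x => abs_heatExt_le ht hMf x)

/-- The form in which the bilinear embedding is used. -/
theorem exists_flow_bound {p q : ℝ} (hp1 : 1 < p) (hq1 : 1 < q) (hq : p⁻¹ + q⁻¹ = 1) :
    ∃ C : ℝ, 0 < C ∧ ∀ f g : E3 → ℝ, Continuous f → (Integrable fun x => |f x| ^ p) →
      (Integrable fun x => f x / (1 + ‖x‖ ^ 2) ^ 2) → ContDiff ℝ ∞ g → HasCompactSupport g →
      ∀ (i j : Fin 3) (a b : ℝ), 0 < a → a ≤ b →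
      |∫ s in a..b, ∫ x, f x * heatExt (pd i (pd j g)) (s, x)| ≤ C * ((∫ x, |f x| ^ p) + ∫ x, |g x| ^ q) := by
  obtain ⟨C, hC, hbil⟩ := exists_bilinear_bound hp1 hq1 hq
  refine ⟨2 * C, by positivity, fun f g hf hfp hfw hg hgc i j a b ha hab => ?_⟩
  have hcs : ∀ f : E3 → ℝ, Continuous f → HasCompactSupport f →
      |∫ s in a..b, ∫ x, f x * heatExt (pd i (pd j g)) (s, x)| ≤ 2 * C * ((∫ x, |f x| ^ p) + ∫ x, |g x| ^ q) := by
    intro f hf hfc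
    set w : ℝ × E3 → ℝ := fun z => dirD (eSpace i) (heatExt f) z * dirD (eSpace j) (heatExt g) z with hw
    have hwm : Measurable w := (measurable_dirD _ _).mul (measurable_dirD _ _)
    -- The substitution s = 2t is the source of the factor 2 in the constant.
    have e1 : ∫ s in a..b, ∫ x, f x * heatExt (pd i (pd j g)) (s, x) = ∫ s in a..b, (fun t => -∫ x, w (t, x)) (s / 2) := by
      refine intervalIntegral.integral_congr fun s hs => ?_
      rw [uIcc_of_le hab] at hs
      have hs2 : 0 < s / 2 := by linarith [hs.1]
      have := integral_mul_heatExt_pd_pd hf hfc hg hgc i j hs2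
      rw [mul_div_cancel₀ s two_ne_zero] at this
      exact this
    rw [e1, intervalIntegral.integral_comp_div (fun t => -∫ x, w (t, x)) two_ne_zero, intervalIntegral.integral_neg,
      smul_eq_mul, abs_mul, abs_neg, abs_two, mul_assoc]
    refine mul_le_mul_of_nonneg_left ?_ zero_le_two
    have h := hbil f g hf hfc hg.continuous hgc i j (a / 2) (b / 2) (by linarith) (by linarith)
    rw [Measure.volume_eq_prod, ← Measure.prod_restrict, Measure.restrict_univ, lintegral_prod _ hwm.enorm.aemeasurable] at h
    have hE : 0 ≤ C * ((∫ x, |f x| ^ p) + ∫ x, |g x| ^ q) := by positivity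
    rw [intervalIntegral.integral_of_le (by linarith), ← ENNReal.ofReal_le_ofReal_iff hE, ← Real.norm_eq_abs, ofReal_norm]
    refine le_trans ((enorm_integral_le_lintegral_enorm _).trans (lintegral_mono fun t => enorm_integral_le_lintegral_enorm _)) h
  obtain ⟨M, hM0, hM, -⟩ := exists_abs_heatExt_pd_le (hg.pd_infty j) (hasCompactSupport_pd hgc j) i
  set K := heatExt (pd i (pd j g)) with hK
  have hKc : ContinuousOn K posTime := (contDiffOn_heatExt ((hg.pd_infty j).pd_infty i).continuous
    (hasCompactSupport_pd (hasCompactSupport_pd hgc j) i)).continuousOn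
  have hS : MeasurableSet (Ioc a b ×ˢ (univ : Set E3)) := measurableSet_Ioc.prod MeasurableSet.univ
  have hSpos : Ioc a b ×ˢ (univ : Set E3) ⊆ posTime := fun z hz => lt_trans ha hz.1.1
  have hdom : IntegrableOn (fun z : ℝ × E3 => M * |f z.2 / (1 + ‖z.2‖ ^ 2) ^ 2|) (Ioc a b ×ˢ univ) := by
    rw [IntegrableOn, Measure.volume_eq_prod, ← Measure.prod_restrict, Measure.restrict_univ]
    exact (hfw.abs.comp_snd (volume.restrict (Ioc a b))).const_mul M
  have hmeas : ∀ {f : E3 → ℝ}, Continuous f → AEStronglyMeasurable (fun z : ℝ × E3 => f z.2 * K z)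
      (volume.restrict (Ioc a b ×ˢ univ)) := fun hf =>
    ((hf.comp continuous_snd).continuousOn.mul (hKc.mono hSpos)).aestronglyMeasurable hS
  have hle : ∀ {k : E3 → ℝ}, (∀ x, |k x| ≤ |f x|) → ∀ᵐ z ∂(volume.restrict (Ioc a b ×ˢ univ)),
      ‖k z.2 * K z‖ ≤ M * |f z.2 / (1 + ‖z.2‖ ^ 2) ^ 2| := by
    intro k hk
    filter_upwards [self_mem_ae_restrict hS] with z hz
    rw [norm_mul, Real.norm_eq_abs, Real.norm_eq_abs, abs_div, abs_of_pos (by positivity : 0 < (1 + ‖z.2‖ ^ 2) ^ 2)]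
    calc |k z.2| * |K z| ≤ |f z.2| * (M * ((1 + ‖z.2‖ ^ 2) ^ 2)⁻¹) :=
          mul_le_mul (hk _) (hM z.1 (hSpos hz) z.2) (abs_nonneg _) (abs_nonneg _)
      _ = _ := by rw [div_eq_mul_inv]; ring
  have hprod : ∀ {k : E3 → ℝ}, Continuous k → (∀ x, |k x| ≤ |f x|) →
      ∫ z in Ioc a b ×ˢ univ, k z.2 * K z = ∫ s in a..b, ∫ x, k x * K (s, x) := by
    intro k hk hkf
    have h : IntegrableOn (fun z : ℝ × E3 => k z.2 * K z) (Ioc a b ×ˢ univ) := hdom.mono' (hmeas hk) (hle hkf)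
    rw [Measure.volume_eq_prod] at h ⊢
    rw [setIntegral_prod _ h, intervalIntegral.integral_of_le hab]
    simp
  rw [← hprod hf fun x => le_rfl]
  obtain ⟨C', -, hC'⟩ := exists_cutoff
  choose! χ c1 c2 c3 c4 c5 c6 using hC'
  have hR : ∀ n : ℕ, (0 : ℝ) < n + 1 := fun n => by positivity
  have hfn : ∀ n : ℕ, ∀ x, |χ (n + 1) x * f x| ≤ |f x| := fun n x => by
    rw [abs_mul, abs_of_nonneg (c3 _ (hR n) x)]
    exact mul_le_of_le_one_left (abs_nonneg _) (c4 _ (hR n) x)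
  have hfnc : ∀ n : ℕ, Continuous fun x => χ (n + 1) x * f x := fun n => (c1 _ (hR n)).continuous.mul hf
  -- Compact support of f is removed by cutoffs. The flow of the second derivative is bounded by
  -- M(1+|x|²)⁻², so the weighted integrability of f provides a dominating function on the bounded
  -- time interval.
  have hlim : Filter.Tendsto (fun n : ℕ => ∫ z in Ioc a b ×ˢ univ, (χ (n + 1) z.2 * f z.2) * K z) Filter.atTop
      (nhds (∫ z in Ioc a b ×ˢ univ, f z.2 * K z)) := by
    refine tendsto_integral_of_dominated_convergence _ (fun n => hmeas (hfnc n)) hdom (fun n => hle (hfn n))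
      (.of_forall fun z => tendsto_const_nhds.congr' ?_)
    obtain ⟨N, hN⟩ := exists_nat_gt ‖z.2‖
    filter_upwards [Filter.eventually_ge_atTop N] with n hn
    have : (N : ℝ) ≤ n := by exact_mod_cast hn
    rw [c5 _ (hR n) _ (by linarith), one_mul]
  refine le_of_tendsto hlim.abs (.of_forall fun n => ?_)
  rw [hprod (hfnc n) (hfn n)]
  refine (hcs _ (hfnc n) (c2 _ (hR n)).mul_right).trans ?_
  have hi : Integrable fun x => |χ (n + 1) x * f x| ^ p :=
    ((hfnc n).abs.rpow_const fun x => Or.inr (by linarith)).integrable_of_hasCompactSupport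
      (((c2 _ (hR n)).mul_right (f' := f)).norm.comp_left (g := fun s : ℝ => s ^ p) (Real.zero_rpow (by linarith)))
  have : ∫ x, |χ (n + 1) x * f x| ^ p ≤ ∫ x, |f x| ^ p :=
    integral_mono hi hfp fun x => Real.rpow_le_rpow (abs_nonneg _) (hfn n x) (by linarith)
  gcongr

/-! ### The Calderón–Zygmund estimate -/

section Pairing

variable {G φ : E3 → ℝ}

theorem exists_growth (hG : ContDiff ℝ ∞ G) (hGc : HasCompactSupport G) (hφ : ContDiff ℝ ∞ φ)
    (hφw : Integrable fun x => φ x / (1 + ‖x‖ ^ 2) ^ 2) :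
    ∃ C : ℝ, (∀ y, |conv G φ y| ≤ C * (1 + ‖y‖ ^ 2) ^ 2) ∧ (∀ k y, |pd k (conv G φ) y| ≤ C * (1 + ‖y‖ ^ 2) ^ 2) ∧
      ∀ k y, |pd k (pd k (conv G φ)) y| ≤ C * (1 + ‖y‖ ^ 2) ^ 2 := by
  have h : ∀ {H : E3 → ℝ}, ContDiff ℝ ∞ H → HasCompactSupport H → ∃ C : ℝ, 0 ≤ C ∧ ∀ y, |conv H φ y| ≤ C * (1 + ‖y‖ ^ 2) ^ 2 :=
    fun hH hHc => exists_abs_conv_le hH.continuous hHc hφ.continuous hφw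
  obtain ⟨C0, hC0, h0⟩ := h hG hGc
  choose C1 hC1 h1 using fun k => h (hG.pd_infty k) (hasCompactSupport_pd hGc k)
  choose C2 hC2 h2 using fun k => h ((hG.pd_infty k).pd_infty k) (hasCompactSupport_pd (hasCompactSupport_pd hGc k) k)
  have s1 : ∀ k, C1 k ≤ ∑ k, C1 k := fun k => Finset.single_le_sum (fun l _ => hC1 l) (Finset.mem_univ k)
  have s2 : ∀ k, C2 k ≤ ∑ k, C2 k := fun k => Finset.single_le_sum (fun l _ => hC2 l) (Finset.mem_univ k)
  have t1 : 0 ≤ ∑ k, C1 k := Finset.sum_nonneg fun k _ => hC1 k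
  have t2 : 0 ≤ ∑ k, C2 k := Finset.sum_nonneg fun k _ => hC2 k
  refine ⟨C0 + (∑ k, C1 k) + ∑ k, C2 k, fun y => (h0 y).trans ?_, fun k y => ?_, fun k y => ?_⟩
  · gcongr; linarith
  · rw [pd_conv' hG hGc hφ]
    refine (h1 k y).trans ?_
    gcongr; linarith [s1 k]
  · rw [pd_conv' hG hGc hφ, pd_conv' (hG.pd_infty k) (hasCompactSupport_pd hGc k) hφ]
    refine (h2 k y).trans ?_
    gcongr; linarith [s2 k]

theorem lap_conv (hG : ContDiff ℝ ∞ G) (hGc : HasCompactSupport G) (hφ : ContDiff ℝ ∞ φ) :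
    lap (conv G φ) = conv G (lap φ) := by
  funext y
  simp only [lap, pd_conv hG.continuous hGc hφ, pd_conv hG.continuous hGc (hφ.pd_infty _)]
  simp only [conv_apply]
  rw [← integral_finsetSum _ fun k _ => ?_]
  · exact integral_congr_ae (.of_forall fun x => (Finset.mul_sum _ _ _).symm)
  exact (hG.continuous.mul (((hφ.pd_infty k).pd_infty k).continuous.comp (by fun_prop))).integrable_of_hasCompactSupport
    hGc.mul_right

end Pairing

/-- Where |f| ≤ 1 the weight alone is integrable; elsewhere |f| ≤ |f|^p. -/
theorem integrable_weight_of_rpow {f : E3 → ℝ} (hf : Continuous f) {p : ℝ} (hp : 1 ≤ p) (hfp : Integrable fun x => |f x| ^ p) :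
    Integrable fun x => f x / (1 + ‖x‖ ^ 2) ^ 2 := by
  refine (integrable_inv_one_add_sq_sq.add hfp).mono' ?_ (.of_forall fun x => ?_)
  · exact (hf.div (by fun_prop) fun x => by positivity).aestronglyMeasurable
  · have h1 : ((1 + ‖x‖ ^ 2) ^ 2)⁻¹ ≤ 1 := inv_le_one_of_one_le₀ (one_le_pow₀ (by nlinarith [sq_nonneg ‖x‖]))
    have h0 : 0 ≤ ((1 + ‖x‖ ^ 2) ^ 2)⁻¹ := by positivity
    rw [norm_div, Real.norm_of_nonneg (by positivity : 0 ≤ (1 + ‖x‖ ^ 2) ^ 2), Real.norm_eq_abs, div_eq_mul_inv]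
    simp only [Pi.add_apply]
    rcases le_total |f x| 1 with h | h
    · have := Real.rpow_nonneg (abs_nonneg (f x)) p
      nlinarith
    · have : |f x| ≤ |f x| ^ p := by
        conv_lhs => rw [← Real.rpow_one |f x|]
        exact Real.rpow_le_rpow_of_exponent_le h hp
      nlinarith

/-- The pairing is Φ(0) for Φ = (∂ⱼg) * φ. Let D(t) be the heat flow of Φ at the origin. Since ΔΦ =
(∂ᵢ∂ⱼg) * f, the derivative D′ involves f alone and its integral over any time interval is bounded
by `exists_flow_bound`. Also D(t) → Φ(0) as t → 0 and D(t) → 0 as t → ∞. -/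
theorem exists_pairing_bound {p q : ℝ} (hp1 : 1 < p) (hq1 : 1 < q) (hq : p⁻¹ + q⁻¹ = 1) :
    ∃ C : ℝ, 0 < C ∧ ∀ φ f g : E3 → ℝ, ContDiff ℝ ∞ φ → ContDiff ℝ ∞ f →
      (Integrable fun x => φ x / (1 + ‖x‖ ^ 2) ^ 2) → (Integrable fun x => |f x| ^ p) →
      ContDiff ℝ ∞ g → HasCompactSupport g → ∀ i j : Fin 3, (∀ x, lap φ x = pd i f x) →
      |∫ x, g x * pd j φ (-x)| ≤ C * ((∫ x, |f x| ^ p) + ∫ x, |g x| ^ q) := by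
  obtain ⟨C, hC, hflow⟩ := exists_flow_bound hp1 hq1 hq
  refine ⟨C, hC, fun φ f g hφ hf hφw hfp hg hgc i j heq => ?_⟩
  have hgj := hg.pd_infty j
  have hgjc := hasCompactSupport_pd hgc j
  have hgij := hgj.pd_infty i
  have hgijc := hasCompactSupport_pd hgjc i
  have hfw := integrable_weight_of_rpow hf.continuous hp1.le hfp
  set Φ := conv (pd j g) φ with hΦdef
  have hΦ : ContDiff ℝ ∞ Φ := contDiff_conv hgj.continuous hgjc hφ
  set Θ := conv (pd i (pd j g)) f with hΘdef
  have hΘ : ContDiff ℝ ∞ Θ := contDiff_conv hgij.continuous hgijc hf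
  have hlap : lap Φ = Θ := by
    rw [hΦdef, lap_conv hgj hgjc hφ, show lap φ = pd i f from funext heq, conv_pd hgj hgjc hf]
  have hΦ0 : Φ 0 = ∫ x, g x * pd j φ (-x) := by
    rw [hΦdef, ← conv_pd hg hgc hφ, conv_apply]; simp
  obtain ⟨CΦ, g0, g1, g2⟩ := exists_growth hgj hgjc hφ hφw
  obtain ⟨CΘ, k0, k1, k2⟩ := exists_growth hgij hgijc hf hfw
  set D : ℝ → ℝ := fun t => ∫ z, gauss 1 z * Φ (Real.sqrt t • z) with hD
  set d : ℝ → ℝ := fun t => ∫ z, gauss 1 z * Θ (Real.sqrt t • z) with hd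
  have hDd : ∀ t, 0 < t → HasDerivAt D (d t) t := fun t ht => by
    have := hasDerivAt_average hΦ g0 g1 g2 ht
    rwa [hlap] at this
  have hdc : ∀ t, 0 < t → ContinuousAt d t := fun t ht => (hasDerivAt_average hΘ k0 k1 k2 ht).continuousAt
  have hD' : ∀ t, 0 < t → D t = ∫ x, φ (-x) * heatExt (pd j g) (t, x) := fun t ht => by
    rw [hD]; simp only
    rw [integral_gauss_scale ht, integral_gauss_mul_conv ht hgj.continuous hgjc hφ.continuous hφw]
  have hd' : ∀ t, 0 < t → d t = ∫ x, f (-x) * heatExt (pd i (pd j g)) (t, x) := fun t ht => by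
    rw [hd]; simp only
    rw [integral_gauss_scale ht, integral_gauss_mul_conv ht hgij.continuous hgijc hf.continuous hfw]
  have hfneg : ∫ x, |f (-x)| ^ p = ∫ x, |f x| ^ p := integral_neg_eq_self (fun x => |f x| ^ p) volume
  set B := C * ((∫ x, |f x| ^ p) + ∫ x, |g x| ^ q) with hB
  have hdiff : ∀ a b, 0 < a → a ≤ b → |D a| ≤ |D b| + B := by
    intro a b ha hab
    have hpos : ∀ t ∈ uIcc a b, 0 < t := fun t ht => by rw [uIcc_of_le hab] at ht; exact ha.trans_le ht.1
    have hint : IntervalIntegrable d volume a b :=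
      ContinuousOn.intervalIntegrable fun t ht => (hdc t (hpos t ht)).continuousWithinAt
    have h1 := intervalIntegral.integral_eq_sub_of_hasDerivAt (fun t ht => hDd t (hpos t ht)) hint
    have h2 := hflow (fun x => f (-x)) g (hf.continuous.comp continuous_neg) hfp.comp_neg
      (by simpa using hfw.comp_neg) hg hgc i j a b ha hab
    rw [hfneg, ← intervalIntegral.integral_congr (fun t ht => hd' t (hpos t ht)), h1] at h2
    have h3 := abs_sub_abs_le_abs_sub (D a) (D b)
    rw [abs_sub_comm] at h3
    linarith
  obtain ⟨M, hM0, hM, hM'⟩ := exists_abs_heatExt_pd_le hg hgc j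
  -- No decay of Φ is known, so the flow is read on the side of g, where it tends to zero pointwise
  -- under a bound uniform in time.
  have htop : Filter.Tendsto D Filter.atTop (nhds 0) := by
    have : Filter.Tendsto (fun t => ∫ x, φ (-x) * heatExt (pd j g) (t, x)) Filter.atTop (nhds (∫ _ : E3, (0 : ℝ))) := by
      refine tendsto_integral_filter_of_dominated_convergence (fun x => M * |φ (-x) / (1 + ‖-x‖ ^ 2) ^ 2|) ?_ ?_ ?_ ?_
      · filter_upwards [Filter.eventually_gt_atTop 0] with t ht
        exact ((hφ.continuous.comp continuous_neg).mul
          (hasDerivAt_slice (contDiffOn_heatExt hgj.continuous hgjc) ht).1.continuous).aestronglyMeasurable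
      · filter_upwards [Filter.eventually_gt_atTop 0] with t ht
        refine .of_forall fun x => ?_
        rw [norm_mul, Real.norm_eq_abs, Real.norm_eq_abs, abs_div, norm_neg, abs_of_pos (by positivity : 0 < (1 + ‖x‖ ^ 2) ^ 2)]
        calc _ ≤ |φ (-x)| * (M * ((1 + ‖x‖ ^ 2) ^ 2)⁻¹) := mul_le_mul_of_nonneg_left (hM t ht x) (abs_nonneg _)
          _ = _ := by rw [div_eq_mul_inv]; ring
      · exact (hφw.abs.comp_neg).const_mul M
      · refine .of_forall fun x => ?_
        have h1 : Filter.Tendsto (fun t : ℝ => M * (Real.sqrt t ^ 4)⁻¹) Filter.atTop (nhds (M * 0)) :=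
          ((tendsto_inv_atTop_zero.comp ((Filter.tendsto_pow_atTop (by norm_num : (4 : ℕ) ≠ 0)).comp
            Real.tendsto_sqrt_atTop))).const_mul M
        rw [mul_zero] at h1
        have h2 : Filter.Tendsto (fun t => heatExt (pd j g) (t, x)) Filter.atTop (nhds 0) := by
          refine squeeze_zero_norm' ?_ h1
          filter_upwards [Filter.eventually_gt_atTop 0] with t ht using hM' t ht x
        simpa using h2.const_mul (φ (-x))
    rw [integral_zero] at this
    refine this.congr' ?_
    filter_upwards [Filter.eventually_gt_atTop 0] with t ht using (hD' t ht).symm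
  have h0 : Filter.Tendsto D (nhdsWithin 0 (Ioi 0)) (nhds (Φ 0)) := tendsto_average_zero hΦ.continuous g0
  have hb : ∀ b, 0 < b → |Φ 0| ≤ |D b| + B := fun b hb => by
    refine le_of_tendsto h0.abs ?_
    filter_upwards [Ioo_mem_nhdsGT hb] with a ha using hdiff a b ha.1 ha.2.le
  have hfin : Filter.Tendsto (fun b => |D b| + B) Filter.atTop (nhds (|0| + B)) := htop.abs.add_const B
  rw [abs_zero, zero_add] at hfin
  rw [← hΦ0]
  refine ge_of_tendsto hfin ?_
  filter_upwards [Filter.eventually_gt_atTop 0] with b hb' using hb b hb'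

/-- The single envelope ψ, continuous and compactly supported, allows dominated convergence in all
integrals at once. -/
theorem exists_smooth_approx {g : E3 → ℝ} (hg : Continuous g) (hgc : HasCompactSupport g) :
    ∃ (ψ : E3 → ℝ) (G : ℕ → E3 → ℝ), Continuous ψ ∧ HasCompactSupport ψ ∧ (∀ n, ContDiff ℝ ∞ (G n)) ∧
      (∀ n, HasCompactSupport (G n)) ∧ (∀ n x, |G n x| ≤ ψ x) ∧
      ∀ x, Filter.Tendsto (fun n => G n x) Filter.atTop (nhds (g x)) := by
  obtain ⟨C', -, hC'⟩ := exists_cutoff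
  obtain ⟨ρ, hρ⟩ := hgc.isBounded.exists_norm_le
  obtain ⟨χ, c1, c2, c3, c4, c5, -⟩ := hC' (max ρ 1) (by positivity)
  obtain ⟨M, hM⟩ := hgc.exists_bound_of_continuous hg
  have hu : UniformContinuous g := hgc.uniformContinuous_of_continuous hg
  choose k k1 k2 using fun n : ℕ => hu.exists_contDiff_dist_le (ε := 1 / ((n : ℝ) + 1)) (by positivity)
  refine ⟨fun x => (M + 1) * χ x, fun n x => χ x * k n x, continuous_const.mul c1.continuous, c2.mul_left,
    fun n => c1.mul (k1 n), fun n => c2.mul_right, fun n x => ?_, fun x => ?_⟩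
  · rw [abs_mul, abs_of_nonneg (c3 x), mul_comm]
    refine mul_le_mul_of_nonneg_right ?_ (c3 x)
    have h1 := k2 n x
    have h2 : 1 / ((n : ℝ) + 1) ≤ 1 := by
      rw [div_le_one (by positivity)]; linarith [(Nat.cast_nonneg n : (0 : ℝ) ≤ n)]
    have h3 := hM x
    rw [Real.dist_eq] at h1
    have h4 := abs_sub_abs_le_abs_sub (k n x) (g x)
    rw [Real.norm_eq_abs] at h3
    linarith
  · have h1 : Filter.Tendsto (fun n => k n x) Filter.atTop (nhds (g x)) := by
      rw [tendsto_iff_dist_tendsto_zero]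
      exact squeeze_zero (fun n => dist_nonneg) (fun n => (k2 n x).le) tendsto_one_div_add_atTop_nhds_zero_nat
    have h2 : χ x * g x = g x := by
      by_cases hx : g x = 0
      · simp [hx]
      · rw [c5 x ((hρ x (subset_tsupport g hx)).trans (le_max_left _ _)), one_mul]
    simpa only [h2] using h1.const_mul (χ x)

theorem exists_pairing_bound_continuous {p q : ℝ} (hp1 : 1 < p) (hq1 : 1 < q) (hq : p⁻¹ + q⁻¹ = 1) :
    ∃ C : ℝ, 0 < C ∧ ∀ φ f g : E3 → ℝ, ContDiff ℝ ∞ φ → ContDiff ℝ ∞ f →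
      (Integrable fun x => φ x / (1 + ‖x‖ ^ 2) ^ 2) → (Integrable fun x => |f x| ^ p) →
      Continuous g → HasCompactSupport g → ∀ i j : Fin 3, (∀ x, lap φ x = pd i f x) →
      |∫ x, g x * pd j φ (-x)| ≤ C * ((∫ x, |f x| ^ p) + ∫ x, |g x| ^ q) := by
  obtain ⟨C, hC, h⟩ := exists_pairing_bound hp1 hq1 hq
  refine ⟨C, hC, fun φ f g hφ hf hφw hfp hg hgc i j heq => ?_⟩
  obtain ⟨ψ, G, hψ, hψc, hG, hGc, hGψ, hGt⟩ := exists_smooth_approx hg hgc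
  have hφj : Continuous fun x => pd j φ (-x) := (hφ.pd_infty j).continuous.comp continuous_neg
  have hψ0 : ∀ x, 0 ≤ ψ x := fun x => (abs_nonneg _).trans (hGψ 0 x)
  have l1 : Filter.Tendsto (fun n => ∫ x, G n x * pd j φ (-x)) Filter.atTop (nhds (∫ x, g x * pd j φ (-x))) := by
    refine tendsto_integral_of_dominated_convergence (fun x => ψ x * |pd j φ (-x)|)
      (fun n => ((hG n).continuous.mul hφj).aestronglyMeasurable)
      ((hψ.mul hφj.abs).integrable_of_hasCompactSupport hψc.mul_right) (fun n => .of_forall fun x => ?_)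
      (.of_forall fun x => (hGt x).mul_const _)
    rw [norm_mul]
    exact mul_le_mul_of_nonneg_right (hGψ n x) (norm_nonneg _)
  have l2 : Filter.Tendsto (fun n => ∫ x, |G n x| ^ q) Filter.atTop (nhds (∫ x, |g x| ^ q)) := by
    refine tendsto_integral_of_dominated_convergence (fun x => ψ x ^ q)
      (fun n => ((hG n).continuous.abs.rpow_const fun x => Or.inr (by linarith)).aestronglyMeasurable)
      ((hψ.rpow_const fun x => Or.inr (by linarith)).integrable_of_hasCompactSupport
        (hψc.comp_left (g := fun s : ℝ => s ^ q) (Real.zero_rpow (by linarith)))) (fun n => .of_forall fun x => ?_)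
      (.of_forall fun x => ?_)
    · rw [Real.norm_of_nonneg (Real.rpow_nonneg (abs_nonneg _) _)]
      exact Real.rpow_le_rpow (abs_nonneg _) (hGψ n x) (by linarith)
    · exact ((Real.continuous_rpow_const (by linarith : 0 ≤ q)).tendsto _).comp (hGt x).abs
  exact le_of_tendsto_of_tendsto l1.abs ((l2.const_add _).const_mul C)
    (.of_forall fun n => h φ f (G n) hφ hf hφw hfp (hG n) (hGc n) i j heq)

/-- The odd power `|y|^(p-1) sgn y`. -/
noncomputable def oddPow (p y : ℝ) : ℝ := max y 0 ^ (p - 1) - max (-y) 0 ^ (p - 1)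

theorem continuous_oddPow {p : ℝ} (hp : 1 < p) : Continuous (oddPow p) :=
  ((continuous_id.max continuous_const).rpow_const fun _ => Or.inr (by linarith)).sub
    ((continuous_neg.max continuous_const).rpow_const fun _ => Or.inr (by linarith))

theorem oddPow_mul {p : ℝ} (hp : 1 < p) (y : ℝ) : oddPow p y * y = |y| ^ p := by
  unfold oddPow
  rcases lt_trichotomy y 0 with h | rfl | h
  · rw [max_eq_right h.le, max_eq_left (by linarith), Real.zero_rpow (by linarith), abs_of_neg h,
      Real.rpow_sub_one (by linarith)]
    have : y ≠ 0 := h.ne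
    field_simp; ring
  · simp [Real.zero_rpow (by linarith : p ≠ 0)]
  · rw [max_eq_left h.le, max_eq_right (by linarith), Real.zero_rpow (by linarith), abs_of_pos h,
      Real.rpow_sub_one h.ne']
    field_simp; ring

theorem abs_oddPow {p : ℝ} (hp : 1 < p) (y : ℝ) : |oddPow p y| = |y| ^ (p - 1) := by
  unfold oddPow
  rcases le_total y 0 with h | h
  · rw [max_eq_right h, max_eq_left (by linarith), Real.zero_rpow (by linarith), abs_of_nonpos h, zero_sub, abs_neg,
      abs_of_nonneg (Real.rpow_nonneg (by linarith) _)]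
  · rw [max_eq_left h, max_eq_right (by linarith), Real.zero_rpow (by linarith), abs_of_nonneg h, sub_zero,
      abs_of_nonneg (Real.rpow_nonneg h _)]

/-- Duality with the extremal test function g = sχ|y|^(p−1) sgn y, where y(x) = ∂ⱼφ(−x). As (p−1)q =
p, both the pairing and ‖g‖_q^q are controlled through ∫χ|y|^p, the latter with the factor s^q; for
small s it is absorbed. The cutoff χ makes the absorbed quantity finite. -/
theorem exists_cz_integral_bound {p : ℝ} (hp1 : 1 < p) :
    ∃ C : ℝ, 0 < C ∧ ∀ φ f : E3 → ℝ, ContDiff ℝ ∞ φ → ContDiff ℝ ∞ f →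
      (Integrable fun x => φ x / (1 + ‖x‖ ^ 2) ^ 2) → (Integrable fun x => |f x| ^ p) →
      ∀ i j : Fin 3, (∀ x, lap φ x = pd i f x) →
      ∫⁻ x, ENNReal.ofReal (|pd j φ x| ^ p) ≤ ENNReal.ofReal (C * ∫ x, |f x| ^ p) := by
  set q := p / (p - 1) with hqdef
  have hp10 : 0 < p - 1 := by linarith
  have hq1 : 1 < q := by rw [hqdef, lt_div_iff₀ hp10]; linarith
  have hq : p⁻¹ + q⁻¹ = 1 := by rw [hqdef]; field_simp; ring
  have hpq : (p - 1) * q = p := by rw [hqdef]; field_simp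
  obtain ⟨C, hC, h⟩ := exists_pairing_bound_continuous hp1 hq1 hq
  have hq10 : 0 < q - 1 := by linarith
  -- Chosen so that C·s^q = s/2: the term in g then takes exactly half of the left side.
  set s := (1 / (2 * C)) ^ (q - 1)⁻¹ with hs
  have hs0 : 0 < s := by positivity
  have hsq : C * s ^ q = s / 2 := by
    have h1 : s ^ (q - 1) = 1 / (2 * C) := by
      rw [hs, ← Real.rpow_mul (by positivity), inv_mul_cancel₀ hq10.ne', Real.rpow_one]
    have h2 : s ^ q = s ^ (q - 1) * s := by
      rw [← Real.rpow_add_one hs0.ne']; congr 1; ring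
    rw [h2, h1]; field_simp
  refine ⟨2 * C / s, by positivity, fun φ f hφ hf hφw hfp i j heq => ?_⟩
  obtain ⟨C', -, hC'⟩ := exists_cutoff
  choose! χ c1 c2 c3 c4 c5 c6 using hC'
  have hR : ∀ n : ℕ, (0 : ℝ) < n + 1 := fun n => by positivity
  set y : E3 → ℝ := fun x => pd j φ (-x) with hy
  have hyc : Continuous y := (hφ.pd_infty j).continuous.comp continuous_neg
  have hyp : Continuous fun x => |y x| ^ p := hyc.abs.rpow_const fun x => Or.inr (by linarith)
  have hcut : ∀ n : ℕ, ∫ x, χ (n + 1) x * |y x| ^ p ≤ 2 * C / s * ∫ x, |f x| ^ p := by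
    intro n
    set χn := χ (n + 1) with hχn
    have hXi : Integrable fun x => χn x * |y x| ^ p :=
      ((c1 _ (hR n)).continuous.mul hyp).integrable_of_hasCompactSupport (c2 _ (hR n)).mul_right
    have hgc : Continuous fun x => s * (χn x * oddPow p (y x)) :=
      continuous_const.mul ((c1 _ (hR n)).continuous.mul ((continuous_oddPow hp1).comp hyc))
    have hgcs : HasCompactSupport fun x => s * (χn x * oddPow p (y x)) := ((c2 _ (hR n)).mul_right).mul_left
    have h1 := h φ f _ hφ hf hφw hfp hgc hgcs i j heq
    have h2 : ∫ x, s * (χn x * oddPow p (y x)) * pd j φ (-x) = s * ∫ x, χn x * |y x| ^ p := by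
      rw [← integral_const_mul]
      refine integral_congr_ae (.of_forall fun x => ?_)
      simp only
      rw [← oddPow_mul hp1 (y x)]; simp only [hy]; ring
    have h3 : ∫ x, |s * (χn x * oddPow p (y x))| ^ q ≤ s ^ q * ∫ x, χn x * |y x| ^ p := by
      rw [← integral_const_mul]
      refine integral_mono ?_ (hXi.const_mul _) fun x => ?_
      · exact (hgc.abs.rpow_const fun x => Or.inr (by linarith)).integrable_of_hasCompactSupport
          (hgcs.norm.comp_left (g := fun s : ℝ => s ^ q) (Real.zero_rpow (by linarith)))
      · simp only
        have h4 : 0 ≤ χn x := c3 _ (hR n) x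
        rw [abs_mul, abs_of_pos hs0, abs_mul, abs_of_nonneg h4, abs_oddPow hp1,
          Real.mul_rpow hs0.le (by positivity), Real.mul_rpow h4 (by positivity), ← Real.rpow_mul (abs_nonneg _), hpq]
        -- Because 0 ≤ χ ≤ 1 and q > 1; the q-th power of the test function is thus bounded by the
        -- same cutoff integral.
        have h5 : χn x ^ q ≤ χn x := by
          conv_rhs => rw [← Real.rpow_one (χn x)]
          exact Real.rpow_le_rpow_of_exponent_ge' h4 (c4 _ (hR n) x) zero_le_one hq1.le
        gcongr
    rw [h2, abs_of_nonneg (mul_nonneg hs0.le (integral_nonneg fun x =>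
      mul_nonneg (c3 _ (hR n) x) (Real.rpow_nonneg (abs_nonneg _) _)))] at h1
    have h6 : C * ∫ x, |s * (χn x * oddPow p (y x))| ^ q ≤ s / 2 * ∫ x, χn x * |y x| ^ p := by
      rw [← hsq, mul_assoc]; exact mul_le_mul_of_nonneg_left h3 hC.le
    rw [mul_add] at h1
    rw [div_mul_eq_mul_div, le_div_iff₀ hs0]
    linarith
  have e1 : ∫⁻ x, ENNReal.ofReal (|pd j φ x| ^ p) = ∫⁻ x, ENNReal.ofReal (|y x| ^ p) :=
    (lintegral_neg_eq_self (fun x => ENNReal.ofReal (|pd j φ x| ^ p))).symm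
  rw [e1]
  calc _ = ∫⁻ x, Filter.liminf (fun n : ℕ => ENNReal.ofReal (χ (n + 1) x * |y x| ^ p)) Filter.atTop := by
        refine lintegral_congr fun x => (Filter.Tendsto.liminf_eq ?_).symm
        refine tendsto_const_nhds.congr' ?_
        obtain ⟨N, hN⟩ := exists_nat_gt ‖x‖
        filter_upwards [Filter.eventually_ge_atTop N] with n hn
        have : (N : ℝ) ≤ n := by exact_mod_cast hn
        rw [c5 _ (hR n) _ (by linarith), one_mul]
    _ ≤ Filter.liminf (fun n : ℕ => ∫⁻ x, ENNReal.ofReal (χ (n + 1) x * |y x| ^ p)) Filter.atTop :=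
        lintegral_liminf_le fun n => ((c1 _ (hR n)).continuous.mul hyp).measurable.ennreal_ofReal
    _ ≤ Filter.liminf (fun _ : ℕ => ENNReal.ofReal (2 * C / s * ∫ x, |f x| ^ p)) Filter.atTop := by
        refine Filter.liminf_le_liminf (.of_forall fun n => ?_)
        rw [← ofReal_integral_eq_lintegral_ofReal]
        · exact ENNReal.ofReal_le_ofReal (hcut n)
        · exact ((c1 _ (hR n)).continuous.mul hyp).integrable_of_hasCompactSupport (c2 _ (hR n)).mul_right
        · exact .of_forall fun x => mul_nonneg (c3 _ (hR n) x) (Real.rpow_nonneg (abs_nonneg _) _)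
    _ = _ := Filter.liminf_const _

/-- The Calderón–Zygmund estimate for `Δ φ = ∂ᵢ f`. -/
theorem exists_cz_bound {p : ℝ} (hp1 : 1 < p) :
    ∃ C : ℝ, 0 < C ∧ ∀ φ f : E3 → ℝ, ContDiff ℝ ∞ φ → ContDiff ℝ ∞ f →
      (Integrable fun x => φ x / (1 + ‖x‖ ^ 2) ^ 2) → ∀ i j : Fin 3, (∀ x, lap φ x = pd i f x) →
      eLpNorm (pd j φ) (ENNReal.ofReal p) volume ≤ ENNReal.ofReal C * eLpNorm f (ENNReal.ofReal p) volume := by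
  obtain ⟨C, hC, h⟩ := exists_cz_integral_bound hp1
  have hp0 : 0 < p := by linarith
  have hpe : ENNReal.ofReal p ≠ 0 := by simpa using hp0
  refine ⟨C ^ p⁻¹, by positivity, fun φ f hφ hf hφw i j heq => ?_⟩
  have hCp : ENNReal.ofReal (C ^ p⁻¹) = ENNReal.ofReal C ^ p⁻¹ := (ENNReal.ofReal_rpow_of_pos hC).symm
  have hCp0 : ENNReal.ofReal (C ^ p⁻¹) ≠ 0 := by simp; positivity
  by_cases hfin : eLpNorm f (ENNReal.ofReal p) volume = ⊤
  · rw [hfin, ENNReal.mul_top hCp0]; exact le_top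
  have hmem : MemLp f (ENNReal.ofReal p) volume := ⟨hf.continuous.aestronglyMeasurable, lt_top_iff_ne_top.2 hfin⟩
  have hfp : Integrable fun x => |f x| ^ p := by
    have := hmem.integrable_norm_rpow hpe ENNReal.ofReal_ne_top
    simpa only [ENNReal.toReal_ofReal hp0.le, Real.norm_eq_abs] using this
  have e : ∀ k : E3 → ℝ, eLpNorm k (ENNReal.ofReal p) volume = (∫⁻ x, ENNReal.ofReal (|k x| ^ p)) ^ p⁻¹ := by
    intro k
    rw [eLpNorm_eq_lintegral_rpow_enorm_toReal hpe ENNReal.ofReal_ne_top, ENNReal.toReal_ofReal hp0.le, one_div]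
    congr 1
    refine lintegral_congr fun x => ?_
    rw [← ofReal_norm, Real.norm_eq_abs, ENNReal.ofReal_rpow_of_nonneg (abs_nonneg _) hp0.le]
  rw [e, e, hCp, ← ENNReal.mul_rpow_of_nonneg _ _ (by positivity)]
  refine ENNReal.rpow_le_rpow ((h φ f hφ hf hφw hfp i j heq).trans ?_) (by positivity)
  rw [ENNReal.ofReal_mul hC.le, ofReal_integral_eq_lintegral_ofReal hfp
    (.of_forall fun x => Real.rpow_nonneg (abs_nonneg _) _)]

/-- Liouville's theorem for functions of moderate growth in the mean. -/
theorem pd_eq_zero_of_lap_eq_zero {φ : E3 → ℝ} (hφ : ContDiff ℝ ∞ φ)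
    (hφw : Integrable fun x => φ x / (1 + ‖x‖ ^ 2) ^ 2) (h : ∀ x, lap φ x = 0) (j : Fin 3) (x : E3) : pd j φ x = 0 := by
  obtain ⟨C, hC, hcz⟩ := exists_cz_bound one_lt_two
  -- The Calderón–Zygmund estimate with right-hand side zero.
  have h1 := hcz φ (fun _ => 0) hφ contDiff_const hφw 0 j (fun x => by rw [h]; simp [pd])
  rw [eLpNorm_zero', mul_zero, nonpos_iff_eq_zero, eLpNorm_eq_zero_iff
    (hφ.pd_infty j).continuous.aestronglyMeasurable (by simp)] at h1
  exact congr_fun ((hφ.pd_infty j).continuous.ae_eq_iff_eq volume continuous_const |>.1 h1) x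

/-! ### Axisymmetric vector fields -/

theorem ae_coord_ne : ∀ᵐ x : E3, x 0 ≠ 0 := by
  have h1 : (volume : Measure E3) (LinearMap.ker (EuclideanSpace.proj (𝕜 := ℝ) (0 : Fin 3) : E3 →L[ℝ] ℝ).toLinearMap : Submodule ℝ E3) = 0 := by
    refine Measure.addHaar_submodule _ _ fun h => ?_
    have h2 : (EuclideanSpace.single 0 1 : E3) ∈ LinearMap.ker (EuclideanSpace.proj (𝕜 := ℝ) (0 : Fin 3) : E3 →L[ℝ] ℝ).toLinearMap := by
      rw [h]; trivial
    simp at h2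
  filter_upwards [compl_mem_ae_iff.2 h1] with x hx h0
  exact hx (by simpa using h0)

theorem rad_ne_zero {x : E3} (h : x 0 ≠ 0) : rad x ≠ 0 := fun h' => h (rad_eq_zero_iff.1 h').1

theorem ae_rad_ne : ∀ᵐ x : E3, rad x ≠ 0 := ae_coord_ne.mono fun _ => rad_ne_zero

/-- Identities on the axis are obtained by dividing off the null set x₁ = 0 and extending by
continuity. -/
theorem eq_of_forall_coord_ne {f g : E3 → ℝ} (hf : Continuous f) (hg : Continuous g)
    (h : ∀ x, x 0 ≠ 0 → f x = g x) (x : E3) : f x = g x :=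
  congr_fun ((hf.ae_eq_iff_eq volume hg).1 (ae_coord_ne.mono h)) x

theorem continuous_rad : Continuous rad := by
  have h0 := (contDiff_coord (n := 0) 0).continuous
  have h1 := (contDiff_coord (n := 0) 1).continuous
  exact ((h0.pow 2).add (h1.pow 2)).sqrt

theorem continuous_coord (i : Fin 3) : Continuous fun x : E3 => x i := (contDiff_coord (n := 0) i).continuous

theorem contDiff_parametric_integral (n : ℕ) {F : Type} [NormedAddCommGroup F] [NormedSpace ℝ F] [CompleteSpace F]
    {K : E3 × ℝ → F} (hK : ContDiff ℝ ∞ K) : ContDiff ℝ n fun x => ∫ s in (0 : ℝ)..1, K (x, s) := by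
  induction n generalizing F with
  | zero =>
    refine contDiff_zero.2 ?_
    exact intervalIntegral.continuous_parametric_intervalIntegral_of_continuous' (f := fun x s => K (x, s)) hK.continuous 0 1
  | succ n ih =>
    have hK' : ContDiff ℝ ∞ fun z => (fderiv ℝ K z).comp (ContinuousLinearMap.inl ℝ E3 ℝ) :=
      (hK.fderiv_right (by simp)).clm_comp contDiff_const
    refine (contDiff_succ_iff_hasFDerivAt (n := n)).2 ⟨_, ih hK', fun x => ?_⟩
    have hc : IsCompact (Metric.closedBall x 1 ×ˢ Icc (0 : ℝ) 1) := (isCompact_closedBall x 1).prod isCompact_Icc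
    obtain ⟨M, hM⟩ := hc.exists_bound_of_continuousOn hK'.continuous.continuousOn
    refine (intervalIntegral.hasFDerivAt_integral_of_dominated_of_fderiv_le (F := fun x s => K (x, s))
      (F' := fun x s => (fderiv ℝ K (x, s)).comp (ContinuousLinearMap.inl ℝ E3 ℝ)) (bound := fun _ => M)
      (Metric.ball_mem_nhds x one_pos) ?_ ?_ ?_ ?_ (by simp) ?_)
    · exact .of_forall fun y => (hK.continuous.comp (by fun_prop)).aestronglyMeasurable
    · exact (hK.continuous.comp (by fun_prop)).intervalIntegrable _ _
    · exact (hK'.continuous.comp (by fun_prop : Continuous fun s : ℝ => (x, s))).aestronglyMeasurable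
    · refine .of_forall fun s hs y hy => hM (y, s) ⟨Metric.ball_subset_closedBall hy, ?_⟩
      rw [uIoc_of_le zero_le_one] at hs
      exact Ioc_subset_Icc_self hs
    · refine .of_forall fun s _ y _ => ?_
      exact ((hK.differentiable (by simp)) (y, s)).hasFDerivAt.comp y (hasFDerivAt_prodMk_left y s)

/-- The horizontal components of an axisymmetric field, described infinitesimally. -/
structure RotPair (a b : E3 → ℝ) : Prop where
  smooth_fst : ContDiff ℝ ∞ a
  smooth_snd : ContDiff ℝ ∞ b
  rot_fst : ∀ x, rotDeriv a x = -b x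
  rot_snd : ∀ x, rotDeriv b x = a x

/-- The point `(τ x₁, τ x₂, x₃)`. -/
noncomputable def squeeze (τ : ℝ) (x : E3) : E3 := !₂[τ * x 0, τ * x 1, x 2]

theorem contDiff_squeeze : ContDiff ℝ ∞ fun z : E3 × ℝ => squeeze z.2 z.1 := by
  refine (contDiff_piLp 2).2 fun i => ?_
  have h : ∀ j : Fin 3, ContDiff ℝ ∞ fun z : E3 × ℝ => z.1 j := fun j => (contDiff_coord j).comp contDiff_fst
  fin_cases i
  · exact contDiff_snd.mul (h 0)
  · exact contDiff_snd.mul (h 1)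
  · exact h 2

/-- The smooth extension across the axis of the radial component divided by the radius. -/
noncomputable def quot (a b : E3 → ℝ) (x : E3) : ℝ :=
  ∫ τ in (0 : ℝ)..1, τ * (pd 0 a (squeeze τ x) + pd 1 b (squeeze τ x))

namespace RotPair

variable {a b : E3 → ℝ}

theorem contDiff_quot (h : RotPair a b) : ContDiff ℝ ∞ (quot a b) := by
  refine contDiff_infty.2 fun n => ?_
  have hK : ContDiff ℝ ∞ fun z : E3 × ℝ => z.2 * (pd 0 a (squeeze z.2 z.1) + pd 1 b (squeeze z.2 z.1)) :=
    contDiff_snd.mul (((h.smooth_fst.pd_infty 0).comp contDiff_squeeze).add ((h.smooth_snd.pd_infty 1).comp contDiff_squeeze))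
  exact contDiff_parametric_integral n hK

/-- The function `x₁ a + x₂ b`. -/
noncomputable def radial (a b : E3 → ℝ) (x : E3) : ℝ := x 0 * a x + x 1 * b x

theorem contDiff_radial (h : RotPair a b) : ContDiff ℝ ∞ (radial a b) :=
  ((contDiff_coord 0).mul h.smooth_fst).add ((contDiff_coord 1).mul h.smooth_snd)

theorem pd_radial (h : RotPair a b) (k : Fin 3) (x : E3) :
    pd k (radial a b) x = ((if k = 0 then a x else 0) + x 0 * pd k a x) + ((if k = 1 then b x else 0) + x 1 * pd k b x) := by
  have ha := h.smooth_fst.differentiable (by simp) x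
  have hb := h.smooth_snd.differentiable (by simp) x
  have h0 := differentiable_coord 0 x
  have h1 := differentiable_coord 1 x
  unfold radial
  rw [pd_add (f := fun y => y 0 * a y) (g := fun y => y 1 * b y) (h0.mul ha) (h1.mul hb),
    pd_mul (f := fun y : E3 => y 0) (g := a) h0 ha, pd_mul (f := fun y : E3 => y 1) (g := b) h1 hb, pd_coord, pd_coord]
  split_ifs <;> ring

/-- Both sides express r∂_r(x₁a + x₂b): the rotation relations exchange the mixed products x₁x₂∂₂a
and x₁x₂∂₁b for pure squares and cancel the undifferentiated terms. -/
theorem radial_pd (h : RotPair a b) (x : E3) :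
    x 0 * pd 0 (radial a b) x + x 1 * pd 1 (radial a b) x = rad x ^ 2 * (pd 0 a x + pd 1 b x) := by
  have e1 := h.rot_fst x
  have e2 := h.rot_snd x
  rw [rotDeriv] at e1 e2
  rw [h.pd_radial, h.pd_radial, rad_sq]
  simp
  linear_combination x 1 * e1 - x 0 * e2

/-- The function x₁a + x₂b vanishes on the axis. It is recovered by integrating its derivative along
the horizontal segment from the axis to x, and by `radial_pd` that derivative carries the factor
r²τ. -/
theorem rad_sq_mul_quot (h : RotPair a b) (x : E3) : rad x ^ 2 * quot a b x = x 0 * a x + x 1 * b x := by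
  have hd : ∀ τ : ℝ, HasDerivAt (fun τ => radial a b (squeeze τ x))
      (x 0 * pd 0 (radial a b) (squeeze τ x) + x 1 * pd 1 (radial a b) (squeeze τ x)) τ := by
    intro τ
    have h1 : HasDerivAt (fun τ => squeeze τ x) (!₂[x 0, x 1, 0] : E3) τ := by
      have e : (fun τ => squeeze τ x) = fun τ : ℝ => τ • (!₂[x 0, x 1, 0] : E3) + !₂[0, 0, x 2] := by
        funext τ; refine ext3 ?_ ?_ ?_ <;> simp [squeeze]
      rw [e]
      exact (((hasDerivAt_id τ).smul_const (!₂[x 0, x 1, 0] : E3)).add_const _).congr_deriv (by simp)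
    refine ((h.contDiff_radial.differentiable (by simp) _).hasFDerivAt.comp_hasDerivAt τ h1).congr_deriv ?_
    rw [fderiv_eq_sum_pd, Fin.sum_univ_three]
    simp
  have hval : ∀ τ : ℝ, x 0 * pd 0 (radial a b) (squeeze τ x) + x 1 * pd 1 (radial a b) (squeeze τ x)
      = rad x ^ 2 * (τ * (pd 0 a (squeeze τ x) + pd 1 b (squeeze τ x))) := by
    have hg : Continuous fun τ : ℝ => squeeze τ x := contDiff_squeeze.continuous.comp (by fun_prop : Continuous fun τ : ℝ => (x, τ))
    -- At the contracted point `radial_pd` carries one extra factor τ on both sides; it is cancelled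
    -- for τ ≠ 0, and continuity covers τ = 0.
    have hne : ∀ τ : ℝ, τ ≠ 0 → x 0 * pd 0 (radial a b) (squeeze τ x) + x 1 * pd 1 (radial a b) (squeeze τ x)
      = rad x ^ 2 * (τ * (pd 0 a (squeeze τ x) + pd 1 b (squeeze τ x))) := by
      intro τ hτ
      have h1 := h.radial_pd (squeeze τ x)
      rw [rad_sq] at h1 ⊢
      have s0 : squeeze τ x 0 = τ * x 0 := by simp [squeeze]
      have s1 : squeeze τ x 1 = τ * x 1 := by simp [squeeze]
      rw [s0, s1] at h1
      refine mul_left_cancel₀ hτ ?_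
      linear_combination h1
    have c1 : Continuous fun τ : ℝ => x 0 * pd 0 (radial a b) (squeeze τ x) + x 1 * pd 1 (radial a b) (squeeze τ x) :=
      (((h.contDiff_radial.pd_infty 0).continuous.comp hg).const_mul _).add
        (((h.contDiff_radial.pd_infty 1).continuous.comp hg).const_mul _)
    have c2 : Continuous fun τ : ℝ => rad x ^ 2 * (τ * (pd 0 a (squeeze τ x) + pd 1 b (squeeze τ x))) :=
      (continuous_id.mul (((h.smooth_fst.pd_infty 0).continuous.comp hg).add
        ((h.smooth_snd.pd_infty 1).continuous.comp hg))).const_mul _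
    exact fun τ => congr_fun (c1.ext_on (dense_compl_singleton (0 : ℝ)) c2 fun τ hτ => hne τ hτ) τ
  have hc : Continuous fun τ : ℝ => x 0 * pd 0 (radial a b) (squeeze τ x) + x 1 * pd 1 (radial a b) (squeeze τ x) := by
    have hg : Continuous fun τ : ℝ => squeeze τ x := contDiff_squeeze.continuous.comp (by fun_prop : Continuous fun τ : ℝ => (x, τ))
    exact (((h.contDiff_radial.pd_infty 0).continuous.comp hg).const_mul _).add
        (((h.contDiff_radial.pd_infty 1).continuous.comp hg).const_mul _)
  have hftc := intervalIntegral.integral_eq_sub_of_hasDerivAt (fun τ _ => hd τ) (hc.intervalIntegrable 0 1)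
  simp only [hval, intervalIntegral.integral_const_mul] at hftc
  have s1 : squeeze 1 x = x := by refine ext3 ?_ ?_ ?_ <;> simp [squeeze]
  have s0 : radial a b (squeeze 0 x) = 0 := by simp [radial, squeeze]
  rw [s1, s0, sub_zero] at hftc
  exact hftc

/-- Both x₁a + x₂b and r² are invariant under rotations, hence so is their quotient. -/
theorem rotDeriv_quot (h : RotPair a b) (x : E3) : rotDeriv (quot a b) x = 0 := by
  have hq := h.contDiff_quot
  have hS : radial a b = fun x => (x 0 ^ 2 + x 1 ^ 2) * quot a b x := by
    funext x; rw [← rad_sq, h.rad_sq_mul_quot]; rfl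
  refine eq_of_forall_coord_ne (f := rotDeriv (quot a b)) (g := fun _ => 0) ?_ continuous_const (fun x hx => ?_) x
  · exact ((continuous_coord 0).mul (hq.pd_infty 1).continuous).sub ((continuous_coord 1).mul (hq.pd_infty 0).continuous)
  have h0 := differentiable_coord 0 x
  have h1 := differentiable_coord 1 x
  have e : ∀ k, pd k (radial a b) x = (2 * x 0 * (if k = 0 then 1 else 0) + 2 * x 1 * (if k = 1 then 1 else 0)) * quot a b x
      + (x 0 ^ 2 + x 1 ^ 2) * pd k (quot a b) x := by
    intro k
    have hr : HasFDerivAt (fun y : E3 => y 0 ^ 2 + y 1 ^ 2) _ x := (h0.hasFDerivAt.pow 2).add (h1.hasFDerivAt.pow 2)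
    rw [hS, pd_mul (f := fun y : E3 => y 0 ^ 2 + y 1 ^ 2) hr.differentiableAt (hq.differentiable (by simp) x), hr.pd_eq]
    have p0 := pd_coord k 0 x
    have p1 := pd_coord k 1 x
    rw [pd] at p0 p1
    simp [p0, p1]
    ring
  have e1 := h.rot_fst x
  have e2 := h.rot_snd x
  have k0 := e 0
  have k1 := e 1
  rw [h.pd_radial] at k0 k1
  simp at k0 k1
  rw [rotDeriv] at e1 e2 ⊢
  have hpos : x 0 ^ 2 + x 1 ^ 2 ≠ 0 := by positivity
  refine mul_left_cancel₀ hpos ?_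
  linear_combination x 1 * k0 - x 0 * k1 + x 0 * e1 + x 1 * e2

theorem isAxisymmetricScalar_quot (h : RotPair a b) : IsAxisymmetricScalar (quot a b) :=
  isAxisymmetricScalar_of_rotDeriv (h.contDiff_quot.differentiable (by simp)) h.rotDeriv_quot

end RotPair

/-- The commutators of ∂ₖ with the generator of rotations, from which the equivariance of the curl
follows. -/
theorem rotDeriv_pd {f : E3 → ℝ} (hf : ContDiff ℝ ∞ f) (x : E3) :
    rotDeriv (pd 0 f) x = pd 0 (rotDeriv f) x - pd 1 f x ∧
    rotDeriv (pd 1 f) x = pd 1 (rotDeriv f) x + pd 0 f x ∧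
    rotDeriv (pd 2 f) x = pd 2 (rotDeriv f) x := by
  have hd : ∀ k, DifferentiableAt ℝ (pd k f) x := fun k => (hf.pd_infty k).differentiable (by simp) x
  have hc : ∀ i j, pd i (pd j f) x = pd j (pd i f) x := fun i j => congr_fun (pd_comm (contDiff_infty.1 hf 2) i j) x
  have e : ∀ k, pd k (rotDeriv f) x = ((if k = 0 then 1 else 0) * pd 1 f x + x 0 * pd k (pd 1 f) x)
      - ((if k = 1 then 1 else 0) * pd 0 f x + x 1 * pd k (pd 0 f) x) := by
    intro k
    have h0 := differentiable_coord 0 x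
    have h1 := differentiable_coord 1 x
    show pd k (fun x => x 0 * pd 1 f x - x 1 * pd 0 f x) x = _
    rw [pd_sub (f := fun x : E3 => x 0 * pd 1 f x) (g := fun x : E3 => x 1 * pd 0 f x) (h0.mul (hd 1)) (h1.mul (hd 0)),
      pd_mul (f := fun x : E3 => x 0) h0 (hd 1), pd_mul (f := fun x : E3 => x 1) h1 (hd 0), pd_coord, pd_coord]
    ring
  refine ⟨?_, ?_, ?_⟩ <;> rw [e, rotDeriv] <;> simp [hc 0 1, hc 2 0, hc 2 1] <;> ring

theorem _root_.ContDiff.comp_coord {v : E3 → E3} (hv : ContDiff ℝ ∞ v) (i : Fin 3) : ContDiff ℝ ∞ fun y => v y i :=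
  (contDiff_coord i).comp hv

theorem IsAxisymmetricField.rot {v : E3 → E3} (h : IsAxisymmetricField v) (hv : ContDiff ℝ ∞ v) :
    RotPair (fun y => v y 0) (fun y => v y 1) ∧ ∀ x, rotDeriv (fun y => v y 2) x = 0 := by
  have hc := hv.comp_coord
  have hcont : ∀ {f : E3 → ℝ}, ContDiff ℝ ∞ f → Continuous (rotDeriv f) := fun hf =>
    ((continuous_coord 0).mul (hf.pd_infty 1).continuous).sub ((continuous_coord 1).mul (hf.pd_infty 0).continuous)
  obtain ⟨vr, vθ, v3, h⟩ := h
  have hrot : ∀ x, x 0 ≠ 0 → ∀ a, v (rotate a x) 0 = Real.cos a * v x 0 - Real.sin a * v x 1 ∧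
      v (rotate a x) 1 = Real.sin a * v x 0 + Real.cos a * v x 1 ∧ v (rotate a x) 2 = v x 2 := by
    intro x hx a
    have hr := rad_ne_zero hx
    rw [h x hr, h (rotate a x) (by rwa [rad_rotate]), rad_rotate, rotate_apply_two]
    simp only [eR, eTheta, eThree, rad_rotate]
    refine ⟨?_, ?_, ?_⟩ <;> simp <;> ring
  have hder : ∀ x, x 0 ≠ 0 → rotDeriv (fun y => v y 0) x = -v x 1 ∧ rotDeriv (fun y => v y 1) x = v x 0 ∧
      rotDeriv (fun y => v y 2) x = 0 := by
    intro x hx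
    have hcs := Real.hasDerivAt_cos 0
    have hsn := Real.hasDerivAt_sin 0
    have hd : ∀ i, HasDerivAt (fun a => v (rotate a x) i) (rotDeriv (fun y => v y i) x) 0 := fun i => by
      have := hasDerivAt_comp_rotate ((hc i).differentiable (by simp)) x 0
      rwa [rotate_zero] at this
    refine ⟨(hd 0).unique ?_, (hd 1).unique ?_, (hd 2).unique ?_⟩
    · simp only [(hrot x hx _).1]
      exact ((hcs.mul_const (v x 0)).sub (hsn.mul_const (v x 1))).congr_deriv (by simp)
    · simp only [(hrot x hx _).2.1]
      exact ((hsn.mul_const (v x 0)).add (hcs.mul_const (v x 1))).congr_deriv (by simp)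
    · simp only [(hrot x hx _).2.2]
      exact hasDerivAt_const _ _
  exact ⟨⟨hc 0, hc 1, eq_of_forall_coord_ne (hcont (hc 0)) (hc 1).continuous.neg fun x hx => (hder x hx).1,
    eq_of_forall_coord_ne (hcont (hc 1)) (hc 0).continuous fun x hx => (hder x hx).2.1⟩,
    eq_of_forall_coord_ne (hcont (hc 2)) continuous_const fun x hx => (hder x hx).2.2⟩

theorem contDiff_curl {v : E3 → E3} (hv : ContDiff ℝ ∞ v) (i : Fin 3) : ContDiff ℝ ∞ fun y => curl v y i := by
  have h : ∀ k j, ContDiff ℝ ∞ (pd k fun y => v y j) := fun k j => (hv.comp_coord j).pd_infty k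
  fin_cases i
  · exact (h 1 2).sub (h 2 1)
  · exact (h 2 0).sub (h 0 2)
  · exact (h 0 1).sub (h 1 0)

theorem rotDeriv_sub {f g : E3 → ℝ} (hf : ContDiff ℝ ∞ f) (hg : ContDiff ℝ ∞ g) (x : E3) :
    rotDeriv (fun y => f y - g y) x = rotDeriv f x - rotDeriv g x := by
  have h1 := hf.differentiable (by simp) x
  have h2 := hg.differentiable (by simp) x
  simp only [rotDeriv, pd_sub h1 h2]
  ring

/-- The pair (ω₂, −ω₁) is the horizontal vorticity turned by a right angle, so its radial component
is ω^θ and its `quot` is the extension of Γ. -/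
theorem IsAxisymmetricField.rot_curl {v : E3 → E3} (h : IsAxisymmetricField v) (hv : ContDiff ℝ ∞ v) :
    RotPair (fun y => curl v y 1) (fun y => -curl v y 0) ∧ ∀ x, rotDeriv (fun y => curl v y 2) x = 0 := by
  obtain ⟨⟨-, -, h0, h1⟩, h2⟩ := h.rot hv
  have hc := hv.comp_coord
  have hp : ∀ k j, ContDiff ℝ ∞ (pd k fun y => v y j) := fun k j => (hc j).pd_infty k
  have r0 : rotDeriv (fun y => v y 0) = fun x => -v x 1 := funext h0
  have r1 : rotDeriv (fun y => v y 1) = fun x => v x 0 := funext h1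
  have r2 : rotDeriv (fun y => v y 2) = fun _ => 0 := funext h2
  have hneg : ∀ k x, pd k (fun x => -v x 1) x = -pd k (fun x => v x 1) x := fun k x => by
    have := pd_const_mul (f := fun x => v x 1) (x := x) (i := k) (-1) ((hc 1).differentiable (by simp) x)
    simpa using this
  have hz : ∀ k x, pd k (fun _ => (0 : ℝ)) x = 0 := fun k x => by simp [pd]
  have c0 : (fun y => curl v y 0) = fun y => pd 1 (fun y => v y 2) y - pd 2 (fun y => v y 1) y := rfl
  have c1 : (fun y => curl v y 1) = fun y => pd 2 (fun y => v y 0) y - pd 0 (fun y => v y 2) y := rfl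
  have c2 : (fun y => curl v y 2) = fun y => pd 0 (fun y => v y 1) y - pd 1 (fun y => v y 0) y := rfl
  have a0 : ∀ x, rotDeriv (fun y => curl v y 0) x = -curl v x 1 := fun x => by
    rw [c0, rotDeriv_sub (hp 1 2) (hp 2 1), (rotDeriv_pd (hc 2) x).2.1, (rotDeriv_pd (hc 1) x).2.2, r1, r2, hz]
    simp [curl]
  have a1 : ∀ x, rotDeriv (fun y => curl v y 1) x = curl v x 0 := fun x => by
    rw [c1, rotDeriv_sub (hp 2 0) (hp 0 2), (rotDeriv_pd (hc 0) x).2.2, (rotDeriv_pd (hc 2) x).1, r0, r2, hz, hneg]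
    simp [curl]; ring
  refine ⟨⟨contDiff_curl hv 1, (contDiff_curl hv 0).neg, fun x => by rw [a1]; simp, fun x => ?_⟩, fun x => ?_⟩
  · have := a0 x
    have e : ∀ k, pd k (fun y => -curl v y 0) x = -pd k (fun y => curl v y 0) x := fun k => by
      have := pd_const_mul (f := fun x => curl v x 0) (x := x) (i := k) (-1) ((contDiff_curl hv 0).differentiable (by simp) x)
      simpa using this
    rw [rotDeriv, e, e] at *
    linarith
  · rw [c2, rotDeriv_sub (hp 0 1) (hp 1 0), (rotDeriv_pd (hc 1) x).1, (rotDeriv_pd (hc 0) x).2.1, r0, r1, hneg]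
    ring

/-! ### The elliptic equation for the radial velocity -/

theorem lap_add {f g : E3 → ℝ} (hf : ContDiff ℝ ∞ f) (hg : ContDiff ℝ ∞ g) (x : E3) :
    lap (fun y => f y + g y) x = lap f x + lap g x := by
  have e : ∀ k, pd k (fun y => f y + g y) = fun y => pd k f y + pd k g y := fun k => funext fun y =>
    pd_add (hf.differentiable (by simp) y) (hg.differentiable (by simp) y) k
  simp only [lap, e]
  rw [← Finset.sum_add_distrib]
  exact Finset.sum_congr rfl fun k _ => pd_add ((hf.pd_infty k).differentiable (by simp) x) ((hg.pd_infty k).differentiable (by simp) x) k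

theorem lap_const_mul {f : E3 → ℝ} (hf : ContDiff ℝ ∞ f) (c : ℝ) (x : E3) :
    lap (fun y => c * f y) x = c * lap f x := by
  have e : ∀ k, pd k (fun y => c * f y) = fun y => c * pd k f y := fun k => funext fun y =>
    pd_const_mul c (hf.differentiable (by simp) y) k
  simp only [lap, e]
  rw [Finset.mul_sum]
  exact Finset.sum_congr rfl fun k _ => pd_const_mul c ((hf.pd_infty k).differentiable (by simp) x) k

theorem pd_coord_mul {f : E3 → ℝ} (hf : Differentiable ℝ f) (j k : Fin 3) (x : E3) :
    pd k (fun y => y j * f y) x = x j * pd k f x + f x * if k = j then 1 else 0 := by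
  rw [pd_mul (f := fun y : E3 => y j) (differentiable_coord j x) (hf x), pd_coord]

theorem lap_coord_mul {f : E3 → ℝ} (hf : ContDiff ℝ ∞ f) (j : Fin 3) (x : E3) :
    lap (fun y => y j * f y) x = x j * lap f x + 2 * pd j f x := by
  have hp : ∀ k, Differentiable ℝ (pd k f) := fun k => (hf.pd_infty k).differentiable (by simp)
  have e : ∀ k, pd k (fun y => y j * f y) = fun y => y j * pd k f y + f y * if k = j then 1 else 0 :=
    fun k => funext fun y => pd_coord_mul (hf.differentiable (by simp)) j k y
  have e2 : ∀ k, pd k (pd k (fun y => y j * f y)) x = x j * pd k (pd k f) x + if k = j then 2 * pd j f x else 0 := by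
    intro k
    rw [e]
    split_ifs with hkj
    · subst hkj
      simp only [mul_one]
      rw [pd_add (f := fun y : E3 => y k * pd k f y) ((differentiable_coord k x).mul (hp k x)) (hf.differentiable (by simp) x),
        pd_coord_mul (hp k), if_pos rfl]
      ring
    · simp only [mul_zero, add_zero]
      simp [pd_coord_mul (hp k), if_neg hkj]
  simp only [lap, e2, Finset.sum_add_distrib, Finset.mul_sum, Finset.sum_ite_eq', Finset.mem_univ, if_true]

namespace RotPair

variable {a b : E3 → ℝ}

theorem radial_eq (h : RotPair a b) : radial a b = fun y => y 0 * (y 0 * quot a b y) + y 1 * (y 1 * quot a b y) := by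
  funext y
  have := h.rad_sq_mul_quot y
  rw [rad_sq] at this
  rw [radial]
  linarith

/-- The horizontal divergence in cylindrical form, (1/r)∂_r(r·rQ) = 2Q + r∂_rQ with Q the quotient.
-/
theorem pd_horizontal (h : RotPair a b) (x : E3) :
    pd 0 a x + pd 1 b x = 2 * quot a b x + (x 0 * pd 0 (quot a b) x + x 1 * pd 1 (quot a b) x) := by
  have hq := h.contDiff_quot
  have hp := fun k => (hq.pd_infty k).continuous
  refine eq_of_forall_coord_ne (f := fun x => pd 0 a x + pd 1 b x) (g := fun x => 2 * quot a b x + (x 0 * pd 0 (quot a b) x + x 1 * pd 1 (quot a b) x))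
    ((h.smooth_fst.pd_infty 0).continuous.add (h.smooth_snd.pd_infty 1).continuous)
    ((hq.continuous.const_mul 2).add (((continuous_coord 0).mul (hp 0)).add ((continuous_coord 1).mul (hp 1)))) (fun x hx => ?_) x
  have h1 := h.radial_pd x
  have hd := hq.differentiable (by simp)
  have e : ∀ k, pd k (radial a b) x = (x 0 * (x 0 * pd k (quot a b) x + quot a b x * if k = 0 then 1 else 0) + x 0 * quot a b x * if k = 0 then 1 else 0)
      + (x 1 * (x 1 * pd k (quot a b) x + quot a b x * if k = 1 then 1 else 0) + x 1 * quot a b x * if k = 1 then 1 else 0) := by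
    intro k
    have d : ∀ j : Fin 3, Differentiable ℝ fun y : E3 => y j * quot a b y := fun j => (differentiable_coord j).mul hd
    rw [h.radial_eq, pd_add (f := fun y : E3 => y 0 * (y 0 * quot a b y)) (g := fun y : E3 => y 1 * (y 1 * quot a b y)) (((differentiable_coord 0).mul (d 0)) x) (((differentiable_coord 1).mul (d 1)) x),
      pd_coord_mul (d 0), pd_coord_mul (d 1), pd_coord_mul hd, pd_coord_mul hd]
  rw [e, e] at h1
  simp at h1
  rw [rad_sq] at h1
  have hpos : x 0 ^ 2 + x 1 ^ 2 ≠ 0 := by positivity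
  refine mul_left_cancel₀ hpos ?_
  linear_combination -h1

/-- The Laplacian of x₁a + x₂b is computed twice, from the product form and from r²Q; the divergence
that appears is removed with `pd_horizontal`. -/
theorem lap_quot (h : RotPair a b) (x : E3) :
    rad x ^ 2 * lap (quot a b) x + 2 * (x 0 * pd 0 (quot a b) x + x 1 * pd 1 (quot a b) x) = x 0 * lap a x + x 1 * lap b x := by
  have hq := h.contDiff_quot
  have c : ∀ j : Fin 3, ∀ {f : E3 → ℝ}, ContDiff ℝ ∞ f → ContDiff ℝ ∞ fun y : E3 => y j * f y := fun j _ hf => (contDiff_coord j).mul hf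
  have l1 : lap (radial a b) x = x 0 * lap a x + 2 * pd 0 a x + (x 1 * lap b x + 2 * pd 1 b x) := by
    unfold radial
    rw [lap_add (c 0 h.smooth_fst) (c 1 h.smooth_snd), lap_coord_mul h.smooth_fst, lap_coord_mul h.smooth_snd]
  have hd := hq.differentiable (by simp)
  have l2 : lap (radial a b) x = (x 0 * (x 0 * lap (quot a b) x + 2 * pd 0 (quot a b) x) + 2 * (x 0 * pd 0 (quot a b) x + quot a b x * 1))
      + (x 1 * (x 1 * lap (quot a b) x + 2 * pd 1 (quot a b) x) + 2 * (x 1 * pd 1 (quot a b) x + quot a b x * 1)) := by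
    rw [h.radial_eq, lap_add (c 0 (c 0 hq)) (c 1 (c 1 hq)), lap_coord_mul (c 0 hq), lap_coord_mul (c 1 hq),
      lap_coord_mul hq, lap_coord_mul hq, pd_coord_mul hd, pd_coord_mul hd, if_pos rfl, if_pos rfl]
  have h3 := h.pd_horizontal x
  rw [rad_sq]
  linear_combination l1 - l2 + 2 * h3

theorem abs_rotDeriv_le (f : E3 → ℝ) (x : E3) : |rotDeriv f x| ≤ rad x * (|pd 0 f x| + |pd 1 f x|) := by
  have h0 : |x 0| ≤ rad x := Real.abs_le_sqrt (by nlinarith [sq_nonneg (x 1)])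
  have h1 : |x 1| ≤ rad x := Real.abs_le_sqrt (by nlinarith [sq_nonneg (x 0)])
  rw [rotDeriv]
  calc _ ≤ |x 0 * pd 1 f x| + |x 1 * pd 0 f x| := abs_sub _ _
    _ ≤ _ := by
      rw [abs_mul, abs_mul]
      nlinarith [abs_nonneg (pd 0 f x), abs_nonneg (pd 1 f x)]

theorem rad_mul_abs_quot_le (h : RotPair a b) {x : E3} (hx : rad x ≠ 0) : rad x * |quot a b x| ≤ |a x| + |b x| := by
  have hr : 0 < rad x := (rad_nonneg x).lt_of_ne' hx
  have h0 : |x 0| ≤ rad x := Real.abs_le_sqrt (by nlinarith [sq_nonneg (x 1)])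
  have h1 : |x 1| ≤ rad x := Real.abs_le_sqrt (by nlinarith [sq_nonneg (x 0)])
  refine le_of_mul_le_mul_left ?_ hr
  calc rad x * (rad x * |quot a b x|) = |rad x ^ 2 * quot a b x| := by
        rw [abs_mul, abs_of_nonneg (sq_nonneg (rad x))]; ring
    _ = |x 0 * a x + x 1 * b x| := by rw [h.rad_sq_mul_quot]
    _ ≤ |x 0 * a x| + |x 1 * b x| := abs_add_le _ _
    _ ≤ _ := by
      rw [abs_mul, abs_mul]
      nlinarith [abs_nonneg (a x), abs_nonneg (b x)]

/-- The components a and b are, up to sign, each other's rotational derivatives, hence bounded by r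
times first derivatives. One factor r is gained, so the quotient is as integrable as the gradient.
-/
theorem abs_quot_le (h : RotPair a b) {x : E3} (hx : rad x ≠ 0) :
    |quot a b x| ≤ (|pd 0 a x| + |pd 1 a x|) + (|pd 0 b x| + |pd 1 b x|) := by
  have hr : 0 < rad x := (rad_nonneg x).lt_of_ne' hx
  refine le_of_mul_le_mul_left ((h.rad_mul_abs_quot_le hx).trans ?_) hr
  have e1 := abs_rotDeriv_le a x
  have e2 := abs_rotDeriv_le b x
  rw [h.rot_fst, abs_neg] at e1
  rw [h.rot_snd] at e2
  linarith

end RotPair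

theorem integrable_prod_weight : Integrable fun x : E3 => ∏ i : Fin 3, (1 + ‖x i‖) ^ (-(4 / 3) : ℝ) := by
  have h1 : Integrable fun s : ℝ => (1 + ‖s‖) ^ (-(4 / 3) : ℝ) := integrable_one_add_norm (by simp; norm_num)
  have h2 : Integrable fun x : Fin 3 → ℝ => ∏ i : Fin 3, (1 + ‖x i‖) ^ (-(4 / 3) : ℝ) :=
    Integrable.fintype_prod (f := fun _ s => (1 + ‖s‖) ^ (-(4 / 3) : ℝ)) fun _ => h1
  exact ((PiLp.volume_preserving_ofLp (Fin 3)).integrable_comp_emb (MeasurableEquiv.toLp 2 (Fin 3 → ℝ)).symm.measurableEmbedding).2 h2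

/-- The four powers are shared as 4/3 per coordinate: x₁ and x₂ take one power each from (1+r)², x₃
takes one from (1+|x|)², and the last power of 1+|x| is divided into three cube roots. Since 4/3 >
1, the product is integrable. -/
theorem inv_weight_le (x : E3) : (((1 + rad x) * (1 + ‖x‖)) ^ 2)⁻¹ ≤ ∏ i : Fin 3, (1 + ‖x i‖) ^ (-(4 / 3) : ℝ) := by
  have p : ∀ i, 0 < 1 + ‖x i‖ := fun i => by positivity
  have h0 : 1 + ‖x 0‖ ≤ 1 + rad x := add_le_add_right (Real.abs_le_sqrt (by nlinarith [sq_nonneg (x 1)])) 1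
  have h1 : 1 + ‖x 1‖ ≤ 1 + rad x := add_le_add_right (Real.abs_le_sqrt (by nlinarith [sq_nonneg (x 0)])) 1
  have hr : 0 < 1 + rad x := by linarith [rad_nonneg x]
  simp only [Real.rpow_neg (p _).le]
  rw [Finset.prod_inv_distrib]
  refine inv_anti₀ (Finset.prod_pos fun i _ => Real.rpow_pos_of_pos (p i) _) ?_
  have e : ∀ {t : ℝ}, 0 < t → t ^ (4 / 3 : ℝ) = t * t ^ (1 / 3 : ℝ) := fun {t} ht => by
    rw [show (4 / 3 : ℝ) = 1 + 1 / 3 by norm_num, Real.rpow_add ht, Real.rpow_one]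
  have e3 : (1 + ‖x‖) ^ (1 / 3 : ℝ) * (1 + ‖x‖) ^ (1 / 3 : ℝ) * (1 + ‖x‖) ^ (1 / 3 : ℝ) = 1 + ‖x‖ := by
    have ht : 0 < 1 + ‖x‖ := by positivity
    rw [← Real.rpow_add ht, ← Real.rpow_add ht]; norm_num
  rw [Fin.prod_univ_three, e (p 0), e (p 1), e (p 2)]
  have q : ∀ i, 0 ≤ (1 + ‖x i‖) ^ (1 / 3 : ℝ) := fun i => (Real.rpow_pos_of_pos (p i) _).le
  calc _ = ((1 + ‖x 0‖) * (1 + ‖x 1‖)) * (1 + ‖x 2‖) * ((1 + ‖x 0‖) ^ (1 / 3 : ℝ) * (1 + ‖x 1‖) ^ (1 / 3 : ℝ) * (1 + ‖x 2‖) ^ (1 / 3 : ℝ)) := by ring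
    _ ≤ ((1 + rad x) * (1 + rad x)) * (1 + ‖x‖) * ((1 + ‖x‖) ^ (1 / 3 : ℝ) * (1 + ‖x‖) ^ (1 / 3 : ℝ) * (1 + ‖x‖) ^ (1 / 3 : ℝ)) := by
      have := q 0; have := q 1; have := q 2
      gcongr
      exacts [PiLp.norm_apply_le x 2, PiLp.norm_apply_le x 0, PiLp.norm_apply_le x 1, PiLp.norm_apply_le x 2]
    _ = _ := by rw [e3]; ring

/-- Here (1+r)f is in L², and so is ((1+r)(1+|x|))⁻¹. The bound on rf is essential, since 1/(1+|x|)
alone is not square integrable in three dimensions. -/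
theorem integrable_div_one_add_norm {f : E3 → ℝ} (hf : Continuous f) (h2 : MemLp f 2) (hr : MemLp (fun x => rad x * f x) 2) :
    Integrable fun x => f x / (1 + ‖x‖) := by
  have h3 : MemLp (fun x => f x + rad x * f x) 2 := h2.add hr
  have i1 : Integrable fun x => (f x + rad x * f x) ^ 2 := h3.integrable_sq
  refine (i1.add integrable_prod_weight).mono' ?_ (.of_forall fun x => ?_)
  · exact (hf.div (by fun_prop) fun x => by positivity).aestronglyMeasurable
  · have hR : 0 < 1 + rad x := by linarith [rad_nonneg x]
    have hN : 0 < 1 + ‖x‖ := by positivity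
    have := inv_weight_le x
    have e : ‖f x / (1 + ‖x‖)‖ = |f x + rad x * f x| * ((1 + rad x) * (1 + ‖x‖))⁻¹ := by
      rw [show f x + rad x * f x = (1 + rad x) * f x by ring, abs_mul, abs_of_pos hR, norm_div, Real.norm_eq_abs, Real.norm_of_nonneg hN.le]
      field_simp
    rw [e]
    show _ ≤ (f x + rad x * f x) ^ 2 + ∏ i : Fin 3, (1 + ‖x i‖) ^ (-(4 / 3) : ℝ)
    rw [← inv_pow] at this
    nlinarith [sq_abs (f x + rad x * f x), sq_nonneg (|f x + rad x * f x| - ((1 + rad x) * (1 + ‖x‖))⁻¹)]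

/-! ### Axisymmetric solenoidal fields in the Sobolev space of order two -/

theorem _root_.MeasureTheory.MemLp.integrable_div_weight {f : E3 → ℝ} (h : MemLp f 2) : Integrable fun x => f x / (1 + ‖x‖ ^ 2) := by
  refine (h.integrable_sq.add integrable_inv_one_add_sq_sq).mono' ?_ (.of_forall fun x => ?_)
  · exact h.aestronglyMeasurable.mul (by fun_prop : Measurable fun x : E3 => (1 + ‖x‖ ^ 2)⁻¹).aestronglyMeasurable
  · have hN : 0 < 1 + ‖x‖ ^ 2 := by positivity
    rw [norm_div, Real.norm_eq_abs, Real.norm_of_nonneg hN.le, div_eq_mul_inv]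
    show _ ≤ f x ^ 2 + ((1 + ‖x‖ ^ 2) ^ 2)⁻¹
    rw [← inv_pow]
    nlinarith [sq_abs (f x), sq_nonneg (|f x| - (1 + ‖x‖ ^ 2)⁻¹), sq_nonneg (f x), sq_nonneg (1 + ‖x‖ ^ 2)⁻¹]

theorem integrable_div_weight_sq {f g : E3 → ℝ} (hf : Continuous f) (hg : Integrable fun x => g x / (1 + ‖x‖ ^ 2))
    (h : ∀ x, |f x| ≤ (1 + ‖x‖ ^ 2) * |g x|) : Integrable fun x => f x / (1 + ‖x‖ ^ 2) ^ 2 := by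
  refine hg.mono (hf.div (by fun_prop) fun x => by positivity).aestronglyMeasurable (.of_forall fun x => ?_)
  have hN : 0 < 1 + ‖x‖ ^ 2 := by positivity
  rw [norm_div, norm_div, Real.norm_eq_abs, Real.norm_of_nonneg hN.le, Real.norm_eq_abs, Real.norm_eq_abs, abs_of_nonneg (a := (1 + ‖x‖ ^ 2) ^ 2) (by positivity),
    div_le_div_iff₀ (by positivity) hN]
  nlinarith [h x]

theorem lap_pd {f : E3 → ℝ} (hf : ContDiff ℝ ∞ f) (k : Fin 3) (x : E3) : lap (pd k f) x = pd k (lap f) x := by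
  have h2 : ∀ i, pd i (pd k f) = pd k (pd i f) := fun i => pd_comm (contDiff_infty.1 hf 2) i k
  show ∑ i, pd i (pd i (pd k f)) x = pd k (fun y => ∑ i, pd i (pd i f) y) x
  rw [pd_sum (f := fun i => pd i (pd i f)) fun i => ((hf.pd_infty i).pd_infty i).differentiable (by simp) x]
  refine Finset.sum_congr rfl fun i _ => ?_
  rw [h2, pd_comm (contDiff_infty.1 (hf.pd_infty i) 2) i k]

/-- Smooth axisymmetric solenoidal vector fields in `H²`. -/
structure IsProfile (v : E3 → E3) : Prop where
  smooth : ContDiff ℝ ∞ v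
  axisymmetric : IsAxisymmetricField v
  div_free : ∀ x, ∑ i : Fin 3, pd i (fun y => v y i) x = 0
  memH2 : ∀ k ≤ 2, MemLp (iteratedFDeriv ℝ k v) 2 volume

theorem IsSmoothAxisymmetricSolution.isProfile {T : ℝ} {u : ℝ → E3 → E3} {p : ℝ → E3 → ℝ}
    (h : IsSmoothAxisymmetricSolution T u p) {t : ℝ} (ht : t ∈ Ioo 0 T) : IsProfile (u t) where
  smooth := by
    have h1 : ContDiff ℝ ∞ fun x : E3 => (t, x) := contDiff_const.prodMk contDiff_id
    exact contDiffOn_univ.1 (h.smooth_u.comp (f := fun x : E3 => (t, x)) h1.contDiffOn fun x _ => ⟨ht, mem_univ _⟩)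
  axisymmetric := h.axisymmetric t ht
  div_free := h.div_free t ht
  memH2 := h.memH2 t ht

/-- The smooth extension of `v^r / r`. -/
noncomputable def velQuot (v : E3 → E3) : E3 → ℝ := quot (fun y => v y 0) (fun y => v y 1)

/-- The smooth extension of `ω^θ / r`. -/
noncomputable def vortQuot (v : E3 → E3) : E3 → ℝ := quot (fun y => curl v y 1) (fun y => -curl v y 0)

namespace IsProfile

variable {v : E3 → E3}

theorem rotPair (h : IsProfile v) : RotPair (fun y => v y 0) (fun y => v y 1) := (h.axisymmetric.rot h.smooth).1

theorem rotPair_curl (h : IsProfile v) : RotPair (fun y => curl v y 1) (fun y => -curl v y 0) := (h.axisymmetric.rot_curl h.smooth).1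

theorem contDiff_velQuot (h : IsProfile v) : ContDiff ℝ ∞ (velQuot v) := h.rotPair.contDiff_quot

theorem contDiff_vortQuot (h : IsProfile v) : ContDiff ℝ ∞ (vortQuot v) := h.rotPair_curl.contDiff_quot

theorem radialOverR_eq (h : IsProfile v) {x : E3} (hx : rad x ≠ 0) : radialOverR v x = velQuot v x := by
  have := h.rotPair.rad_sq_mul_quot x
  rw [radialOverR, velQuot, div_eq_iff hx]
  refine mul_left_cancel₀ hx ?_
  simp only [eR, PiLp.inner_apply, Fin.sum_univ_three]
  simp
  field_simp
  left
  linarith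

theorem gam_eq (h : IsProfile v) {x : E3} (hx : rad x ≠ 0) : Gam v x = vortQuot v x := by
  have := h.rotPair_curl.rad_sq_mul_quot x
  rw [Gam, vortQuot, div_eq_iff hx]
  refine mul_left_cancel₀ hx ?_
  simp only [eTheta, PiLp.inner_apply, Fin.sum_univ_three]
  simp
  field_simp
  left
  linarith

theorem memLp_coord (h : IsProfile v) (i : Fin 3) : MemLp (fun y => v y i) 2 :=
  (h.memH2 0 (by norm_num)).mono (h.smooth.comp_coord i).continuous.aestronglyMeasurable (.of_forall fun x => by
    rw [norm_iteratedFDeriv_zero]; exact PiLp.norm_apply_le _ i)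

theorem pd_coord_eq (h : IsProfile v) (i j : Fin 3) (x : E3) :
    pd j (fun y => v y i) x = fderiv ℝ v x (EuclideanSpace.single j 1) i := by
  have h1 : HasFDerivAt (fun y => v y i) ((EuclideanSpace.proj (𝕜 := ℝ) i : E3 →L[ℝ] ℝ).comp (fderiv ℝ v x)) x :=
    (EuclideanSpace.proj (𝕜 := ℝ) i : E3 →L[ℝ] ℝ).hasFDerivAt.comp x (h.smooth.differentiable (by simp) x).hasFDerivAt
  rw [h1.pd_eq]; rfl

theorem memLp_pd (h : IsProfile v) (i j : Fin 3) : MemLp (pd j fun y => v y i) 2 :=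
  (h.memH2 1 (by norm_num)).mono ((h.smooth.comp_coord i).pd_infty j).continuous.aestronglyMeasurable (.of_forall fun x => by
    rw [norm_iteratedFDeriv_one, h.pd_coord_eq]
    refine (PiLp.norm_apply_le _ i).trans (((fderiv ℝ v x).le_opNorm _).trans ?_)
    simp)

theorem memLp_pd_pd (h : IsProfile v) (i j l : Fin 3) : MemLp (pd l (pd j fun y => v y i)) 2 :=
  (h.memH2 2 le_rfl).mono (((h.smooth.comp_coord i).pd_infty j).pd_infty l).continuous.aestronglyMeasurable (.of_forall fun x => by
    have hd : ContDiff ℝ ∞ (fderiv ℝ v) := h.smooth.fderiv_right (by simp)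
    have h1 : HasFDerivAt (pd j fun y => v y i) ((EuclideanSpace.proj (𝕜 := ℝ) i : E3 →L[ℝ] ℝ).comp
        ((ContinuousLinearMap.apply ℝ E3 (EuclideanSpace.single j 1 : E3)).comp (fderiv ℝ (fderiv ℝ v) x))) x := by
      have e : (pd j fun y => v y i) = fun x => fderiv ℝ v x (EuclideanSpace.single j 1) i := funext (h.pd_coord_eq i j)
      rw [e]
      exact (EuclideanSpace.proj (𝕜 := ℝ) i : E3 →L[ℝ] ℝ).hasFDerivAt.comp x
        ((ContinuousLinearMap.apply ℝ E3 (EuclideanSpace.single j 1 : E3)).hasFDerivAt.comp x (hd.differentiable (by simp) x).hasFDerivAt)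
    rw [h1.pd_eq]
    have h2 := (iteratedFDeriv ℝ 2 v x).le_opNorm ![EuclideanSpace.single l 1, EuclideanSpace.single j 1]
    rw [iteratedFDeriv_two_apply] at h2
    simp only [Fin.prod_univ_two] at h2
    refine (PiLp.norm_apply_le _ i).trans (h2.trans ?_)
    simp)

theorem memLp_curl (h : IsProfile v) (i : Fin 3) : MemLp (fun y => curl v y i) 2 := by
  fin_cases i
  · exact (h.memLp_pd 2 1).sub (h.memLp_pd 1 2)
  · exact (h.memLp_pd 0 2).sub (h.memLp_pd 2 0)
  · exact (h.memLp_pd 1 0).sub (h.memLp_pd 0 1)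

theorem pd_curl (h : IsProfile v) (k : Fin 3) :
    (pd k (fun y => curl v y 0) = fun x => pd k (pd 1 fun y => v y 2) x - pd k (pd 2 fun y => v y 1) x) ∧
    (pd k (fun y => curl v y 1) = fun x => pd k (pd 2 fun y => v y 0) x - pd k (pd 0 fun y => v y 2) x) ∧
    (pd k (fun y => curl v y 2) = fun x => pd k (pd 0 fun y => v y 1) x - pd k (pd 1 fun y => v y 0) x) := by
  have hd : ∀ i j, Differentiable ℝ (pd j fun y => v y i) := fun i j => ((h.smooth.comp_coord i).pd_infty j).differentiable (by simp)
  exact ⟨funext fun x => pd_sub (hd 2 1 x) (hd 1 2 x) k, funext fun x => pd_sub (hd 0 2 x) (hd 2 0 x) k,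
    funext fun x => pd_sub (hd 1 0 x) (hd 0 1 x) k⟩

theorem memLp_pd_curl (h : IsProfile v) (i k : Fin 3) : MemLp (pd k fun y => curl v y i) 2 := by
  obtain ⟨h0, h1, h2⟩ := h.pd_curl k
  fin_cases i
  · exact h0 ▸ (h.memLp_pd_pd 2 1 k).sub (h.memLp_pd_pd 1 2 k)
  · exact h1 ▸ (h.memLp_pd_pd 0 2 k).sub (h.memLp_pd_pd 2 0 k)
  · exact h2 ▸ (h.memLp_pd_pd 1 0 k).sub (h.memLp_pd_pd 0 1 k)

theorem pd_neg {f : E3 → ℝ} (hf : Differentiable ℝ f) (k : Fin 3) (x : E3) : pd k (fun y => -f y) x = -pd k f x := by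
  have := pd_const_mul (f := f) (x := x) (-1) (hf x) k
  simpa using this

theorem memLp_vortQuot (h : IsProfile v) : MemLp (vortQuot v) 2 := by
  have hm := fun i k => (h.memLp_pd_curl i k).norm
  refine (((hm 1 0).add (hm 1 1)).add ((hm 0 0).add (hm 0 1))).mono' h.contDiff_vortQuot.continuous.aestronglyMeasurable ?_
  filter_upwards [ae_rad_ne] with x hx
  have := h.rotPair_curl.abs_quot_le hx
  have hd := (contDiff_curl h.smooth 0).differentiable (by simp)
  rw [pd_neg hd, pd_neg hd, abs_neg, abs_neg] at this
  exact this

theorem memLp_rad_mul_vortQuot (h : IsProfile v) : MemLp (fun x => rad x * vortQuot v x) 2 := by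
  refine ((h.memLp_curl 1).norm.add (h.memLp_curl 0).norm).mono' (continuous_rad.mul h.contDiff_vortQuot.continuous).aestronglyMeasurable ?_
  filter_upwards [ae_rad_ne] with x hx
  have := h.rotPair_curl.rad_mul_abs_quot_le hx
  rw [abs_neg] at this
  rw [norm_mul, Real.norm_of_nonneg (rad_nonneg x)]
  exact this

theorem memLp_coord_mul_velQuot (h : IsProfile v) : MemLp (fun x => x 0 * velQuot v x) 2 := by
  refine ((h.memLp_coord 0).norm.add (h.memLp_coord 1).norm).mono' ((continuous_coord 0).mul h.contDiff_velQuot.continuous).aestronglyMeasurable ?_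
  filter_upwards [ae_rad_ne] with x hx
  have := h.rotPair.rad_mul_abs_quot_le hx
  have h0 : |x 0| ≤ rad x := Real.abs_le_sqrt (by nlinarith [sq_nonneg (x 1)])
  rw [norm_mul]
  exact (mul_le_mul_of_nonneg_right h0 (abs_nonneg _)).trans this

theorem integrable_vortQuot (h : IsProfile v) : Integrable fun x => vortQuot v x / (1 + ‖x‖) :=
  integrable_div_one_add_norm h.contDiff_vortQuot.continuous h.memLp_vortQuot h.memLp_rad_mul_vortQuot

theorem weighted_vortQuot (h : IsProfile v) : Weighted (vortQuot v) :=
  ⟨h.contDiff_vortQuot.continuous, h.memLp_vortQuot.integrable_div_weight⟩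

/-- This is ΔF + (2/r)∂_rF = ∂₃Γ multiplied by r². It is the radial component of Δv = −curl ω, which
holds because v is solenoidal; the contribution of ω₃ is its rotational derivative and vanishes. -/
theorem lap_velQuot (h : IsProfile v) (x : E3) :
    rad x ^ 2 * lap (velQuot v) x + 2 * (x 0 * pd 0 (velQuot v) x + x 1 * pd 1 (velQuot v) x) = rad x ^ 2 * pd 2 (vortQuot v) x := by
  have hc := h.smooth.comp_coord
  have hp : ∀ i j, ContDiff ℝ ∞ (pd j fun y => v y i) := fun i j => (hc i).pd_infty j
  have hcomm : ∀ i j k, pd j (pd k fun y => v y i) x = pd k (pd j fun y => v y i) x := fun i j k => congr_fun (pd_comm (contDiff_infty.1 (hc i) 2) j k) x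
  rw [velQuot, h.rotPair.lap_quot]
  have hdiv : ∀ k, pd k (pd 0 fun y => v y 0) x + pd k (pd 1 fun y => v y 1) x + pd k (pd 2 fun y => v y 2) x = 0 := by
    intro k
    have h1 : (fun x => ∑ i : Fin 3, pd i (fun y => v y i) x) = fun _ => 0 := funext h.div_free
    have h2 := pd_sum (f := fun i => pd i fun y => v y i) (x := x) (fun i => (hp i i).differentiable (by simp) x) k
    rw [h1, Fin.sum_univ_three] at h2
    rw [← h2]; simp [pd]
  have hrot := (h.axisymmetric.rot_curl h.smooth).2 x
  have hS : pd 2 (RotPair.radial (fun y => curl v y 1) (fun y => -curl v y 0)) x = rad x ^ 2 * pd 2 (vortQuot v) x := by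
    have d := h.contDiff_vortQuot.differentiable (by simp)
    have d2 : ∀ j : Fin 3, Differentiable ℝ fun y : E3 => y j * vortQuot v y := fun j => (differentiable_coord j).mul d
    rw [h.rotPair_curl.radial_eq, rad_sq]
    show pd 2 (fun y : E3 => y 0 * (y 0 * vortQuot v y) + y 1 * (y 1 * vortQuot v y)) x = _
    rw [pd_add (f := fun y : E3 => y 0 * (y 0 * vortQuot v y)) (g := fun y : E3 => y 1 * (y 1 * vortQuot v y))
      (((differentiable_coord 0).mul (d2 0)) x) (((differentiable_coord 1).mul (d2 1)) x), pd_coord_mul (d2 0), pd_coord_mul (d2 1), pd_coord_mul d, pd_coord_mul d]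
    simp
    ring
  rw [← hS, h.rotPair_curl.pd_radial, pd_neg ((contDiff_curl h.smooth 0).differentiable (by simp)), (h.pd_curl 2).1, (h.pd_curl 2).2.1]
  rw [rotDeriv, (h.pd_curl 0).2.2, (h.pd_curl 1).2.2] at hrot
  simp only [lap_eq]
  simp
  have d0 := hdiv 0
  have d1 := hdiv 1
  rw [hcomm 1 0 1, hcomm 2 0 2] at d0
  rw [hcomm 0 1 0, hcomm 2 1 2] at d1
  linear_combination x 0 * d0 + x 1 * d1 - hrot

/-- The potential `Δ⁻¹∂₃Γ`. -/
theorem invLapD_gam (h : IsProfile v) : invLapD 2 (Gam v) = invLapD 2 (vortQuot v) := by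
  funext x
  refine integral_congr_ae ?_
  filter_upwards [ae_rad_ne] with y hy
  rw [h.gam_eq hy]

theorem integrable_dNewton_gam (h : IsProfile v) (x : E3) : Integrable fun y => dNewton 2 (x - y) * Gam v y := by
  refine (h.weighted_vortQuot.integrable_dNewton 2 x).congr ?_
  filter_upwards [ae_rad_ne] with y hy
  rw [h.gam_eq hy]

theorem contDiff_pot (h : IsProfile v) : ContDiff ℝ ∞ (invLapD 2 (vortQuot v)) :=
  h.weighted_vortQuot.contDiff_invLapD (n := ⊤) h.contDiff_vortQuot 2

theorem lap_pot (h : IsProfile v) (x : E3) : lap (invLapD 2 (vortQuot v)) x = pd 2 (vortQuot v) x := by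
  rw [← h.weighted_vortQuot.pd_invLap, lap_pd (h.weighted_vortQuot.contDiff_infty_invLap h.contDiff_vortQuot)]
  congr 1
  funext y
  exact h.weighted_vortQuot.lap_invLap (contDiff_infty.1 h.contDiff_vortQuot 1) y

theorem weighted_pot (h : IsProfile v) : Weighted (invLapD 2 (vortQuot v)) :=
  h.weighted_vortQuot.weighted_invLapD h.integrable_vortQuot 2

theorem memLp_pd_pot (h : IsProfile v) (k : Fin 3) : MemLp (pd k (invLapD 2 (vortQuot v))) 2 := by
  obtain ⟨C, -, hC⟩ := exists_cz_bound (p := 2) (by norm_num)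
  refine ⟨(h.contDiff_pot.pd_infty k).continuous.aestronglyMeasurable, ?_⟩
  have := hC _ _ h.contDiff_pot h.contDiff_vortQuot (h.weighted_vortQuot.integrable_invLapD 2) 2 k h.lap_pot
  rw [ENNReal.ofReal_ofNat] at this
  exact this.trans_lt (ENNReal.mul_lt_top ENNReal.ofReal_lt_top h.memLp_vortQuot.2)

theorem isAdmissible_pot (h : IsProfile v) : IsAdmissible (invLapD 2 (vortQuot v)) where
  axisymmetric := h.rotPair_curl.isAxisymmetricScalar_quot.invLapD_two
  contDiff := contDiff_infty.1 h.contDiff_pot 1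
  integrable := h.weighted_pot.2
  integrable_fderiv := by
    have h1 : Integrable fun x => ∑ k : Fin 3, |pd k (invLapD 2 (vortQuot v)) x / (1 + ‖x‖ ^ 2)| :=
      integrable_finsetSum _ fun k _ => (h.memLp_pd_pot k).integrable_div_weight.norm
    refine h1.mono' ?_ (.of_forall fun x => ?_)
    · exact ((h.contDiff_pot.continuous_fderiv (by simp)).norm.div (by fun_prop) fun x => by positivity).aestronglyMeasurable
    · have hN : 0 < 1 + ‖x‖ ^ 2 := by positivity
      rw [norm_div, norm_norm, Real.norm_of_nonneg hN.le]
      simp only [abs_div, abs_of_pos hN]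
      rw [← Finset.sum_div]
      exact div_le_div_of_nonneg_right (norm_fderiv_le_sum_pd _ x) hN.le

/-- The factor x₁ turns the operator Δ + (2/r)∂_r into the ordinary Laplacian, so the left side is
harmonic. Multiplication by x₁ and differentiation of V stay within the growth allowed by
Liouville's theorem. -/
theorem coord_mul_velQuot (h : IsProfile v) (x : E3) :
    x 0 * velQuot v x - x 0 * invLapD 2 (vortQuot v) x + 2 * pd 0 (invLap (invLapD 2 (vortQuot v))) x = 0 := by
  set W := invLapD 2 (vortQuot v) with hW
  have cF := h.contDiff_velQuot
  have cW : ContDiff ℝ ∞ W := h.contDiff_pot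
  have cV : ContDiff ℝ ∞ (invLap W) := h.weighted_pot.contDiff_infty_invLap cW
  have c : ∀ {f : E3 → ℝ}, ContDiff ℝ ∞ f → ContDiff ℝ ∞ fun y : E3 => y 0 * f y := fun hf => (contDiff_coord 0).mul hf
  have cG : ContDiff ℝ ∞ fun y => velQuot v y + -1 * W y := cF.add (contDiff_const.mul cW)
  have cP := cV.pd_infty 0
  set X : E3 → ℝ := fun y => y 0 * (velQuot v y + -1 * W y) + 2 * pd 0 (invLap W) y with hX
  have cX : ContDiff ℝ ∞ X := (c cG).add (contDiff_const.mul cP)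
  have lX : ∀ y, lap X y = y 0 * (lap (velQuot v) y - pd 2 (vortQuot v) y) + 2 * pd 0 (velQuot v) y := by
    intro y
    have l1 : lap (pd 0 (invLap W)) y = pd 0 W y := by
      rw [lap_pd cV]
      congr 1
      funext z
      exact h.weighted_pot.lap_invLap (contDiff_infty.1 cW 1) z
    have l2 : pd 0 (fun y => velQuot v y + -1 * W y) y = pd 0 (velQuot v) y + -1 * pd 0 W y := by
      rw [pd_add (g := fun y => -1 * W y) (cF.differentiable (by simp) y) ((cW.differentiable (by simp) y).const_mul _),
        pd_const_mul _ (cW.differentiable (by simp) y)]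
    rw [hX, lap_add (c cG) (contDiff_const.mul cP), lap_coord_mul cG, lap_add cF (contDiff_const.mul cW), lap_const_mul cW,
      lap_const_mul cP, l1, l2, h.lap_pot]
    ring
  have harm : ∀ y, lap X y = 0 := by
    have hL : ContDiff ℝ ∞ fun y => y 0 * (lap (velQuot v) y - pd 2 (vortQuot v) y) + 2 * pd 0 (velQuot v) y := by
      refine (c (ContDiff.sub ?_ (h.contDiff_vortQuot.pd_infty 2))).add (contDiff_const.mul (cF.pd_infty 0))
      exact ContDiff.sum fun i _ => (cF.pd_infty i).pd_infty i
    intro y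
    rw [lX]
    refine eq_of_forall_coord_ne hL.continuous continuous_const (fun y hy => ?_) y
    have e1 := h.lap_velQuot y
    have e2 : rotDeriv (velQuot v) y = 0 := h.rotPair.rotDeriv_quot y
    rw [rotDeriv] at e2
    rw [rad_sq] at e1
    have hpos : y 0 ^ 2 + y 1 ^ 2 ≠ 0 := by positivity
    refine mul_left_cancel₀ hpos ?_
    linear_combination y 0 * e1 - 2 * y 1 * e2
  -- Three reasons: x₁F is bounded by the horizontal velocity, which is in L²; the factor x₁ on W
  -- costs less than one weight; and ∂₁V is the potential of the weighted function W.
  have wX : Integrable fun y => X y / (1 + ‖y‖ ^ 2) ^ 2 := by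
    have w1 : Integrable fun y : E3 => y 0 * velQuot v y / (1 + ‖y‖ ^ 2) ^ 2 :=
      integrable_div_weight_sq (c cF).continuous h.memLp_coord_mul_velQuot.integrable_div_weight fun y => by
        nlinarith [abs_nonneg (y 0 * velQuot v y), sq_nonneg ‖y‖]
    have w2 : Integrable fun y : E3 => y 0 * W y / (1 + ‖y‖ ^ 2) ^ 2 :=
      integrable_div_weight_sq (c cW).continuous h.weighted_pot.2 fun y => by
        rw [abs_mul]
        have h1 : |y 0| ≤ ‖y‖ := PiLp.norm_apply_le y 0
        refine mul_le_mul_of_nonneg_right (h1.trans ?_) (abs_nonneg _)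
        nlinarith [sq_nonneg (‖y‖ - 1)]
    have w3 : Integrable fun y => pd 0 (invLap W) y / (1 + ‖y‖ ^ 2) ^ 2 := by
      rw [h.weighted_pot.pd_invLap]
      exact h.weighted_pot.integrable_invLapD 0
    refine ((w1.sub w2).add (w3.const_mul 2)).congr (.of_forall fun y => ?_)
    simp only [hX, Pi.add_apply, Pi.sub_apply]
    ring
  have hpd := pd_eq_zero_of_lap_eq_zero cX wX harm
  have hconst : X x = X !₂[0, 1, 0] := by
    refine is_const_of_fderiv_eq_zero (𝕜 := ℝ) (cX.differentiable (by simp)) (fun y => ?_) _ _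
    ext z
    rw [fderiv_eq_sum_pd]
    simp [hpd]
  -- At a point with x₁ = 0 and x₂ ≠ 0 the relation x₁∂₂V = x₂∂₁V forces ∂₁V = 0.
  have h0 : X !₂[0, 1, 0] = 0 := by
    have e := (h.isAdmissible_pot.axisymmetric.invLap).rotDeriv_eq_zero (cV.differentiable (by simp)) !₂[0, 1, 0]
    rw [rotDeriv, ← hW] at e
    simp at e
    simp [hX, e]
  rw [h0] at hconst
  simp only [hX] at hconst
  linarith

theorem radialOverR_eq_pot (h : IsProfile v) {x : E3} (hx : rad x ≠ 0) :
    radialOverR v x = invLapD 2 (vortQuot v) x - 2 * drOverRInvLap (invLapD 2 (vortQuot v)) x := by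
  set W := invLapD 2 (vortQuot v) with hW
  have cV : ContDiff ℝ ∞ (invLap W) := h.weighted_pot.contDiff_infty_invLap h.contDiff_pot
  -- Off the plane x₁ = 0 this is the coordinate identity with ∂₂V eliminated by x₁∂₂V = x₂∂₁V;
  -- continuity gives it everywhere.
  have key : ∀ y, rad y ^ 2 * (velQuot v y - W y) + 2 * (y 0 * pd 0 (invLap W) y + y 1 * pd 1 (invLap W) y) = 0 := by
    refine eq_of_forall_coord_ne ?_ continuous_const fun y hy => ?_
    · exact ((continuous_rad.pow 2).mul (h.contDiff_velQuot.continuous.sub h.contDiff_pot.continuous)).add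
        ((((continuous_coord 0).mul (cV.pd_infty 0).continuous).add ((continuous_coord 1).mul (cV.pd_infty 1).continuous)).const_mul 2)
    · have e1 := h.coord_mul_velQuot y
      have e2 := (h.isAdmissible_pot.axisymmetric.invLap).rotDeriv_eq_zero (cV.differentiable (by simp)) y
      rw [rotDeriv] at e2
      rw [← hW] at e1 e2
      refine mul_left_cancel₀ hy ?_
      rw [rad_sq]
      linear_combination (y 0 ^ 2 + y 1 ^ 2) * e1 + 2 * y 1 * e2
  have := key x
  rw [h.radialOverR_eq hx, drOverRInvLap, dr_eq]
  field_simp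
  linarith

end IsProfile

/-! ### Angular coefficients -/

theorem isOpen_rad_ne : IsOpen {x : E3 | rad x ≠ 0} := isOpen_ne_fun continuous_rad continuous_const

theorem eventually_rad_ne {x : E3} (hx : rad x ≠ 0) : ∀ᶠ y in nhds x, rad y ≠ 0 := isOpen_rad_ne.mem_nhds hx

/-- Functions of the angular variable, bounded by one, away from the axis. -/
structure IsAngular (c : E3 → ℝ) : Prop where
  differentiableAt : ∀ {x}, rad x ≠ 0 → DifferentiableAt ℝ c x
  abs_le_one : ∀ {x}, rad x ≠ 0 → |c x| ≤ 1
  pd_horizontal : ∀ {x}, rad x ≠ 0 → x 0 * pd 0 c x + x 1 * pd 1 c x = 0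
  pd_two : ∀ {x}, rad x ≠ 0 → pd 2 c x = 0

namespace IsAngular

theorem const {a : ℝ} (ha : |a| ≤ 1) : IsAngular fun _ => a where
  differentiableAt _ := differentiableAt_const _
  abs_le_one _ := ha
  pd_horizontal _ := by simp [pd]
  pd_two _ := by simp [pd]

theorem mul {c d : E3 → ℝ} (hc : IsAngular c) (hd : IsAngular d) : IsAngular fun x => c x * d x where
  differentiableAt hx := (hc.differentiableAt hx).mul (hd.differentiableAt hx)
  abs_le_one hx := by
    rw [abs_mul]
    exact mul_le_one₀ (hc.abs_le_one hx) (abs_nonneg _) (hd.abs_le_one hx)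
  pd_horizontal {x} hx := by
    rw [pd_mul (hc.differentiableAt hx) (hd.differentiableAt hx), pd_mul (hc.differentiableAt hx) (hd.differentiableAt hx)]
    linear_combination c x * hd.pd_horizontal hx + d x * hc.pd_horizontal hx
  pd_two hx := by
    rw [pd_mul (hc.differentiableAt hx) (hd.differentiableAt hx), hc.pd_two hx, hd.pd_two hx]
    ring

theorem pd_coord_div_rad (j : Fin 3) {x : E3} (hx : rad x ≠ 0) :
    DifferentiableAt ℝ (fun y => y j / rad y) x ∧ ∀ k, pd k (fun y => y j / rad y) x
      = (if k = j then 1 else 0) / rad x - x j * (x 0 * (if k = 0 then 1 else 0) + x 1 * (if k = 1 then 1 else 0)) / rad x ^ 3 := by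
  have h0 := (differentiable_coord 0 x).hasFDerivAt
  have h1 := (differentiable_coord 1 x).hasFDerivAt
  have hj := (differentiable_coord j x).hasFDerivAt
  have hpos : x 0 ^ 2 + x 1 ^ 2 ≠ 0 := by rw [← rad_sq]; positivity
  have hs : HasFDerivAt (fun y : E3 => y 0 ^ 2 + y 1 ^ 2) _ x := (h0.pow 2).add (h1.pow 2)
  have hr : HasFDerivAt rad _ x := hs.sqrt hpos
  have hi : HasFDerivAt (fun y => (rad y)⁻¹) _ x := (hasDerivAt_inv hx).comp_hasFDerivAt x hr
  have hm : HasFDerivAt (fun y => y j * (rad y)⁻¹) _ x := hj.mul hi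
  refine ⟨hm.differentiableAt, fun k => ?_⟩
  have p0 := pd_coord k 0 x
  have p1 := pd_coord k 1 x
  have pj := pd_coord k j x
  rw [pd] at p0 p1 pj
  simp only [div_eq_mul_inv (_ : ℝ) (rad _)]
  generalize (if k = 0 then (1 : ℝ) else 0) = a0 at p0 ⊢
  generalize (if k = 1 then (1 : ℝ) else 0) = a1 at p1 ⊢
  generalize (if k = j then (1 : ℝ) else 0) = aj at pj ⊢
  rw [hm.pd_eq]
  have e : Real.sqrt (x 0 ^ 2 + x 1 ^ 2) = rad x := rfl
  simp [p0, p1, pj, e]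
  field_simp
  ring

theorem cos : IsAngular fun x => x 0 / rad x where
  differentiableAt hx := (pd_coord_div_rad 0 hx).1
  abs_le_one {x} hx := by
    have hr : 0 < rad x := (rad_nonneg x).lt_of_ne' hx
    rw [abs_div, abs_of_pos hr, div_le_one hr]
    exact Real.abs_le_sqrt (by nlinarith [sq_nonneg (x 1)])
  pd_horizontal {x} hx := by
    have h := rad_sq x
    rw [(pd_coord_div_rad 0 hx).2, (pd_coord_div_rad 0 hx).2]
    simp
    field_simp
    linear_combination x 0 * h
  pd_two hx := by rw [(pd_coord_div_rad 0 hx).2]; simp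

theorem sin : IsAngular fun x => x 1 / rad x where
  differentiableAt hx := (pd_coord_div_rad 1 hx).1
  abs_le_one {x} hx := by
    have hr : 0 < rad x := (rad_nonneg x).lt_of_ne' hx
    rw [abs_div, abs_of_pos hr, div_le_one hr]
    exact Real.abs_le_sqrt (by nlinarith [sq_nonneg (x 0)])
  pd_horizontal {x} hx := by
    have h := rad_sq x
    rw [(pd_coord_div_rad 1 hx).2, (pd_coord_div_rad 1 hx).2]
    simp
    field_simp
    linear_combination x 1 * h
  pd_two hx := by rw [(pd_coord_div_rad 1 hx).2]; simp

end IsAngular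

/-- Derivative along a direction field that annihilates the angular functions. -/
noncomputable def dirOp (e : Fin 3 → E3 → ℝ) (f : E3 → ℝ) (x : E3) : ℝ := ∑ k, e k x * pd k f x

structure IsCylDir (e : Fin 3 → E3 → ℝ) : Prop where
  angular : ∀ k, IsAngular (e k)
  dirOp_angular : ∀ {c}, IsAngular c → ∀ {x}, rad x ≠ 0 → dirOp e c x = 0

noncomputable def radDir : Fin 3 → E3 → ℝ := ![fun x => x 0 / rad x, fun x => x 1 / rad x, fun _ => 0]

noncomputable def axDir : Fin 3 → E3 → ℝ := ![fun _ => 0, fun _ => 0, fun _ => 1]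

theorem dr_eq_dirOp (f : E3 → ℝ) : dr f = dirOp radDir f := by
  funext x
  rw [dr_eq, dirOp, Fin.sum_univ_three]
  simp [radDir]

theorem pd_eq_dirOp (f : E3 → ℝ) : pd 2 f = dirOp axDir f := by
  funext x
  rw [dirOp, Fin.sum_univ_three]
  simp [axDir]

theorem isCylDir_radDir : IsCylDir radDir where
  angular k := by
    fin_cases k
    · exact .cos
    · exact .sin
    · exact .const (a := 0) (by simp)
  dirOp_angular {c} hc {x} hx := by
    have := hc.pd_horizontal hx
    rw [dirOp, Fin.sum_univ_three]
    simp [radDir]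
    field_simp
    rw [this, mul_zero]

theorem isCylDir_axDir : IsCylDir axDir where
  angular k := by
    fin_cases k
    · exact .const (a := 0) (by simp)
    · exact .const (a := 0) (by simp)
    · exact .const (a := 1) (by simp)
  dirOp_angular {c} hc {x} hx := by rw [← pd_eq_dirOp, hc.pd_two hx]

/-- Combinations of smooth functions with angular coefficients. -/
structure Represents {ι : Type} [Fintype ι] (f : E3 → ℝ) (c g : ι → E3 → ℝ) : Prop where
  angular : ∀ m, IsAngular (c m)
  smooth : ∀ m, ContDiff ℝ ∞ (g m)
  eq : ∀ {x}, rad x ≠ 0 → f x = ∑ m, c m x * g m x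

namespace Represents

variable {ι : Type} [Fintype ι] {f : E3 → ℝ} {c g : ι → E3 → ℝ}

/-- The product rule produces derivatives of the coefficients along e, and these vanish since the
coefficients depend on the angle only. So ∂_r and ∂₃ act on the smooth factors alone, with new
coefficients of the same kind, and the operation can be iterated. -/
theorem dirOp (h : Represents f c g) {e : Fin 3 → E3 → ℝ} (he : IsCylDir e) :
    Represents (dirOp e f) (fun (m : ι × Fin 3) x => c m.1 x * e m.2 x) (fun m => pd m.2 (g m.1)) where
  angular m := (h.angular m.1).mul (he.angular m.2)
  smooth m := (h.smooth m.1).pd_infty m.2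
  eq {x} hx := by
    have hf : ∀ k, pd k f x = ∑ m, (c m x * pd k (g m) x + g m x * pd k (c m) x) := by
      intro k
      have h1 : f =ᶠ[nhds x] fun y => ∑ m, c m y * g m y := (eventually_rad_ne hx).mono fun y hy => h.eq hy
      have h2 : HasFDerivAt (fun y => ∑ m, c m y * g m y) _ x := HasFDerivAt.fun_sum (u := Finset.univ) fun m _ =>
        ((h.angular m).differentiableAt hx).hasFDerivAt.mul (((h.smooth m).differentiable (by simp)) x).hasFDerivAt
      rw [pd_congr h1, h2.pd_eq]
      simp [pd]
    have hz : ∀ m, ∑ k, e k x * pd k (c m) x = 0 := fun m => he.dirOp_angular (h.angular m) hx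
    rw [Fintype.sum_prod_type, Axi.dirOp]
    simp only [hf, Finset.mul_sum]
    rw [Finset.sum_comm]
    refine Finset.sum_congr rfl fun m _ => ?_
    have : ∑ k, e k x * (c m x * pd k (g m) x + g m x * pd k (c m) x)
        = ∑ k, c m x * e k x * pd k (g m) x + g m x * ∑ k, e k x * pd k (c m) x := by
      rw [Finset.mul_sum, ← Finset.sum_add_distrib]
      exact Finset.sum_congr rfl fun k _ => by ring
    rw [this, hz, mul_zero, add_zero]

theorem abs_le (h : Represents f c g) {x : E3} (hx : rad x ≠ 0) : |f x| ≤ ∑ m, |g m x| := by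
  rw [h.eq hx]
  refine (Finset.abs_sum_le_sum_abs _ _).trans (Finset.sum_le_sum fun m _ => ?_)
  rw [abs_mul]
  exact mul_le_of_le_one_left (abs_nonneg _) ((h.angular m).abs_le_one hx)

theorem tgrad_le (h : Represents f c g) {x : E3} (hx : rad x ≠ 0) :
    tgrad f x ≤ 2 * ∑ m : ι × Fin 3, |pd m.2 (g m.1) x| := by
  have h1 := (h.dirOp isCylDir_radDir).abs_le hx
  have h2 := (h.dirOp isCylDir_axDir).abs_le hx
  rw [← dr_eq_dirOp] at h1
  rw [← pd_eq_dirOp] at h2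
  refine (Real.sqrt_le_iff.2 ⟨add_nonneg (abs_nonneg (dr f x)) (abs_nonneg (pd 2 f x)), ?_⟩).trans (by linarith : |dr f x| + |pd 2 f x| ≤ _)
  rw [← sq_abs (dr f x), ← sq_abs (pd 2 f x)]
  nlinarith [abs_nonneg (dr f x), abs_nonneg (pd 2 f x)]

theorem tgradTwo_le (h : Represents f c g) {x : E3} (hx : rad x ≠ 0) :
    tgradTwo f x ≤ 4 * ∑ m : (ι × Fin 3) × Fin 3, |pd m.2 (pd m.1.2 (g m.1.1)) x| := by
  have h1 := ((h.dirOp isCylDir_radDir).dirOp isCylDir_radDir).abs_le hx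
  have h2 := ((h.dirOp isCylDir_axDir).dirOp isCylDir_radDir).abs_le hx
  have h3 := ((h.dirOp isCylDir_radDir).dirOp isCylDir_axDir).abs_le hx
  have h4 := ((h.dirOp isCylDir_axDir).dirOp isCylDir_axDir).abs_le hx
  simp only [← dr_eq_dirOp, ← pd_eq_dirOp] at h1 h2 h3 h4
  have n1 := abs_nonneg (dr (dr f) x)
  have n2 := abs_nonneg (dr (pd 2 f) x)
  have n3 := abs_nonneg (pd 2 (dr f) x)
  have n4 := abs_nonneg (pd 2 (pd 2 f) x)
  refine (Real.sqrt_le_iff.2 ⟨add_nonneg (add_nonneg n1 n2) (add_nonneg n3 n4), ?_⟩).trans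
    (by linarith : |dr (dr f) x| + |dr (pd 2 f) x| + (|pd 2 (dr f) x| + |pd 2 (pd 2 f) x|) ≤ _)
  rw [← sq_abs (dr (dr f) x), ← sq_abs (dr (pd 2 f) x), ← sq_abs (pd 2 (dr f) x), ← sq_abs (pd 2 (pd 2 f) x)]
  nlinarith [mul_nonneg n1 n2, mul_nonneg n1 n3, mul_nonneg n1 n4, mul_nonneg n2 n3, mul_nonneg n2 n4, mul_nonneg n3 n4]

end Represents

theorem eLpNorm_le_of_ae_le_sum {ι : Type} [Fintype ι] {F : E3 → ℝ} {g : ι → E3 → ℝ} (hg : ∀ m, Continuous (g m))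
    {q : ℝ} (hq : 1 < q) {A : ℝ} (hA : 0 ≤ A) (hF0 : ∀ x, 0 ≤ F x) (h : ∀ {x}, rad x ≠ 0 → F x ≤ A * ∑ m, |g m x|) {K : ENNReal}
    (hK : ∀ m, eLpNorm (g m) (ENNReal.ofReal q) volume ≤ K) :
    eLpNorm F (ENNReal.ofReal q) volume ≤ ENNReal.ofReal A * (Fintype.card ι * K) := by
  have h1 : eLpNorm F (ENNReal.ofReal q) volume ≤ eLpNorm (A • ∑ m, fun x => |g m x|) (ENNReal.ofReal q) volume := by
    refine eLpNorm_mono_ae ?_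
    filter_upwards [ae_rad_ne] with x hx
    rw [Real.norm_of_nonneg (hF0 x)]
    refine (h hx).trans ((le_of_eq ?_).trans (le_abs_self _))
    simp
  refine h1.trans ?_
  rw [eLpNorm_const_smul, Real.enorm_of_nonneg hA]
  gcongr
  refine (eLpNorm_sum_le (fun m _ => (hg m).abs.aestronglyMeasurable) (by simpa using hq.le)).trans ?_
  calc _ ≤ ∑ _m : ι, K := Finset.sum_le_sum fun m _ => by
        refine le_trans (le_of_eq ?_) (hK m)
        exact eLpNorm_norm (g m)
    _ = _ := by simp

/-! ### The angular expansion of u^r/r and the elliptic equations of its terms. -/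

namespace IsProfile

variable {v : E3 → E3}

/-- The coefficients in the expansion of `v^r / r` in second derivatives of the potential. -/
noncomputable def coeff : Fin 9 → E3 → ℝ :=
  let s : E3 → ℝ := fun x => -1 * (x 1 / rad x * (x 1 / rad x))
  let c : E3 → ℝ := fun x => -1 * (x 0 / rad x * (x 0 / rad x))
  let m : E3 → ℝ := fun x => x 0 / rad x * (x 1 / rad x)
  -- Angular coefficients are bounded by one, so the factors 2 and 4 of the expansion appear as
  -- repeated terms.
  ![fun _ => 1, s, s, c, c, m, m, m, m]

/-- The functions in the expansion of `v^r / r` in second derivatives of the potential. -/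
noncomputable def comp (W : E3 → ℝ) : Fin 9 → E3 → ℝ :=
  let V := invLap W
  ![W, pd 0 (pd 0 V), pd 0 (pd 0 V), pd 1 (pd 1 V), pd 1 (pd 1 V), pd 1 (pd 0 V), pd 1 (pd 0 V), pd 1 (pd 0 V), pd 1 (pd 0 V)]

theorem comp_cases (W : E3 → ℝ) (m : Fin 9) : comp W m = W ∨ ∃ i j, comp W m = pd i (pd j (invLap W)) := by
  fin_cases m
  · exact .inl rfl
  all_goals exact .inr ⟨_, _, rfl⟩

theorem contDiff_invLap_pot (h : IsProfile v) : ContDiff ℝ ∞ (invLap (invLapD 2 (vortQuot v))) :=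
  h.weighted_pot.contDiff_infty_invLap h.contDiff_pot

theorem represents (h : IsProfile v) : Represents (radialOverR v) coeff (comp (invLapD 2 (vortQuot v))) where
  angular m := by
    have hs : IsAngular fun x => -1 * (x 1 / rad x * (x 1 / rad x)) := (IsAngular.const (by simp)).mul (IsAngular.sin.mul .sin)
    have hc : IsAngular fun x => -1 * (x 0 / rad x * (x 0 / rad x)) := (IsAngular.const (by simp)).mul (IsAngular.cos.mul .cos)
    have hm : IsAngular fun x => x 0 / rad x * (x 1 / rad x) := IsAngular.cos.mul .sin
    fin_cases m
    exacts [.const (a := 1) (by simp), hs, hs, hc, hc, hm, hm, hm, hm]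
  smooth m := by
    rcases comp_cases (invLapD 2 (vortQuot v)) m with e | ⟨i, j, e⟩ <;> rw [e]
    · exact h.contDiff_pot
    · exact (h.contDiff_invLap_pot.pd_infty j).pd_infty i
  eq {x} hx := by
    rw [h.radialOverR_eq_pot hx, h.isAdmissible_pot.drOverRInvLap_eq hx, h.isAdmissible_pot.riesz_eq, h.isAdmissible_pot.riesz_eq,
      h.isAdmissible_pot.riesz_eq]
    simp [Fin.sum_univ_succ, coeff, comp]
    ring

theorem lap_pd_invLap_pot (h : IsProfile v) (i j : Fin 3) (x : E3) :
    lap (pd i (pd j (invLap (invLapD 2 (vortQuot v))))) x = pd i (pd j (invLapD 2 (vortQuot v))) x := by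
  have cV := h.contDiff_invLap_pot
  have e : lap (invLap (invLapD 2 (vortQuot v))) = invLapD 2 (vortQuot v) :=
    funext fun y => h.weighted_pot.lap_invLap (contDiff_infty.1 h.contDiff_pot 1) y
  have e1 : lap (pd j (invLap (invLapD 2 (vortQuot v)))) = pd j (invLapD 2 (vortQuot v)) := funext fun y => by rw [lap_pd cV, e]
  rw [lap_pd (cV.pd_infty j), e1]

theorem integrable_pd_pd_invLap_pot (h : IsProfile v) (i j : Fin 3) :
    Integrable fun x => pd i (pd j (invLap (invLapD 2 (vortQuot v)))) x / (1 + ‖x‖ ^ 2) ^ 2 := by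
  have hw := h.isAdmissible_pot.weighted_pd
  rw [h.weighted_pot.pd_invLap, h.weighted_pot.pd_invLapD (contDiff_infty.1 h.contDiff_pot 1) hw]
  exact (hw i).integrable_invLapD j

theorem integrable_weight_sq {f : E3 → ℝ} (hf : Continuous f) (h : Integrable fun x => f x / (1 + ‖x‖ ^ 2)) :
    Integrable fun x => f x / (1 + ‖x‖ ^ 2) ^ 2 :=
  integrable_div_weight_sq hf h fun x => by nlinarith [abs_nonneg (f x), sq_nonneg ‖x‖]

/-- A third derivative of V is the unknown φ in the second-order bound, so its weighted
integrability is needed there; it comes from the estimate in L², with ∇W ∈ L². -/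
theorem integrable_pd_pd_pd_invLap_pot (h : IsProfile v) (k i j : Fin 3) :
    Integrable fun x => pd k (pd i (pd j (invLap (invLapD 2 (vortQuot v))))) x / (1 + ‖x‖ ^ 2) ^ 2 := by
  have c2 := (h.contDiff_invLap_pot.pd_infty j).pd_infty i
  have c3 := (c2.pd_infty k).continuous
  refine integrable_weight_sq c3 (MemLp.integrable_div_weight ⟨c3.aestronglyMeasurable, ?_⟩)
  obtain ⟨C, -, hC⟩ := exists_cz_bound (p := 2) (by norm_num)
  have := hC _ _ c2 (h.contDiff_pot.pd_infty j) (h.integrable_pd_pd_invLap_pot i j) i k (h.lap_pd_invLap_pot i j)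
  rw [ENNReal.ofReal_ofNat] at this
  exact this.trans_lt (ENNReal.mul_lt_top ENNReal.ofReal_lt_top (h.memLp_pd_pot j).2)

theorem lap_pd_pot (h : IsProfile v) (k : Fin 3) (x : E3) :
    lap (pd k (invLapD 2 (vortQuot v))) x = pd k (pd 2 (vortQuot v)) x := by
  rw [lap_pd h.contDiff_pot, funext h.lap_pot]

theorem eLpNorm_gam (h : IsProfile v) (q : ENNReal) : eLpNorm (Gam v) q volume = eLpNorm (vortQuot v) q volume :=
  eLpNorm_congr_ae (ae_rad_ne.mono fun _ hx => h.gam_eq hx)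

theorem eLpNorm_pd_gam (h : IsProfile v) (q : ENNReal) : eLpNorm (pd 2 (Gam v)) q volume = eLpNorm (pd 2 (vortQuot v)) q volume :=
  eLpNorm_congr_ae (ae_rad_ne.mono fun _ hx => pd_congr ((eventually_rad_ne hx).mono fun _ hy => h.gam_eq hy) 2)

end IsProfile

theorem exists_radialOverR_bound {q : ℝ} (hq : 1 < q) : ∃ C : ℝ, 0 < C ∧ ∀ v : E3 → E3, IsProfile v →
    eLpNorm (tgrad (radialOverR v)) (ENNReal.ofReal q) volume ≤ ENNReal.ofReal C * eLpNorm (Gam v) (ENNReal.ofReal q) volume ∧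
    eLpNorm (tgradTwo (radialOverR v)) (ENNReal.ofReal q) volume
      ≤ ENNReal.ofReal C * eLpNorm (pd 2 (Gam v)) (ENNReal.ofReal q) volume := by
  obtain ⟨C, hC0, hC⟩ := exists_cz_bound hq
  -- The sum C + C² covers terms that need one or two applications of the Calderón–Zygmund estimate.
  have hD0 : 0 < C + C * C := by positivity
  have hle1 : ENNReal.ofReal C ≤ ENNReal.ofReal (C + C * C) := ENNReal.ofReal_le_ofReal (by nlinarith)
  have hle2 : ENNReal.ofReal C * ENNReal.ofReal C ≤ ENNReal.ofReal (C + C * C) := by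
    rw [← ENNReal.ofReal_mul hC0.le]; exact ENNReal.ofReal_le_ofReal (by linarith)
  -- There are 9·3 = 27 terms for first derivatives and 9·3·3 = 81 for second ones; the factor 4
  -- counts the entries of ∇̃∇̃.
  refine ⟨4 * (81 * (C + C * C)), by positivity, fun v h => ?_⟩
  have hfin : ∀ {A n : ℝ} {N : ℕ} {E : ENNReal}, 0 ≤ A → (N : ℝ) = n → A * n ≤ 4 * 81 →
      ENNReal.ofReal A * (N * (ENNReal.ofReal (C + C * C) * E)) ≤ ENNReal.ofReal (4 * (81 * (C + C * C))) * E := by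
    intro A n N E hA hN hAn
    rw [← mul_assoc, ← mul_assoc, ← ENNReal.ofReal_natCast, ← ENNReal.ofReal_mul hA, ← ENNReal.ofReal_mul (by positivity), hN]
    refine mul_le_mul_left (ENNReal.ofReal_le_ofReal ?_) _
    nlinarith [mul_le_mul_of_nonneg_right hAn hD0.le]
  have chain : ∀ {a b : ENNReal} {E : ENNReal}, a ≤ ENNReal.ofReal C * b → b ≤ ENNReal.ofReal C * E → a ≤ ENNReal.ofReal (C + C * C) * E := by
    intro a b E h1 h2
    calc a ≤ ENNReal.ofReal C * (ENNReal.ofReal C * E) := h1.trans (by gcongr)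
      _ ≤ _ := by rw [← mul_assoc]; gcongr
  have chain1 : ∀ {a : ENNReal} {E : ENNReal}, a ≤ ENNReal.ofReal C * E → a ≤ ENNReal.ofReal (C + C * C) * E := fun h1 => h1.trans (by gcongr)
  have cV := h.contDiff_invLap_pot
  have hW : ∀ k, eLpNorm (pd k (invLapD 2 (vortQuot v))) (ENNReal.ofReal q) volume ≤ ENNReal.ofReal C * eLpNorm (vortQuot v) (ENNReal.ofReal q) volume :=
    fun k => hC _ _ h.contDiff_pot h.contDiff_vortQuot (h.weighted_vortQuot.integrable_invLapD 2) 2 k h.lap_pot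
  have hWW : ∀ l k, eLpNorm (pd l (pd k (invLapD 2 (vortQuot v)))) (ENNReal.ofReal q) volume
      ≤ ENNReal.ofReal C * eLpNorm (pd 2 (vortQuot v)) (ENNReal.ofReal q) volume :=
    fun l k => hC _ _ (h.contDiff_pot.pd_infty k) (h.contDiff_vortQuot.pd_infty 2)
      (IsProfile.integrable_weight_sq (h.contDiff_pot.pd_infty k).continuous (h.isAdmissible_pot.weighted_pd k).2) k l (h.lap_pd_pot k)
  have hr := h.represents
  rw [h.eLpNorm_gam, h.eLpNorm_pd_gam]
  constructor
  · refine (eLpNorm_le_of_ae_le_sum (g := fun m : Fin 9 × Fin 3 => pd m.2 (IsProfile.comp (invLapD 2 (vortQuot v)) m.1))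
      (fun m => ((hr.smooth m.1).pd_infty m.2).continuous) hq zero_le_two (fun x => Real.sqrt_nonneg _) (fun hx => hr.tgrad_le hx)
      (K := ENNReal.ofReal (C + C * C) * eLpNorm (vortQuot v) (ENNReal.ofReal q) volume) fun m => ?_).trans
      (hfin (n := 27) zero_le_two (by simp) (by norm_num))
    rcases IsProfile.comp_cases (invLapD 2 (vortQuot v)) m.1 with e | ⟨i, j, e⟩ <;> simp only [e]
    · exact chain1 (hW _)
    · exact chain (hC _ _ ((cV.pd_infty j).pd_infty i) (h.contDiff_pot.pd_infty j) (h.integrable_pd_pd_invLap_pot i j) i m.2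
        (h.lap_pd_invLap_pot i j)) (hW j)
  · refine (eLpNorm_le_of_ae_le_sum (g := fun m : (Fin 9 × Fin 3) × Fin 3 => pd m.2 (pd m.1.2 (IsProfile.comp (invLapD 2 (vortQuot v)) m.1.1)))
      (fun m => (((hr.smooth m.1.1).pd_infty m.1.2).pd_infty m.2).continuous) hq zero_le_four (fun x => Real.sqrt_nonneg _) (fun hx => hr.tgradTwo_le hx)
      (K := ENNReal.ofReal (C + C * C) * eLpNorm (pd 2 (vortQuot v)) (ENNReal.ofReal q) volume) fun m => ?_).trans
      (hfin (n := 81) zero_le_four (by simp) (by norm_num))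
    rcases IsProfile.comp_cases (invLapD 2 (vortQuot v)) m.1.1 with e | ⟨i, j, e⟩ <;> simp only [e]
    · exact chain1 (hWW _ _)
    · refine chain (hC _ _ (((cV.pd_infty j).pd_infty i).pd_infty m.1.2) ((h.contDiff_pot.pd_infty j).pd_infty i)
        (h.integrable_pd_pd_pd_invLap_pot m.1.2 i j) m.1.2 m.2 fun x => ?_) (hWW i j)
      rw [lap_pd ((cV.pd_infty j).pd_infty i), funext (h.lap_pd_invLap_pot i j)]

end Axi

theorem mainTheorem7 :
    -- the operator `(∂_r / r) Δ⁻¹` on axisymmetric functions, through the Riesz operators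
    (∀ W : E3 → ℝ, Axi.IsAdmissible W →
      (∀ x, Integrable (fun y => (Axi.newton (x - y) - Axi.newton (-y)) * W y) volume) ∧
      (∀ i j x, Integrable (fun y => Axi.dNewton i (x - y) * Axi.pd j W y) volume) ∧
      ContDiff ℝ 2 (Axi.invLap W) ∧
      (∀ x, Axi.lap (Axi.invLap W) x = W x) ∧
      ∀ x, Axi.rad x ≠ 0 →
        Axi.drOverRInvLap W x
          = (x 1) ^ 2 / (Axi.rad x) ^ 2 * Axi.riesz 0 0 W x
            + (x 0) ^ 2 / (Axi.rad x) ^ 2 * Axi.riesz 1 1 W x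
            - 2 * (x 0 * x 1 / (Axi.rad x) ^ 2) * Axi.riesz 0 1 W x) ∧
    -- the expression of `u^r / r` through `Γ = ω^θ / r`
    (∀ (T : ℝ) (u : ℝ → E3 → E3) (p : ℝ → E3 → ℝ),
      Axi.IsSmoothAxisymmetricSolution T u p → ∀ t ∈ Ioo 0 T,
        (∀ x, Integrable (fun y => Axi.dNewton 2 (x - y) * Axi.Gam (u t) y) volume) ∧
        Axi.IsAdmissible (Axi.invLapD 2 (Axi.Gam (u t))) ∧
        ∀ x, Axi.rad x ≠ 0 →
          Axi.radialOverR (u t) x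
            = Axi.invLapD 2 (Axi.Gam (u t)) x
              - 2 * Axi.drOverRInvLap (Axi.invLapD 2 (Axi.Gam (u t))) x) ∧
    -- the estimates, with a constant that depends on `q` only
    (∀ q : ℝ, 1 < q → ∃ C : ℝ, 0 < C ∧
      ∀ (T : ℝ) (u : ℝ → E3 → E3) (p : ℝ → E3 → ℝ),
        Axi.IsSmoothAxisymmetricSolution T u p → ∀ t ∈ Ioo 0 T,
          eLpNorm (Axi.tgrad (Axi.radialOverR (u t))) (ENNReal.ofReal q) volume
              ≤ ENNReal.ofReal C * eLpNorm (Axi.Gam (u t)) (ENNReal.ofReal q) volume ∧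
          eLpNorm (Axi.tgradTwo (Axi.radialOverR (u t))) (ENNReal.ofReal q) volume
              ≤ ENNReal.ofReal C
                * eLpNorm (Axi.pd 2 (Axi.Gam (u t))) (ENNReal.ofReal q) volume) := by
  refine ⟨fun W hW => hW.potential, fun T u p h t ht => ?_, fun q hq => ?_⟩
  · have hu := h.isProfile ht
    refine ⟨hu.integrable_dNewton_gam, ?_, fun x hx => ?_⟩
    · rw [hu.invLapD_gam]; exact hu.isAdmissible_pot
    · rw [hu.invLapD_gam]; exact hu.radialOverR_eq_pot hx
  · obtain ⟨C, hC0, hC⟩ := Axi.exists_radialOverR_bound hq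
    exact ⟨C, hC0, fun T u p h t ht => hC _ (h.isProfile ht)⟩
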